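/- All curves are smooth, projective and connected over $\mathbb C$. Consider double covers $\pi\colon E\to\mathbb P^1$, where $E$ is an elliptic curve whose origin is a ramification point of $\pi$. Translation by the points of $E[2]$ induces a group $G(\pi)\subset \mathrm{PGL}_2(\mathbb C)$ of automorphisms of $\mathbb P^1$. For two such covers $\pi_1\colon E_1\to\mathbb P^1$ and $\pi_2\colon E_2\to\mathbb P^1$ put \[ I(\pi_1,\pi_2)=\pi_1(E_{1,\mathrm{tors}})\cap\pi_2(E_{2,\mathrm{tors}}),\qquad P(\pi_1,\pi_2)=\bigl(\#(\pi_1(E_1[2])\cap\pi_2(E_2[2])),\ \#(G(\pi_1)\cap G(\pi_2))\bigr), \] and let $T(a,b)$ be the maximum (supremum in $\mathbb N\cup\{\infty\}$) of $\#I(\pi_1,\pi_2)$ over all pairs with $P(\pi_1,\pi_2)=(a,b)$. A torsion packet on a curve $C$ of genus at least $2$ is a maximal set of points of $C$ such that the difference of any two of them is a torsion point of the Jacobian; a hyperelliptic torsion packet is one that contains the ramification points of the hyperelliptic double cover $C\to\mathbb P^1$. A curve of genus $2$ is bielliptic if it admits a double cover of an elliptic curve. Let $T$ be the maximum (supremum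 in $\mathbb N\cup\{\infty\}$) of the sizes of hyperelliptic torsion packets on bielliptic curves of genus $2$. Then \[ 4\,T(3,1)-6\ \ge\ T \qquad\text{and}\qquad T(0,4)\ \ge\ T\ \ge\ 34. \] Consequently, the maximal size of $I(\pi_1,\pi_2)$ over all pairs with $\pi_1(E_1[2])\ne\pi_2(E_2[2])$ is at least $T$; and the maximal size of a finite intersection $I(\pi_1,\pi_2)$ is at least the maximal size of a finite hyperelliptic torsion packet on a bielliptic curve of genus $2$ (maxima again understood as suprema in $\mathbb N\cup\{\infty\}$). -/

import Mathlib

/-! A smooth projective curve over `ℂ` is represented by its function field `K`. Its points are the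
places of `K`, i.e. the normalized discrete valuations of `K` that are trivial on `ℂ`; a
morphism to `ℙ¹` is an element `x` of `K`, its degree is `[K : ℂ(x)]`; a morphism to another
curve is an inclusion of function fields. -/

open scoped WithZero KaehlerDifferential LinearAlgebra.Projectivization MatrixGroups

noncomputable section

namespace TorsionPackets

/-- `K` is the function field of a curve over `ℂ`: a finitely generated field extension of
transcendence degree one. -/
structure IsCurve (K : Type) [Field K] [Algebra ℂ K] : Prop where
  fg : Algebra.EssFiniteType ℂ K
  trdeg : Algebra.trdeg ℂ K = 1

/-- A point of the curve with function field `K`: a normalized discrete valuation of `K` (written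
multiplicatively) that is trivial on `ℂ`. -/
@[ext]
structure Place (K : Type) [Field K] [Algebra ℂ K] where
  v : Valuation K ℤᵐ⁰
  surjective : Function.Surjective v
  trivial : ∀ c : ℂ, c ≠ 0 → v (algebraMap ℂ K c) = 1

variable {K : Type} [Field K] [Algebra ℂ K]

/-- The order of vanishing of a nonzero function `f` at `P` (the junk value at `f = 0` is `0`). -/
def Place.ord (P : Place K) (f : K) : ℤ := -WithZero.log (P.v f)

theorem Place.ord_mul (P : Place K) {f g : K} (hf : f ≠ 0) (hg : g ≠ 0) :
    P.ord (f * g) = P.ord f + P.ord g := by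
  have h1 : P.v f ≠ 0 := by simpa using hf
  have h2 : P.v g ≠ 0 := by simpa using hg
  simp only [Place.ord, map_mul, WithZero.log_mul h1 h2]
  ring

theorem Place.ord_inv (P : Place K) (f : K) : P.ord f⁻¹ = -P.ord f := by
  simp [Place.ord, WithZero.log_inv]

theorem Place.algebraMap_mem (P : Place K) (c : ℂ) : algebraMap ℂ K c ∈ P.v.integer := by
  rw [Valuation.mem_integer_iff]
  by_cases hc : c = 0
  · simp [hc]
  · exact (P.trivial c hc).le

/-! ### Genus -/

/-- The differentials on the curve that are regular at `P`: the image in `Ω[K⁄ℂ]` of the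
differentials of the local ring at `P`. -/
def differentialsRegularAt (P : Place K) : Submodule P.v.integer Ω[K⁄ℂ] :=
  Submodule.span P.v.integer (Set.range fun a : P.v.integer => KaehlerDifferential.D ℂ K (a : K))

/-- The space of everywhere regular differentials. -/
def regularDifferentials (K : Type) [Field K] [Algebra ℂ K] : Submodule ℂ Ω[K⁄ℂ] where
  carrier := {ω | ∀ P : Place K, ω ∈ differentialsRegularAt P}
  add_mem' h₁ h₂ P := add_mem (h₁ P) (h₂ P)
  zero_mem' P := zero_mem _
  smul_mem' c ω h P := by
    have := (differentialsRegularAt P).smul_mem (⟨_, P.algebraMap_mem c⟩ : P.v.integer) (h P)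
    rw [← algebraMap_smul K] at this
    rw [← algebraMap_smul K c ω]
    exact this

/-- The genus: the dimension of the space of regular differentials. -/
def genus (K : Type) [Field K] [Algebra ℂ K] : ℕ :=
  Module.finrank ℂ (regularDifferentials K)

/-! ### Divisors and the Jacobian -/

/-- Divisors of rational functions. -/
def principalDivisors (K : Type) [Field K] [Algebra ℂ K] : AddSubgroup (Place K →₀ ℤ) where
  carrier := {D | ∃ f : K, f ≠ 0 ∧ ∀ P, D P = P.ord f}
  add_mem' := by
    rintro D E ⟨f, hf, hD⟩ ⟨g, hg, hE⟩
    exact ⟨f * g, mul_ne_zero hf hg, fun P => by simp [hD, hE, P.ord_mul hf hg]⟩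
  zero_mem' := ⟨1, one_ne_zero, fun P => by simp [Place.ord]⟩
  neg_mem' := by
    rintro D ⟨f, hf, hD⟩
    exact ⟨f⁻¹, inv_ne_zero hf, fun P => by simp [hD, P.ord_inv]⟩

/-- The divisor class group of the curve; the points of the Jacobian are the classes of
degree zero. -/
abbrev ClassGroup (K : Type) [Field K] [Algebra ℂ K] : Type :=
  (Place K →₀ ℤ) ⧸ principalDivisors K

/-- The class of the degree zero divisor `P - Q`, a point of the Jacobian. -/
def diffClass (P Q : Place K) : ClassGroup K :=
  QuotientAddGroup.mk (Finsupp.single P 1 - Finsupp.single Q 1)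

/-! ### Morphisms to the projective line -/

/-- The projective line over `ℂ`. -/
abbrev P1 : Type := ℙ ℂ (Fin 2 → ℂ)

/-- The point `(c : 1)`. -/
def P1.ofComplex (c : ℂ) : P1 := Projectivization.mk ℂ ![c, 1] (by simp)

/-- The point `(1 : 0)`. -/
def P1.infinity : P1 := Projectivization.mk ℂ ![1, 0] (by simp)

open Classical in
/-- The value at the point `P` of the morphism to `ℙ¹` given by the function `x`:
the number `c` such that `x - c` vanishes at `P`, or infinity if `x` has a pole at `P`. -/
def value (x : K) (P : Place K) : P1 :=
  if h : ∃ c : ℂ, P.v (x - algebraMap ℂ K c) < 1 then P1.ofComplex h.choose else P1.infinity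

/-- The function `x` is a double cover of `ℙ¹`. -/
def IsDoubleCover (x : K) : Prop :=
  Module.finrank (IntermediateField.adjoin ℂ {x}) K = 2

/-- The morphism to `ℙ¹` given by the nonconstant function `x` is ramified at `P`: its value at `P`
is taken with multiplicity at least two. -/
def IsRamifiedAt (x : K) (P : Place K) : Prop :=
  (∃ c : ℂ, 2 ≤ P.ord (x - algebraMap ℂ K c)) ∨ P.ord x ≤ -2

/-! ### Elliptic curves as double covers of the projective line -/

/-- A double cover `π : E → ℙ¹` of the projective line by an elliptic curve `E` such that the
origin of `E` is a ramification point of `π`. -/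
structure EllipticDoubleCover where
  K : Type
  [field : Field K]
  [algebra : Algebra ℂ K]
  isCurve : IsCurve K
  genus_eq : genus K = 1
  origin : Place K
  x : K
  isDoubleCover : IsDoubleCover x
  ramified : IsRamifiedAt x origin

attribute [instance] EllipticDoubleCover.field EllipticDoubleCover.algebra

namespace EllipticDoubleCover

variable (π π₁ π₂ : EllipticDoubleCover)

/-- The map `π` on points. -/
def toFun (P : Place π.K) : P1 := value π.x P

/-- The point `P` of `E` as an element of the Jacobian of `E`; this is the embedding that
defines the group law of `E`. -/
def cls (P : Place π.K) : ClassGroup π.K := diffClass P π.origin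

/-- The set of torsion points of `E`. -/
def torsion : Set (Place π.K) := {P | IsOfFinAddOrder (π.cls P)}

/-- The set `E[2]`. -/
def twoTorsion : Set (Place π.K) := {P | 2 • π.cls P = 0}

/-- The set `π(E[2])`. -/
def branchSet : Set P1 := π.toFun '' π.twoTorsion

/-- The group of automorphisms of `ℙ¹` that are induced by translation by a point of `E[2]`;
here `Q = P + T` in the group law of `E`. -/
def G : Set PGL(2, ℂ) :=
  {γ | ∃ T ∈ π.twoTorsion, ∀ P Q : Place π.K, π.cls Q = π.cls P + π.cls T →
    π.toFun Q = γ • π.toFun P}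

/-- The set of common values of `π₁` and `π₂` on torsion points. -/
def I : Set P1 := (π₁.toFun '' π₁.torsion) ∩ (π₂.toFun '' π₂.torsion)

/-- The pair of numerical invariants of `(π₁, π₂)`. -/
def P : ℕ∞ × ℕ∞ := ((π₁.branchSet ∩ π₂.branchSet).encard, (π₁.G ∩ π₂.G).encard)

end EllipticDoubleCover

/-- The maximal size of `I(π₁, π₂)` over all pairs with invariants `(a, b)`, as a supremum in
`ℕ ∪ {∞}`. -/
def maxI (a b : ℕ) : ℕ∞ :=
  ⨆ (π₁ : EllipticDoubleCover) (π₂ : EllipticDoubleCover)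
    (_ : EllipticDoubleCover.P π₁ π₂ = ((a : ℕ∞), (b : ℕ∞))),
    (EllipticDoubleCover.I π₁ π₂).encard

/-! ### Torsion packets on bielliptic curves of genus two -/

/-- A torsion packet: a maximal set of points such that the difference of any two of them is
torsion in the Jacobian. -/
def IsTorsionPacket (S : Set (Place K)) : Prop :=
  Maximal (fun S : Set (Place K) => ∀ P ∈ S, ∀ Q ∈ S, IsOfFinAddOrder (diffClass P Q)) S

/-- A hyperelliptic torsion packet: a torsion packet that contains the ramification points of the
hyperelliptic double cover of `ℙ¹` (which, for genus at least two, is unique up to automorphisms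
of `ℙ¹`). -/
def IsHyperellipticTorsionPacket (S : Set (Place K)) : Prop :=
  IsTorsionPacket S ∧ ∃ x : K, IsDoubleCover x ∧ ∀ W, IsRamifiedAt x W → W ∈ S

/-- A bielliptic curve of genus two: a curve of genus two with a double cover of a
curve of genus one. -/
structure BiellipticGenusTwoCurve where
  K : Type
  [field : Field K]
  [algebra : Algebra ℂ K]
  isCurve : IsCurve K
  genus_eq : genus K = 2
  bielliptic : ∃ F : IntermediateField ℂ K, IsCurve F ∧ genus F = 1 ∧ Module.finrank F K = 2

attribute [instance] BiellipticGenusTwoCurve.field BiellipticGenusTwoCurve.algebra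

/-- The maximal size of a hyperelliptic torsion packet on a bielliptic curve of genus two, as a
supremum in `ℕ ∪ {∞}`. -/
def maxPacket : ℕ∞ :=
  ⨆ (C : BiellipticGenusTwoCurve) (S : Set (Place C.K)) (_ : IsHyperellipticTorsionPacket S),
    S.encard

end TorsionPackets

end

open scoped WithZero KaehlerDifferential LinearAlgebra.Projectivization MatrixGroups
open Polynomial

noncomputable section

set_option linter.unusedSectionVars false

/-! Let `C` be bielliptic of genus 2. The bielliptic involution descends to the hyperelliptic
quotient and changes the sign of a suitable coordinate `x` there, so `C` is `y² = k (x² - A)(x² -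
B)(x² - D)`. A Möbius function `t` of `x²` then exhibits `C` as the normalized fibre product, over
the `t`-line, of `E₁ : y₁² = t (t - 1)(t - a)` and `E₂ : y₂² = t (t - 1)(t - b)` with `a ≠ b`
(`BiellipticGenusTwoCurve.exists_isBiquadratic`).

The product of the involutions of `C` over `E₁` and over `E₂` is the hyperelliptic involution, which
acts on the Jacobian as `-1`. Hence twice a class of degree zero is the sum of what comes from `E₁`
and from `E₂`. It follows that, for `P₀` over `t = ∞`, the class of `P - P₀` is torsion exactly when
`t(P)` is the coordinate of a torsion point on both curves (`IsBiquadratic.isOfFinAddOrder_iff`).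
Every hyperelliptic packet is therefore `t⁻¹(I)` with `I` the set of common torsion values.

Invariants (3,1): the covers `t : Eᵢ → ℙ¹` share the branch points `0, 1, ∞`, which lie in `I`. As
`t : C → ℙ¹` has degree 4 with at most two points over each of these three, the packet has at most
`4 #I - 6` points.

Invariants (0,4): choose on each `Eᵢ` a coordinate `w` in which translation by `Eᵢ[2]` is `w ↦ ±w,
±1/w`. The quotient of the `w`-line by this group is `fourfold`. Doubling is the quotient by `E[2]`,
so the coordinate `t` of `2P + T`, with `T` a fixed point of order two, is `fourfold` of the
coordinate `w` of `P` (`IsHyper.exists_two_nsmul_add`). Thus the new covers have intersection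
`fourfold⁻¹(I)`, which has at least `4 #I - 6` elements, no fewer than the packet. Their branch sets
lie over `a` and over `b`, hence are disjoint, while the translation groups coincide.

The bound 34: two curves conjugate over `ℚ(√13)` have, besides `0, 1, ∞`, seven common torsion
values different from `a` and `b`, checked by the duplication formula. This gives at least `4 · 10 -
6` points (`exists_large_packet`).

All of this rests on an elementary theory of places: ramification in quadratic extensions, norm and
pull-back of divisors, the genus of `y² = f(x)`, and the chord-tangent law. -/

namespace TorsionPackets

/-! ### Orders at a place, and torsion classes of differences of points -/

section

namespace Place

variable {K : Type} [Field K] [Algebra ℂ K] (P : Place K)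

theorem v_ne_zero {f : K} (hf : f ≠ 0) : P.v f ≠ 0 := by simpa using hf

theorem v_eq_exp {f : K} (hf : f ≠ 0) : P.v f = WithZero.exp (-P.ord f) := by
  simp [ord, WithZero.exp_log (P.v_ne_zero hf)]

/-- The function `f` vanishes at `P` to order at least `k`. -/
def AtLeast (k : ℤ) (f : K) : Prop := P.v f ≤ WithZero.exp (-k)

variable {P}

theorem atLeast_iff {f : K} (hf : f ≠ 0) {k : ℤ} : P.AtLeast k f ↔ k ≤ P.ord f := by
  rw [AtLeast, P.v_eq_exp hf, WithZero.exp_le_exp]; omega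

/-- This is the advantage of `AtLeast` over an inequality for `ord`: the zero function satisfies
every lower bound, whereas its `ord` is the junk value `0`. -/
theorem atLeast_zero_fun (k : ℤ) : P.AtLeast k (0 : K) := by simp [AtLeast]

theorem AtLeast.le_ord {f : K} {k : ℤ} (h : P.AtLeast k f) (hf : f ≠ 0) : k ≤ P.ord f :=
  (atLeast_iff hf).1 h

theorem AtLeast.add {f g : K} {k : ℤ} (hf : P.AtLeast k f) (hg : P.AtLeast k g) :
    P.AtLeast k (f + g) := P.v.map_add_le hf hg

theorem AtLeast.neg {f : K} {k : ℤ} (hf : P.AtLeast k f) : P.AtLeast k (-f) := by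
  simpa [AtLeast] using hf

theorem AtLeast.sub {f g : K} {k : ℤ} (hf : P.AtLeast k f) (hg : P.AtLeast k g) :
    P.AtLeast k (f - g) := by
  rw [sub_eq_add_neg]; exact hf.add hg.neg

theorem AtLeast.mul {f g : K} {k l : ℤ} (hf : P.AtLeast k f) (hg : P.AtLeast l g) :
    P.AtLeast (k + l) (f * g) := by
  unfold AtLeast at *
  rw [map_mul, neg_add, WithZero.exp_add]
  exact mul_le_mul' hf hg

theorem AtLeast.mono {f : K} {k l : ℤ} (hf : P.AtLeast k f) (h : l ≤ k) : P.AtLeast l f :=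
  le_trans (show P.v f ≤ _ from hf) (WithZero.exp_le_exp.2 (by omega))

theorem AtLeast.pow {f : K} {k : ℤ} (hf : P.AtLeast k f) (n : ℕ) : P.AtLeast (n * k) (f ^ n) := by
  induction n with
  | zero => simp [AtLeast]
  | succ n ih => rw [pow_succ]; exact (ih.mul hf).mono (by push_cast; linarith)

theorem atLeast_zero_iff {f : K} : P.AtLeast 0 f ↔ P.v f ≤ 1 := by simp [AtLeast]

theorem atLeast_one_iff {f : K} : P.AtLeast 1 f ↔ P.v f < 1 := by
  by_cases hf : f = 0
  · simp [hf, AtLeast]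
  · rw [atLeast_iff hf, P.v_eq_exp hf, ← WithZero.exp_zero, WithZero.exp_lt_exp]; omega

theorem atLeast_const (c : ℂ) : P.AtLeast 0 (algebraMap ℂ K c) :=
  atLeast_zero_iff.2 (P.algebraMap_mem c)

variable (P)

@[simp] theorem ord_zero : P.ord (0 : K) = 0 := by simp [ord]

@[simp] theorem ord_const (c : ℂ) : P.ord (algebraMap ℂ K c) = 0 := by
  by_cases hc : c = 0
  · simp [hc]
  · simp [ord, P.trivial c hc]

@[simp] theorem ord_neg (f : K) : P.ord (-f) = P.ord f := by simp [ord]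

@[simp] theorem ord_pow (f : K) (n : ℕ) : P.ord (f ^ n) = n * P.ord f := by
  simp [ord, WithZero.log_pow]

@[simp] theorem ord_zpow (f : K) (n : ℤ) : P.ord (f ^ n) = n * P.ord f := by
  simp [ord, WithZero.log_zpow]

theorem ord_div {f g : K} (hf : f ≠ 0) (hg : g ≠ 0) : P.ord (f / g) = P.ord f - P.ord g := by
  rw [div_eq_mul_inv, P.ord_mul hf (inv_ne_zero hg), P.ord_inv]; ring

theorem ord_const_mul {c : ℂ} (hc : c ≠ 0) (f : K) :
    P.ord (algebraMap ℂ K c * f) = P.ord f := by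
  by_cases hf : f = 0
  · simp [hf]
  · rw [P.ord_mul (by simpa using hc) hf, P.ord_const, zero_add]

theorem not_atLeast_const {c : ℂ} (hc : c ≠ 0) : ¬ P.AtLeast 1 (algebraMap ℂ K c) := by
  rw [atLeast_iff (by simpa using hc), ord_const]; omega

theorem exists_ord_eq (n : ℤ) : ∃ f : K, f ≠ 0 ∧ P.ord f = n := by
  obtain ⟨f, hf⟩ := P.surjective (WithZero.exp (-n))
  refine ⟨f, ?_, by simp [ord, hf]⟩
  rintro rfl
  rw [map_zero] at hf
  exact WithZero.exp_ne_zero hf.symm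

variable {P}

theorem ord_add_eq {f g : K} (hf : f ≠ 0) (hg : P.AtLeast (P.ord f + 1) g) :
    f + g ≠ 0 ∧ P.ord (f + g) = P.ord f := by
  have h : P.v g < P.v f := by
    rw [P.v_eq_exp hf]
    exact lt_of_le_of_lt hg (WithZero.exp_lt_exp.2 (by omega))
  have h2 : P.v (f + g) = P.v f := P.v.map_add_eq_of_lt_left h
  refine ⟨?_, by simp [ord, h2]⟩
  intro h0
  rw [h0, map_zero] at h2
  exact P.v_ne_zero hf h2.symm

/-- The order of a sum of two terms of different orders. -/
theorem ord_add_of_ne {f g : K} (hf : f ≠ 0) (hg : g ≠ 0) (h : P.ord f ≠ P.ord g) :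
    f + g ≠ 0 ∧ P.ord (f + g) = min (P.ord f) (P.ord g) := by
  rcases lt_or_gt_of_ne h with h | h
  · rw [min_eq_left h.le]
    exact ord_add_eq hf ((atLeast_iff hg).2 h)
  · rw [min_eq_right h.le, add_comm]
    exact ord_add_eq hg ((atLeast_iff hf).2 h)

/-- A function with nonzero value `c` is a unit. -/
theorem ord_eq_zero_of_value {f : K} {c : ℂ} (hc : c ≠ 0)
    (h : P.AtLeast 1 (f - algebraMap ℂ K c)) : f ≠ 0 ∧ P.ord f = 0 := by
  have := ord_add_eq (P := P) (f := algebraMap ℂ K c) (by simpa using hc)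
    (g := f - algebraMap ℂ K c) (by simpa using h)
  simpa using this

theorem value_unique {f : K} {c d : ℂ} (hc : P.AtLeast 1 (f - algebraMap ℂ K c))
    (hd : P.AtLeast 1 (f - algebraMap ℂ K d)) : c = d := by
  by_contra h
  have := hd.sub hc
  rw [sub_sub_sub_cancel_left, ← map_sub] at this
  exact P.not_atLeast_const (sub_ne_zero.2 h) this

theorem atLeast_zero_of_value {f : K} {c : ℂ} (hc : P.AtLeast 1 (f - algebraMap ℂ K c)) :
    P.AtLeast 0 f := by
  have := (hc.mono (by omega : (0 : ℤ) ≤ 1)).add (atLeast_const (P := P) c)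
  simpa using this

theorem ext_ord {P Q : Place K} (h : ∀ f : K, f ≠ 0 → P.ord f = Q.ord f) : P = Q := by
  ext f
  by_cases hf : f = 0
  · simp [hf]
  · rw [P.v_eq_exp hf, Q.v_eq_exp hf, h f hf]

/-- If the local ring at `P` is contained in the one at `Q`, then `P = Q`. -/
theorem eq_of_le {P Q : Place K} (h : ∀ f : K, f ≠ 0 → 0 ≤ P.ord f → 0 ≤ Q.ord f) : P = Q := by
  have hu : ∀ f : K, f ≠ 0 → P.ord f = 0 → Q.ord f = 0 := by
    intro f hf h0
    have h1 := h f hf h0.ge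
    have h2 := h f⁻¹ (inv_ne_zero hf) (by rw [ord_inv]; omega)
    rw [ord_inv] at h2; omega
  obtain ⟨t, ht, ht1⟩ := P.exists_ord_eq 1
  -- Dividing by a power of the uniformizer `t` of `P` leaves a unit at `P`, so `Q.ord` is a
  -- constant multiple of `P.ord`. Since `Q.ord` takes the value 1, the constant is 1.
  have hk : ∀ f : K, f ≠ 0 → Q.ord f = P.ord f * Q.ord t := by
    intro f hf
    have := hu (f / t ^ (P.ord f)) (div_ne_zero hf (zpow_ne_zero _ ht))
      (by rw [P.ord_div hf (zpow_ne_zero _ ht), ord_zpow, ht1]; ring)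
    rw [Q.ord_div hf (zpow_ne_zero _ ht), ord_zpow] at this
    linarith
  have ht0 := h t ht (by omega)
  obtain ⟨s, hs, hs1⟩ := Q.exists_ord_eq 1
  have h1 : Q.ord t = 1 := by
    have := hk s hs
    rw [hs1] at this
    have h3 : Q.ord t ∣ 1 := ⟨P.ord s, by rw [this]; ring⟩
    exact Int.eq_one_of_dvd_one ht0 h3
  exact ext_ord fun f hf => by rw [hk f hf, h1, mul_one]

/-- A place from an order function. -/
def ofOrd (o : K → ℤ) (hmul : ∀ f g, f ≠ 0 → g ≠ 0 → o (f * g) = o f + o g)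
    (hadd : ∀ f g, f ≠ 0 → g ≠ 0 → f + g ≠ 0 → min (o f) (o g) ≤ o (f + g))
    (hsurj : ∃ t, t ≠ 0 ∧ o t = 1) (hconst : ∀ c : ℂ, c ≠ 0 → o (algebraMap ℂ K c) = 0) :
    Place K where
  v := by
    classical
    exact
    { toFun := fun f => if f = 0 then 0 else WithZero.exp (-o f)
      map_zero' := by simp
      map_one' := by
        have := hconst 1 one_ne_zero
        rw [map_one] at this
        simp [this]
      map_mul' := by
        intro f g
        by_cases hf : f = 0
        · simp [hf]
        by_cases hg : g = 0
        · simp [hg]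
        simp only [hf, hg, mul_eq_zero, or_self, if_false, hmul f g hf hg, ← WithZero.exp_add]
        congr 1; ring
      map_add_le_max' := by
        intro f g
        by_cases hf : f = 0
        · simp [hf]
        by_cases hg : g = 0
        · simp [hg]
        by_cases hfg : f + g = 0
        · simp [hfg]
        have := hadd f g hf hg hfg
        simp only [hf, hg, hfg, if_false, le_max_iff, WithZero.exp_le_exp]
        rcases min_le_iff.1 this with h | h
        · left; omega
        · right; omega }
  surjective := by
    intro γ
    by_cases hγ : γ = 0
    · exact ⟨0, by simp [hγ]⟩
    obtain ⟨t, ht, ht1⟩ := hsurj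
    have hpow : ∀ n : ℕ, o (t ^ n) = n := by
      intro n
      induction n with
      | zero => simpa using hconst 1 one_ne_zero
      | succ n ih => rw [pow_succ, hmul _ _ (pow_ne_zero _ ht) ht, ih, ht1]; push_cast; ring
    have hinv : ∀ f, f ≠ 0 → o f⁻¹ = - o f := by
      intro f hf
      have h1 := hmul f f⁻¹ hf (inv_ne_zero hf)
      have h2 := hconst 1 one_ne_zero
      rw [map_one] at h2
      rw [mul_inv_cancel₀ hf, h2] at h1; omega
    have hzpow : ∀ n : ℤ, o (t ^ n) = n := by
      intro n
      rcases n with n | n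
      · simpa using hpow n
      · rw [zpow_negSucc, hinv _ (pow_ne_zero _ ht), hpow]; rfl
    refine ⟨t ^ (-WithZero.log γ), ?_⟩
    simp only [MonoidWithZeroHom.coe_mk, ZeroHom.coe_mk, Valuation.coe_mk, zpow_ne_zero _ ht,
      if_false]
    rw [hzpow, neg_neg, WithZero.exp_log hγ]
  trivial := by
    intro c hc
    have : algebraMap ℂ K c ≠ 0 := by simpa using hc
    simp [hconst c hc, hc]

theorem ord_ofOrd (o : K → ℤ) (hmul hadd hsurj hconst) {f : K} (hf : f ≠ 0) :
    (ofOrd o hmul hadd hsurj hconst).ord f = o f := by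
  simp [ord, ofOrd, hf]

/-- The image of a place under an isomorphism of function fields. -/
def comap {K' : Type} [Field K'] [Algebra ℂ K'] (e : K ≃ₐ[ℂ] K') (P : Place K') : Place K where
  v := P.v.comap (e : K →+* K')
  surjective := fun γ => by
    obtain ⟨f, hf⟩ := P.surjective γ
    exact ⟨e.symm f, by simpa using hf⟩
  trivial := fun c hc => by simpa using P.trivial c hc

theorem atLeast_comap {K' : Type} [Field K'] [Algebra ℂ K'] (e : K ≃ₐ[ℂ] K') (P : Place K')
    (f : K) (k : ℤ) : (P.comap e).AtLeast k f ↔ P.AtLeast k (e f) := Iff.rfl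

end Place

/-! ### Torsion in the class group -/

section ClassGroup

variable {K : Type} [Field K] [Algebra ℂ K]

theorem mk_eq_zero_iff (D : Place K →₀ ℤ) :
    (QuotientAddGroup.mk D : ClassGroup K) = 0 ↔ ∃ f : K, f ≠ 0 ∧ ∀ P, D P = P.ord f := by
  rw [QuotientAddGroup.eq_zero_iff]; rfl

theorem diffClass_add_diffClass (P Q R : Place K) :
    diffClass P Q + diffClass Q R = diffClass P R := by
  simp only [diffClass, ← QuotientAddGroup.mk_add]
  congr 1; abel

theorem neg_diffClass (P Q : Place K) : -diffClass P Q = diffClass Q P := by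
  simp only [diffClass, ← QuotientAddGroup.mk_neg]
  congr 1; abel

@[simp] theorem diffClass_self (P : Place K) : diffClass P P = 0 := by
  simp [diffClass]

open Classical in
/-- The divisor of the point `P`, as a function. -/
def delta (P R : Place K) : ℤ := if R = P then 1 else 0

theorem nsmul_diffClass_eq_zero_iff (n : ℕ) (P Q : Place K) :
    n • diffClass P Q = 0 ↔
      ∃ f : K, f ≠ 0 ∧ ∀ R : Place K, R.ord f = n * (delta P R - delta Q R) := by
  classical
  rw [diffClass, ← QuotientAddGroup.mk_nsmul, mk_eq_zero_iff]
  refine exists_congr fun f => and_congr Iff.rfl (forall_congr' fun R => ?_)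
  simp only [Finsupp.smul_apply, Finsupp.sub_apply, Finsupp.single_apply, delta, eq_comm (a := R),
    nsmul_eq_mul]
  exact eq_comm

theorem isOfFinAddOrder_diffClass_iff (P Q : Place K) :
    IsOfFinAddOrder (diffClass P Q) ↔ ∃ n : ℕ, 0 < n ∧
      ∃ f : K, f ≠ 0 ∧ ∀ R : Place K, R.ord f = n * (delta P R - delta Q R) := by
  rw [isOfFinAddOrder_iff_nsmul_eq_zero]
  simp only [nsmul_diffClass_eq_zero_iff]

end ClassGroup

end

/-! ### Values at places; places in quadratic extensions; push-forward and pull-back of torsion -/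

section

/-! ### Residues -/

theorem IsCurve.isAlgebraic_adjoin {K : Type} [Field K] [Algebra ℂ K] (hK : IsCurve K) {f : K}
    (hf : Transcendental ℂ f) : Algebra.IsAlgebraic (IntermediateField.adjoin ℂ {f}) K := by
  have h1 : AlgebraicIndependent ℂ (fun _ : Unit => f) :=
    (algebraicIndependent_unique_type_iff (ι := Unit)).2 hf
  have h2 := h1.isTranscendenceBasis_of_trdeg_le_of_finite (by simp [hK.trdeg])
  have h3 := h2.isAlgebraic_field
  have h4 : (Set.range fun _ : Unit => f) = {f} := by simp
  rw [h4] at h3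
  exact h3

/-- A function without a pole at `P` has a value at `P`. -/
theorem IsCurve.exists_value {K : Type} [Field K] [Algebra ℂ K] (hK : IsCurve K) (P : Place K)
    {f : K} (hf : P.AtLeast 0 f) : ∃ c : ℂ, P.AtLeast 1 (f - algebraMap ℂ K c) := by
  by_contra hcon
  push Not at hcon
  -- If `f` has no value, every `f - c` is a unit, hence so is every nonzero polynomial in `f`. The
  -- valuation is then trivial on `ℂ(f)`, over which `K` is algebraic, so no element could have a
  -- pole.
  have hunit : ∀ p : Polynomial ℂ, p ≠ 0 →
      P.v (Polynomial.aeval f p) = 1 := by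
    intro p hp
    have hsplit := IsAlgClosed.splits p
    rw [hsplit.eq_prod_roots]
    rw [map_mul, map_mul, Polynomial.aeval_C, P.trivial _ (by simpa using hp), one_mul]
    rw [map_multiset_prod, map_multiset_prod, Multiset.map_map, Multiset.map_map]
    apply Multiset.prod_eq_one
    intro x hx
    obtain ⟨c, -, rfl⟩ := Multiset.mem_map.1 hx
    simp only [Function.comp_apply, map_sub, Polynomial.aeval_X, Polynomial.aeval_C]
    apply le_antisymm
    · exact Place.atLeast_zero_iff.1 (hf.sub (Place.atLeast_const c))
    · by_contra h
      exact hcon c (Place.atLeast_one_iff.2 (not_le.1 h))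
  have htr : Transcendental ℂ f := by
    rw [transcendental_iff]
    intro p hp
    by_contra h
    have := hunit p h
    rw [hp, map_zero] at this
    exact zero_ne_one this
  have halg := hK.isAlgebraic_adjoin htr
  obtain ⟨g, hg, hg1⟩ := P.exists_ord_eq (-1)
  have hint : IsIntegral (IntermediateField.adjoin ℂ {f}) g :=
    (halg.isAlgebraic g).isIntegral
  have hle : ∀ a : IntermediateField.adjoin ℂ {f}, P.v (a : K) ≤ 1 := by
    rintro ⟨a, ha⟩
    rw [IntermediateField.mem_adjoin_simple_iff] at ha
    obtain ⟨r, s, rfl⟩ := ha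
    by_cases hr : r = 0
    · simp [hr]
    by_cases hs : s = 0
    · simp [hs]
    simp [hunit r hr, hunit s hs]
  have : P.v g ≤ 1 := by
    obtain ⟨p, hp, hp0⟩ := hint
    have hmem := Valuation.Integers.mem_of_integral (Valuation.integer.integers P.v) (x := g) ?_
    · exact hmem
    · let φ : IntermediateField.adjoin ℂ {f} →+* P.v.integer :=
        RingHom.codRestrict (algebraMap _ K) _ hle
      refine ⟨p.map φ, hp.map φ, ?_⟩
      rw [Polynomial.eval₂_map]
      exact hp0
  rw [← Place.atLeast_zero_iff, Place.atLeast_iff hg] at this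
  omega

/-! ### Quadratic extensions -/

variable {F K : Type} [Field F] [Field K] [Algebra ℂ F] [Algebra ℂ K] [Algebra F K]
  [IsScalarTower ℂ F K]

/-- `σ` is the nontrivial automorphism of the quadratic extension `K` of `F`. -/
structure IsConj (σ : K ≃ₐ[F] K) : Prop where
  invol : ∀ z, σ (σ z) = z
  ne : ∃ z, σ z ≠ z
  fixed : ∀ z, σ z = z → ∃ a : F, algebraMap F K a = z

/-- The conjugate place. -/
def Place.conj (σ : K ≃ₐ[F] K) (P : Place K) : Place K := P.comap (σ.restrictScalars ℂ)

@[simp] theorem Place.ord_conj (σ : K ≃ₐ[F] K) (P : Place K) (f : K) :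
    (P.conj σ).ord f = P.ord (σ f) := rfl

theorem Place.atLeast_conj (σ : K ≃ₐ[F] K) (P : Place K) (f : K) (k : ℤ) :
    (P.conj σ).AtLeast k f ↔ P.AtLeast k (σ f) := Iff.rfl

/-- `P` lies over `Q` with ramification index `e`. -/
def Place.LiesOver (P : Place K) (Q : Place F) (e : ℤ) : Prop :=
  ∀ a : F, P.ord (algebraMap F K a) = e * Q.ord a

theorem Place.isDiscreteValuationRing (Q : Place F) :
    IsDiscreteValuationRing Q.v.valuationSubring := by
  have : Nontrivial (MonoidWithZeroHom.ofClass Q.v).valueGroup := by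
    obtain ⟨t, ht, ht1⟩ := Q.exists_ord_eq 1
    rw [Subgroup.nontrivial_iff_exists_ne_one]
    refine ⟨Units.mk0 (Q.v t) (Q.v_ne_zero ht), MonoidWithZeroHom.mem_valueGroup _ ⟨t, rfl⟩, ?_⟩
    intro h
    have h1 := congrArg Units.val h
    simp only [Units.val_mk0, Units.val_one] at h1
    simp [Place.ord, h1] at ht1
  infer_instance

namespace IsConj

variable {σ : K ≃ₐ[F] K}

theorem conj_conj (hσ : IsConj σ) (P : Place K) : (P.conj σ).conj σ = P :=
  Place.ext_ord fun f _ => by simp [hσ.invol]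

theorem exists_trace (hσ : IsConj σ) (z : K) : ∃ T : F, algebraMap F K T = z + σ z :=
  hσ.fixed _ (by rw [map_add, hσ.invol, add_comm])

theorem exists_norm (hσ : IsConj σ) (z : K) : ∃ N : F, algebraMap F K N = z * σ z :=
  hσ.fixed _ (by rw [map_mul, hσ.invol, mul_comm])

theorem exists_anti (hσ : IsConj σ) : ∃ θ : K, θ ≠ 0 ∧ σ θ = -θ := by
  obtain ⟨z, hz⟩ := hσ.ne
  exact ⟨σ z - z, sub_ne_zero.2 hz, by rw [map_sub, hσ.invol]; ring⟩

theorem exists_coords (hσ : IsConj σ) {z : K} (hz : σ z ≠ z) (w : K) :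
    ∃ a b : F, w = algebraMap F K a + algebraMap F K b * z := by
  have hd : z - σ z ≠ 0 := sub_ne_zero.2 (Ne.symm hz)
  have hd' : σ z - z ≠ 0 := sub_ne_zero.2 hz
  obtain ⟨b, hb⟩ := hσ.fixed ((w - σ w) / (z - σ z)) (by
    rw [map_div₀, map_sub, map_sub, hσ.invol, hσ.invol, ← neg_sub w, ← neg_sub z, neg_div_neg_eq])
  obtain ⟨a, ha⟩ := hσ.fixed (w - algebraMap F K b * z) (by
    rw [map_sub, map_mul, AlgEquiv.commutes]
    have : algebraMap F K b * (z - σ z) = w - σ w := by rw [hb]; field_simp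
    linear_combination this)
  exact ⟨a, b, by rw [ha]; ring⟩

theorem exists_anti_coords (hσ : IsConj σ) {θ : K} (h0 : θ ≠ 0) (hθ : σ θ = -θ) (w : K) :
    ∃ a b : F, w = algebraMap F K a + algebraMap F K b * θ :=
  hσ.exists_coords (by
    rw [hθ]; intro h
    have h2 : (2 : K) * θ = 0 := by linear_combination -h
    have : CharZero K := charZero_of_injective_algebraMap (algebraMap ℂ K).injective
    exact h0 ((mul_eq_zero.1 h2).resolve_left two_ne_zero)) w

/-- A uniformizer `z` satisfies `z² + N = T z` with `T`, `N` in `F`. Comparing the orders of the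
three terms produces an element of `F` of order 1 or 2 at `P`, so the orders of elements of `F` form
`ℤ` or `2ℤ`; dividing them by `e` gives a place of `F`. -/
theorem exists_liesOver (hσ : IsConj σ) (P : Place K) :
    ∃ (Q : Place F) (e : ℤ), (e = 1 ∨ e = 2) ∧ P.LiesOver Q e := by
  have inj : ∀ {a : F}, a ≠ 0 → algebraMap F K a ≠ 0 := fun h => by simpa using h
  have hodd : (∃ a : F, a ≠ 0 ∧ P.ord (algebraMap F K a) = 1) ∨
      ∃ a : F, a ≠ 0 ∧ P.ord (algebraMap F K a) = 2 := by
    obtain ⟨z, hz, hz1⟩ := P.exists_ord_eq 1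
    obtain ⟨T, hT⟩ := hσ.exists_trace z
    obtain ⟨N, hN⟩ := hσ.exists_norm z
    have hN0 : N ≠ 0 := by
      rintro rfl
      rw [map_zero] at hN
      exact mul_ne_zero hz (by simpa using hz) hN.symm
    have heq : z ^ 2 + algebraMap F K N = algebraMap F K T * z := by rw [hT, hN]; ring
    have hz2 : P.ord (z ^ 2) = 2 := by rw [P.ord_pow, hz1]; norm_num
    by_cases hT0 : T = 0
    · right
      refine ⟨N, hN0, ?_⟩
      rw [hT0, map_zero, zero_mul] at heq
      rw [← hz2, ← P.ord_neg, ← eq_neg_of_add_eq_zero_left heq]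
    · by_cases h : P.ord (z ^ 2) = P.ord (algebraMap F K N)
      · right; exact ⟨N, hN0, by rw [← h, hz2]⟩
      · left
        have h3 := (Place.ord_add_of_ne (pow_ne_zero 2 hz) (inj hN0) h).2
        rw [heq, P.ord_mul (inj hT0) hz, hz2, hz1] at h3
        rcases min_choice (2 : ℤ) (P.ord (algebraMap F K N)) with h4 | h4
        · exact ⟨T, hT0, by omega⟩
        · refine ⟨N / T, div_ne_zero hN0 hT0, ?_⟩
          rw [map_div₀, P.ord_div (inj hN0) (inj hT0)]; omega
  have key : ∀ e : ℤ, (e = 1 ∨ e = 2) → (∃ a : F, a ≠ 0 ∧ P.ord (algebraMap F K a) = e) →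
      (∀ a : F, e ∣ P.ord (algebraMap F K a)) →
      ∃ (Q : Place F) (e : ℤ), (e = 1 ∨ e = 2) ∧ P.LiesOver Q e := by
    rintro e he ⟨t, ht, hte⟩ hdvd
    have he0 : 0 < e := by omega
    have hmul : ∀ a : F, e * (P.ord (algebraMap F K a) / e) = P.ord (algebraMap F K a) :=
      fun a => Int.mul_ediv_cancel' (hdvd a)
    refine ⟨Place.ofOrd (fun a => P.ord (algebraMap F K a) / e) ?_ ?_ ?_ ?_, e, he, ?_⟩
    · intro f g hf hg
      simp only [map_mul, P.ord_mul (inj hf) (inj hg)]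
      exact Int.add_ediv_of_dvd_left (hdvd f)
    · intro f g hf hg hfg
      have h1 : min (P.ord (algebraMap F K f)) (P.ord (algebraMap F K g)) ≤
          P.ord (algebraMap F K (f + g)) := by
        apply Place.AtLeast.le_ord _ (inj hfg)
        rw [map_add]
        exact ((Place.atLeast_iff (inj hf)).2 (min_le_left _ _)).add
          ((Place.atLeast_iff (inj hg)).2 (min_le_right _ _))
      rcases min_le_iff.1 h1 with h | h
      · exact min_le_iff.2 (Or.inl (Int.ediv_le_ediv he0 h))
      · exact min_le_iff.2 (Or.inr (Int.ediv_le_ediv he0 h))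
    · exact ⟨t, ht, by rw [hte]; exact Int.ediv_self he0.ne'⟩
    · intro c _
      rw [← IsScalarTower.algebraMap_apply, P.ord_const]; simp
    · intro a
      by_cases ha : a = 0
      · simp [ha]
      · rw [Place.ord_ofOrd _ _ _ _ _ ha, hmul]
  by_cases h1 : ∃ a : F, a ≠ 0 ∧ P.ord (algebraMap F K a) = 1
  · exact key 1 (Or.inl rfl) h1 fun _ => one_dvd _
  · refine key 2 (Or.inr rfl) (hodd.resolve_left h1) fun a => ?_
    obtain ⟨t, ht, ht2⟩ := hodd.resolve_left h1
    by_contra hnd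
    have ha : a ≠ 0 := by rintro rfl; simp at hnd
    set n := P.ord (algebraMap F K a) with hn
    refine h1 ⟨a / t ^ (n / 2), div_ne_zero ha (zpow_ne_zero _ ht), ?_⟩
    rw [map_div₀, map_zpow₀, P.ord_div (inj ha) (zpow_ne_zero _ (inj ht)), P.ord_zpow, ht2, ← hn]
    omega

/-- Orders at a ramified place, in terms of a uniformizer. -/
theorem exists_uniformizer (hσ : IsConj σ) {P : Place K} {Q : Place F} (h : P.LiesOver Q 2) :
    ∃ z : K, z ≠ 0 ∧ P.ord z = 1 ∧ P.ord (σ z) = 1 ∧ σ z ≠ z := by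
  obtain ⟨z, hz, hz1⟩ := P.exists_ord_eq 1
  have hsz : σ z ≠ 0 := by simpa using hz
  obtain ⟨T, hT⟩ := hσ.exists_trace z
  obtain ⟨N, hN⟩ := hσ.exists_norm z
  have h1 := h N
  rw [hN, P.ord_mul hz hsz, hz1] at h1
  have h2 := h T
  rw [hT] at h2
  refine ⟨z, hz, hz1, ?_, ?_⟩
  · by_contra hne
    rw [← hz1] at hne
    have h3 := (Place.ord_add_of_ne hz hsz (Ne.symm hne)).2
    rw [h2, hz1] at h3
    rcases min_choice (1 : ℤ) (P.ord (σ z)) with h4 | h4 <;> omega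
  · intro heq
    obtain ⟨a, ha⟩ := hσ.fixed z heq
    have := h a
    rw [ha, hz1] at this
    omega

/-- The two terms have orders of different parity, so no cancellation occurs and the order of the
sum is determined by the orders of `a` and `b` at `Q`. -/
theorem ord_eq_of_ramified {P P' : Place K} {Q : Place F} (h : P.LiesOver Q 2)
    (h' : P'.LiesOver Q 2) {z z' : K} (hz : P.ord z = 1) (hz' : P'.ord z' = 1) (a b : F) :
    P.ord (algebraMap F K a + algebraMap F K b * z) =
      P'.ord (algebraMap F K a + algebraMap F K b * z') := by
  have inj : ∀ {a : F}, a ≠ 0 → algebraMap F K a ≠ 0 := fun h => by simpa using h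
  have hz0 : z ≠ 0 := by rintro rfl; simp at hz
  have hz0' : z' ≠ 0 := by rintro rfl; simp at hz'
  by_cases ha : a = 0
  · by_cases hb : b = 0
    · simp [ha, hb]
    · simp [ha, P.ord_mul (inj hb) hz0, P'.ord_mul (inj hb) hz0', h b, h' b, hz, hz']
  by_cases hb : b = 0
  · simp [hb, h a, h' a]
  rw [(Place.ord_add_of_ne (P := P) (inj ha) (mul_ne_zero (inj hb) hz0) _).2,
    (Place.ord_add_of_ne (P := P') (inj ha) (mul_ne_zero (inj hb) hz0') _).2]
  · simp [P.ord_mul (inj hb) hz0, P'.ord_mul (inj hb) hz0', h b, h' b, h a, h' a, hz, hz']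
  · rw [P'.ord_mul (inj hb) hz0', h' b, h' a, hz']; omega
  · rw [P.ord_mul (inj hb) hz0, h b, h a, hz]; omega

theorem conj_eq_of_ramified (hσ : IsConj σ) {P : Place K} {Q : Place F} (h : P.LiesOver Q 2) :
    P.conj σ = P := by
  obtain ⟨z, hz, hz1, hsz1, hne⟩ := hσ.exists_uniformizer h
  refine Place.ext_ord fun w _ => ?_
  obtain ⟨a, b, rfl⟩ := hσ.exists_coords hne w
  rw [Place.ord_conj, map_add, map_mul, AlgEquiv.commutes, AlgEquiv.commutes]
  exact ord_eq_of_ramified h h hsz1 hz1 a b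

theorem liesOver_conj {P : Place K} {Q : Place F} {e : ℤ} (h : P.LiesOver Q e) :
    (P.conj σ).LiesOver Q e := fun a => by
  rw [Place.ord_conj, AlgEquiv.commutes, h a]

theorem exists_anti_unit (hσ : IsConj σ) {P : Place K} {Q : Place F} (h : P.LiesOver Q 1) :
    ∃ θ : K, θ ≠ 0 ∧ σ θ = -θ ∧ P.ord θ = 0 := by
  obtain ⟨θ, h0, hθ⟩ := hσ.exists_anti
  obtain ⟨a, ha, han⟩ := Q.exists_ord_eq (P.ord θ)
  have ha' : algebraMap F K a ≠ 0 := by simpa using ha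
  refine ⟨θ / algebraMap F K a, div_ne_zero h0 ha', ?_, ?_⟩
  · rw [map_div₀, hθ, AlgEquiv.commutes, neg_div]
  · rw [P.ord_div h0 ha', h a, han]; ring

/-- A unit that is anti-invariant under `σ` has a nonzero value. -/
theorem exists_anti_value (hσ : IsConj σ) (hK : IsCurve K) {P : Place K} {Q : Place F} (h : P.LiesOver Q 1) :
    ∃ (θ : K) (c : ℂ), θ ≠ 0 ∧ σ θ = -θ ∧ c ≠ 0 ∧ P.AtLeast 1 (θ - algebraMap ℂ K c) := by
  obtain ⟨θ, h0, hθ, hu⟩ := hσ.exists_anti_unit h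
  obtain ⟨c, hc⟩ := hK.exists_value P ((Place.atLeast_iff h0).2 hu.ge)
  refine ⟨θ, c, h0, hθ, ?_, hc⟩
  rintro rfl
  rw [map_zero, sub_zero, Place.atLeast_iff h0] at hc
  omega

/-- An anti-invariant unit takes opposite nonzero values at a place and at its conjugate. -/
theorem conj_ne_of_unramified (hσ : IsConj σ) (hK : IsCurve K) {P : Place K} {Q : Place F}
    (h : P.LiesOver Q 1) : P.conj σ ≠ P := by
  obtain ⟨θ, c, h0, hθ, hc0, hc⟩ := hσ.exists_anti_value hK h
  intro heq
  have h2 := hc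
  rw [← heq, Place.atLeast_conj, map_sub, hθ] at h2
  have hcc : σ (algebraMap ℂ K c) = algebraMap ℂ K c := (σ.restrictScalars ℂ).commutes c
  rw [hcc] at h2
  have h3 := h2.add hc
  have h4 : -θ - algebraMap ℂ K c + (θ - algebraMap ℂ K c) = algebraMap ℂ K (-2 * c) := by
    rw [map_mul, map_neg, map_ofNat]; ring
  rw [h4] at h3
  exact P.not_atLeast_const (by simpa using hc0) h3

/-- The norm of a uniformizer `z` of `P` has order 1 at `Q`, so the orders of `z` and `σ z` at `P'`
add up to `e`. If they differed, the smaller one would be the order of the trace, which vanishes at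
`Q`, hence at least `e`, and the sum would be too large. So they are equal, `e = 2`, and `z` is a
uniformizer at `P'` too. -/
theorem eq_of_ramified (hσ : IsConj σ) {P P' : Place K} {Q : Place F} {e : ℤ} (he : e = 1 ∨ e = 2)
    (h : P.LiesOver Q 2) (h' : P'.LiesOver Q e) : P' = P := by
  obtain ⟨z, hz, hz1, hsz1, hne⟩ := hσ.exists_uniformizer h
  have hsz : σ z ≠ 0 := by simpa using hz
  obtain ⟨T, hT⟩ := hσ.exists_trace z
  obtain ⟨N, hN⟩ := hσ.exists_norm z
  have hN1 : Q.ord N = 1 := by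
    have := h N
    rw [hN, P.ord_mul hz hsz, hz1, hsz1] at this; omega
  have hN' := h' N
  rw [hN, P'.ord_mul hz hsz, hN1, mul_one] at hN'
  have heq : P'.ord z = P'.ord (σ z) := by
    by_contra hne'
    obtain ⟨hs0, hs⟩ := Place.ord_add_of_ne hz hsz hne'
    have h1 : 1 ≤ P.ord (z + σ z) := Place.AtLeast.le_ord
      (((Place.atLeast_iff hz).2 hz1.ge).add ((Place.atLeast_iff hsz).2 hsz1.ge)) hs0
    have h2 := h T
    have h3 := h' T
    rw [hT] at h2 h3
    have h4 : 1 ≤ Q.ord T := by omega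
    rw [hs] at h3
    have h5 : e ≤ e * Q.ord T := by rcases he with rfl | rfl <;> omega
    rcases min_le_iff.1 (le_refl (min (P'.ord z) (P'.ord (σ z)))) with h6 | h6 <;> omega
  have he2 : e = 2 := by omega
  subst he2
  refine Place.ext_ord fun w _ => ?_
  obtain ⟨a, b, rfl⟩ := hσ.exists_coords hne w
  exact ord_eq_of_ramified h' h (by omega) hz1 a b

/-- The value of an anti-invariant unit separates the places over `Q`. The critical case is `a + θ`
with `a` a unit of value `α`. If `α + c ≠ 0` it is a unit at both places. Otherwise its conjugate `a
- θ` is a unit at both, and the order of `a + θ` equals that of its norm, which lies in `F`. -/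
theorem eq_of_value_eq (hσ : IsConj σ) (hK : IsCurve K) {P P' : Place K} {Q : Place F} (h : P.LiesOver Q 1)
    (h' : P'.LiesOver Q 1) {θ : K} {c : ℂ} (h0 : θ ≠ 0) (hθ : σ θ = -θ) (hc : c ≠ 0)
    (hP : P.AtLeast 1 (θ - algebraMap ℂ K c)) (hP' : P'.AtLeast 1 (θ - algebraMap ℂ K c)) :
    P = P' := by
  have inj : ∀ {a : F}, a ≠ 0 → algebraMap F K a ≠ 0 := fun h => by simpa using h
  have hu : P.ord θ = 0 := (Place.ord_eq_zero_of_value hc hP).2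
  have hu' : P'.ord θ = 0 := (Place.ord_eq_zero_of_value hc hP').2
  have hF : ∀ a : F, P.ord (algebraMap F K a) = P'.ord (algebraMap F K a) := fun a => by
    rw [h a, h' a]
  have hFA : ∀ (a : F) k, P.AtLeast k (algebraMap F K a) → P'.AtLeast k (algebraMap F K a) := by
    intro a k hk
    by_cases ha : a = 0
    · rw [ha, map_zero]; exact Place.atLeast_zero_fun _
    · rwa [Place.atLeast_iff (inj ha), ← hF, ← Place.atLeast_iff (inj ha)]
  have key : ∀ a : F, a ≠ 0 →
      P.ord (algebraMap F K a + θ) = P'.ord (algebraMap F K a + θ) := by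
    intro a ha
    by_cases ha0 : P.ord (algebraMap F K a) = 0
    · obtain ⟨α, hα⟩ := hK.exists_value P ((Place.atLeast_iff (inj ha)).2 ha0.ge)
      have hα' : P'.AtLeast 1 (algebraMap F K a - algebraMap ℂ K α) := by
        rw [IsScalarTower.algebraMap_apply ℂ F K, ← map_sub] at hα ⊢
        exact hFA _ _ hα
      have hdiff : ∀ R : Place K, R.AtLeast 1 (algebraMap F K a - algebraMap ℂ K α) →
          R.AtLeast 1 (θ - algebraMap ℂ K c) →
          R.AtLeast 1 ((algebraMap F K a - θ) - algebraMap ℂ K (α - c)) := by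
        intro R h1 h2
        have := h1.sub h2
        rw [map_sub]
        convert this using 1; ring
      have hsum : ∀ R : Place K, R.AtLeast 1 (algebraMap F K a - algebraMap ℂ K α) →
          R.AtLeast 1 (θ - algebraMap ℂ K c) →
          R.AtLeast 1 ((algebraMap F K a + θ) - algebraMap ℂ K (α + c)) := by
        intro R h1 h2
        have := h1.add h2
        rw [map_add]
        convert this using 1; ring
      by_cases hαc : α + c = 0
      · have hαc' : α - c ≠ 0 := by
          intro h1
          apply hc
          have : 2 * c = 0 := by linear_combination hαc - h1
          simpa using this
        have h1 := Place.ord_eq_zero_of_value hαc' (hdiff P hα hP)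
        have h2 := Place.ord_eq_zero_of_value hαc' (hdiff P' hα' hP')
        have h3 : algebraMap F K a + θ ≠ 0 := by
          intro h3
          apply h1.1
          have := congrArg σ h3
          rw [map_add, AlgEquiv.commutes, hθ, map_zero] at this
          rw [sub_eq_add_neg, this]
        obtain ⟨N, hN⟩ := hσ.exists_norm (algebraMap F K a + θ)
        rw [map_add, AlgEquiv.commutes, hθ, ← sub_eq_add_neg] at hN
        have h4 := hF N
        rw [hN, P.ord_mul h3 h1.1, P'.ord_mul h3 h1.1, h1.2, h2.2] at h4
        simpa using h4
      · rw [(Place.ord_eq_zero_of_value hαc (hsum P hα hP)).2,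
          (Place.ord_eq_zero_of_value hαc (hsum P' hα' hP')).2]
    · rw [(Place.ord_add_of_ne (P := P) (inj ha) h0 (by rwa [hu])).2,
        (Place.ord_add_of_ne (P := P') (inj ha) h0 (by rwa [hu', ← hF])).2, hF, hu, hu']
  refine Place.ext_ord fun w _ => ?_
  obtain ⟨a, b, rfl⟩ := hσ.exists_anti_coords h0 hθ w
  by_cases hb : b = 0
  · simp [hb, hF]
  by_cases ha : a = 0
  · simp [ha, P.ord_mul (inj hb) h0, P'.ord_mul (inj hb) h0, hF, hu, hu']
  have hfac : algebraMap F K a + algebraMap F K b * θ =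
      algebraMap F K b * (algebraMap F K (a / b) + θ) := by
    have := inj hb
    rw [map_div₀]; field_simp
  have hab := div_ne_zero ha hb
  by_cases hs : algebraMap F K (a / b) + θ = 0
  · rw [hfac, hs]; simp
  · rw [hfac, P.ord_mul (inj hb) hs, P'.ord_mul (inj hb) hs, hF, key _ hab]

/-- The places over a given place form one orbit under `σ`. -/
theorem eq_or_eq_conj (hσ : IsConj σ) (hK : IsCurve K) {P P' : Place K} {Q : Place F} {e e' : ℤ}
    (he : e = 1 ∨ e = 2) (he' : e' = 1 ∨ e' = 2) (h : P.LiesOver Q e) (h' : P'.LiesOver Q e') :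
    P' = P ∨ P' = P.conj σ := by
  rcases he with rfl | rfl
  swap
  · exact Or.inl (hσ.eq_of_ramified he' h h')
  rcases he' with rfl | rfl
  swap
  · exact Or.inl (hσ.eq_of_ramified (Or.inl rfl) h' h).symm
  obtain ⟨θ, c, h0, hθ, hc, hP⟩ := hσ.exists_anti_value hK h
  obtain ⟨d, hd⟩ := hσ.exists_norm θ
  have hcc : σ (algebraMap ℂ K c) = algebraMap ℂ K c := (σ.restrictScalars ℂ).commutes c
  -- `θ² - c²` lies in `F` and vanishes at `P`, hence at `Q`, hence at `P'`: the value of `θ` at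
  -- `P'` is `c` or `-c`.
  have hprod : (θ - algebraMap ℂ K c) * (θ + algebraMap ℂ K c) =
      algebraMap F K (-d - algebraMap ℂ F (c ^ 2)) := by
    rw [map_sub, map_neg, hd, hθ, ← IsScalarTower.algebraMap_apply, map_pow]; ring
  have hA : P.AtLeast 0 (θ + algebraMap ℂ K c) :=
    (Place.atLeast_zero_of_value hP).add (Place.atLeast_const c)
  have h1 := hP.mul hA
  rw [hprod] at h1
  have hn1 : θ - algebraMap ℂ K c ≠ 0 := by
    intro h2
    rw [sub_eq_zero.1 h2, hcc] at hθ
    have : algebraMap ℂ K (2 * c) = 0 := by rw [map_mul, map_ofNat]; linear_combination hθ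
    simp [hc] at this
  have hn2 : θ + algebraMap ℂ K c ≠ 0 := by
    intro h2
    have := congrArg σ h2
    rw [map_add, hθ, hcc, map_zero] at this
    exact hn1 (by linear_combination -this)
  have h2 : P'.AtLeast 1 (algebraMap F K (-d - algebraMap ℂ F (c ^ 2))) := by
    have hne : algebraMap F K (-d - algebraMap ℂ F (c ^ 2)) ≠ 0 := by
      rw [← hprod]; exact mul_ne_zero hn1 hn2
    rw [Place.atLeast_iff hne, h'] ; rw [Place.atLeast_iff hne, h] at h1; simpa using h1
  rw [← hprod, Place.atLeast_iff (mul_ne_zero hn1 hn2), P'.ord_mul hn1 hn2] at h2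
  have h3 : P'.AtLeast 1 (θ - algebraMap ℂ K c) ∨ P'.AtLeast 1 (θ + algebraMap ℂ K c) := by
    rw [Place.atLeast_iff hn1, Place.atLeast_iff hn2]; omega
  rcases h3 with h3 | h3
  · exact Or.inl (hσ.eq_of_value_eq hK h' h h0 hθ hc h3 hP)
  · right
    have h4 : (P'.conj σ).AtLeast 1 (θ - algebraMap ℂ K c) := by
      rw [Place.atLeast_conj, map_sub, hθ, hcc]
      have := h3.neg
      rwa [neg_add, ← sub_eq_add_neg] at this
    have h5 := hσ.eq_of_value_eq hK (liesOver_conj h') h h0 hθ hc h4 hP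
    rw [← h5, hσ.conj_conj]

-- The integral closure in `K` of the valuation ring of `Q` is a Dedekind domain and not a field. A
-- maximal ideal of it gives a place of `K`, and the place of `F` below has a local ring containing
-- that of `Q`, hence is `Q`.
open IsDedekindDomain in
theorem exists_place_over (hσ : IsConj σ) (hfin : Module.Finite F K)
    (Q : Place F) :
    ∃ (P : Place K) (e : ℤ), (e = 1 ∨ e = 2) ∧ P.LiesOver Q e := by
  let A := Q.v.valuationSubring
  have hA : IsDiscreteValuationRing A := Q.isDiscreteValuationRing
  have hT : IsScalarTower A F K := ⟨fun a b c => mul_smul (a : F) b c⟩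
  have : CharZero F := charZero_of_injective_algebraMap (algebraMap ℂ F).injective
  let B := integralClosure A K
  have hB : IsDedekindDomain B := integralClosure.isDedekindDomain A F K
  have hBK : IsFractionRing B K := integralClosure.isFractionRing_of_finite_extension F K
  have hBf : ¬ IsField B := by
    intro h
    refine IsDiscreteValuationRing.not_isField A (isField_of_isIntegral_of_isField ?_ h)
    rw [injective_iff_map_eq_zero]
    intro a ha
    have h2 : algebraMap B K (algebraMap A B a) = 0 := by rw [ha, map_zero]
    rw [← IsScalarTower.algebraMap_apply, IsScalarTower.algebraMap_apply A F K] at h2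
    simpa using h2
  obtain ⟨p, hp⟩ := Ideal.exists_maximal B
  have hp0 : p ≠ ⊥ := by
    rintro rfl
    exact hBf (Ring.isField_iff_maximal_bot.2 hp)
  let w : HeightOneSpectrum B := ⟨p, hp.isPrime, hp0⟩
  have hle : ∀ a : A, w.valuation K (algebraMap F K a) ≤ 1 := by
    intro a
    exact w.valuation_le_one (K := K) (algebraMap A B a)
  have hc : ∀ c : ℂ, w.valuation K (algebraMap ℂ K c) ≤ 1 := by
    intro c
    have := hle ⟨algebraMap ℂ F c, Q.algebraMap_mem c⟩
    rwa [show ((⟨algebraMap ℂ F c, Q.algebraMap_mem c⟩ : A) : F) = algebraMap ℂ F c from rfl,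
      ← IsScalarTower.algebraMap_apply] at this
  let P : Place K :=
    { v := w.valuation K
      surjective := w.valuation_surjective K
      trivial := fun c h0 => by
        refine le_antisymm (hc c) ?_
        have h1 := hc c⁻¹
        rw [map_inv₀, map_inv₀] at h1
        have h2 : w.valuation K (algebraMap ℂ K c) ≠ 0 := by simpa using h0
        exact (inv_le_one₀ (zero_lt_iff.2 h2)).1 h1 }
  obtain ⟨Q', e, he, h⟩ := hσ.exists_liesOver P
  have hQ : Q = Q' := by
    refine Place.eq_of_le fun f hf h0 => ?_
    have h1 : P.AtLeast 0 (algebraMap F K f) :=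
      Place.atLeast_zero_iff.2 (hle ⟨f, Place.atLeast_zero_iff.1 ((Place.atLeast_iff hf).2 h0)⟩)
    rw [Place.atLeast_iff (by simpa using hf), h f] at h1
    rcases he with rfl | rfl <;> omega
  exact ⟨P, e, he, hQ ▸ h⟩

/-! ### Push-forward and pull-back of torsion classes -/

theorem exists_place_liesOver (hσ : IsConj σ) (hfin : Module.Finite F K) (hK : IsCurve K) (Q : Place F) :
    ∃ P : Place K, (P.LiesOver Q 1 ∧ P.conj σ ≠ P) ∨ (P.LiesOver Q 2 ∧ P.conj σ = P) := by
  obtain ⟨P, e, rfl | rfl, h⟩ := hσ.exists_place_over hfin Q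
  · exact ⟨P, Or.inl ⟨h, hσ.conj_ne_of_unramified hK h⟩⟩
  · exact ⟨P, Or.inr ⟨h, hσ.conj_eq_of_ramified h⟩⟩

theorem liesOver_unique {P : Place K} {Q Q' : Place F} {e e' : ℤ} (he : e = 1 ∨ e = 2)
    (he' : e' = 1 ∨ e' = 2) (h : P.LiesOver Q e) (h' : P.LiesOver Q' e') : Q = Q' := by
  refine Place.eq_of_le fun f _ h0 => ?_
  have h1 := h f
  rw [h' f] at h1
  rcases he with rfl | rfl <;> rcases he' with rfl | rfl <;> omega

/-- If `f` has divisor `n (P - P₀)`, then the norm of `f` has divisor `n (Q - Q₀)`. -/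
theorem isOfFinAddOrder_push (hσ : IsConj σ) (hfin : Module.Finite F K) (hK : IsCurve K) {P P₀ : Place K}
    {Q Q₀ : Place F} {e e₀ : ℤ} (he : e = 1 ∨ e = 2) (he₀ : e₀ = 1 ∨ e₀ = 2)
    (h : P.LiesOver Q e) (h₀ : P₀.LiesOver Q₀ e₀) (ht : IsOfFinAddOrder (diffClass P P₀)) :
    IsOfFinAddOrder (diffClass Q Q₀) := by
  rw [isOfFinAddOrder_diffClass_iff] at ht ⊢
  obtain ⟨n, hn, f, hf, hdiv⟩ := ht
  obtain ⟨N, hN⟩ := hσ.exists_norm f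
  have hsf : σ f ≠ 0 := by simpa using hf
  refine ⟨n, hn, N, ?_, fun R => ?_⟩
  · rintro rfl
    rw [map_zero] at hN
    exact mul_ne_zero hf hsf hN.symm
  -- The order of the norm at `R'` collects contributions at `R'` and at its conjugate. These are
  -- distinct when `R'` is unramified; at a ramified place they coincide and count twice, which
  -- matches the ramification index `k`.
  have key : ∀ {P : Place K} {Q : Place F} {e : ℤ}, (e = 1 ∨ e = 2) → P.LiesOver Q e →
      ∀ {R' : Place K} {k : ℤ}, (k = 1 ∧ R'.LiesOver R 1 ∧ R'.conj σ ≠ R' ∨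
        k = 2 ∧ R'.LiesOver R 2 ∧ R'.conj σ = R') →
      delta P R' + delta P (R'.conj σ) = k * delta Q R := by
    intro P Q e he h R' k hR'
    have hover : R'.LiesOver R k ∧ (k = 1 ∨ k = 2) := by
      rcases hR' with ⟨rfl, h1, -⟩ | ⟨rfl, h1, -⟩ <;> exact ⟨h1, by simp⟩
    simp only [delta]
    by_cases hQ : R = Q
    · subst hQ
      have := hσ.eq_or_eq_conj hK hover.2 he hover.1 h
      rcases hR' with ⟨rfl, h1, h2⟩ | ⟨rfl, h1, h2⟩
      · rcases this with rfl | rfl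
        · simp [h2]
        · simp [Ne.symm h2]
      · rw [h2] at this ⊢
        obtain rfl : P = R' := by simpa using this
        simp
    · have h1 : R' ≠ P := by
        rintro rfl
        exact hQ (liesOver_unique hover.2 he hover.1 h)
      have h2 : R'.conj σ ≠ P := by
        rintro rfl
        exact hQ (liesOver_unique hover.2 he (liesOver_conj hover.1) h)
      simp [hQ, h1, h2]
  obtain ⟨R', hR'⟩ := hσ.exists_place_liesOver hfin hK R
  obtain ⟨k, hk⟩ : ∃ k : ℤ, (k = 1 ∧ R'.LiesOver R 1 ∧ R'.conj σ ≠ R' ∨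
      k = 2 ∧ R'.LiesOver R 2 ∧ R'.conj σ = R') := by
    rcases hR' with h1 | h1
    · exact ⟨1, Or.inl ⟨rfl, h1⟩⟩
    · exact ⟨2, Or.inr ⟨rfl, h1⟩⟩
  have h1 : R'.ord (algebraMap F K N) = k * R.ord N := by
    rcases hk with ⟨rfl, h1, -⟩ | ⟨rfl, h1, -⟩ <;> exact h1 N
  have h2 := hdiv R'
  have h3 := hdiv (R'.conj σ)
  rw [Place.ord_conj] at h3
  rw [hN, R'.ord_mul hf hsf, h2, h3] at h1
  have h4 := key he h hk
  have h5 := key he₀ h₀ hk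
  have h6 : k ≠ 0 := by rcases hk with ⟨rfl, -⟩ | ⟨rfl, -⟩ <;> norm_num
  apply mul_left_cancel₀ h6
  linear_combination -h1 + (n : ℤ) * h4 - (n : ℤ) * h5

/-- The pull-back of the divisor `Q` is `P + P.conj σ`, which is `2 P` at a ramified place, and a
function on the lower curve, viewed in `K`, has the pulled back divisor. -/
theorem isOfFinAddOrder_pull (hσ : IsConj σ) (hK : IsCurve K) {P P₀ : Place K}
    {Q Q₀ : Place F} {e e₀ : ℤ} (he : e = 1 ∨ e = 2) (he₀ : e₀ = 1 ∨ e₀ = 2)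
    (h : P.LiesOver Q e) (h₀ : P₀.LiesOver Q₀ e₀) (ht : IsOfFinAddOrder (diffClass Q Q₀)) :
    IsOfFinAddOrder (diffClass P P₀ + diffClass (P.conj σ) (P₀.conj σ)) := by
  rw [isOfFinAddOrder_diffClass_iff] at ht
  rw [isOfFinAddOrder_iff_nsmul_eq_zero]
  obtain ⟨n, hn, g, hg, hdiv⟩ := ht
  refine ⟨n, hn, ?_⟩
  simp only [diffClass, ← QuotientAddGroup.mk_add, ← QuotientAddGroup.mk_nsmul]
  rw [mk_eq_zero_iff]
  refine ⟨algebraMap F K g, by simpa using hg, fun R' => ?_⟩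
  obtain ⟨R, k, hk, hR⟩ := hσ.exists_liesOver R'
  have key : ∀ {P : Place K} {Q : Place F} {e : ℤ}, (e = 1 ∨ e = 2) → P.LiesOver Q e →
      delta P R' + delta (P.conj σ) R' = k * delta Q R := by
    intro P Q e he h
    simp only [delta]
    by_cases hQ : R = Q
    · subst hQ
      have := hσ.eq_or_eq_conj hK he hk h hR
      rcases hk with rfl | rfl
      · have h2 := hσ.conj_ne_of_unramified hK hR
        rcases this with rfl | rfl
        · simp [Ne.symm h2]
        · rw [hσ.conj_conj] at h2
          simp [Ne.symm h2]
      · obtain rfl := hσ.eq_of_ramified he hR h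
        simp [hσ.conj_eq_of_ramified hR]
    · have h1 : R' ≠ P := by
        rintro rfl
        exact hQ (liesOver_unique hk he hR h)
      have h2 : R' ≠ P.conj σ := by
        rintro rfl
        exact hQ (liesOver_unique hk he hR (liesOver_conj h))
      simp [hQ, h1, h2]
  rw [hR g, hdiv R]
  have h4 := key he h
  have h5 := key he₀ h₀
  classical
  simp only [Finsupp.smul_apply, Finsupp.sub_apply, Finsupp.add_apply, Finsupp.single_apply,
    nsmul_eq_mul]
  simp only [delta, eq_comm (a := R')] at h4 h5 ⊢
  linear_combination (n : ℤ) * h4 - (n : ℤ) * h5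

end IsConj

end

/-! ### Polynomials in one function; places of a rational function field -/

section

section Aeval

variable {K : Type} [Field K] [Algebra ℂ K] {P : Place K} {x : K}

theorem Place.atLeast_aeval (hx : P.AtLeast 0 x) (p : ℂ[X]) : P.AtLeast 0 (aeval x p) := by
  induction p using Polynomial.induction_on' with
  | add p q hp hq => rw [map_add]; exact hp.add hq
  | monomial n a =>
    rw [aeval_monomial]
    exact ((Place.atLeast_const a).mul (hx.pow n)).mono (by simp)

theorem Place.atLeast_aeval_sub {c : ℂ} (hx : P.AtLeast 1 (x - algebraMap ℂ K c)) (p : ℂ[X]) :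
    P.AtLeast 1 (aeval x p - algebraMap ℂ K (p.eval c)) := by
  obtain ⟨q, hq⟩ := X_sub_C_dvd_sub_C_eval (a := c) (p := p)
  have := congrArg (aeval x) hq
  simp only [map_sub, map_mul, aeval_C, aeval_X] at this
  rw [this]
  exact (hx.mul (Place.atLeast_aeval (Place.atLeast_zero_of_value hx) q)).mono (by simp)

/-- The order of a polynomial in `x` at a place with `x = c`. -/
theorem Place.ord_aeval {c : ℂ} (hx : P.AtLeast 1 (x - algebraMap ℂ K c))
    (hne : x ≠ algebraMap ℂ K c) {p : ℂ[X]} (hp : p ≠ 0) :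
    P.ord (aeval x p) = p.rootMultiplicity c * P.ord (x - algebraMap ℂ K c) := by
  obtain ⟨q, hq, hqc⟩ := exists_eq_pow_rootMultiplicity_mul_and_not_dvd p hp c
  rw [dvd_iff_isRoot, IsRoot.def] at hqc
  have h1 := Place.ord_eq_zero_of_value hqc (Place.atLeast_aeval_sub hx q)
  conv_lhs => rw [hq]
  rw [map_mul, map_pow, map_sub, aeval_X, aeval_C,
    P.ord_mul (pow_ne_zero _ (sub_ne_zero.2 hne)) h1.1, h1.2, P.ord_pow, add_zero]

/-- The order of a polynomial in `x` at a pole of `x`. -/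
theorem Place.ord_aeval_pole (hx : P.ord x < 0) {p : ℂ[X]} (hp : p ≠ 0) :
    P.ord (aeval x p) = p.natDegree * P.ord x := by
  have hx0 : x ≠ 0 := by rintro rfl; simp at hx
  have h1 : aeval x p = aeval x⁻¹ p.reverse * x ^ p.natDegree := by
    let _ := invertibleOfNonzero hx0
    have := eval₂_reverse_mul_pow (algebraMap ℂ K) x p
    rw [invOf_eq_inv] at this
    exact this.symm
  have h2 : P.AtLeast 1 (x⁻¹ - algebraMap ℂ K 0) := by
    rw [map_zero, sub_zero, Place.atLeast_iff (inv_ne_zero hx0), P.ord_inv]; omega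
  have h3 := Place.ord_eq_zero_of_value (f := aeval x⁻¹ p.reverse) (c := p.reverse.eval 0)
    (by rw [← coeff_zero_eq_eval_zero, coeff_zero_reverse]; simpa using hp)
    (Place.atLeast_aeval_sub h2 p.reverse)
  rw [h1, P.ord_mul h3.1 (pow_ne_zero _ hx0), h3.2, P.ord_pow, zero_add]

theorem aeval_ne_zero_of_transcendental (hx : Transcendental ℂ x) {p : ℂ[X]} (hp : p ≠ 0) :
    aeval x p ≠ 0 := by
  rw [transcendental_iff] at hx
  exact fun h => hp (hx p h)

theorem ne_const_of_transcendental (hx : Transcendental ℂ x) (c : ℂ) : x ≠ algebraMap ℂ K c := by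
  rintro rfl
  exact hx (isAlgebraic_algebraMap c)

end Aeval

/-! ### Rational function fields -/

/-- `F` is the field of rational functions in `x`. -/
structure IsRational {F : Type} [Field F] [Algebra ℂ F] (x : F) : Prop where
  trans : Transcendental ℂ x
  gen : IntermediateField.adjoin ℂ {x} = ⊤

theorem isCurve_of_gen {K : Type} [Field K] [Algebra ℂ K] {x y : K} (hx : Transcendental ℂ x)
    (hy : IsAlgebraic (IntermediateField.adjoin ℂ {x}) y)
    (hgen : IntermediateField.adjoin ℂ {x, y} = ⊤) : IsCurve K := by
  have hfg : Algebra.EssFiniteType ℂ K := by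
    rw [← IntermediateField.fg_top_iff, ← hgen]
    exact IntermediateField.fg_adjoin_of_finite (Set.toFinite _)
  refine ⟨hfg, ?_⟩
  have halg : Algebra.IsAlgebraic (IntermediateField.adjoin ℂ {x}) K := by
    have h1 : IntermediateField.adjoin (IntermediateField.adjoin ℂ {x}) {y} = ⊤ := by
      rw [← IntermediateField.restrictScalars_eq_top_iff (K := ℂ),
        IntermediateField.adjoin_simple_adjoin_simple, hgen]
    have h2 := IntermediateField.isAlgebraic_adjoin_simple hy.isIntegral
    rw [h1] at h2
    exact (IntermediateField.topEquiv (F := IntermediateField.adjoin ℂ {x}) (E := K)).isAlgebraic_iff.1 h2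
  have h3 : Algebra.trdeg ℂ (RatFunc ℂ) = 1 := by
    have : Algebra.IsAlgebraic ℂ[X] (RatFunc ℂ) := IsLocalization.isAlgebraic _ (nonZeroDivisors ℂ[X])
    rw [← trdeg_add_eq ℂ ℂ[X] (A := RatFunc ℂ), Polynomial.trdeg_of_isDomain,
      trdeg_eq_zero, add_zero]
  rw [← trdeg_add_eq ℂ (IntermediateField.adjoin ℂ {x}) (A := K),
    trdeg_eq_zero (R := IntermediateField.adjoin ℂ {x}), add_zero, ← h3]
  exact (RatFunc.algEquivOfTranscendental x hx).symm.trdeg_eq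

namespace IsRational

variable {F : Type} [Field F] [Algebra ℂ F] {x : F}

theorem exists_frac (h : IsRational x) (a : F) :
    ∃ p q : ℂ[X], IsCoprime p q ∧ q ≠ 0 ∧ a = aeval x p / aeval x q := by
  have ha : a ∈ IntermediateField.adjoin ℂ {x} := by rw [h.gen]; trivial
  rw [IntermediateField.mem_adjoin_simple_iff] at ha
  obtain ⟨r, s, rfl⟩ := ha
  by_cases hs : s = 0
  · exact ⟨0, 1, isCoprime_one_right, one_ne_zero, by simp [hs]⟩
  have hd : EuclideanDomain.gcd r s ≠ 0 := fun h => hs (EuclideanDomain.gcd_eq_zero_iff.1 h).2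
  obtain ⟨p, hp⟩ := EuclideanDomain.gcd_dvd_left r s
  obtain ⟨q, hq⟩ := EuclideanDomain.gcd_dvd_right r s
  refine ⟨p, q, ?_, ?_, ?_⟩
  · refine ⟨EuclideanDomain.gcdA r s, EuclideanDomain.gcdB r s, mul_left_cancel₀ hd ?_⟩
    have := EuclideanDomain.gcd_eq_gcd_ab r s
    linear_combination -this - EuclideanDomain.gcdA r s * hp - EuclideanDomain.gcdB r s * hq
  · rintro rfl; rw [mul_zero] at hq; exact hs hq
  · have hp' := congrArg (aeval x) hp
    have hq' := congrArg (aeval x) hq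
    rw [map_mul] at hp' hq'
    rw [hp', hq', mul_div_mul_left _ _ (aeval_ne_zero_of_transcendental h.trans hd)]

theorem isCurve (h : IsRational x) : IsCurve F :=
  isCurve_of_gen (y := x) h.trans (isAlgebraic_algebraMap
    (⟨x, IntermediateField.mem_adjoin_simple_self ℂ x⟩ : IntermediateField.adjoin ℂ {x}))
    (by simpa using h.gen)

theorem inv (h : IsRational x) : IsRational x⁻¹ where
  trans := fun h1 => h.trans (by simpa using h1.inv)
  gen := by
    rw [← top_le_iff, ← h.gen, IntermediateField.adjoin_simple_le_iff]
    simpa using inv_mem (IntermediateField.mem_adjoin_simple_self ℂ x⁻¹)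

/-- Rational function fields are isomorphic. -/
def equiv (h : IsRational x) : F ≃ₐ[ℂ] RatFunc ℂ :=
  (IntermediateField.topEquiv.symm.trans (IntermediateField.equivOfEq h.gen.symm)).trans
    (RatFunc.algEquivOfTranscendental x h.trans).symm

theorem equiv_self (h : IsRational x) : h.equiv x = RatFunc.X := by
  have : (IntermediateField.topEquiv.symm.trans (IntermediateField.equivOfEq h.gen.symm)) x =
      IntermediateField.AdjoinSimple.gen ℂ x := rfl
  rw [equiv, AlgEquiv.trans_apply, this, RatFunc.algEquivOfTranscendental_symm_gen]

open IsDedekindDomain in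
theorem exists_place (h : IsRational x) (c : ℂ) :
    ∃ Q : Place F, Q.AtLeast 1 (x - algebraMap ℂ F c) := by
  have hirr : Irreducible (X - C c) := irreducible_X_sub_C c
  let w : HeightOneSpectrum ℂ[X] := ⟨Ideal.span {X - C c},
    (Ideal.span_singleton_prime hirr.ne_zero).2 hirr.prime, by simpa using hirr.ne_zero⟩
  have hle : ∀ c : ℂ, w.valuation (RatFunc ℂ) (algebraMap ℂ _ c) ≤ 1 := by
    intro c
    exact w.valuation_le_one (K := RatFunc ℂ) (C c)
  let P : Place (RatFunc ℂ) :=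
    { v := w.valuation _
      surjective := w.valuation_surjective _
      trivial := fun c h0 => by
        refine le_antisymm (hle c) ?_
        have h1 := hle c⁻¹
        rw [map_inv₀, map_inv₀] at h1
        have h2 : w.valuation (RatFunc ℂ) (algebraMap ℂ _ c) ≠ 0 := by simpa using h0
        exact (inv_le_one₀ (zero_lt_iff.2 h2)).1 h1 }
  refine ⟨P.comap h.equiv, ?_⟩
  rw [Place.atLeast_comap, map_sub, h.equiv_self, AlgEquiv.commutes, Place.atLeast_one_iff]
  have := (w.valuation_lt_one_iff_mem (K := RatFunc ℂ) (X - C c)).2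
    (Ideal.mem_span_singleton_self _)
  simpa using this

theorem exists_place_infinity (h : IsRational x) : ∃ Q : Place F, Q.ord x < 0 := by
  obtain ⟨Q, hQ⟩ := h.inv.exists_place 0
  have hx : x ≠ 0 := by simpa using ne_const_of_transcendental h.trans 0
  rw [map_zero, sub_zero, Place.atLeast_iff (inv_ne_zero hx), Place.ord_inv] at hQ
  exact ⟨Q, by omega⟩

/-- All orders at `Q` are multiples of that of `x - c`, and the order 1 occurs. -/
theorem ord_eq_one (h : IsRational x) {Q : Place F} {c : ℂ}
    (hQ : Q.AtLeast 1 (x - algebraMap ℂ F c)) : Q.ord (x - algebraMap ℂ F c) = 1 := by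
  have hne := ne_const_of_transcendental h.trans c
  obtain ⟨a, ha, ha1⟩ := Q.exists_ord_eq 1
  obtain ⟨p, q, -, hq, rfl⟩ := h.exists_frac a
  have hp : p ≠ 0 := by rintro rfl; simp at ha
  rw [Q.ord_div (aeval_ne_zero_of_transcendental h.trans hp)
    (aeval_ne_zero_of_transcendental h.trans hq), Place.ord_aeval hQ hne hp,
    Place.ord_aeval hQ hne hq, ← sub_mul] at ha1
  have h1 := hQ.le_ord (sub_ne_zero.2 hne)
  exact Int.eq_one_of_dvd_one (by omega) ⟨_, by rw [mul_comm]; exact ha1.symm⟩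

theorem ord_eq_neg_one (h : IsRational x) {Q : Place F} (hQ : Q.ord x < 0) : Q.ord x = -1 := by
  have hx : x ≠ 0 := by simpa using ne_const_of_transcendental h.trans 0
  have := h.inv.ord_eq_one (Q := Q) (c := 0) (by
    rw [map_zero, sub_zero, Place.atLeast_iff (inv_ne_zero hx), Place.ord_inv]; omega)
  rw [map_zero, sub_zero, Place.ord_inv] at this
  omega

theorem place_unique (h : IsRational x) {Q Q' : Place F} {c : ℂ}
    (hQ : Q.AtLeast 1 (x - algebraMap ℂ F c)) (hQ' : Q'.AtLeast 1 (x - algebraMap ℂ F c)) :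
    Q = Q' := by
  have hne := ne_const_of_transcendental h.trans c
  refine Place.ext_ord fun a ha => ?_
  obtain ⟨p, q, -, hq, rfl⟩ := h.exists_frac a
  have hp : p ≠ 0 := by rintro rfl; simp at ha
  have hp' := aeval_ne_zero_of_transcendental h.trans hp
  have hq' := aeval_ne_zero_of_transcendental h.trans hq
  rw [Q.ord_div hp' hq', Q'.ord_div hp' hq', Place.ord_aeval hQ hne hp, Place.ord_aeval hQ hne hq,
    Place.ord_aeval hQ' hne hp, Place.ord_aeval hQ' hne hq, h.ord_eq_one hQ, h.ord_eq_one hQ']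

theorem place_infinity_unique (h : IsRational x) {Q Q' : Place F} (hQ : Q.ord x < 0)
    (hQ' : Q'.ord x < 0) : Q = Q' := by
  have hx : x ≠ 0 := by simpa using ne_const_of_transcendental h.trans 0
  have key : ∀ R : Place F, R.ord x < 0 → R.AtLeast 1 (x⁻¹ - algebraMap ℂ F 0) := by
    intro R hR
    rw [map_zero, sub_zero, Place.atLeast_iff (inv_ne_zero hx), Place.ord_inv]; omega
  exact h.inv.place_unique (key Q hQ) (key Q' hQ')

/-- A rational function without finite poles is a polynomial. -/
theorem exists_polynomial (h : IsRational x) {a : F}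
    (ha : ∀ (Q : Place F) (c : ℂ), Q.AtLeast 1 (x - algebraMap ℂ F c) → Q.AtLeast 0 a) :
    ∃ p : ℂ[X], a = aeval x p := by
  by_cases ha0 : a = 0
  · exact ⟨0, by simp [ha0]⟩
  obtain ⟨p, q, hpq, hq, rfl⟩ := h.exists_frac a
  have hp : p ≠ 0 := by rintro rfl; simp at ha0
  have hp' := aeval_ne_zero_of_transcendental h.trans hp
  have hq' := aeval_ne_zero_of_transcendental h.trans hq
  by_cases hdeg : q.degree = 0
  · rw [eq_C_of_degree_eq_zero hdeg] at hq' ⊢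
    rw [aeval_C] at hq' ⊢
    refine ⟨C (q.coeff 0)⁻¹ * p, ?_⟩
    rw [map_mul, aeval_C, map_inv₀]
    field_simp
  · obtain ⟨c, hc⟩ := IsAlgClosed.exists_root q hdeg
    obtain ⟨Q, hQ⟩ := h.exists_place c
    have h1 := (ha Q c hQ).le_ord ha0
    have hne := ne_const_of_transcendental h.trans c
    rw [Q.ord_div hp' hq', Place.ord_aeval hQ hne hp, Place.ord_aeval hQ hne hq,
      h.ord_eq_one hQ] at h1
    have h2 : 0 < q.rootMultiplicity c := (rootMultiplicity_pos hq).2 hc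
    have h3 : p.rootMultiplicity c = 0 := by
      apply rootMultiplicity_eq_zero
      intro hpc
      obtain ⟨u, v, huv⟩ := hpq
      have := congrArg (eval c) huv
      rw [IsRoot.def] at hc hpc
      simp [hc, hpc] at this
    omega

end IsRational

theorem isRational_gen {K : Type} [Field K] [Algebra ℂ K] {x : K} (hx : Transcendental ℂ x) :
    IsRational (IntermediateField.AdjoinSimple.gen ℂ x) where
  trans := by
    rw [← transcendental_algebraMap_iff (FaithfulSMul.algebraMap_injective _ K)]
    exact hx
  gen := by
    apply IntermediateField.lift_injective
    rw [IntermediateField.lift_adjoin_simple, IntermediateField.lift_top,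
      IntermediateField.AdjoinSimple.coe_gen]

end

/-! ### Double covers of the line in the form `y² = f(x)`, and their places -/

section

theorem exists_isConj {F K : Type} [Field F] [Field K] [CharZero F] [Algebra F K]
    (h : Module.finrank F K = 2) : ∃ σ : K ≃ₐ[F] K, IsConj σ := by
  have hq : Algebra.IsQuadraticExtension F K := ⟨h⟩
  have hcard : Nat.card (K ≃ₐ[F] K) = 2 := by rw [IsGalois.card_aut_eq_finrank, h]
  obtain ⟨σ, hσ, huniq⟩ := (Nat.card_eq_two_iff' (1 : K ≃ₐ[F] K)).1 hcard
  have hall : ∀ g : K ≃ₐ[F] K, g = 1 ∨ g = σ := fun g => by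
    by_cases hg : g = 1
    · exact Or.inl hg
    · exact Or.inr (huniq g hg)
  refine ⟨σ, fun z => ?_, ?_, fun z hz => ?_⟩
  · have : σ * σ = 1 := by
      rcases hall (σ * σ) with h1 | h1
      · exact h1
      · exact absurd (mul_eq_left.1 h1) hσ
    exact DFunLike.congr_fun this z
  · by_contra hcon
    push Not at hcon
    exact hσ (AlgEquiv.ext hcon)
  · have : z ∈ (⊥ : IntermediateField F K) := by
      rw [IsGalois.mem_bot_iff_fixed]
      intro g
      rcases hall g with rfl | rfl
      · rfl
      · exact hz
    rwa [IntermediateField.mem_bot] at this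

theorem exists_sq_mul_squarefree {g : ℂ[X]} (hg : g ≠ 0) :
    ∃ s f : ℂ[X], g = s ^ 2 * f ∧ Squarefree f := by
  induction h : g.natDegree using Nat.strong_induction_on generalizing g with
  | _ n ih =>
    by_cases hs : Squarefree g
    · exact ⟨1, g, by simp, hs⟩
    · rw [Squarefree] at hs
      push Not at hs
      obtain ⟨u, ⟨v, rfl⟩, hu⟩ := hs
      have hu0 : u ≠ 0 := by rintro rfl; simp at hg
      have hv0 : v ≠ 0 := by rintro rfl; simp at hg
      have hud : u.natDegree ≠ 0 := fun h0 => hu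
        (by rw [isUnit_iff_degree_eq_zero, degree_eq_natDegree hu0, h0]; rfl)
      rw [natDegree_mul (mul_ne_zero hu0 hu0) hv0, natDegree_mul hu0 hu0] at h
      obtain ⟨s, f, rfl, hf⟩ := ih v.natDegree (by omega) hv0 rfl
      exact ⟨u * s, f, by ring, hf⟩

/-- `K` is generated by `x` and `y` with `y² = f(x)`, `f` a squarefree nonconstant polynomial. -/
structure IsHyper {K : Type} [Field K] [Algebra ℂ K] (x y : K) (f : ℂ[X]) : Prop where
  trans : Transcendental ℂ x
  gen : IntermediateField.adjoin ℂ {x, y} = ⊤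
  sq : y ^ 2 = aeval x f
  sqf : Squarefree f
  deg : f.natDegree ≠ 0

variable {K : Type} [Field K] [Algebra ℂ K]

/-- A double cover of the projective line is given by an equation `y² = f(x)`. -/
theorem IsDoubleCover.exists_isHyper (hK : IsCurve K) {x : K} (hx : IsDoubleCover x) :
    ∃ (y : K) (f : ℂ[X]), IsHyper x y f := by
  have hfin : Module.Finite (IntermediateField.adjoin ℂ {x}) K :=
    Module.finite_of_finrank_pos (by rw [hx]; norm_num)
  have htr : Transcendental ℂ x := by
    intro halg
    have h1 : Algebra.IsAlgebraic ℂ (IntermediateField.adjoin ℂ {x}) :=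
      IntermediateField.isAlgebraic_adjoin_simple halg.isIntegral
    have h2 : Algebra.IsAlgebraic ℂ K := Algebra.IsAlgebraic.trans ℂ (IntermediateField.adjoin ℂ {x}) K
    have := hK.trdeg
    rw [trdeg_eq_zero] at this
    exact zero_ne_one this
  obtain ⟨σ, hσ⟩ := exists_isConj hx
  -- An anti-invariant `θ` has `θ² = -p/q` with polynomials `p`, `q` in `x`. Then `θ q` squares to
  -- `-p q`, and dividing by the square part `s` leaves `y` with `y²` squarefree.
  obtain ⟨θ, hθ0, hθ⟩ := hσ.exists_anti
  obtain ⟨d, hd⟩ := hσ.exists_norm θ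
  have hrat := isRational_gen htr
  obtain ⟨p, q, -, hq, hdpq⟩ := hrat.exists_frac d
  have haev : ∀ p : ℂ[X], algebraMap (IntermediateField.adjoin ℂ {x}) K
      (aeval (IntermediateField.AdjoinSimple.gen ℂ x) p) = aeval x p := fun p => by
    rw [← aeval_algebraMap_apply]; rfl
  have hσp : ∀ p : ℂ[X], σ (aeval x p) = aeval x p := fun p => by rw [← haev, AlgEquiv.commutes]
  have hq' := aeval_ne_zero_of_transcendental htr hq
  have h1 : (θ * aeval x q) ^ 2 = aeval x (-(p * q)) := by
    have : algebraMap (IntermediateField.adjoin ℂ {x}) K d = aeval x p / aeval x q := by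
      rw [hdpq, map_div₀, haev, haev]
    rw [this, hθ] at hd
    rw [map_neg, map_mul]
    field_simp at hd
    linear_combination aeval x q * hd
  have hpq : -(p * q) ≠ 0 := by
    intro h
    rw [h, map_zero] at h1
    exact pow_ne_zero 2 (mul_ne_zero hθ0 hq') h1
  obtain ⟨s, f, hsf, hf⟩ := exists_sq_mul_squarefree hpq
  have hs : s ≠ 0 := by rintro rfl; simp at hsf; simp [hsf] at hpq
  have hs' := aeval_ne_zero_of_transcendental htr hs
  set y := θ * aeval x q / aeval x s with hy
  have hy0 : y ≠ 0 := div_ne_zero (mul_ne_zero hθ0 hq') hs'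
  have hσy : σ y = -y := by
    rw [hy, map_div₀, map_mul, hσp, hσp, hθ]; ring
  have hy2 : y ^ 2 = aeval x f := by
    rw [hy, div_pow, h1, hsf, map_mul, map_pow]; field_simp
  refine ⟨y, f, htr, ?_, hy2, hf, ?_⟩
  · rw [← IntermediateField.adjoin_simple_adjoin_simple, IntermediateField.restrictScalars_eq_top_iff,
      ← top_le_iff]
    intro w _
    obtain ⟨a, b, rfl⟩ := hσ.exists_anti_coords hy0 hσy w
    exact add_mem (IntermediateField.algebraMap_mem _ a)
      (mul_mem (IntermediateField.algebraMap_mem _ b) (IntermediateField.mem_adjoin_simple_self _ y))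
  -- If `f` were constant, `y` would be a constant because `ℂ` is algebraically closed,
  -- contradicting `σ y = -y`.
  · intro h0
    rw [eq_C_of_natDegree_eq_zero h0, aeval_C] at hy2
    obtain ⟨c, hc⟩ := IsAlgClosed.exists_pow_nat_eq (f.coeff 0) (n := 2) (by norm_num)
    rw [← hc, map_pow, sq_eq_sq_iff_eq_or_eq_neg] at hy2
    have hfix : σ y = y := by
      have hcc : σ (algebraMap ℂ K c) = algebraMap ℂ K c := (σ.restrictScalars ℂ).commutes c
      rcases hy2 with h | h
      · rw [h, hcc]
      · rw [h, map_neg, hcc]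
    rw [hσy] at hfix
    have : CharZero K := charZero_of_injective_algebraMap (algebraMap ℂ K).injective
    have h2 : 2 * y = 0 := by linear_combination -hfix
    exact hy0 ((mul_eq_zero.1 h2).resolve_left two_ne_zero)

namespace IsHyper

variable {x y : K} {f : ℂ[X]}

theorem ne_zero (h : IsHyper x y f) : f ≠ 0 := h.sqf.ne_zero

theorem y_ne_zero (h : IsHyper x y f) : y ≠ 0 := by
  rintro rfl
  have := h.sq
  rw [zero_pow two_ne_zero] at this
  exact aeval_ne_zero_of_transcendental h.trans h.ne_zero this.symm

theorem algebraMap_aeval (p : ℂ[X]) : algebraMap (IntermediateField.adjoin ℂ {x}) K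
      (aeval (IntermediateField.AdjoinSimple.gen ℂ x) p) = aeval x p := by
  rw [← aeval_algebraMap_apply]; rfl

theorem exists_root (h : IsHyper x y f) : ∃ c : ℂ, f.eval c = 0 := by
  obtain ⟨c, hc⟩ := IsAlgClosed.exists_root f (fun h0 => h.deg (natDegree_eq_of_degree_eq_some h0))
  exact ⟨c, hc⟩

theorem rootMultiplicity_eq_one (h : IsHyper x y f) {c : ℂ} (hc : f.eval c = 0) :
    f.rootMultiplicity c = 1 := by
  have h1 : 0 < f.rootMultiplicity c := (rootMultiplicity_pos h.ne_zero).2 hc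
  have h2 : f.rootMultiplicity c ≤ 1 := by
    by_contra hcon
    have h3 : (X - C c) * (X - C c) ∣ f := by
      rw [← pow_two, ← le_rootMultiplicity_iff h.ne_zero]; omega
    exact (irreducible_X_sub_C c).not_isUnit (h.sqf _ h3)
  omega

/-- At a root of the squarefree `f` the function `f(x)` has order 1 on the line, so it is not a
square in `ℂ(x)`. -/
theorem y_notMem (h : IsHyper x y f) : y ∉ IntermediateField.adjoin ℂ {x} := by
  intro hy
  have hrat := isRational_gen h.trans
  obtain ⟨c, hc⟩ := h.exists_root
  obtain ⟨Q, hQ⟩ := hrat.exists_place c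
  have h1 : (⟨y, hy⟩ : IntermediateField.adjoin ℂ {x}) ^ 2 =
      aeval (IntermediateField.AdjoinSimple.gen ℂ x) f := by
    apply (algebraMap (IntermediateField.adjoin ℂ {x}) K).injective
    rw [algebraMap_aeval, ← h.sq]; rfl
  have h2 := congrArg Q.ord h1
  rw [Q.ord_pow, Place.ord_aeval hQ (ne_const_of_transcendental hrat.trans c) h.ne_zero,
    h.rootMultiplicity_eq_one hc, hrat.ord_eq_one hQ] at h2
  push_cast at h2
  omega

theorem adjoin_y (h : IsHyper x y f) :
    IntermediateField.adjoin (IntermediateField.adjoin ℂ {x}) {y} = ⊤ := by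
  rw [← IntermediateField.restrictScalars_eq_top_iff (K := ℂ),
    IntermediateField.adjoin_simple_adjoin_simple, h.gen]

theorem isDoubleCover (h : IsHyper x y f) : IsDoubleCover x := by
  let d := aeval (IntermediateField.AdjoinSimple.gen ℂ x) f
  have hmon : (X ^ 2 - C d).Monic := monic_X_pow_sub_C _ two_ne_zero
  have hroot : aeval y (X ^ 2 - C d) = 0 := by
    rw [map_sub, map_pow, aeval_X, aeval_C, algebraMap_aeval, h.sq, sub_self]
  have hint : IsIntegral (IntermediateField.adjoin ℂ {x}) y := ⟨_, hmon, hroot⟩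
  have h1 := IntermediateField.adjoin.finrank hint
  rw [h.adjoin_y, IntermediateField.finrank_top'] at h1
  rw [IsDoubleCover, h1]
  apply le_antisymm
  · have := natDegree_le_natDegree (minpoly.min _ y hmon hroot)
    rwa [natDegree_X_pow_sub_C] at this
  · rw [minpoly.two_le_natDegree_iff hint]
    rintro ⟨a, ha⟩
    exact h.y_notMem (ha ▸ a.2)

theorem isCurve (h : IsHyper x y f) : IsCurve K := by
  have hfin : Module.Finite (IntermediateField.adjoin ℂ {x}) K :=
    Module.finite_of_finrank_pos (by rw [h.isDoubleCover]; norm_num)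
  exact isCurve_of_gen h.trans (Algebra.IsAlgebraic.isAlgebraic y) h.gen

theorem finite (h : IsHyper x y f) : Module.Finite (IntermediateField.adjoin ℂ {x}) K :=
  Module.finite_of_finrank_pos (by rw [h.isDoubleCover]; norm_num)

/-- The hyperelliptic involution. -/
theorem exists_conj (h : IsHyper x y f) :
    ∃ σ : K ≃ₐ[IntermediateField.adjoin ℂ {x}] K, IsConj σ ∧ σ y = -y := by
  obtain ⟨σ, hσ⟩ := exists_isConj h.isDoubleCover
  refine ⟨σ, hσ, ?_⟩
  have h1 : (σ y) ^ 2 = y ^ 2 := by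
    rw [← map_pow, h.sq, ← algebraMap_aeval, AlgEquiv.commutes]
  rcases sq_eq_sq_iff_eq_or_eq_neg.1 h1 with h2 | h2
  · obtain ⟨a, ha⟩ := hσ.fixed y h2
    exact absurd (ha ▸ a.2) h.y_notMem
  · exact h2

/-- The hyperelliptic involution `y ↦ -y`. -/
def conj (h : IsHyper x y f) : K ≃ₐ[IntermediateField.adjoin ℂ {x}] K := h.exists_conj.choose

theorem isConj (h : IsHyper x y f) : IsConj h.conj := h.exists_conj.choose_spec.1

@[simp] theorem conj_y (h : IsHyper x y f) : h.conj y = -y := h.exists_conj.choose_spec.2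

@[simp] theorem conj_aeval (h : IsHyper x y f) (p : ℂ[X]) : h.conj (aeval x p) = aeval x p := by
  rw [← algebraMap_aeval, AlgEquiv.commutes]

@[simp] theorem conj_x (h : IsHyper x y f) : h.conj x = x := by
  simpa using h.conj_aeval X

@[simp] theorem conj_const (h : IsHyper x y f) (c : ℂ) :
    h.conj (algebraMap ℂ K c) = algebraMap ℂ K c := (h.conj.restrictScalars ℂ).commutes c

theorem liesOver_finite {P : Place K} {Q : Place (IntermediateField.adjoin ℂ {x})} {e : ℤ}
    (hQ : P.LiesOver Q e) (c : ℂ) : P.ord (x - algebraMap ℂ K c) =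
      e * Q.ord (IntermediateField.AdjoinSimple.gen ℂ x - algebraMap ℂ _ c) := by
  rw [← hQ, map_sub]; rfl

/-- Orders at a branch point. -/
theorem ord_of_branch (h : IsHyper x y f) {P : Place K} {c : ℂ}
    (hP : P.AtLeast 1 (x - algebraMap ℂ K c)) (hc : f.eval c = 0) :
    P.ord (x - algebraMap ℂ K c) = 2 ∧ P.ord y = 1 ∧ P.conj h.conj = P := by
  have hne := ne_const_of_transcendental h.trans c
  have hpos := hP.le_ord (sub_ne_zero.2 hne)
  have hrat := isRational_gen h.trans
  obtain ⟨Q, e, he, hQ⟩ := h.isConj.exists_liesOver P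
  have h1 := liesOver_finite hQ c
  have hne' := ne_const_of_transcendental hrat.trans c
  have hQ1 : Q.AtLeast 1 (IntermediateField.AdjoinSimple.gen ℂ x - algebraMap ℂ _ c) := by
    rw [Place.atLeast_iff (sub_ne_zero.2 hne')]
    rcases he with rfl | rfl <;> omega
  rw [hrat.ord_eq_one hQ1] at h1
  have h2 := congrArg P.ord h.sq
  rw [P.ord_pow, Place.ord_aeval hP hne h.ne_zero, h.rootMultiplicity_eq_one hc, h1] at h2
  push_cast at h2
  have he2 : e = 2 := by omega
  subst he2
  exact ⟨by omega, by omega, h.isConj.conj_eq_of_ramified hQ⟩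

/-- Orders at a point that is neither a branch point nor a pole. -/
theorem ord_of_not_branch (h : IsHyper x y f) {P : Place K} {c : ℂ}
    (hP : P.AtLeast 1 (x - algebraMap ℂ K c)) (hc : f.eval c ≠ 0) :
    P.ord (x - algebraMap ℂ K c) = 1 ∧ P.ord y = 0 ∧ P.conj h.conj ≠ P := by
  have hne := ne_const_of_transcendental h.trans c
  have hpos := hP.le_ord (sub_ne_zero.2 hne)
  have hrat := isRational_gen h.trans
  obtain ⟨Q, e, he, hQ⟩ := h.isConj.exists_liesOver P
  have h1 := liesOver_finite hQ c
  have hne' := ne_const_of_transcendental hrat.trans c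
  have hQ1 : Q.AtLeast 1 (IntermediateField.AdjoinSimple.gen ℂ x - algebraMap ℂ _ c) := by
    rw [Place.atLeast_iff (sub_ne_zero.2 hne')]
    rcases he with rfl | rfl <;> omega
  rw [hrat.ord_eq_one hQ1] at h1
  have h2 := congrArg P.ord h.sq
  rw [P.ord_pow, Place.ord_aeval hP hne h.ne_zero, rootMultiplicity_eq_zero hc] at h2
  push_cast at h2
  have hy0 : P.ord y = 0 := by omega
  have hconj : P.conj h.conj ≠ P := by
    intro heq
    obtain ⟨b, hb⟩ := h.isCurve.exists_value P ((Place.atLeast_iff h.y_ne_zero).2 hy0.ge)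
    have hb2 := hb
    rw [← heq, Place.atLeast_conj, map_sub, h.conj_y, h.conj_const] at hb2
    have h3 := hb2.neg
    rw [neg_sub, sub_neg_eq_add, add_comm] at h3
    have h4 := P.value_unique hb (d := -b) (by simpa using h3)
    have hb0 : b = 0 := by
      have : 2 * b = 0 := by linear_combination h4
      simpa using this
    rw [hb0, map_zero, sub_zero, Place.atLeast_iff h.y_ne_zero] at hb
    omega
  rcases he with rfl | rfl
  · exact ⟨by omega, hy0, hconj⟩
  · exact absurd (h.isConj.conj_eq_of_ramified hQ) hconj

/-- Orders at a pole of `x`, if there is one. -/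
theorem ord_of_pole_odd (h : IsHyper x y f) {P : Place K} (hP : P.ord x < 0)
    (hodd : Odd f.natDegree) :
    P.ord x = -2 ∧ P.ord y = -f.natDegree ∧ P.conj h.conj = P := by
  have hrat := isRational_gen h.trans
  obtain ⟨Q, e, he, hQ⟩ := h.isConj.exists_liesOver P
  have h1 : P.ord x = e * Q.ord (IntermediateField.AdjoinSimple.gen ℂ x) :=
    hQ (IntermediateField.AdjoinSimple.gen ℂ x)
  rw [hrat.ord_eq_neg_one (by rcases he with rfl | rfl <;> omega)] at h1
  have h2 := congrArg P.ord h.sq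
  rw [P.ord_pow, Place.ord_aeval_pole hP h.ne_zero] at h2
  obtain ⟨k, hk⟩ := hodd
  rcases he with rfl | rfl
  · rw [h1, hk] at h2; push_cast at h2; omega
  · rw [h1] at h2
    push_cast at h2
    exact ⟨by omega, by omega, h.isConj.conj_eq_of_ramified hQ⟩

/-- `y / x ^ m` is a unit at the pole, and the involution negates its nonzero value. So the pole is
not fixed, and `t`-ramification is excluded: the index over the line is 1. -/
theorem ord_of_pole_even (h : IsHyper x y f) {P : Place K} (hP : P.ord x < 0) {m : ℕ}
    (hm : f.natDegree = 2 * m) :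
    P.ord x = -1 ∧ P.ord y = -m ∧ P.conj h.conj ≠ P := by
  have hrat := isRational_gen h.trans
  obtain ⟨Q, e, he, hQ⟩ := h.isConj.exists_liesOver P
  have h1 : P.ord x = e * Q.ord (IntermediateField.AdjoinSimple.gen ℂ x) :=
    hQ (IntermediateField.AdjoinSimple.gen ℂ x)
  rw [hrat.ord_eq_neg_one (by rcases he with rfl | rfl <;> omega)] at h1
  have h2 := congrArg P.ord h.sq
  rw [P.ord_pow, Place.ord_aeval_pole hP h.ne_zero, hm] at h2
  push_cast at h2
  have hx : x ≠ 0 := by simpa using ne_const_of_transcendental h.trans 0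
  have hxm := pow_ne_zero m hx
  have hne : y / x ^ m ≠ 0 := div_ne_zero h.y_ne_zero hxm
  have hy0 : P.ord (y / x ^ m) = 0 := by
    rw [P.ord_div h.y_ne_zero hxm, P.ord_pow]; linarith
  have hconj : P.conj h.conj ≠ P := by
    intro heq
    obtain ⟨b, hb⟩ := h.isCurve.exists_value P ((Place.atLeast_iff hne).2 hy0.ge)
    have hb2 := hb
    rw [← heq, Place.atLeast_conj, map_sub, map_div₀, map_pow, h.conj_y, h.conj_const,
      h.conj_x] at hb2
    have h3 := hb2.neg
    have h4 := P.value_unique hb (d := -b) (by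
      convert h3 using 1; rw [map_neg]; ring)
    have hb0 : b = 0 := by
      have : 2 * b = 0 := by linear_combination h4
      simpa using this
    rw [hb0, map_zero, sub_zero, Place.atLeast_iff hne] at hb
    omega
  rcases he with rfl | rfl
  · refine ⟨by omega, ?_, hconj⟩
    rw [h1] at h2; linarith
  · exact absurd (h.isConj.conj_eq_of_ramified hQ) hconj

theorem exists_place (h : IsHyper x y f) (c : ℂ) :
    ∃ P : Place K, P.AtLeast 1 (x - algebraMap ℂ K c) := by
  have hrat := isRational_gen h.trans
  obtain ⟨Q, hQ⟩ := hrat.exists_place c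
  obtain ⟨P, e, he, hP⟩ := h.isConj.exists_place_over h.finite Q
  refine ⟨P, ?_⟩
  rw [Place.atLeast_iff (sub_ne_zero.2 (ne_const_of_transcendental h.trans c)),
    liesOver_finite hP, hrat.ord_eq_one hQ]
  omega

theorem exists_pole (h : IsHyper x y f) : ∃ P : Place K, P.ord x < 0 := by
  have hrat := isRational_gen h.trans
  obtain ⟨Q, hQ⟩ := hrat.exists_place_infinity
  obtain ⟨P, e, he, hP⟩ := h.isConj.exists_place_over h.finite Q
  refine ⟨P, ?_⟩
  have h1 : P.ord x = e * Q.ord (IntermediateField.AdjoinSimple.gen ℂ x) :=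
    hP (IntermediateField.AdjoinSimple.gen ℂ x)
  rw [h1, hrat.ord_eq_neg_one hQ]
  omega

theorem exists_value_or_pole (h : IsHyper x y f) (P : Place K) :
    (∃ c : ℂ, P.AtLeast 1 (x - algebraMap ℂ K c)) ∨ P.ord x < 0 := by
  by_cases hx : P.ord x < 0
  · exact Or.inr hx
  · have hx0 : x ≠ 0 := by simpa using ne_const_of_transcendental h.trans 0
    exact Or.inl (h.isCurve.exists_value P ((Place.atLeast_iff hx0).2 (by omega)))

theorem eq_or_eq_conj_of_value (h : IsHyper x y f) {P P' : Place K} {c : ℂ}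
    (hP : P.AtLeast 1 (x - algebraMap ℂ K c)) (hP' : P'.AtLeast 1 (x - algebraMap ℂ K c)) :
    P' = P ∨ P' = P.conj h.conj := by
  have hrat := isRational_gen h.trans
  obtain ⟨Q, e, he, hQ⟩ := h.isConj.exists_liesOver P
  obtain ⟨Q', e', he', hQ'⟩ := h.isConj.exists_liesOver P'
  have hne := sub_ne_zero.2 (ne_const_of_transcendental h.trans c)
  have hne' := sub_ne_zero.2 (ne_const_of_transcendental hrat.trans c)
  have h1 : Q = Q' := by
    apply hrat.place_unique (c := c)
    · rw [Place.atLeast_iff hne, liesOver_finite hQ] at hP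
      rw [Place.atLeast_iff hne']
      rcases he with rfl | rfl <;> omega
    · rw [Place.atLeast_iff hne, liesOver_finite hQ'] at hP'
      rw [Place.atLeast_iff hne']
      rcases he' with rfl | rfl <;> omega
  subst h1
  exact h.isConj.eq_or_eq_conj h.isCurve he he' hQ hQ'

theorem eq_or_eq_conj_of_pole (h : IsHyper x y f) {P P' : Place K}
    (hP : P.ord x < 0) (hP' : P'.ord x < 0) : P' = P ∨ P' = P.conj h.conj := by
  have hrat := isRational_gen h.trans
  obtain ⟨Q, e, he, hQ⟩ := h.isConj.exists_liesOver P
  obtain ⟨Q', e', he', hQ'⟩ := h.isConj.exists_liesOver P'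
  have h1 : Q = Q' := by
    have h2 : P.ord x = e * Q.ord (IntermediateField.AdjoinSimple.gen ℂ x) :=
    hQ (IntermediateField.AdjoinSimple.gen ℂ x)
    have h3 : P'.ord x = e' * Q'.ord (IntermediateField.AdjoinSimple.gen ℂ x) :=
      hQ' (IntermediateField.AdjoinSimple.gen ℂ x)
    apply hrat.place_infinity_unique
    · rcases he with rfl | rfl <;> omega
    · rcases he' with rfl | rfl <;> omega
  subst h1
  exact h.isConj.eq_or_eq_conj h.isCurve he he' hQ hQ'

theorem atLeast_conj_x (h : IsHyper x y f) {P : Place K} {c : ℂ} (k : ℤ) :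
    (P.conj h.conj).AtLeast k (x - algebraMap ℂ K c) ↔ P.AtLeast k (x - algebraMap ℂ K c) := by
  rw [Place.atLeast_conj, map_sub, h.conj_x, h.conj_const]

theorem ord_conj_x (h : IsHyper x y f) {P : Place K} : (P.conj h.conj).ord x = P.ord x := by
  rw [Place.ord_conj, h.conj_x]

/-- A function without poles over the affine line is a polynomial in `x` and `y`. -/
theorem exists_polynomials (h : IsHyper x y f) {g : K}
    (hg : ∀ (P : Place K) (c : ℂ), P.AtLeast 1 (x - algebraMap ℂ K c) → P.AtLeast 0 g) :
    ∃ p q : ℂ[X], g = aeval x p + aeval x q * y := by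
  have hrat := isRational_gen h.trans
  have : CharZero K := charZero_of_injective_algebraMap (algebraMap ℂ K).injective
  have hover : ∀ (Q : Place (IntermediateField.adjoin ℂ {x})) (c : ℂ),
      Q.AtLeast 1 (IntermediateField.AdjoinSimple.gen ℂ x - algebraMap ℂ _ c) →
      ∃ (P : Place K) (e : ℤ), (e = 1 ∨ e = 2) ∧ P.LiesOver Q e ∧
        P.AtLeast 1 (x - algebraMap ℂ K c) := by
    intro Q c hQ
    obtain ⟨P, e, he, hP⟩ := h.isConj.exists_place_over h.finite Q
    refine ⟨P, e, he, hP, ?_⟩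
    rw [Place.atLeast_iff (sub_ne_zero.2 (ne_const_of_transcendental h.trans c)),
      liesOver_finite hP, hrat.ord_eq_one hQ]
    omega
  have hdown : ∀ (P : Place K) (Q : Place (IntermediateField.adjoin ℂ {x})) (e : ℤ),
      (e = 1 ∨ e = 2) → P.LiesOver Q e → ∀ a, P.AtLeast 0 (algebraMap _ K a) →
      Q.AtLeast 0 a := by
    intro P Q e he hP a ha
    by_cases ha0 : a = 0
    · rw [ha0]; exact Place.atLeast_zero_fun _
    · rw [Place.atLeast_iff (by simpa using ha0), hP] at ha
      rw [Place.atLeast_iff ha0]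
      rcases he with rfl | rfl <;> omega
  obtain ⟨a, b, rfl⟩ := h.isConj.exists_anti_coords h.y_ne_zero h.conj_y g
  have hconj : ∀ (P : Place K) (c : ℂ), P.AtLeast 1 (x - algebraMap ℂ K c) →
      P.AtLeast 0 (algebraMap _ K a - algebraMap _ K b * y) := by
    intro P c hP
    have := hg (P.conj h.conj) c ((h.atLeast_conj_x 1).2 hP)
    rw [Place.atLeast_conj, map_add, map_mul, AlgEquiv.commutes, AlgEquiv.commutes,
      h.conj_y] at this
    convert this using 1; ring
  have hhalf : ∀ (P : Place K) (z : K), P.AtLeast 0 (2 * z) → P.AtLeast 0 z := by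
    intro P z hz
    have := (Place.atLeast_const (P := P) (1 / 2)).mul hz
    rw [add_zero] at this
    convert this using 1
    rw [map_div₀, map_one, map_ofNat]; field_simp
  obtain ⟨p, hp⟩ := hrat.exists_polynomial (a := a) (by
    intro Q c hQ
    obtain ⟨P, e, he, hP, hPc⟩ := hover Q c hQ
    refine hdown P Q e he hP a (hhalf P _ ?_)
    have := (hg P c hPc).add (hconj P c hPc)
    convert this using 1; ring)
  obtain ⟨q, hq⟩ := hrat.exists_polynomial (a := b) (by
    intro Q c hQ
    obtain ⟨P, e, he, hP, hPc⟩ := hover Q c hQ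
    by_cases hb0 : b = 0
    · rw [hb0]; exact Place.atLeast_zero_fun _
    have hb' : algebraMap (IntermediateField.adjoin ℂ {x}) K b ≠ 0 := by simpa using hb0
    have h1 : P.AtLeast 0 (algebraMap _ K b * y) := by
      apply hhalf
      have := (hg P c hPc).sub (hconj P c hPc)
      convert this using 1; ring
    rw [Place.atLeast_iff (mul_ne_zero hb' h.y_ne_zero), P.ord_mul hb' h.y_ne_zero, hP] at h1
    have h2 := liesOver_finite hP c
    rw [hrat.ord_eq_one hQ] at h2
    rw [Place.atLeast_iff hb0]
    -- At a branch point regularity of `b y` gives only `e * ord b ≥ -1`, but there `e = 2`, so `b`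
    -- is still regular.
    by_cases hc : f.eval c = 0
    · have := h.ord_of_branch hPc hc
      rcases he with rfl | rfl <;> omega
    · have := h.ord_of_not_branch hPc hc
      rcases he with rfl | rfl <;> omega)
  exact ⟨p, q, by rw [hp, hq, algebraMap_aeval, algebraMap_aeval]⟩

end IsHyper

end

/-! ### Differentials, local parameters, and the genus of `y² = f(x)` -/

section

open KaehlerDifferential

variable {K : Type} [Field K] [Algebra ℂ K]

/-! ### Differentials -/

theorem D_aeval (x : K) (p : ℂ[X]) :
    D ℂ K (aeval x p) = aeval x (derivative p) • D ℂ K x :=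
  (D ℂ K).map_aeval p x

theorem D_div {a b : K} (hb : b ≠ 0) :
    D ℂ K (a / b) = (1 / b) • D ℂ K a - (a / b ^ 2) • D ℂ K b := by
  rw [Derivation.leibniz_div]
  rw [smul_sub, smul_smul, smul_smul]
  congr 2 <;> field_simp

theorem D_sq (w : K) : D ℂ K (w ^ 2) = (2 * w) • D ℂ K w := by
  rw [pow_two, Derivation.leibniz, ← add_smul]; congr 1; ring

/-- The functions whose differential is a multiple of `dx`. -/
theorem exists_D_eq_smul {x y : K} (hgen : IntermediateField.adjoin ℂ {x, y} = ⊤)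
    (hy : ∃ h : K, D ℂ K y = h • D ℂ K x) (a : K) : ∃ h : K, D ℂ K a = h • D ℂ K x := by
  have ha : a ∈ IntermediateField.adjoin ℂ {x, y} := by rw [hgen]; trivial
  induction ha using IntermediateField.adjoin_induction with
  | mem z hz =>
    rcases hz with rfl | rfl
    · exact ⟨1, by simp⟩
    · exact hy
  | algebraMap c => exact ⟨0, by simp⟩
  | add a b _ _ ha hb =>
    obtain ⟨h, hh⟩ := ha
    obtain ⟨k, hk⟩ := hb
    exact ⟨h + k, by rw [map_add, hh, hk, add_smul]⟩
  | inv a _ ha =>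
    obtain ⟨h, hh⟩ := ha
    exact ⟨-(a⁻¹ ^ 2) * h, by rw [Derivation.leibniz_inv, hh, smul_smul]⟩
  | mul a b _ _ ha hb =>
    obtain ⟨h, hh⟩ := ha
    obtain ⟨k, hk⟩ := hb
    exact ⟨a * k + b * h, by rw [Derivation.leibniz, hh, hk, smul_smul, smul_smul, ← add_smul]⟩

theorem exists_eq_smul {x : K} (hx : ∀ a : K, ∃ h : K, D ℂ K a = h • D ℂ K x) (ω : Ω[K⁄ℂ]) :
    ∃ h : K, ω = h • D ℂ K x := by
  have h1 : ω ∈ Submodule.span K (Set.range (D ℂ K)) := by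
    rw [KaehlerDifferential.span_range_derivation]; trivial
  induction h1 using Submodule.span_induction with
  | mem z hz => obtain ⟨a, rfl⟩ := hz; exact hx a
  | zero => exact ⟨0, by simp⟩
  | add a b _ _ ha hb =>
    obtain ⟨h, hh⟩ := ha
    obtain ⟨k, hk⟩ := hb
    exact ⟨h + k, by rw [hh, hk, add_smul]⟩
  | smul c a _ ha =>
    obtain ⟨h, hh⟩ := ha
    exact ⟨c * h, by rw [hh, smul_smul]⟩

/-- If `dx = 0` then all differentials vanish, so `K` is formally unramified over `ℂ`, hence
separable algebraic, against transcendence degree one. -/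
theorem D_ne_zero (hK : IsCurve K) {x : K} (hx : ∀ a : K, ∃ h : K, D ℂ K a = h • D ℂ K x) :
    D ℂ K x ≠ 0 := by
  intro h0
  have hsub : Subsingleton Ω[K⁄ℂ] := by
    refine ⟨fun a b => ?_⟩
    obtain ⟨h, rfl⟩ := exists_eq_smul hx a
    obtain ⟨k, rfl⟩ := exists_eq_smul hx b
    rw [h0, smul_zero, smul_zero]
  have hu : Algebra.FormallyUnramified ℂ K := ⟨hsub⟩
  have hfg := hK.fg
  have hs : Algebra.IsSeparable ℂ K := Algebra.FormallyUnramified.isSeparable ℂ K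
  have := hK.trdeg
  rw [trdeg_eq_zero] at this
  exact zero_ne_one this

/-- `t` is a function on the local ring at `P` whose differential generates the differentials that
are regular at `P`. -/
structure IsLocalParam (P : Place K) (t : K) : Prop where
  mem : P.AtLeast 0 t
  gen : ∀ a, P.AtLeast 0 a → ∃ h, P.AtLeast 0 h ∧ D ℂ K a = h • D ℂ K t

theorem IsLocalParam.mem_iff {P : Place K} {t : K} (ht : IsLocalParam P t) (ω : Ω[K⁄ℂ]) :
    ω ∈ differentialsRegularAt P ↔ ∃ h, P.AtLeast 0 h ∧ ω = h • D ℂ K t := by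
  constructor
  · intro hω
    rw [differentialsRegularAt] at hω
    induction hω using Submodule.span_induction with
    | mem z hz =>
      obtain ⟨a, rfl⟩ := hz
      exact ht.gen a (Place.atLeast_zero_iff.2 a.2)
    | zero => exact ⟨0, Place.atLeast_zero_fun 0, by simp⟩
    | add a b _ _ ha hb =>
      obtain ⟨h, h0, hh⟩ := ha
      obtain ⟨k, k0, hk⟩ := hb
      exact ⟨h + k, h0.add k0, by rw [hh, hk, add_smul]⟩
    | smul c a _ ha =>
      obtain ⟨h, h0, hh⟩ := ha
      refine ⟨c * h, ((Place.atLeast_zero_iff.2 c.2).mul h0), ?_⟩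
      rw [hh, mul_smul]; rfl
  · rintro ⟨h, h0, rfl⟩
    have h1 : D ℂ K t ∈ differentialsRegularAt P :=
      Submodule.subset_span ⟨⟨t, Place.atLeast_zero_iff.1 ht.mem⟩, rfl⟩
    exact (differentialsRegularAt P).smul_mem ⟨h, Place.atLeast_zero_iff.1 h0⟩ h1

/-- The functions regular at `P` whose differential is a regular multiple of `dt`. -/
def Good (P : Place K) (t a : K) : Prop :=
  P.AtLeast 0 a ∧ ∃ h, P.AtLeast 0 h ∧ D ℂ K a = h • D ℂ K t

namespace Good

variable {P : Place K} {t a b : K}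

theorem add (ha : Good P t a) (hb : Good P t b) : Good P t (a + b) := by
  obtain ⟨ha0, h, h0, hh⟩ := ha
  obtain ⟨hb0, k, k0, hk⟩ := hb
  exact ⟨ha0.add hb0, h + k, h0.add k0, by rw [map_add, hh, hk, add_smul]⟩

theorem mul (ha : Good P t a) (hb : Good P t b) : Good P t (a * b) := by
  obtain ⟨ha0, h, h0, hh⟩ := ha
  obtain ⟨hb0, k, k0, hk⟩ := hb
  exact ⟨ha0.mul hb0, a * k + b * h, (ha0.mul k0).add (hb0.mul h0),
    by rw [Derivation.leibniz, hh, hk, smul_smul, smul_smul, ← add_smul]⟩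

theorem div (ha : Good P t a) (hb : Good P t b) (hb0 : b ≠ 0) (hbu : P.ord b = 0) :
    Good P t (a / b) := by
  have hinv : P.AtLeast 0 b⁻¹ :=
    (Place.atLeast_iff (inv_ne_zero hb0)).2 (by rw [P.ord_inv]; omega)
  obtain ⟨ha0, h, h0, hh⟩ := ha
  obtain ⟨hb1, k, k0, hk⟩ := hb
  refine ⟨by rw [div_eq_mul_inv]; exact ha0.mul hinv, b⁻¹ * h - a * (b⁻¹ * b⁻¹) * k,
    (hinv.mul h0).sub ((ha0.mul (hinv.mul hinv)).mul k0), ?_⟩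
  rw [D_div hb0, hh, hk, smul_smul, smul_smul, ← sub_smul]
  congr 1; field_simp

theorem aeval {z : K} (hz : Good P t z) (p : ℂ[X]) : Good P t (aeval z p) := by
  obtain ⟨h1, h, h0, hh⟩ := hz
  exact ⟨Place.atLeast_aeval h1 p, Polynomial.aeval z (derivative p) * h,
    (Place.atLeast_aeval h1 _).mul h0, by rw [D_aeval, hh, smul_smul]⟩

/-- Rational functions in `z` that are regular at `P` are good if `z` is. -/
theorem of_mem_adjoin {z : K} (hz : Good P t z) (hz0 : Transcendental ℂ z) (hz1 : P.AtLeast 1 z)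
    (ha : a ∈ IntermediateField.adjoin ℂ {z}) (ha0 : P.AtLeast 0 a) : Good P t a := by
  obtain ⟨p, q, hpq, hq, h1⟩ := (isRational_gen hz0).exists_frac ⟨a, ha⟩
  have h2 := congrArg (algebraMap (IntermediateField.adjoin ℂ {z}) K) h1
  rw [map_div₀, IsHyper.algebraMap_aeval, IsHyper.algebraMap_aeval] at h2
  change a = _ at h2
  subst h2
  have hq' := aeval_ne_zero_of_transcendental hz0 hq
  have hne := ne_const_of_transcendental hz0 0
  have hz1' : P.AtLeast 1 (z - algebraMap ℂ K 0) := by simpa using hz1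
  have hpos := hz1'.le_ord (sub_ne_zero.2 hne)
  refine (hz.aeval p).div (hz.aeval q) hq' ?_
  have hordq := Place.ord_aeval hz1' hne hq
  -- If the denominator vanished at `P`, the coprime numerator would not, and `a` would have a pole.
  by_cases hq0 : q.eval 0 = 0
  · exfalso
    have hqm : 0 < q.rootMultiplicity 0 := (rootMultiplicity_pos hq).2 hq0
    have hp : p ≠ 0 := by
      rintro rfl
      rw [isCoprime_zero_left, isUnit_iff_degree_eq_zero] at hpq
      rw [eq_C_of_degree_eq_zero hpq, eval_C] at hq0
      rw [eq_C_of_degree_eq_zero hpq, hq0] at hq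
      simp at hq
    have hp0 : p.rootMultiplicity 0 = 0 := by
      apply rootMultiplicity_eq_zero
      intro hpc
      obtain ⟨u, v, huv⟩ := hpq
      have := congrArg (eval 0) huv
      rw [IsRoot.def] at hpc
      simp [hq0, hpc] at this
    have hp' := aeval_ne_zero_of_transcendental hz0 hp
    have := ha0.le_ord (div_ne_zero hp' hq')
    rw [P.ord_div hp' hq', hordq, Place.ord_aeval hz1' hne hp, hp0] at this
    have h5 : 0 < (q.rootMultiplicity 0 : ℤ) * P.ord (z - algebraMap ℂ K 0) := by positivity
    rw [Nat.cast_zero, zero_mul] at this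
    omega
  · rw [hordq, rootMultiplicity_eq_zero hq0]; simp

end Good

theorem good_self {P : Place K} {z : K} (hz : P.AtLeast 0 z) : Good P z z :=
  ⟨hz, 1, by simpa using Place.atLeast_const (P := P) 1, by simp⟩

theorem IsRational.isLocalParam {z : K} (hz : IsRational z) {P : Place K} (hP : P.AtLeast 1 z) :
    IsLocalParam P z where
  mem := hP.mono (by norm_num)
  gen a ha := ((good_self (hP.mono (by norm_num))).of_mem_adjoin hz.trans hP
    (by rw [hz.gen]; trivial) ha).2

section Quadratic

variable {P : Place K} {z w : K} {g : ℂ[X]}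

/-- Since `2 w dw = g'(z) dz`, the unit `w` is good, and so is `α + β w` when `α` and `β` are
regular. If `β` has a pole, then `α / β + w` vanishes at `P`, so its conjugate `α / β - w` is a
unit. The product of `a` with this unit is a regular element of `ℂ(z)`, hence good, and `a` is
recovered by division. -/
theorem isLocalParam_of_unramified (hz : Transcendental ℂ z) (hP : P.AtLeast 1 z)
    (hw : w ^ 2 = aeval z g) (hg : g.eval 0 ≠ 0)
    (hdec : ∀ a : K, ∃ α ∈ IntermediateField.adjoin ℂ {z},
      ∃ β ∈ IntermediateField.adjoin ℂ {z}, a = α + β * w) : IsLocalParam P z := by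
  have : CharZero K := charZero_of_injective_algebraMap (algebraMap ℂ K).injective
  have hz0 : z ≠ 0 := by simpa using ne_const_of_transcendental hz 0
  have hzg : Good P z z := good_self (hP.mono (by norm_num))
  have hP' : P.AtLeast 1 (z - algebraMap ℂ K 0) := by simpa using hP
  have hgu := Place.ord_eq_zero_of_value hg (Place.atLeast_aeval_sub hP' g)
  have hw0 : w ≠ 0 := by rintro rfl; exact hgu.1 (by rw [← hw]; simp)
  have hwu : P.ord w = 0 := by
    have := congrArg P.ord hw
    rw [P.ord_pow, hgu.2] at this
    push_cast at this; omega
  have hzmem := IntermediateField.mem_adjoin_simple_self ℂ z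
  have hgmem : aeval z g ∈ IntermediateField.adjoin ℂ {z} :=
    IntermediateField.algebra_adjoin_le_adjoin _ _ (aeval_mem_adjoin_singleton ℂ z)
  have hw1 : P.AtLeast 0 w := (Place.atLeast_iff hw0).2 hwu.ge
  have hwg : Good P z w := by
    refine ⟨hw1, w⁻¹ * algebraMap ℂ K (1 / 2) * aeval z (derivative g), ?_, ?_⟩
    · have hinv : P.AtLeast 0 w⁻¹ :=
        (Place.atLeast_iff (inv_ne_zero hw0)).2 (by rw [P.ord_inv]; omega)
      exact (hinv.mul (Place.atLeast_const _)).mul (Place.atLeast_aeval (hP.mono (by norm_num)) _)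
    · have h1 := congrArg (D ℂ K) hw
      rw [D_aeval, D_sq] at h1
      rw [mul_smul, ← h1, smul_smul, map_div₀, map_one, map_ofNat,
        show w⁻¹ * (1 / 2) * (2 * w) = 1 by field_simp, one_smul]
  have hF : ∀ α ∈ IntermediateField.adjoin ℂ {z}, P.AtLeast 0 α → Good P z α :=
    fun α hα hα0 => hzg.of_mem_adjoin hz hP hα hα0
  refine ⟨hP.mono (by norm_num), fun a ha => ?_⟩
  suffices Good P z a from this.2
  obtain ⟨α, hα, β, hβ, rfl⟩ := hdec a
  by_cases hβ1 : P.AtLeast 0 β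
  · refine (hF α hα ?_).add ((hF β hβ hβ1).mul hwg)
    have := ha.sub (hβ1.mul hw1)
    simpa using this
  have hβ0 : β ≠ 0 := by rintro rfl; exact hβ1 (Place.atLeast_zero_fun 0)
  rw [Place.atLeast_iff hβ0, not_le] at hβ1
  have hfac : α + β * w = β * (α / β + w) := by field_simp
  have hcmem : α / β ∈ IntermediateField.adjoin ℂ {z} := div_mem hα hβ
  have hc1 : P.AtLeast 1 (α / β + w) := by
    have h1 := ((Place.atLeast_iff (inv_ne_zero hβ0)).2
      (show 1 ≤ P.ord β⁻¹ by rw [P.ord_inv]; omega)).mul ha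
    rw [hfac, inv_mul_cancel_left₀ hβ0] at h1
    simpa using h1
  have hc0 : P.AtLeast 0 (α / β) := by
    simpa using (hc1.mono (by norm_num : (0 : ℤ) ≤ 1)).sub hw1
  have h2w : P.ord (-(2 * w)) = 0 := by
    have := P.ord_const_mul (two_ne_zero (α := ℂ)) w
    rw [map_ofNat] at this
    rw [P.ord_neg, this, hwu]
  have hb := Place.ord_add_eq (P := P) (f := -(2 * w)) (g := α / β + w)
    (neg_ne_zero.2 (mul_ne_zero two_ne_zero hw0)) (by rwa [h2w, zero_add])
  rw [show -(2 * w) + (α / β + w) = α / β - w by ring, h2w] at hb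
  have hbg : Good P z (α / β - w) := by
    have hm1 : Good P z (algebraMap ℂ K (-1)) :=
      ⟨Place.atLeast_const _, 0, Place.atLeast_zero_fun _, by simp⟩
    have := (hF _ hcmem hc0).add (hm1.mul hwg)
    rw [map_neg, map_one] at this
    convert this using 1; ring
  have hprod : (α + β * w) * (α / β - w) = β * ((α / β) ^ 2 - aeval z g) := by
    rw [← hw, hfac]; ring
  have hnum : Good P z ((α + β * w) * (α / β - w)) := by
    refine hF _ ?_ (ha.mul hbg.1)
    rw [hprod]
    exact mul_mem hβ (sub_mem (pow_mem hcmem 2) hgmem)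
  have := hnum.div hbg hb.1 hb.2
  rwa [mul_div_cancel_right₀ _ hb.1] at this

theorem exists_ord_eq_mul (hz : Transcendental ℂ z) (hP : P.AtLeast 1 z) {a : K}
    (ha : a ∈ IntermediateField.adjoin ℂ {z}) (ha0 : a ≠ 0) : ∃ n : ℤ, P.ord a = n * P.ord z := by
  rw [IntermediateField.mem_adjoin_simple_iff] at ha
  obtain ⟨p, q, rfl⟩ := ha
  have hp : p ≠ 0 := by rintro rfl; simp at ha0
  have hq : q ≠ 0 := by rintro rfl; simp at ha0
  have hP' : P.AtLeast 1 (z - algebraMap ℂ K 0) := by simpa using hP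
  have hne := ne_const_of_transcendental hz 0
  refine ⟨p.rootMultiplicity 0 - q.rootMultiplicity 0, ?_⟩
  rw [P.ord_div (aeval_ne_zero_of_transcendental hz hp) (aeval_ne_zero_of_transcendental hz hq),
    Place.ord_aeval hP' hne hp, Place.ord_aeval hP' hne hq, map_zero, sub_zero, sub_mul]

/-- Elements of `ℂ(z)` have even order, so `α` and `β w` have orders of different parity and are
both regular as soon as their sum is. The relation `2 w dw = g'(z) dz` with `g'(z)` a unit makes `z`
good with respect to `w`. -/
theorem isLocalParam_of_ramified (hz : Transcendental ℂ z) (hP : P.ord z = 2)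
    (hw : w ^ 2 = aeval z g) (hw1 : P.ord w = 1) (hg : (derivative g).eval 0 ≠ 0)
    (hdec : ∀ a : K, ∃ α ∈ IntermediateField.adjoin ℂ {z},
      ∃ β ∈ IntermediateField.adjoin ℂ {z}, a = α + β * w) : IsLocalParam P w := by
  have : CharZero K := charZero_of_injective_algebraMap (algebraMap ℂ K).injective
  have hz0 : z ≠ 0 := by simpa using ne_const_of_transcendental hz 0
  have hz1 : P.AtLeast 1 z := (Place.atLeast_iff hz0).2 (by omega)
  have hP' : P.AtLeast 1 (z - algebraMap ℂ K 0) := by simpa using hz1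
  have hgu := Place.ord_eq_zero_of_value hg (Place.atLeast_aeval_sub hP' (derivative g))
  have hw0 : w ≠ 0 := by rintro rfl; simp at hw1
  have hwm : P.AtLeast 0 w := (Place.atLeast_iff hw0).2 (by omega)
  have hzg : Good P w z := by
    refine ⟨hz1.mono (by norm_num), (aeval z (derivative g))⁻¹ * (algebraMap ℂ K 2 * w), ?_, ?_⟩
    · have hinv : P.AtLeast 0 (aeval z (derivative g))⁻¹ :=
        (Place.atLeast_iff (inv_ne_zero hgu.1)).2 (by rw [P.ord_inv]; omega)
      exact hinv.mul ((Place.atLeast_const _).mul hwm)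
    · have h1 := congrArg (D ℂ K) hw
      rw [D_aeval, D_sq] at h1
      rw [mul_smul, map_ofNat, h1, smul_smul, inv_mul_cancel₀ hgu.1, one_smul]
  have hF : ∀ α ∈ IntermediateField.adjoin ℂ {z}, P.AtLeast 0 α → Good P w α :=
    fun α hα hα0 => hzg.of_mem_adjoin hz hz1 hα hα0
  refine ⟨hwm, fun a ha => ?_⟩
  suffices Good P w a from this.2
  obtain ⟨α, hα, β, hβ, rfl⟩ := hdec a
  by_cases hβ0 : β = 0
  · subst hβ0
    rw [zero_mul, add_zero] at ha ⊢
    exact hF α hα ha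
  obtain ⟨n, hn⟩ := exists_ord_eq_mul hz hz1 hβ hβ0
  have hβw : P.ord (β * w) = n * 2 + 1 := by rw [P.ord_mul hβ0 hw0, hn, hP, hw1]
  have hboth : P.AtLeast 0 α ∧ 0 ≤ P.ord (β * w) := by
    by_cases hα0 : α = 0
    · subst hα0
      rw [zero_add] at ha
      exact ⟨Place.atLeast_zero_fun 0, ha.le_ord (mul_ne_zero hβ0 hw0)⟩
    · obtain ⟨m, hm⟩ := exists_ord_eq_mul hz hz1 hα hα0
      have h1 := Place.ord_add_of_ne (P := P) hα0 (mul_ne_zero hβ0 hw0)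
        (by rw [hβw, hm, hP]; omega)
      have h2 := ha.le_ord h1.1
      rw [h1.2] at h2
      rw [Place.atLeast_iff hα0]
      exact ⟨le_trans h2 (min_le_left _ _), le_trans h2 (min_le_right _ _)⟩
  have hβ1 : P.AtLeast 0 β := by rw [Place.atLeast_iff hβ0, hn, hP]; omega
  exact (hF α hα hboth.1).add ((hF β hβ hβ1).mul (good_self hwm))

end Quadratic

/-! ### The genus -/

theorem IsRational.exists_D (F : Type) [Field F] [Algebra ℂ F] {x : F} (h : IsRational x) (a : F) :
    ∃ k : F, D ℂ F a = k • D ℂ F x :=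
  exists_D_eq_smul (x := x) (y := x) (by simpa using h.gen) ⟨1, by simp⟩ a

theorem D_inv_eq {x : K} (hx : x ≠ 0) : D ℂ K x = (-x ^ 2) • D ℂ K x⁻¹ := by
  rw [Derivation.leibniz_inv, smul_smul]
  rw [show -x ^ 2 * -x⁻¹ ^ 2 = 1 by field_simp, one_smul]

theorem smul_D_injective (hK : IsCurve K) {x : K}
    (hx : ∀ a : K, ∃ h : K, D ℂ K a = h • D ℂ K x) {h k : K}
    (hh : h • D ℂ K x = k • D ℂ K x) : h = k :=
  smul_left_injective K (D_ne_zero hK hx) hh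

/-- If `dt` is a regular multiple of `dx` then it generates the differentials. -/
theorem exists_D_of_smul {x t : K} (hx : ∀ a : K, ∃ h : K, D ℂ K a = h • D ℂ K x) {u : K}
    (hu : D ℂ K x = u • D ℂ K t) (a : K) : ∃ h : K, D ℂ K a = h • D ℂ K t := by
  obtain ⟨h, hh⟩ := hx a
  exact ⟨h * u, by rw [hh, hu, smul_smul]⟩

theorem IsLocalParam.smul_mem_iff (hK : IsCurve K) {P : Place K} {t x : K} (ht : IsLocalParam P t)
    (hx : ∀ a : K, ∃ h : K, D ℂ K a = h • D ℂ K x) {u : K} (hu : D ℂ K x = u • D ℂ K t) (h : K) :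
    h • D ℂ K x ∈ differentialsRegularAt P ↔ P.AtLeast 0 (h * u) := by
  rw [ht.mem_iff]
  constructor
  · rintro ⟨k, hk, hk2⟩
    rw [hu, smul_smul] at hk2
    rwa [smul_D_injective hK (exists_D_of_smul hx hu) hk2]
  · intro h1
    exact ⟨_, h1, by rw [hu, smul_smul]⟩

theorem adjoin_sub_const (x : K) (c : ℂ) :
    IntermediateField.adjoin ℂ {x - algebraMap ℂ K c} = IntermediateField.adjoin ℂ {x} := by
  apply le_antisymm <;> rw [IntermediateField.adjoin_simple_le_iff]
  · exact sub_mem (IntermediateField.mem_adjoin_simple_self ℂ x)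
      (IntermediateField.algebraMap_mem _ c)
  · have := add_mem (IntermediateField.mem_adjoin_simple_self ℂ (x - algebraMap ℂ K c))
      (IntermediateField.algebraMap_mem _ c)
    rwa [sub_add_cancel] at this

theorem adjoin_inv (x : K) :
    IntermediateField.adjoin ℂ {x⁻¹} = IntermediateField.adjoin ℂ {x} := by
  apply le_antisymm <;> rw [IntermediateField.adjoin_simple_le_iff]
  · exact inv_mem (IntermediateField.mem_adjoin_simple_self ℂ x)
  · have := inv_mem (IntermediateField.mem_adjoin_simple_self ℂ x⁻¹)
    rwa [inv_inv] at this

theorem transcendental_sub_const {x : K} (hx : Transcendental ℂ x) (c : ℂ) :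
    Transcendental ℂ (x - algebraMap ℂ K c) := by
  intro h
  apply hx
  have := h.add (isAlgebraic_algebraMap (A := K) c)
  rwa [sub_add_cancel] at this

theorem IsRational.sub_const {x : K} (h : IsRational x) (c : ℂ) :
    IsRational (x - algebraMap ℂ K c) :=
  ⟨transcendental_sub_const h.trans c, by rw [adjoin_sub_const, h.gen]⟩

/-- Regularity of `k dx` at the finite places makes `k` a polynomial. At infinity `dx = -x² d(1/x)`
has a double pole, which multiplication by a nonzero polynomial does not cancel. -/
theorem IsRational.genus_eq_zero {F : Type} [Field F] [Algebra ℂ F] {x : F} (h : IsRational x) :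
    genus F = 0 := by
  have hD := IsRational.exists_D F h
  have hbot : regularDifferentials F = ⊥ := by
    rw [eq_bot_iff]
    intro ω hω
    obtain ⟨k, rfl⟩ := exists_eq_smul hD ω
    have hx : x ≠ 0 := by simpa using ne_const_of_transcendental h.trans 0
    obtain ⟨p, rfl⟩ := h.exists_polynomial (a := k) (by
      intro Q c hQ
      have h1 := (((h.sub_const c).isLocalParam hQ).smul_mem_iff h.isCurve hD (u := 1) (by simp) k).1 (hω Q)
      simpa using h1)
    obtain ⟨Q, hQ⟩ := h.exists_place_infinity
    have hQ1 := h.ord_eq_neg_one hQ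
    have h1 := ((h.inv.isLocalParam (P := Q) ((Place.atLeast_iff (inv_ne_zero hx)).2
      (by rw [Q.ord_inv]; omega))).smul_mem_iff h.isCurve hD (D_inv_eq hx) _).1 (hω Q)
    by_cases hp : p = 0
    · simp [hp]
    have hp' := aeval_ne_zero_of_transcendental h.trans hp
    rw [Place.atLeast_iff (mul_ne_zero hp' (neg_ne_zero.2 (pow_ne_zero 2 hx))),
      Q.ord_mul hp' (neg_ne_zero.2 (pow_ne_zero 2 hx)), Q.ord_neg, Q.ord_pow,
      Place.ord_aeval_pole hQ hp, hQ1] at h1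
    push_cast at h1
    omega
  rw [genus, hbot, finrank_bot]

namespace IsHyper

variable {x y : K} {f : ℂ[X]}

theorem exists_D (h : IsHyper x y f) (a : K) : ∃ k : K, D ℂ K a = k • D ℂ K x := by
  have : CharZero K := charZero_of_injective_algebraMap (algebraMap ℂ K).injective
  refine exists_D_eq_smul h.gen ⟨(2 * y)⁻¹ * aeval x (derivative f), ?_⟩ a
  have h1 := congrArg (D ℂ K) h.sq
  rw [D_aeval, D_sq] at h1
  rw [mul_smul, ← h1, smul_smul, inv_mul_cancel₀ (mul_ne_zero two_ne_zero h.y_ne_zero), one_smul]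

theorem decomposition (h : IsHyper x y f) (a : K) : ∃ α ∈ IntermediateField.adjoin ℂ {x},
      ∃ β ∈ IntermediateField.adjoin ℂ {x}, a = α + β * y := by
  obtain ⟨α, β, rfl⟩ := h.isConj.exists_anti_coords h.y_ne_zero h.conj_y a
  exact ⟨α, α.2, β, β.2, rfl⟩

theorem eval_derivative_ne_zero (h : IsHyper x y f) {c : ℂ} (hc : f.eval c = 0) :
    (derivative f).eval c ≠ 0 := by
  intro h0
  have := (one_lt_rootMultiplicity_iff_isRoot h.ne_zero).2 ⟨hc, h0⟩
  rw [h.rootMultiplicity_eq_one hc] at this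
  omega

/-- `dx / y` generates the regular differentials at every finite place: away from the branch points
`y` is a unit and `x - c` a parameter, and at a branch point `y` is a parameter and `dx / y = 2 dy /
f'(x)`. -/
theorem smul_mem_iff_of_value (h : IsHyper x y f) {P : Place K} {c : ℂ}
    (hP : P.AtLeast 1 (x - algebraMap ℂ K c)) (k : K) :
    (k / y) • D ℂ K x ∈ differentialsRegularAt P ↔ P.AtLeast 0 k := by
  have : CharZero K := charZero_of_injective_algebraMap (algebraMap ℂ K).injective
  have htr := transcendental_sub_const h.trans c
  have hw : y ^ 2 = aeval (x - algebraMap ℂ K c) (f.comp (X + C c)) := by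
    rw [h.sq, aeval_comp]; simp
  have hdec := h.decomposition
  rw [← adjoin_sub_const x c] at hdec
  by_cases hk : k = 0
  · subst hk
    simpa using Place.atLeast_zero_fun (P := P) 0
  by_cases hc : f.eval c = 0
  · obtain ⟨h1, h2, -⟩ := h.ord_of_branch hP hc
    have hd := h.eval_derivative_ne_zero hc
    have hdu := Place.ord_eq_zero_of_value hd (Place.atLeast_aeval_sub hP (derivative f))
    have ht := isLocalParam_of_ramified htr h1 hw h2 (by
      rw [derivative_comp]; simpa using hd) hdec
    have hu : D ℂ K x = (2 * y / aeval x (derivative f)) • D ℂ K y := by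
      have h3 := congrArg (D ℂ K) h.sq
      rw [D_aeval, D_sq] at h3
      rw [div_eq_inv_mul, mul_smul, h3, smul_smul, inv_mul_cancel₀ hdu.1, one_smul]
    have h2u : P.ord (algebraMap ℂ K 2) = 0 := P.ord_const 2
    rw [ht.smul_mem_iff h.isCurve h.exists_D hu,
      show k / y * (2 * y / aeval x (derivative f)) =
        k * (algebraMap ℂ K 2 / aeval x (derivative f)) by
          rw [map_ofNat]; field_simp [h.y_ne_zero, hdu.1],
      Place.atLeast_iff (mul_ne_zero hk (div_ne_zero (by simp) hdu.1)),
      Place.atLeast_iff hk, P.ord_mul hk (div_ne_zero (by simp) hdu.1),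
      P.ord_div (by simp) hdu.1, hdu.2, h2u]
    simp
  · obtain ⟨h1, h2, -⟩ := h.ord_of_not_branch hP hc
    have ht := isLocalParam_of_unramified htr hP hw (by rw [eval_comp]; simpa using hc) hdec
    rw [ht.smul_mem_iff h.isCurve h.exists_D (u := 1) (by simp), mul_one,
      Place.atLeast_iff (div_ne_zero hk h.y_ne_zero), Place.atLeast_iff hk,
      P.ord_div hk h.y_ne_zero, h2, sub_zero]

/-- Let `m` be half the degree of `f`, rounded up, and `w = y / x ^ m`. Then `w²` is the reflected
polynomial evaluated at `1/x`. For even degree `1/x` is a parameter, for odd degree `w` is. In both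
cases `dx / y` has order `(2 - m) * ord x`. -/
theorem smul_mem_iff_of_pole (h : IsHyper x y f) {P : Place K} (hP : P.ord x < 0) (k : K) :
    (k / y) • D ℂ K x ∈ differentialsRegularAt P ↔
      P.AtLeast ((((f.natDegree + 1) / 2 : ℕ) - 2 : ℤ) * P.ord x) k := by
  have : CharZero K := charZero_of_injective_algebraMap (algebraMap ℂ K).injective
  have hx : x ≠ 0 := by simpa using ne_const_of_transcendental h.trans 0
  set m := (f.natDegree + 1) / 2 with hm
  have hxm := pow_ne_zero m hx
  have htr : Transcendental ℂ x⁻¹ := fun h0 => h.trans (by simpa using h0.inv)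
  have hw0 : y / x ^ m ≠ 0 := div_ne_zero h.y_ne_zero hxm
  have hw : (y / x ^ m) ^ 2 = aeval x⁻¹ (reflect (2 * m) f) := by
    let := invertibleOfNonzero hx
    have := eval₂_reflect_mul_pow (algebraMap ℂ K) x (2 * m) f (by omega)
    rw [invOf_eq_inv] at this
    rw [div_pow, h.sq, aeval_def, aeval_def, ← this, ← pow_mul, mul_comm m 2]
    field_simp
  have hdec : ∀ a : K, ∃ α ∈ IntermediateField.adjoin ℂ {x⁻¹},
      ∃ β ∈ IntermediateField.adjoin ℂ {x⁻¹}, a = α + β * (y / x ^ m) := by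
    intro a
    rw [adjoin_inv]
    obtain ⟨α, hα, β, hβ, rfl⟩ := h.decomposition a
    exact ⟨α, hα, β * x ^ m,
      mul_mem hβ (pow_mem (IntermediateField.mem_adjoin_simple_self ℂ x) m), by field_simp⟩
  have hdx := D_inv_eq (K := K) hx
  have hz1 : P.AtLeast 1 x⁻¹ := (Place.atLeast_iff (inv_ne_zero hx)).2 (by rw [P.ord_inv]; omega)
  by_cases hk : k = 0
  · subst hk
    simpa using Place.atLeast_zero_fun (P := P) _
  rcases Nat.even_or_odd' f.natDegree with ⟨d, hd | hd⟩
  · have hmd : m = d := by omega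
    obtain ⟨h1, h2, -⟩ := h.ord_of_pole_even hP hd
    have ht := isLocalParam_of_unramified htr hz1 hw (by
      rw [← coeff_zero_eq_eval_zero, coeff_reflect, revAt_le (by omega), hmd, ← hd]
      simpa using h.ne_zero) hdec
    have hne : -x ^ 2 / y ≠ 0 := div_ne_zero (neg_ne_zero.2 (pow_ne_zero 2 hx)) h.y_ne_zero
    rw [ht.smul_mem_iff h.isCurve h.exists_D hdx,
      show k / y * (-x ^ 2) = k * (-x ^ 2 / y) by ring,
      Place.atLeast_iff (mul_ne_zero hk hne), Place.atLeast_iff hk, P.ord_mul hk hne,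
      P.ord_div (neg_ne_zero.2 (pow_ne_zero 2 hx)) h.y_ne_zero, P.ord_neg, P.ord_pow, h1, h2, hmd]
    push_cast
    constructor <;> intro <;> linarith
  · have hmd : m = d + 1 := by omega
    obtain ⟨h1, h2, -⟩ := h.ord_of_pole_odd hP ⟨d, hd⟩
    have hg : (derivative (reflect (2 * m) f)).eval 0 ≠ 0 := by
      rw [← coeff_zero_eq_eval_zero, coeff_derivative, coeff_reflect, revAt_le (by omega),
        show 2 * m - (0 + 1) = f.natDegree by omega]
      simpa using h.ne_zero
    have hz1' : P.AtLeast 1 (x⁻¹ - algebraMap ℂ K 0) := by simpa using hz1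
    have hgu := Place.ord_eq_zero_of_value hg (Place.atLeast_aeval_sub hz1' _)
    have how : P.ord (y / x ^ m) = 1 := by
      rw [P.ord_div h.y_ne_zero hxm, P.ord_pow, h1, h2, hd, hmd]; push_cast; ring
    have ht := isLocalParam_of_ramified htr (by rw [P.ord_inv, h1]; rfl) hw how hg hdec
    have hu : D ℂ K x = (-x ^ 2 * (2 * (y / x ^ m) /
        aeval x⁻¹ (derivative (reflect (2 * m) f)))) • D ℂ K (y / x ^ m) := by
      have h3 := congrArg (D ℂ K) hw
      rw [D_aeval, D_sq] at h3
      rw [hdx, mul_smul, div_eq_inv_mul, mul_smul, h3, smul_smul _ _ (D ℂ K x⁻¹),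
        inv_mul_cancel₀ hgu.1, one_smul]
    have h2u : P.ord (algebraMap ℂ K 2) = 0 := P.ord_const 2
    have hne : -x ^ 2 / x ^ m ≠ 0 := div_ne_zero (neg_ne_zero.2 (pow_ne_zero 2 hx)) hxm
    have hne2 : algebraMap ℂ K 2 / aeval x⁻¹ (derivative (reflect (2 * m) f)) ≠ 0 :=
      div_ne_zero (by simp) hgu.1
    have hy := h.y_ne_zero
    rw [ht.smul_mem_iff h.isCurve h.exists_D hu,
      show k / y * (-x ^ 2 * (2 * (y / x ^ m) / aeval x⁻¹ (derivative (reflect (2 * m) f)))) =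
        k * (-x ^ 2 / x ^ m * (algebraMap ℂ K 2 /
          aeval x⁻¹ (derivative (reflect (2 * m) f)))) by
          rw [map_ofNat]; field_simp,
      Place.atLeast_iff (mul_ne_zero hk (mul_ne_zero hne hne2)), Place.atLeast_iff hk,
      P.ord_mul hk (mul_ne_zero hne hne2), P.ord_mul hne hne2, P.ord_div (by simp) hgu.1, hgu.2,
      h2u, P.ord_div (neg_ne_zero.2 (pow_ne_zero 2 hx)) hxm, P.ord_neg, P.ord_pow, P.ord_pow, h1]
    push_cast
    constructor <;> intro <;> linarith

/-- The regular differentials are the `p(x) dx / y` with `p` of small degree. -/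
theorem mem_regularDifferentials_iff (h : IsHyper x y f) (ω : Ω[K⁄ℂ]) :
    ω ∈ regularDifferentials K ↔
      ∃ p ∈ degreeLT ℂ ((f.natDegree + 1) / 2 - 1), ω = (aeval x p / y) • D ℂ K x := by
  have : CharZero K := charZero_of_injective_algebraMap (algebraMap ℂ K).injective
  have hdeg := h.deg
  have hiff : ω ∈ regularDifferentials K ↔ ∀ P : Place K, ω ∈ differentialsRegularAt P := Iff.rfl
  rw [hiff]
  constructor
  · intro hω
    obtain ⟨k, rfl⟩ := exists_eq_smul h.exists_D ω
    obtain ⟨k, rfl⟩ : ∃ k', k = k' / y := ⟨k * y, by field_simp [h.y_ne_zero]⟩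
    obtain ⟨p, q, rfl⟩ := h.exists_polynomials (g := k)
      fun P c hP => (h.smul_mem_iff_of_value hP k).1 (hω P)
    obtain ⟨P, hP⟩ := h.exists_pole
    have h1 := (h.smul_mem_iff_of_pole hP _).1 (hω P)
    have h2 := (h.smul_mem_iff_of_pole (by rwa [h.ord_conj_x]) _).1 (hω (P.conj h.conj))
    rw [Place.atLeast_conj, h.ord_conj_x, map_add, map_mul, h.conj_aeval, h.conj_aeval,
      h.conj_y] at h2
    have hhalf : ∀ (n : ℤ) (z : K), P.AtLeast n (2 * z) → P.AtLeast n z := by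
      intro n z hz
      have := (Place.atLeast_const (P := P) (1 / 2)).mul hz
      rw [zero_add] at this
      convert this using 1
      rw [map_div₀, map_one, map_ofNat]; field_simp
    have h3 := hhalf _ (aeval x p) (by convert h1.add h2 using 1; ring)
    have h4 := hhalf _ (aeval x q * y) (by convert h1.sub h2 using 1; ring)
    -- The pole of `y` itself, of order half the degree of `f` times that of `x`, exceeds what is
    -- allowed; multiplying by a nonzero polynomial only worsens it.
    have hq : q = 0 := by
      by_contra hq
      have hq' := aeval_ne_zero_of_transcendental h.trans hq
      have h5 := h4.le_ord (mul_ne_zero hq' h.y_ne_zero)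
      rw [P.ord_mul hq' h.y_ne_zero, Place.ord_aeval_pole hP hq] at h5
      have h6 := congrArg P.ord h.sq
      rw [P.ord_pow, Place.ord_aeval_pole hP h.ne_zero] at h6
      push_cast at h6
      have h7 : (2 * (((f.natDegree + 1) / 2 : ℕ) - 2 : ℤ)) < f.natDegree := by omega
      nlinarith [mul_nonneg (Nat.cast_nonneg (α := ℤ) q.natDegree) (neg_nonneg.2 hP.le)]
    subst hq
    refine ⟨p, ?_, by simp⟩
    rw [mem_degreeLT]
    by_cases hp : p = 0
    · rw [hp, degree_zero]; exact WithBot.bot_lt_coe _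
    have h5 := h3.le_ord (aeval_ne_zero_of_transcendental h.trans hp)
    rw [Place.ord_aeval_pole hP hp] at h5
    have h6 := (mul_le_mul_right_of_neg hP).1 h5
    rw [degree_eq_natDegree hp]
    norm_cast
    omega
  · rintro ⟨p, hp, rfl⟩ P
    rcases h.exists_value_or_pole P with ⟨c, hc⟩ | hP
    · rw [h.smul_mem_iff_of_value hc]
      have hx0 : P.AtLeast 0 x := by
        have := (hc.mono (by norm_num : (0 : ℤ) ≤ 1)).add (Place.atLeast_const c)
        rwa [sub_add_cancel] at this
      exact Place.atLeast_aeval hx0 p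
    · rw [h.smul_mem_iff_of_pole hP]
      by_cases hp0 : p = 0
      · rw [hp0, map_zero]; exact Place.atLeast_zero_fun _
      rw [mem_degreeLT, degree_eq_natDegree hp0] at hp
      norm_cast at hp
      rw [Place.atLeast_iff (aeval_ne_zero_of_transcendental h.trans hp0),
        Place.ord_aeval_pole hP hp0]
      exact mul_le_mul_of_nonpos_right (by omega) hP.le

theorem genus_eq (h : IsHyper x y f) : genus K = (f.natDegree - 1) / 2 := by
  set n := (f.natDegree + 1) / 2 - 1 with hn
  let φ : degreeLT ℂ n →ₗ[ℂ] Ω[K⁄ℂ] :=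
    { toFun := fun p => (aeval x (p : ℂ[X]) / y) • D ℂ K x
      map_add' := fun p q => by
        rw [Submodule.coe_add, map_add, add_div, add_smul]
      map_smul' := fun c p => by
        rw [Submodule.coe_smul, map_smul, RingHom.id_apply, Algebra.smul_def, mul_div_assoc,
          mul_smul, algebraMap_smul] }
  have hinj : Function.Injective φ := by
    intro p q hpq
    have h1 := smul_D_injective h.isCurve h.exists_D hpq
    rw [div_left_inj' h.y_ne_zero] at h1
    apply Subtype.ext
    have h2 : aeval x ((p : ℂ[X]) - (q : ℂ[X])) = 0 := by rw [map_sub, h1, sub_self]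
    by_contra hne
    exact aeval_ne_zero_of_transcendental h.trans (sub_ne_zero.2 hne) h2
  have hrange : LinearMap.range φ = regularDifferentials K := by
    ext ω
    rw [h.mem_regularDifferentials_iff, LinearMap.mem_range]
    constructor
    · rintro ⟨p, rfl⟩; exact ⟨p, p.2, rfl⟩
    · rintro ⟨p, hp, rfl⟩; exact ⟨⟨p, hp⟩, rfl⟩
  rw [genus, ← hrange, LinearMap.finrank_range_of_inj hinj,
    LinearEquiv.finrank_eq (degreeLTEquiv ℂ n), Module.finrank_fin_fun]
  have := h.deg
  omega

end IsHyper

end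

/-! ### Points of hyperelliptic curves and the chord-tangent law -/

section

variable {K : Type} [Field K] [Algebra ℂ K]

/-! ### Points of a hyperelliptic curve -/

/-- The functions `x` and `y` take the values `c` and `d` at `P`. -/
def Place.At (P : Place K) (x y : K) (c d : ℂ) : Prop :=
  P.AtLeast 1 (x - algebraMap ℂ K c) ∧ P.AtLeast 1 (y - algebraMap ℂ K d)

theorem delta_self (P : Place K) : delta P P = 1 := by simp [delta]

theorem delta_of_ne {P R : Place K} (h : R ≠ P) : delta P R = 0 := by simp [delta, h]

theorem diffClass_add_three_eq_zero {P₁ P₂ P₃ O : Place K} {g : K} (hg : g ≠ 0)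
    (h : ∀ R : Place K, R.ord g = delta P₁ R + delta P₂ R + delta P₃ R - 3 * delta O R) :
    diffClass P₁ O + diffClass P₂ O + diffClass P₃ O = 0 := by
  classical
  simp only [diffClass, ← QuotientAddGroup.mk_add]
  rw [mk_eq_zero_iff]
  refine ⟨g, hg, fun R => ?_⟩
  rw [h R]
  simp only [Finsupp.add_apply, Finsupp.sub_apply, Finsupp.single_apply, delta, eq_comm (a := R)]
  ring

theorem diffClass_add_two_eq_zero {P₁ P₂ O : Place K} {g : K} (hg : g ≠ 0)
    (h : ∀ R : Place K, R.ord g = delta P₁ R + delta P₂ R - 2 * delta O R) :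
    diffClass P₁ O + diffClass P₂ O = 0 := by
  have := diffClass_add_three_eq_zero (P₁ := P₁) (P₂ := P₂) (P₃ := O) (O := O) hg
    (fun R => by rw [h R]; ring)
  rwa [diffClass_self, add_zero] at this

theorem Place.ne_of_pole {x : K} {P O : Place K} {c : ℂ}
    (hP : P.AtLeast 1 (x - algebraMap ℂ K c)) (hO : O.ord x < 0) : P ≠ O := by
  rintro rfl
  have h0 := Place.atLeast_zero_of_value hP
  by_cases hx : x = 0
  · rw [hx] at hO; simp at hO
  · have := h0.le_ord hx; omega

theorem Place.ord_sub_of_value {x : K} {R : Place K} {c c' : ℂ}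
    (hR : R.AtLeast 1 (x - algebraMap ℂ K c)) (hc : c ≠ c') :
    R.ord (x - algebraMap ℂ K c') = 0 := by
  refine (Place.ord_eq_zero_of_value (P := R) (c := c - c') (sub_ne_zero.2 hc) ?_).2
  convert hR using 1
  rw [map_sub]; ring

theorem Place.ord_sub_of_pole {x : K} {R : Place K} (hR : R.ord x < 0) (c : ℂ) :
    R.ord (x - algebraMap ℂ K c) = R.ord x := by
  have := Place.ord_aeval_pole hR (X_sub_C_ne_zero c)
  simpa using this

namespace IsHyper

variable {x y : K} {f : ℂ[X]}

theorem sq_eq_of_at (h : IsHyper x y f) {P : Place K} {c d : ℂ} (hP : P.At x y c d) :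
    d ^ 2 = f.eval c := by
  have h1 := Place.atLeast_aeval_sub hP.1 f
  have h2 := Place.atLeast_aeval_sub hP.2 (X ^ 2)
  rw [map_pow, aeval_X, h.sq] at h2
  have := Place.value_unique h2 h1
  simpa using this

theorem exists_at_of_value (h : IsHyper x y f) {P : Place K} {c : ℂ}
    (hP : P.AtLeast 1 (x - algebraMap ℂ K c)) : ∃ d : ℂ, P.At x y c d := by
  have hy : 0 ≤ P.ord y := by
    by_cases hc : f.eval c = 0
    · rw [(h.ord_of_branch hP hc).2.1]; norm_num
    · rw [(h.ord_of_not_branch hP hc).2.1]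
  obtain ⟨d, hd⟩ := h.isCurve.exists_value P ((Place.atLeast_iff h.y_ne_zero).2 hy)
  exact ⟨d, hP, hd⟩

theorem at_conj (h : IsHyper x y f) {P : Place K} {c d : ℂ} (hP : P.At x y c d) :
    (P.conj h.conj).At x y c (-d) := by
  refine ⟨(h.atLeast_conj_x 1).2 hP.1, ?_⟩
  rw [Place.atLeast_conj, map_sub, h.conj_y, h.conj_const, map_neg]
  convert hP.2.neg using 1; ring

theorem exists_at (h : IsHyper x y f) {c d : ℂ} (hcd : d ^ 2 = f.eval c) :
    ∃ P : Place K, P.At x y c d := by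
  obtain ⟨P, hP⟩ := h.exists_place c
  obtain ⟨d', hd⟩ := h.exists_at_of_value hP
  have h1 := h.sq_eq_of_at hd
  rw [← hcd, sq_eq_sq_iff_eq_or_eq_neg] at h1
  rcases h1 with rfl | rfl
  · exact ⟨P, hd⟩
  · exact ⟨P.conj h.conj, by simpa using h.at_conj hd⟩

theorem at_unique (h : IsHyper x y f) {P P' : Place K} {c d : ℂ} (hP : P.At x y c d)
    (hP' : P'.At x y c d) : P' = P := by
  rcases h.eq_or_eq_conj_of_value hP.1 hP'.1 with h1 | h1
  · exact h1
  · have h2 := h.at_conj hP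
    rw [← h1] at h2
    have h3 := P'.value_unique h2.2 hP'.2
    have hd : d = 0 := by
      have : 2 * d = 0 := by linear_combination -h3
      simpa using this
    have hc := h.sq_eq_of_at hP
    rw [hd, zero_pow two_ne_zero] at hc
    rw [h1, (h.ord_of_branch hP.1 hc.symm).2.2]

theorem exists_at_or_pole (h : IsHyper x y f) (P : Place K) :
    (∃ c d : ℂ, P.At x y c d) ∨ P.ord x < 0 := by
  rcases h.exists_value_or_pole P with ⟨c, hc⟩ | hP
  · exact Or.inl ⟨c, h.exists_at_of_value hc⟩
  · exact Or.inr hP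

theorem pole_unique (h : IsHyper x y f) (hodd : Odd f.natDegree) {O O' : Place K}
    (hO : O.ord x < 0) (hO' : O'.ord x < 0) : O' = O := by
  rcases h.eq_or_eq_conj_of_pole hO hO' with h1 | h1
  · exact h1
  · rw [h1, (h.ord_of_pole_odd hO hodd).2.2]

theorem ord_x_sub (h : IsHyper x y f) (hodd : Odd f.natDegree) {P O : Place K} {c : ℂ}
    (hP : P.AtLeast 1 (x - algebraMap ℂ K c)) (hO : O.ord x < 0) (R : Place K) :
    R.ord (x - algebraMap ℂ K c) = delta P R + delta (P.conj h.conj) R - 2 * delta O R := by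
  have hP' := (h.atLeast_conj_x 1).2 hP
  rcases h.exists_value_or_pole R with ⟨c', hR⟩ | hR
  · rw [delta_of_ne (Place.ne_of_pole hR hO)]
    by_cases hcc : c' = c
    · subst hcc
      by_cases hb : f.eval c' = 0
      · have h1 := h.ord_of_branch hP hb
        have h2 := h.ord_of_branch hR hb
        have h3 : R = P := by
          rcases h.eq_or_eq_conj_of_value hP hR with h4 | h4
          · exact h4
          · rw [h4, h1.2.2]
        rw [h1.2.2, h2.1, h3, delta_self]; norm_num
      · have h1 := h.ord_of_not_branch hP hb
        have h2 := h.ord_of_not_branch hR hb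
        rw [h2.1]
        rcases h.eq_or_eq_conj_of_value hP hR with h4 | h4
        · rw [h4, delta_self, delta_of_ne h1.2.2.symm]; norm_num
        · rw [h4, delta_self, delta_of_ne h1.2.2]; norm_num
    · rw [Place.ord_sub_of_value hR hcc, delta_of_ne, delta_of_ne]
      · norm_num
      · rintro rfl; exact hcc (Place.value_unique hR hP')
      · rintro rfl; exact hcc (Place.value_unique hR hP)
  · have h0 := h.pole_unique hodd hO hR
    subst h0
    rw [Place.ord_sub_of_pole hR, (h.ord_of_pole_odd hR hodd).1, delta_self,
      delta_of_ne (Place.ne_of_pole hP hO).symm, delta_of_ne (Place.ne_of_pole hP' hO).symm]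
    norm_num

/-- The function `x - c` has divisor `P + P.conj - 2 O`. -/
theorem diffClass_conj (h : IsHyper x y f) (hodd : Odd f.natDegree) {O : Place K}
    (hO : O.ord x < 0) (P : Place K) : diffClass (P.conj h.conj) O = -diffClass P O := by
  rcases h.exists_value_or_pole P with ⟨c, hP⟩ | hP
  · rw [eq_neg_iff_add_eq_zero, add_comm]
    exact diffClass_add_two_eq_zero (sub_ne_zero.2 (ne_const_of_transcendental h.trans c))
      (h.ord_x_sub hodd hP hO)
  · rw [(h.ord_of_pole_odd hP hodd).2.2, h.pole_unique hodd hO hP]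
    simp

/-- On a curve of positive genus different points are not linearly equivalent. -/
theorem eq_of_diffClass_eq_zero (h : IsHyper x y f) (hodd : Odd f.natDegree)
    (hdeg : 3 ≤ f.natDegree) {P Q : Place K} (hPQ : diffClass P Q = 0) : P = Q := by
  by_contra hne
  obtain ⟨O, hO⟩ := h.exists_pole
  have hOx := h.ord_of_pole_odd hO hodd
  -- At `O` polynomials in `x` have even order and their multiples of `y` odd order at most `-3`. No
  -- cancellation is possible, so a function with a nonzero `y`-part has a pole of order at least 3.
  have hord : ∀ p q : ℂ[X], q ≠ 0 → aeval x p + aeval x q * y ≠ 0 ∧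
      O.ord (aeval x p + aeval x q * y) ≤ -3 := by
    intro p q hq
    have hq' := mul_ne_zero (aeval_ne_zero_of_transcendental h.trans hq) h.y_ne_zero
    have h2 : O.ord (aeval x q * y) = q.natDegree * (-2) - f.natDegree := by
      rw [O.ord_mul (aeval_ne_zero_of_transcendental h.trans hq) h.y_ne_zero,
        Place.ord_aeval_pole hO hq, hOx.1, hOx.2.1]; ring
    by_cases hp : p = 0
    · rw [hp, map_zero, zero_add, h2]
      exact ⟨hq', by omega⟩
    · have hp' := aeval_ne_zero_of_transcendental h.trans hp
      have h1 : O.ord (aeval x p) = p.natDegree * (-2) := by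
        rw [Place.ord_aeval_pole hO hp, hOx.1]
      have h3 := Place.ord_add_of_ne (P := O) hp' hq' (by
        obtain ⟨k, hk⟩ := hodd
        rw [h1, h2, hk]; push_cast; omega)
      refine ⟨h3.1, h3.2.trans_le ((min_le_right _ _).trans ?_)⟩
      rw [h2]; omega
  have hPQ' : (1 : ℕ) • diffClass P Q = 0 := by rw [one_smul, hPQ]
  rw [nsmul_diffClass_eq_zero_iff] at hPQ'
  obtain ⟨g, hg, hdiv⟩ := hPQ'
  simp only [Nat.cast_one, one_mul] at hdiv
  have hdP : ∀ R, 0 ≤ delta P R := fun R => by unfold delta; split_ifs <;> norm_num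
  have hPO : ∀ {R : Place K}, R ≠ Q → R.AtLeast 0 g := fun {R} hR => by
    rw [Place.atLeast_iff hg, hdiv, delta_of_ne hR]; linarith [hdP R]
  have hgQ : Q.ord g = -1 := by
    rw [hdiv, delta_self, delta_of_ne (Ne.symm hne)]; norm_num
  rcases h.exists_value_or_pole Q with ⟨c, hQ⟩ | hQ
  · have hxc := sub_ne_zero.2 (ne_const_of_transcendental h.trans c)
    have hgx := mul_ne_zero hg hxc
    -- Multiplying by `x - c` removes the pole at `Q` and creates at most a double pole at `O`, so
    -- the product is a polynomial in `x`. Such a function has even order at a branch point and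
    -- equal orders at `Q` and its conjugate, which is incompatible with a single simple pole of `g`
    -- at `Q`.
    obtain ⟨p, q, hpq⟩ := h.exists_polynomials (g := g * (x - algebraMap ℂ K c)) (by
      intro R c' hR
      have h1 : R.AtLeast 0 (x - algebraMap ℂ K c) :=
        (Place.atLeast_zero_of_value hR).sub (Place.atLeast_const c)
      by_cases hRQ : R = Q
      · rw [Place.atLeast_iff hgx, hRQ, Q.ord_mul hg hxc, hgQ]
        have := hQ.le_ord hxc
        omega
      · simpa using (hPO hRQ).mul h1)
    have hq : q = 0 := by
      by_contra hq
      have h1 := (hord p q hq).2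
      rw [← hpq, O.ord_mul hg hxc, Place.ord_sub_of_pole hO, hOx.1] at h1
      have := (hPO (Place.ne_of_pole hQ hO).symm).le_ord hg
      omega
    rw [hq, map_zero, zero_mul, add_zero] at hpq
    have hp : p ≠ 0 := by rintro rfl; rw [map_zero] at hpq; exact hgx hpq
    have h1 := Q.ord_mul hg hxc
    rw [hpq, hgQ, Place.ord_aeval hQ (ne_const_of_transcendental h.trans c) hp] at h1
    by_cases hb : f.eval c = 0
    · rw [(h.ord_of_branch hQ hb).1] at h1
      omega
    · have hb' := h.ord_of_not_branch hQ hb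
      rw [hb'.1] at h1
      have hQ' := (h.atLeast_conj_x 1).2 hQ
      have h2 := (Q.conj h.conj).ord_mul hg hxc
      rw [hpq, Place.ord_aeval hQ' (ne_const_of_transcendental h.trans c) hp,
        (h.ord_of_not_branch hQ' hb).1] at h2
      have := (hPO hb'.2.2).le_ord hg
      omega
  · have hQO := h.pole_unique hodd hO hQ
    subst hQO
    obtain ⟨p, q, hpq⟩ := h.exists_polynomials (g := g)
      fun R c hR => hPO (Place.ne_of_pole hR hO)
    by_cases hq : q = 0
    · rw [hq, map_zero, zero_mul, add_zero] at hpq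
      have hp : p ≠ 0 := by rintro rfl; rw [map_zero] at hpq; exact hg hpq
      rw [hpq, Place.ord_aeval_pole hO hp, hOx.1] at hgQ
      omega
    · have := (hord p q hq).2
      rw [← hpq] at this
      omega

theorem two_nsmul_diffClass_eq_zero_iff (h : IsHyper x y f) (hodd : Odd f.natDegree)
    (hdeg : 3 ≤ f.natDegree) {O : Place K} (hO : O.ord x < 0) (P : Place K) :
    2 • diffClass P O = 0 ↔ P = O ∨ ∃ e, f.eval e = 0 ∧ P.At x y e 0 := by
  constructor
  · intro h2
    rw [two_nsmul, ← eq_neg_iff_add_eq_zero, ← h.diffClass_conj hodd hO] at h2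
    have h3 : diffClass P (P.conj h.conj) = 0 := by
      rw [← diffClass_add_diffClass P O, h2, ← neg_diffClass (P.conj h.conj) O, add_neg_cancel]
    have h4 := h.eq_of_diffClass_eq_zero hodd hdeg h3
    rcases h.exists_at_or_pole P with ⟨c, d, hP⟩ | hP
    · by_cases hb : f.eval c = 0
      · have hd := h.sq_eq_of_at hP
        rw [hb, sq_eq_zero_iff] at hd
        subst hd
        exact Or.inr ⟨c, hb, hP⟩
      · exact absurd h4.symm (h.ord_of_not_branch hP.1 hb).2.2
    · exact Or.inl (h.pole_unique hodd hO hP)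
  · rintro (rfl | ⟨e, he, hP⟩)
    · simp
    · have := h.diffClass_conj hodd hO P
      rw [(h.ord_of_branch hP.1 he).2.2, eq_neg_iff_add_eq_zero] at this
      rw [two_nsmul, this]

/-- The divisor of a line. -/
theorem diffClass_add_of_line (h : IsHyper x y f) (hdeg : f.natDegree = 3) {O P₁ P₂ P₃ : Place K}
    {s b c₁ c₂ c₃ : ℂ} (hO : O.ord x < 0) (h₁ : P₁.At x y c₁ (s * c₁ + b))
    (h₂ : P₂.At x y c₂ (s * c₂ + b)) (h₃ : P₃.At x y c₃ (s * c₃ + b))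
    (hN : f - (C s * X + C b) ^ 2 = (X - C c₁) * (X - C c₂) * (X - C c₃)) :
    diffClass P₁ O + diffClass P₂ O + diffClass P₃ O = 0 := by
  have hodd : Odd f.natDegree := by rw [hdeg]; decide
  set ℓ := y - (algebraMap ℂ K s * x + algebraMap ℂ K b) with hℓ
  have hx : ∀ c : ℂ, x - algebraMap ℂ K c ≠ 0 :=
    fun c => sub_ne_zero.2 (ne_const_of_transcendental h.trans c)
  -- The norm of the equation `ℓ` of the line is a polynomial in `x` with the roots `c₁`, `c₂`,
  -- `c₃`; it bounds the zeros of `ℓ` to points over these values.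
  have hprod : ℓ * h.conj ℓ = -((x - algebraMap ℂ K c₁) * (x - algebraMap ℂ K c₂) *
      (x - algebraMap ℂ K c₃)) := by
    have h1 := congrArg (aeval x) hN
    simp only [map_sub, map_mul, map_pow, map_add, aeval_X, aeval_C, ← h.sq] at h1
    rw [hℓ, ← h1, map_sub, map_add, map_mul, h.conj_y, h.conj_const, h.conj_const, h.conj_x]
    ring
  have hne : ℓ * h.conj ℓ ≠ 0 := by
    rw [hprod, neg_ne_zero]
    exact mul_ne_zero (mul_ne_zero (hx _) (hx _)) (hx _)
  have hℓ0 : ℓ ≠ 0 := left_ne_zero_of_mul hne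
  have hℓ1 : h.conj ℓ ≠ 0 := right_ne_zero_of_mul hne
  have hsum : ∀ R : Place K, R.ord ℓ + (R.conj h.conj).ord ℓ =
      R.ord (x - algebraMap ℂ K c₁) + R.ord (x - algebraMap ℂ K c₂) +
        R.ord (x - algebraMap ℂ K c₃) := by
    intro R
    rw [Place.ord_conj, ← R.ord_mul hℓ0 hℓ1, hprod, R.ord_neg,
      R.ord_mul (mul_ne_zero (hx _) (hx _)) (hx _), R.ord_mul (hx _) (hx _)]
  have hval : ∀ {R : Place K} {c d : ℂ}, R.At x y c d →
      R.AtLeast 1 (ℓ - algebraMap ℂ K (d - (s * c + b))) := by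
    intro R c d hR
    have h1 := hR.2.sub ((Place.atLeast_const s).mul hR.1)
    convert h1 using 1
    rw [hℓ]
    simp only [map_sub, map_add, map_mul]
    ring
  refine diffClass_add_three_eq_zero hℓ0 fun R => ?_
  rcases h.exists_at_or_pole R with ⟨c, d, hR⟩ | hR
  · rw [delta_of_ne (Place.ne_of_pole hR.1 hO)]
    by_cases hd : d = s * c + b
    · have hdel : ∀ {P : Place K} {c' : ℂ}, P.At x y c' (s * c' + b) →
          R.ord (x - algebraMap ℂ K c') = R.ord (x - algebraMap ℂ K c) * delta P R := by
        intro P c' hP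
        by_cases hcc : c = c'
        · subst hcc
          rw [← hd] at hP
          rw [h.at_unique hP hR, delta_self, mul_one]
        · rw [Place.ord_sub_of_value hR.1 hcc, delta_of_ne, mul_zero]
          rintro rfl
          exact hcc (R.value_unique hR.1 hP.1)
      have h1 := hsum R
      rw [hdel h₁, hdel h₂, hdel h₃] at h1
      -- At a branch point `R` is its own conjugate, so `hsum` gives twice the order of `ℓ`.
      -- Elsewhere on the line `ℓ` takes the nonzero value `-2d` at the conjugate of `R`, so `R`
      -- carries the whole order of the norm.
      by_cases hb : f.eval c = 0
      · obtain ⟨h2, -, h3⟩ := h.ord_of_branch hR.1 hb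
        rw [h3, h2] at h1
        omega
      · obtain ⟨h2, -, -⟩ := h.ord_of_not_branch hR.1 hb
        have hd0 : d ≠ 0 := by
          rintro rfl
          have := h.sq_eq_of_at hR
          rw [zero_pow two_ne_zero] at this
          exact hb this.symm
        have h3 := (Place.ord_eq_zero_of_value (P := R.conj h.conj)
          (c := -d - (s * c + b)) (by
            rw [← hd]; intro h0; apply hd0
            have : 2 * d = 0 := by linear_combination -h0
            simpa using this) (hval (h.at_conj hR))).2
        rw [h3, h2] at h1
        omega
    · rw [(Place.ord_eq_zero_of_value (sub_ne_zero.2 hd) (hval hR)).2]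
      have hdel : ∀ {P : Place K} {c' : ℂ}, P.At x y c' (s * c' + b) → delta P R = 0 := by
        intro P c' hP
        apply delta_of_ne
        rintro rfl
        obtain rfl := R.value_unique hR.1 hP.1
        exact hd (R.value_unique hR.2 hP.2)
      rw [hdel h₁, hdel h₂, hdel h₃]; norm_num
  · have h0 := h.pole_unique hodd hO hR
    subst h0
    have h1 := h.ord_of_pole_odd hR hodd
    have h2 := hsum R
    rw [h1.2.2, Place.ord_sub_of_pole hR, Place.ord_sub_of_pole hR, Place.ord_sub_of_pole hR, h1.1] at h2
    rw [delta_self, delta_of_ne (Place.ne_of_pole h₁.1 hO).symm, delta_of_ne (Place.ne_of_pole h₂.1 hO).symm,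
      delta_of_ne (Place.ne_of_pole h₃.1 hO).symm]
    omega

end IsHyper

/-! ### The group law of an elliptic curve -/

/-- The monic cubic polynomial with roots `e₁`, `e₂`, `e₃`. -/
def cubic (e₁ e₂ e₃ : ℂ) : ℂ[X] := (X - C e₁) * (X - C e₂) * (X - C e₃)

@[simp] theorem eval_cubic (e₁ e₂ e₃ c : ℂ) :
    (cubic e₁ e₂ e₃).eval c = (c - e₁) * (c - e₂) * (c - e₃) := by simp [cubic]

theorem natDegree_cubic (e₁ e₂ e₃ : ℂ) : (cubic e₁ e₂ e₃).natDegree = 3 := by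
  rw [cubic, natDegree_mul (mul_ne_zero (X_sub_C_ne_zero _) (X_sub_C_ne_zero _))
    (X_sub_C_ne_zero _), natDegree_mul (X_sub_C_ne_zero _) (X_sub_C_ne_zero _)]
  simp

theorem odd_natDegree_cubic (e₁ e₂ e₃ : ℂ) : Odd (cubic e₁ e₂ e₃).natDegree := by
  rw [natDegree_cubic]; decide

theorem cubic_rotate (e₁ e₂ e₃ : ℂ) : cubic e₁ e₂ e₃ = cubic e₂ e₃ e₁ := by
  unfold cubic; ring

theorem squarefree_X_sub_C_mul {f : ℂ[X]} (hf : Squarefree f) {e : ℂ} (he : f.eval e ≠ 0) :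
    Squarefree ((X - C e) * f) := by
  rw [squarefree_mul_iff]
  refine ⟨?_, (irreducible_X_sub_C e).squarefree, hf⟩
  exact ((irreducible_X_sub_C e).coprime_iff_not_dvd.2
    (by rwa [dvd_iff_isRoot])).isRelPrime

theorem squarefree_cubic {e₁ e₂ e₃ : ℂ} (h₁₂ : e₁ ≠ e₂) (h₁₃ : e₁ ≠ e₃) (h₂₃ : e₂ ≠ e₃) :
    Squarefree (cubic e₁ e₂ e₃) := by
  rw [cubic, mul_assoc]
  refine squarefree_X_sub_C_mul (squarefree_X_sub_C_mul (irreducible_X_sub_C e₃).squarefree ?_) ?_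
  · simpa [sub_eq_zero] using h₂₃
  · simpa [sub_eq_zero] using ⟨h₁₂, h₁₃⟩

section Elliptic

variable {x y : K} {e₁ e₂ e₃ : ℂ}

theorem IsHyper.cubic_distinct (h : IsHyper x y (cubic e₁ e₂ e₃)) : e₁ ≠ e₂ ∧ e₁ ≠ e₃ := by
  have h1 := h.eval_derivative_ne_zero (c := e₁) (by simp)
  constructor <;> rintro rfl <;> apply h1 <;> simp [cubic]

/-- The tangent at `P`, of slope `s = f'(c) / (2 d)`, meets the curve twice at `P` and once more at
a point whose conjugate is `2 P`; the sum of the three roots of the intersection cubic gives its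
coordinate. -/
theorem IsHyper.double (h : IsHyper x y (cubic e₁ e₂ e₃)) {O P : Place K} (hO : O.ord x < 0)
    {c d : ℂ} (hP : P.At x y c d) (hd : d ≠ 0) :
    ∃ (Q : Place K) (d' : ℂ), Q.At x y (((derivative (cubic e₁ e₂ e₃)).eval c / (2 * d)) ^ 2 +
      (e₁ + e₂ + e₃) - 2 * c) d' ∧ diffClass Q O = 2 • diffClass P O := by
  set s := (derivative (cubic e₁ e₂ e₃)).eval c / (2 * d) with hs
  set c₃ := s ^ 2 + (e₁ + e₂ + e₃) - 2 * c with hc₃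
  have hd2 := h.sq_eq_of_at hP
  have hsd : 2 * d * s = (derivative (cubic e₁ e₂ e₃)).eval c := by rw [hs]; field_simp
  rw [eval_cubic] at hd2
  have hder : (derivative (cubic e₁ e₂ e₃)).eval c =
      (c - e₁) * (c - e₂) + (c - e₁) * (c - e₃) + (c - e₂) * (c - e₃) := by
    simp [cubic]; ring
  rw [hder] at hsd
  have hNe : ∀ T, (T - e₁) * (T - e₂) * (T - e₃) - (s * T + (d - s * c)) ^ 2 =
      (T - c) * (T - c) * (T - c₃) := by
    intro T
    rw [hc₃]
    linear_combination (-(T - c)) * hsd - hd2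
  have hN : cubic e₁ e₂ e₃ - (C s * X + C (d - s * c)) ^ 2 =
      (X - C c) * (X - C c) * (X - C c₃) := by
    apply Polynomial.funext
    intro T
    simpa [cubic] using hNe T
  obtain ⟨R, hR⟩ := h.exists_at (c := c₃) (d := s * c₃ + (d - s * c)) (by
    rw [eval_cubic]
    linear_combination -hNe c₃)
  have hP' : P.At x y c (s * c + (d - s * c)) := by simpa using hP
  have h1 := h.diffClass_add_of_line (natDegree_cubic _ _ _) hO hP' hP' hR hN
  refine ⟨R.conj h.conj, _, h.at_conj hR, ?_⟩
  rw [h.diffClass_conj (odd_natDegree_cubic _ _ _) hO, two_nsmul]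
  exact (eq_neg_of_add_eq_zero_left h1).symm

/-- The chord through `P` and `T` has slope `d / (c - e₁)`; the conjugate of the third intersection
point is `P + T`. -/
theorem IsHyper.translate (h : IsHyper x y (cubic e₁ e₂ e₃)) {O P T : Place K} (hO : O.ord x < 0)
    (hT : T.At x y e₁ 0) {c d : ℂ} (hP : P.At x y c d) (hc : c ≠ e₁) :
    ∃ (Q : Place K) (d' : ℂ), Q.At x y (e₁ + (e₁ - e₂) * (e₁ - e₃) / (c - e₁)) d' ∧
      diffClass Q O = diffClass P O + diffClass T O := by
  have hce := sub_ne_zero.2 hc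
  set s := d / (c - e₁) with hs
  set c₃ := e₁ + (e₁ - e₂) * (e₁ - e₃) / (c - e₁) with hc₃
  have hd2 := h.sq_eq_of_at hP
  rw [eval_cubic] at hd2
  have hs2 : s ^ 2 = (c - e₂) * (c - e₃) / (c - e₁) := by
    rw [hs, div_pow, hd2]; field_simp
  have hNe : ∀ T, (T - e₁) * (T - e₂) * (T - e₃) - (s * T + (-s * e₁)) ^ 2 =
      (T - c) * (T - e₁) * (T - c₃) := by
    intro T
    have : (s * T + (-s * e₁)) ^ 2 = (c - e₂) * (c - e₃) / (c - e₁) * (T - e₁) ^ 2 := by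
      rw [← hs2]; ring
    rw [this, hc₃]
    field_simp
    ring
  have hN : cubic e₁ e₂ e₃ - (C s * X + C (-s * e₁)) ^ 2 =
      (X - C c) * (X - C e₁) * (X - C c₃) := by
    apply Polynomial.funext
    intro T
    simpa [cubic] using hNe T
  obtain ⟨R, hR⟩ := h.exists_at (c := c₃) (d := s * c₃ + (-s * e₁)) (by
    rw [eval_cubic]
    linear_combination -hNe c₃)
  have hP' : P.At x y c (s * c + (-s * e₁)) := by
    convert hP using 1
    rw [hs]; field_simp; ring
  have hT' : T.At x y e₁ (s * e₁ + (-s * e₁)) := by simpa using hT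
  have h1 := h.diffClass_add_of_line (natDegree_cubic _ _ _) hO hP' hT' hR hN
  refine ⟨R.conj h.conj, _, h.at_conj hR, ?_⟩
  rw [h.diffClass_conj (odd_natDegree_cubic _ _ _) hO]
  exact (eq_neg_of_add_eq_zero_left h1).symm

end Elliptic

end

/-! ### The projective line, Möbius transformations, and values of functions -/

section

variable {K : Type} [Field K] [Algebra ℂ K]

/-! ### The projective line -/

theorem P1.ofComplex_injective : Function.Injective P1.ofComplex := by
  intro a b h
  rw [P1.ofComplex, P1.ofComplex, Projectivization.mk_eq_mk_iff'] at h
  obtain ⟨u, hu⟩ := h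
  have h0 := congrFun hu 0
  have h1 := congrFun hu 1
  simp at h0 h1
  rw [← h0, h1, one_mul]

@[simp] theorem P1.ofComplex_inj {a b : ℂ} : P1.ofComplex a = P1.ofComplex b ↔ a = b :=
  P1.ofComplex_injective.eq_iff

@[simp] theorem P1.ofComplex_ne_infinity (a : ℂ) : P1.ofComplex a ≠ P1.infinity := by
  intro h
  rw [P1.ofComplex, P1.infinity, Projectivization.mk_eq_mk_iff'] at h
  obtain ⟨u, hu⟩ := h
  have h1 := congrFun hu 1
  simp at h1

@[simp] theorem P1.infinity_ne_ofComplex (a : ℂ) : P1.infinity ≠ P1.ofComplex a :=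
  (P1.ofComplex_ne_infinity a).symm

theorem P1.mk_eq_ofComplex {a b : ℂ} (hv : ![a, b] ≠ 0) (hb : b ≠ 0) :
    (Projectivization.mk ℂ ![a, b] hv : P1) = P1.ofComplex (a / b) := by
  rw [P1.ofComplex, Projectivization.mk_eq_mk_iff']
  refine ⟨b, ?_⟩
  ext i
  fin_cases i
  · simp; field_simp
  · simp

theorem P1.mk_eq_infinity {a b : ℂ} (hv : ![a, b] ≠ 0) (hb : b = 0) :
    (Projectivization.mk ℂ ![a, b] hv : P1) = P1.infinity := by
  rw [P1.infinity, Projectivization.mk_eq_mk_iff']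
  refine ⟨a, ?_⟩
  ext i
  fin_cases i <;> simp [hb]

theorem P1.cases (p : P1) : (∃ c, p = P1.ofComplex c) ∨ p = P1.infinity := by
  induction p using Projectivization.ind with
  | h v hv =>
    have h2 : v = ![v 0, v 1] := by ext i; fin_cases i <;> rfl
    by_cases h1 : v 1 = 0
    · right
      have := P1.mk_eq_infinity (h2 ▸ hv) h1
      rw [← this]; congr
    · left
      have := P1.mk_eq_ofComplex (h2 ▸ hv) h1
      exact ⟨_, by rw [← this]; congr⟩

/-- The Möbius transformation `z ↦ (a z + b) / (c z + d)`. -/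
def mob (a b c d : ℂ) (h : a * d - b * c ≠ 0) : PGL(2, ℂ) :=
  Matrix.ProjGenLinGroup.mk
    (Matrix.GeneralLinearGroup.mkOfDetNeZero !![a, b; c, d] (by rwa [Matrix.det_fin_two_of]))

theorem mob_smul_mk {a b c d : ℂ} (h : a * d - b * c ≠ 0) {u v : ℂ} (huv : ![u, v] ≠ 0)
    (hne : ![a * u + b * v, c * u + d * v] ≠ 0) :
    mob a b c d h • (Projectivization.mk ℂ ![u, v] huv : P1) =
      Projectivization.mk ℂ ![a * u + b * v, c * u + d * v] hne := by
  rw [mob, Projectivization.PGL.mk_smul_mk]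
  congr 1
  simp [Matrix.GeneralLinearGroup.mkOfDetNeZero]

theorem mob_ne_zero {a b c d : ℂ} (h : a * d - b * c ≠ 0) {u v : ℂ} (huv : ![u, v] ≠ 0) :
    ![a * u + b * v, c * u + d * v] ≠ 0 := by
  intro h0
  have h1 := congrFun h0 0
  have h2 := congrFun h0 1
  simp at h1 h2
  apply huv
  have h3 : (a * d - b * c) * u = 0 := by linear_combination d * h1 - b * h2
  have h4 : (a * d - b * c) * v = 0 := by linear_combination a * h2 - c * h1
  rw [mul_eq_zero, or_iff_right h] at h3 h4
  simp [h3, h4]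

theorem mob_smul_ofComplex {a b c d : ℂ} (h : a * d - b * c ≠ 0) {z : ℂ} (hz : c * z + d ≠ 0) :
    mob a b c d h • P1.ofComplex z = P1.ofComplex ((a * z + b) / (c * z + d)) := by
  have hv : ![z, 1] ≠ 0 := by simp
  rw [P1.ofComplex, mob_smul_mk h hv (mob_ne_zero h hv), P1.mk_eq_ofComplex _ (by simpa using hz)]
  simp

theorem mob_smul_ofComplex_eq_infinity {a b c d : ℂ} (h : a * d - b * c ≠ 0) {z : ℂ}
    (hz : c * z + d = 0) : mob a b c d h • P1.ofComplex z = P1.infinity := by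
  have hv : ![z, 1] ≠ 0 := by simp
  rw [P1.ofComplex, mob_smul_mk h hv (mob_ne_zero h hv), P1.mk_eq_infinity _ (by simpa using hz)]

theorem mob_smul_infinity {a b c d : ℂ} (h : a * d - b * c ≠ 0) (hc : c ≠ 0) :
    mob a b c d h • P1.infinity = P1.ofComplex (a / c) := by
  have hv : ![(1 : ℂ), 0] ≠ 0 := by simp
  rw [P1.infinity, mob_smul_mk h hv (mob_ne_zero h hv), P1.mk_eq_ofComplex _ (by simpa using hc)]
  simp

theorem mob_smul_infinity_eq_infinity {a b c d : ℂ} (h : a * d - b * c ≠ 0) (hc : c = 0) :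
    mob a b c d h • P1.infinity = P1.infinity := by
  have hv : ![(1 : ℂ), 0] ≠ 0 := by simp
  conv_lhs => rw [P1.infinity, mob_smul_mk h hv (mob_ne_zero h hv)]
  exact P1.mk_eq_infinity _ (by simpa using hc)

theorem exists_eq_mob (γ : PGL(2, ℂ)) : ∃ (a b c d : ℂ) (h : a * d - b * c ≠ 0),
    γ = mob a b c d h := by
  induction γ using Matrix.ProjGenLinGroup.induction_on with
  | mk g =>
    have hdet : g.1.det ≠ 0 := by
      have := (Matrix.isUnit_iff_isUnit_det g.1).1 g.isUnit
      exact this.ne_zero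
    rw [Matrix.det_fin_two] at hdet
    refine ⟨g.1 0 0, g.1 0 1, g.1 1 0, g.1 1 1, hdet, ?_⟩
    rw [mob]
    congr 1
    ext i j
    fin_cases i <;> fin_cases j <;> simp [Matrix.GeneralLinearGroup.mkOfDetNeZero]

theorem mob_eq_of_smul {a b c d a' b' c' d' : ℂ} (h : a * d - b * c ≠ 0)
    (h' : a' * d' - b' * c' ≠ 0) (k : ℂ) (ha : a' = k * a) (hb : b' = k * b) (hc : c' = k * c)
    (hd : d' = k * d) : mob a b c d h = mob a' b' c' d' h' := by
  have hk : k ≠ 0 := by rintro rfl; apply h'; simp [ha, hb, hc, hd]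
  rw [mob, mob, Matrix.ProjGenLinGroup.mk_eq_mk_iff]
  refine ⟨Units.mk0 k hk, ?_⟩
  ext i j
  fin_cases i <;> fin_cases j <;>
    simp [Matrix.GeneralLinearGroup.mkOfDetNeZero, ha, hb, hc, hd, mul_comm]

theorem mob_mul {a b c d a' b' c' d' : ℂ} (h : a * d - b * c ≠ 0) (h' : a' * d' - b' * c' ≠ 0) :
    mob a b c d h * mob a' b' c' d' h' = mob (a * a' + b * c') (a * b' + b * d')
      (c * a' + d * c') (c * b' + d * d') (by
        convert mul_ne_zero h h' using 1; ring) := by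
  rw [mob, mob, ← map_mul, mob]
  congr 1
  ext i j
  fin_cases i <;> fin_cases j <;>
    simp [Matrix.GeneralLinearGroup.mkOfDetNeZero]

theorem mob_one : mob 1 0 0 1 (by norm_num) = 1 := by
  rw [mob, ← Matrix.ProjGenLinGroup.mk_one]
  congr 1
  ext i j
  fin_cases i <;> fin_cases j <;> simp [Matrix.GeneralLinearGroup.mkOfDetNeZero]

/-- The action of `PGL₂(ℂ)` on the projective line is faithful. -/
theorem eq_of_smul_eq {γ γ' : PGL(2, ℂ)} (h : ∀ p : P1, γ • p = γ' • p) : γ = γ' := by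
  rw [← inv_mul_eq_one]
  have hfix : ∀ p : P1, (γ⁻¹ * γ') • p = p := fun p => by
    rw [mul_smul, ← h, inv_smul_smul]
  obtain ⟨a, b, c, d, hd, hγ⟩ := exists_eq_mob (γ⁻¹ * γ')
  rw [hγ] at hfix ⊢
  have hc : c = 0 := by
    by_contra hc
    have := hfix P1.infinity
    rw [mob_smul_infinity _ hc] at this
    exact P1.ofComplex_ne_infinity _ this
  subst hc
  have hd0 : d ≠ 0 := by rintro rfl; simp at hd
  have h0 := hfix (P1.ofComplex 0)
  have h1 := hfix (P1.ofComplex 1)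
  rw [mob_smul_ofComplex _ (by simpa using hd0), P1.ofComplex_inj] at h0 h1
  have hb : b = 0 := by simpa [hd0] using h0
  rw [zero_mul, zero_add, div_eq_one_iff_eq hd0] at h1
  have ha : a = d := by linear_combination h1 - hb
  rw [← mob_one]
  exact (mob_eq_of_smul _ _ d (by simp [ha]) (by simp [hb]) (by simp) (by simp)).symm

/-! ### Values of functions -/

theorem value_eq_ofComplex {x : K} {P : Place K} {c : ℂ} (h : P.AtLeast 1 (x - algebraMap ℂ K c)) :
    value x P = P1.ofComplex c := by
  have hex : ∃ c : ℂ, P.v (x - algebraMap ℂ K c) < 1 := ⟨c, Place.atLeast_one_iff.1 h⟩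
  rw [value, dif_pos hex, P1.ofComplex_inj]
  exact Place.value_unique (Place.atLeast_one_iff.2 hex.choose_spec) h

theorem value_eq_infinity {x : K} {P : Place K} (h : P.ord x < 0) : value x P = P1.infinity := by
  rw [value, dif_neg]
  rintro ⟨c, hc⟩
  have h0 := Place.atLeast_zero_of_value (Place.atLeast_one_iff.2 hc)
  have hx : x ≠ 0 := by rintro rfl; simp at h
  have := h0.le_ord hx
  omega

theorem value_eq_ofComplex_iff {x : K} {P : Place K} {c : ℂ} :
    value x P = P1.ofComplex c ↔ P.AtLeast 1 (x - algebraMap ℂ K c) := by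
  refine ⟨fun h => ?_, value_eq_ofComplex⟩
  by_cases hex : ∃ c : ℂ, P.v (x - algebraMap ℂ K c) < 1
  · obtain ⟨c', hc'⟩ := hex
    have h1 := Place.atLeast_one_iff.2 hc'
    rw [value_eq_ofComplex h1, P1.ofComplex_inj] at h
    rwa [← h]
  · rw [value, dif_neg hex] at h
    exact absurd h (P1.infinity_ne_ofComplex c)

theorem IsHyper.value_eq_infinity_iff {x y : K} {f : ℂ[X]} (h : IsHyper x y f) {P : Place K} :
    value x P = P1.infinity ↔ P.ord x < 0 := by
  refine ⟨fun h1 => ?_, value_eq_infinity⟩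
  rcases h.exists_value_or_pole P with ⟨c, hc⟩ | hP
  · rw [value_eq_ofComplex hc] at h1
    exact absurd h1 (P1.ofComplex_ne_infinity c)
  · exact hP

theorem IsHyper.eq_or_eq_conj {x y : K} {f : ℂ[X]} (h : IsHyper x y f) {P P' : Place K}
    (hP : value x P' = value x P) : P' = P ∨ P' = P.conj h.conj := by
  rcases h.exists_value_or_pole P with ⟨c, hc⟩ | h1
  · rw [value_eq_ofComplex hc, value_eq_ofComplex_iff] at hP
    exact h.eq_or_eq_conj_of_value hc hP
  · rw [value_eq_infinity h1, h.value_eq_infinity_iff] at hP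
    exact h.eq_or_eq_conj_of_pole h1 hP

theorem IsHyper.value_surjective {x y : K} {f : ℂ[X]} (h : IsHyper x y f) (p : P1) :
    ∃ P, value x P = p := by
  rcases P1.cases p with ⟨c, rfl⟩ | rfl
  · obtain ⟨P, hP⟩ := h.exists_place c
    exact ⟨P, value_eq_ofComplex hP⟩
  · obtain ⟨P, hP⟩ := h.exists_pole
    exact ⟨P, value_eq_infinity hP⟩

theorem IsHyper.value_mob {x y : K} {f : ℂ[X]} (h : IsHyper x y f) {a b c d : ℂ}
    (hd : a * d - b * c ≠ 0) (P : Place K) :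
    value ((algebraMap ℂ K a * x + algebraMap ℂ K b) / (algebraMap ℂ K c * x + algebraMap ℂ K d)) P
      = mob a b c d hd • value x P := by
  have hlin : ∀ u v : ℂ, algebraMap ℂ K u * x + algebraMap ℂ K v = aeval x (C u * X + C v) := by
    intro u v; simp
  have hne : ∀ u v : ℂ, (u ≠ 0 ∨ v ≠ 0) → (C u * X + C v : ℂ[X]) ≠ 0 := by
    intro u v huv h0
    have h1 := congrArg (fun p => coeff p 1) h0
    have h2 := congrArg (fun p => coeff p 0) h0
    simp at h1 h2
    rcases huv with h3 | h3
    · exact h3 h1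
    · exact h3 h2
  have hab : a ≠ 0 ∨ b ≠ 0 := by
    by_contra! h0; apply hd; simp [h0.1, h0.2]
  have hcd : c ≠ 0 ∨ d ≠ 0 := by
    by_contra! h0; apply hd; simp [h0.1, h0.2]
  have hn := aeval_ne_zero_of_transcendental h.trans (hne a b hab)
  have hm := aeval_ne_zero_of_transcendental h.trans (hne c d hcd)
  rcases h.exists_value_or_pole P with ⟨z, hz⟩ | hP
  · rw [value_eq_ofComplex hz]
    have h1 := Place.atLeast_aeval_sub hz (C a * X + C b)
    have h2 := Place.atLeast_aeval_sub hz (C c * X + C d)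
    by_cases h0 : c * z + d = 0
    · rw [mob_smul_ofComplex_eq_infinity hd h0]
      apply value_eq_infinity
      have hn0 : a * z + b ≠ 0 := by
        intro hn0
        exact hd (by linear_combination a * h0 - c * hn0)
      have h3 := (Place.ord_eq_zero_of_value (by simpa using hn0) h1).2
      rw [hlin, hlin, P.ord_div hn hm, h3]
      simp only [eval_add, eval_mul, eval_C, eval_X, h0, map_zero, sub_zero] at h2
      have := h2.le_ord hm
      omega
    · rw [mob_smul_ofComplex hd h0]
      apply value_eq_ofComplex
      simp only [eval_add, eval_mul, eval_C, eval_X] at h1 h2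
      have h3 := Place.ord_eq_zero_of_value h0 h2
      have hinv : P.AtLeast 0 (aeval x (C c * X + C d))⁻¹ :=
        (Place.atLeast_iff (inv_ne_zero hm)).2 (by rw [P.ord_inv]; omega)
      have h4 := hinv.mul (h1.sub ((Place.atLeast_const ((a * z + b) / (c * z + d))).mul h2))
      have h00 : algebraMap ℂ K (c * z + d) ≠ 0 := (_root_.map_ne_zero _).2 h0
      rw [zero_add] at h4
      convert h4 using 1
      have key : ∀ {N M u v : K}, M ≠ 0 → v ≠ 0 →
          N / M - u / v = M⁻¹ * (N - u - u / v * (M - v)) := by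
        intro N M u v hM hv
        field_simp
        ring
      rw [hlin, hlin, map_div₀, key hm h00]
  · rw [value_eq_infinity hP]
    by_cases hc : c = 0
    · subst hc
      rw [mob_smul_infinity_eq_infinity hd rfl]
      apply value_eq_infinity
      have ha : a ≠ 0 := by rintro rfl; simp at hd
      rw [hlin, hlin, P.ord_div hn hm, Place.ord_aeval_pole hP (hne a b hab),
        Place.ord_aeval_pole hP (hne 0 d hcd), natDegree_linear ha]
      simp
      exact hP
    · rw [mob_smul_infinity hd hc]
      apply value_eq_ofComplex
      have hc' : algebraMap ℂ K c ≠ 0 := by simpa using hc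
      have h5 : algebraMap ℂ K (b * c - a * d) ≠ 0 := by
        have : b * c - a * d ≠ 0 := fun h0 => hd (by linear_combination -h0)
        exact (_root_.map_ne_zero _).2 this
      have h4 : (algebraMap ℂ K a * x + algebraMap ℂ K b) /
          (algebraMap ℂ K c * x + algebraMap ℂ K d) - algebraMap ℂ K (a / c) =
          algebraMap ℂ K (b * c - a * d) / (algebraMap ℂ K c * aeval x (C c * X + C d)) := by
        rw [map_div₀, hlin c d]
        field_simp
        simp
        ring
      rw [h4, Place.atLeast_iff (div_ne_zero h5 (mul_ne_zero hc' hm)),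
        P.ord_div h5 (mul_ne_zero hc' hm), P.ord_const, P.ord_const_mul hc,
        Place.ord_aeval_pole hP (hne c d hcd), natDegree_linear hc]
      simp
      omega

end

/-! ### Elliptic double covers: branch set, translation group, torsion values -/

section

variable {K : Type} [Field K] [Algebra ℂ K]

/-! ### Elliptic double covers -/

section Cover

variable {x y : K} {e₁ e₂ e₃ : ℂ}

/-- The involution of the projective line that is induced by translation by the point of order two
with coordinate `e₁`. -/
def transl (e₁ e₂ e₃ : ℂ) (h₂ : e₁ ≠ e₂) (h₃ : e₁ ≠ e₃) : PGL(2, ℂ) :=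
  mob e₁ ((e₁ - e₂) * (e₁ - e₃) - e₁ ^ 2) 1 (-e₁) (by
    have := mul_ne_zero (sub_ne_zero.2 h₂) (sub_ne_zero.2 h₃)
    intro h0; apply this; linear_combination -h0)

theorem IsHyper.exists_translate (h : IsHyper x y (cubic e₁ e₂ e₃)) {O T : Place K}
    (hO : O.ord x < 0) (hT : T.At x y e₁ 0) (P : Place K) :
    ∃ Q : Place K, diffClass Q O = diffClass P O + diffClass T O ∧
      value x Q = transl e₁ e₂ e₃ h.cubic_distinct.1 h.cubic_distinct.2 • value x P := by
  rcases h.exists_at_or_pole P with ⟨c, d, hP⟩ | hP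
  · rw [value_eq_ofComplex hP.1]
    by_cases hc : c = e₁
    · subst hc
      have hd := h.sq_eq_of_at hP
      simp only [eval_cubic, sub_self, zero_mul, sq_eq_zero_iff] at hd
      subst hd
      refine ⟨O, ?_, ?_⟩
      · have h2 := (h.two_nsmul_diffClass_eq_zero_iff (odd_natDegree_cubic _ _ _)
          (natDegree_cubic _ _ _).ge hO T).2 (Or.inr ⟨c, by simp, hT⟩)
        rw [h.at_unique hT hP, ← two_nsmul, h2, diffClass_self]
      · rw [value_eq_infinity hO, transl, mob_smul_ofComplex_eq_infinity _ (by ring)]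
    · obtain ⟨Q, d', hQ, hsum⟩ := h.translate hO hT hP hc
      refine ⟨Q, hsum, ?_⟩
      have hce := sub_ne_zero.2 hc
      rw [value_eq_ofComplex hQ.1, transl, mob_smul_ofComplex _ (by
        rwa [one_mul, ← sub_eq_add_neg]), P1.ofComplex_inj, one_mul, ← sub_eq_add_neg]
      field_simp
      ring
  · rw [value_eq_infinity hP, h.pole_unique (odd_natDegree_cubic _ _ _) hO hP]
    refine ⟨T, by simp, ?_⟩
    rw [value_eq_ofComplex hT.1, transl, mob_smul_infinity _ one_ne_zero, div_one]

theorem IsHyper.eq_of_diffClass_eq (h : IsHyper x y (cubic e₁ e₂ e₃)) {O P Q : Place K}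
    (hPQ : diffClass P O = diffClass Q O) : P = Q := by
  apply h.eq_of_diffClass_eq_zero (odd_natDegree_cubic _ _ _) (natDegree_cubic _ _ _).ge
  rw [← diffClass_add_diffClass P O Q, hPQ, ← neg_diffClass Q O, add_neg_cancel]

theorem adjoin_mob {a b c d : ℂ} (hd : a * d - b * c ≠ 0) (hx : Transcendental ℂ x) :
    IntermediateField.adjoin ℂ {(algebraMap ℂ K a * x + algebraMap ℂ K b) /
      (algebraMap ℂ K c * x + algebraMap ℂ K d)} = IntermediateField.adjoin ℂ {x} := by
  have hm : algebraMap ℂ K c * x + algebraMap ℂ K d ≠ 0 := by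
    intro h0
    have h1 : aeval x (C c * X + C d) = 0 := by simpa using h0
    by_cases hcd : (C c * X + C d : ℂ[X]) = 0
    · have h2 := congrArg (fun p => coeff p 1) hcd
      have h3 := congrArg (fun p => coeff p 0) hcd
      simp at h2 h3
      apply hd; simp [h2, h3]
    · exact aeval_ne_zero_of_transcendental hx hcd h1
  set w := (algebraMap ℂ K a * x + algebraMap ℂ K b) / (algebraMap ℂ K c * x + algebraMap ℂ K d)
    with hw
  have hdet : algebraMap ℂ K (a * d - b * c) ≠ 0 := (_root_.map_ne_zero _).2 hd
  have hden : algebraMap ℂ K a - algebraMap ℂ K c * w =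
      algebraMap ℂ K (a * d - b * c) / (algebraMap ℂ K c * x + algebraMap ℂ K d) := by
    rw [hw, map_sub, map_mul, map_mul]
    field_simp
    ring
  have hden0 : algebraMap ℂ K a - algebraMap ℂ K c * w ≠ 0 := by
    rw [hden]; exact div_ne_zero hdet hm
  have hxw : x = (algebraMap ℂ K d * w - algebraMap ℂ K b) /
      (algebraMap ℂ K a - algebraMap ℂ K c * w) := by
    rw [eq_div_iff hden0]
    have h1 := (eq_div_iff hm).1 hw
    linear_combination -h1
  have hconst : ∀ (F : IntermediateField ℂ K) (c : ℂ), algebraMap ℂ K c ∈ F :=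
    fun F c => F.algebraMap_mem c
  apply le_antisymm <;> rw [IntermediateField.adjoin_simple_le_iff]
  · have := IntermediateField.mem_adjoin_simple_self ℂ x
    exact div_mem (add_mem (mul_mem (hconst _ _) this) (hconst _ _))
      (add_mem (mul_mem (hconst _ _) this) (hconst _ _))
  · have := IntermediateField.mem_adjoin_simple_self ℂ w
    rw [hxw]
    exact div_mem (sub_mem (mul_mem (hconst _ _) this) (hconst _ _))
      (sub_mem (hconst _ _) (mul_mem (hconst _ _) this))

theorem isRamifiedAt_mob {a b c d : ℂ} (hd : a * d - b * c ≠ 0) {O : Place K} (hO : O.ord x ≤ -2) :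
    IsRamifiedAt ((algebraMap ℂ K a * x + algebraMap ℂ K b) /
      (algebraMap ℂ K c * x + algebraMap ℂ K d)) O := by
  have hO' : O.ord x < 0 := by omega
  have hlin : ∀ u v : ℂ, u ≠ 0 → algebraMap ℂ K u * x + algebraMap ℂ K v ≠ 0 ∧
      O.ord (algebraMap ℂ K u * x + algebraMap ℂ K v) = O.ord x := by
    intro u v hu
    have hx : x ≠ 0 := by rintro rfl; simp at hO'
    have hux : algebraMap ℂ K u * x ≠ 0 := mul_ne_zero (by simpa using hu) hx
    have h1 := Place.ord_add_eq (P := O) hux (g := algebraMap ℂ K v)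
      ((Place.atLeast_const v).mono (by rw [O.ord_const_mul hu]; omega))
    rwa [O.ord_const_mul hu] at h1
  by_cases hc : c = 0
  · subst hc
    have ha : a ≠ 0 := by rintro rfl; simp at hd
    have hd0 : d ≠ 0 := by rintro rfl; simp at hd
    right
    rw [map_zero, zero_mul, zero_add, O.ord_div (hlin a b ha).1 (by simpa using hd0),
      (hlin a b ha).2, O.ord_const]
    omega
  · left
    refine ⟨a / c, ?_⟩
    have hc' : algebraMap ℂ K c ≠ 0 := by simpa using hc
    have h5 : algebraMap ℂ K (b * c - a * d) ≠ 0 := by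
      have : b * c - a * d ≠ 0 := fun h0 => hd (by linear_combination -h0)
      exact (_root_.map_ne_zero _).2 this
    have hm := (hlin c d hc).1
    have h4 : (algebraMap ℂ K a * x + algebraMap ℂ K b) /
        (algebraMap ℂ K c * x + algebraMap ℂ K d) - algebraMap ℂ K (a / c) =
        algebraMap ℂ K (b * c - a * d) /
          (algebraMap ℂ K c * (algebraMap ℂ K c * x + algebraMap ℂ K d)) := by
      rw [map_div₀, map_sub, map_mul, map_mul, div_sub_div _ _ hm hc',
        div_eq_div_iff (mul_ne_zero hm hc') (mul_ne_zero hc' hm)]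
      ring
    rw [h4, O.ord_div h5 (mul_ne_zero hc' hm), O.ord_const, O.ord_const_mul hc, (hlin c d hc).2]
    omega

/-- The elliptic curve `y² = (x - e₁)(x - e₂)(x - e₃)` with the double cover
`(a x + b) / (c x + d)`. -/
def IsHyper.cover (h : IsHyper x y (cubic e₁ e₂ e₃)) {O : Place K} (hO : O.ord x < 0)
    {a b c d : ℂ} (hd : a * d - b * c ≠ 0) : EllipticDoubleCover where
  K := K
  isCurve := h.isCurve
  genus_eq := by rw [h.genus_eq, natDegree_cubic]
  origin := O
  x := (algebraMap ℂ K a * x + algebraMap ℂ K b) / (algebraMap ℂ K c * x + algebraMap ℂ K d)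
  isDoubleCover := by
    rw [IsDoubleCover, adjoin_mob hd h.trans]
    exact h.isDoubleCover
  ramified := isRamifiedAt_mob hd (h.ord_of_pole_odd hO (odd_natDegree_cubic _ _ _)).1.le

variable (h : IsHyper x y (cubic e₁ e₂ e₃)) {O : Place K} (hO : O.ord x < 0)
    {a b c d : ℂ} (hd : a * d - b * c ≠ 0)

theorem IsHyper.toFun_cover (P : Place K) :
    (h.cover hO hd).toFun P = mob a b c d hd • value x P :=
  h.value_mob hd P

theorem IsHyper.mem_twoTorsion_cover (P : Place K) : P ∈ (h.cover hO hd).twoTorsion ↔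
    P = O ∨ P.At x y e₁ 0 ∨ P.At x y e₂ 0 ∨ P.At x y e₃ 0 := by
  refine (h.two_nsmul_diffClass_eq_zero_iff (odd_natDegree_cubic _ _ _)
    (natDegree_cubic _ _ _).ge hO P).trans ?_
  refine or_congr Iff.rfl ⟨?_, ?_⟩
  · rintro ⟨e, he, hP⟩
    simp only [eval_cubic, mul_eq_zero, sub_eq_zero] at he
    rcases he with (rfl | rfl) | rfl
    · exact Or.inl hP
    · exact Or.inr (Or.inl hP)
    · exact Or.inr (Or.inr hP)
  · rintro (hP | hP | hP) <;> exact ⟨_, by simp, hP⟩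

theorem IsHyper.branchSet_cover : (h.cover hO hd).branchSet = {mob a b c d hd • P1.infinity,
    mob a b c d hd • P1.ofComplex e₁, mob a b c d hd • P1.ofComplex e₂,
    mob a b c d hd • P1.ofComplex e₃} := by
  ext p
  constructor
  · rintro ⟨P, hP, rfl⟩
    rw [Set.mem_insert_iff, Set.mem_insert_iff, Set.mem_insert_iff, Set.mem_singleton_iff,
      h.toFun_cover hO hd P]
    rcases (h.mem_twoTorsion_cover hO hd P).1 hP with h0 | hP | hP | hP
    · exact Or.inl (by rw [h0, value_eq_infinity hO])
    · exact Or.inr (Or.inl (by rw [value_eq_ofComplex hP.1]))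
    · exact Or.inr (Or.inr (Or.inl (by rw [value_eq_ofComplex hP.1])))
    · exact Or.inr (Or.inr (Or.inr (by rw [value_eq_ofComplex hP.1])))
  · have hex : ∀ e, (cubic e₁ e₂ e₃).eval e = 0 → (∀ P : Place K, P.At x y e 0 →
        P ∈ (h.cover hO hd).twoTorsion) →
        mob a b c d hd • P1.ofComplex e ∈ (h.cover hO hd).branchSet := by
      intro e he hmem
      obtain ⟨P, hP⟩ := h.exists_at (c := e) (d := 0) (by rw [he]; simp)
      exact ⟨P, hmem P hP, by rw [h.toFun_cover, value_eq_ofComplex hP.1]⟩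
    rintro (rfl | rfl | rfl | rfl)
    · exact ⟨O, (h.mem_twoTorsion_cover hO hd O).2 (Or.inl rfl), by
        rw [h.toFun_cover, value_eq_infinity hO]⟩
    · exact hex _ (by simp) fun P hP => (h.mem_twoTorsion_cover hO hd P).2 (by tauto)
    · exact hex _ (by simp) fun P hP => (h.mem_twoTorsion_cover hO hd P).2 (by tauto)
    · exact hex _ (by simp) fun P hP => (h.mem_twoTorsion_cover hO hd P).2 (by tauto)

/-- The cover is `M ∘ x` with a Möbius map `M`, so its translations are the conjugates by `M` of
those for `x`. Each point of order at most two induces exactly one automorphism, because `x` is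
surjective on points and `PGL₂` acts faithfully. The conjugates enter as free `gᵢ` so that closed
forms can be substituted. -/
theorem IsHyper.mem_G_cover {g₁ g₂ g₃ γ₁ γ₂ γ₃ : PGL(2, ℂ)}
    (hγ₁ : γ₁ = transl e₁ e₂ e₃ h.cubic_distinct.1 h.cubic_distinct.2)
    (hγ₂ : γ₂ = transl e₂ e₃ e₁ (cubic_rotate e₁ e₂ e₃ ▸ h).cubic_distinct.1
      (cubic_rotate e₁ e₂ e₃ ▸ h).cubic_distinct.2)
    (hγ₃ : γ₃ = transl e₃ e₁ e₂ (cubic_rotate e₃ e₁ e₂ ▸ h).cubic_distinct.1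
      (cubic_rotate e₃ e₁ e₂ ▸ h).cubic_distinct.2)
    (h₁ : g₁ * mob a b c d hd = mob a b c d hd * γ₁)
    (h₂ : g₂ * mob a b c d hd = mob a b c d hd * γ₂)
    (h₃ : g₃ * mob a b c d hd = mob a b c d hd * γ₃) :
    (h.cover hO hd).G = {1, g₁, g₂, g₃} := by
  have key : ∀ (T : Place K) (g γ' : PGL(2, ℂ)), g * mob a b c d hd = mob a b c d hd * γ' →
      (∀ P : Place K, ∃ Q : Place K, diffClass Q O = diffClass P O + diffClass T O ∧
        value x Q = γ' • value x P) → ∀ γ : PGL(2, ℂ),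
      ((∀ P Q : Place K, (h.cover hO hd).cls Q = (h.cover hO hd).cls P + (h.cover hO hd).cls T →
        (h.cover hO hd).toFun Q = γ • (h.cover hO hd).toFun P) ↔ γ = g) := by
    intro T g γ' hg hex γ
    constructor
    · intro hall
      apply eq_of_smul_eq
      intro p
      obtain ⟨P, hP⟩ := h.value_surjective ((mob a b c d hd)⁻¹ • p)
      have hp : p = mob a b c d hd • value x P := by rw [hP, smul_inv_smul]
      obtain ⟨Q, hQ, hv⟩ := hex P
      have h1 := hall P Q hQ
      rw [h.toFun_cover, h.toFun_cover, ← hp, hv, ← mul_smul, ← hg, mul_smul, ← hp] at h1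
      exact h1.symm
    · rintro rfl P Q hPQ
      obtain ⟨Q', hQ', hv⟩ := hex P
      have h1 : Q = Q' := h.eq_of_diffClass_eq (O := O) (by rw [hQ']; exact hPQ)
      subst h1
      rw [h.toFun_cover, h.toFun_cover, hv, ← mul_smul, ← mul_smul, hg]
  have key₀ := key O 1 1 (by rw [one_mul, mul_one]) fun P => ⟨P, by simp, by simp⟩
  have key₁ : ∀ T : Place K, T.At x y e₁ 0 → _ := fun T hT =>
    key T g₁ γ₁ h₁ fun P => hγ₁ ▸ h.exists_translate hO hT P
  have key₂ : ∀ T : Place K, T.At x y e₂ 0 → _ := fun T hT =>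
    key T g₂ γ₂ h₂ fun P => hγ₂ ▸ (cubic_rotate e₁ e₂ e₃ ▸ h).exists_translate hO hT P
  have key₃ : ∀ T : Place K, T.At x y e₃ 0 → _ := fun T hT =>
    key T g₃ γ₃ h₃ fun P => hγ₃ ▸ (cubic_rotate e₃ e₁ e₂ ▸ h).exists_translate hO hT P
  ext γ
  constructor
  · rintro ⟨T, hT, hall⟩
    rcases (h.mem_twoTorsion_cover hO hd T).1 hT with h0 | hT | hT | hT
    · refine Or.inl ((key₀ γ).1 fun P Q hPQ => hall P Q ?_)
      rw [h0]; exact hPQ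
    · exact Or.inr (Or.inl ((key₁ T hT γ).1 hall))
    · exact Or.inr (Or.inr (Or.inl ((key₂ T hT γ).1 hall)))
    · exact Or.inr (Or.inr (Or.inr ((key₃ T hT γ).1 hall)))
  · have hex : ∀ e, (cubic e₁ e₂ e₃).eval e = 0 → ∃ P : Place K, P.At x y e 0 :=
      fun e he => h.exists_at (c := e) (d := 0) (by rw [he]; simp)
    rintro (hγ | hγ | hγ | hγ)
    · exact ⟨O, (h.mem_twoTorsion_cover hO hd O).2 (Or.inl rfl), (key₀ γ).2 hγ⟩
    · obtain ⟨T, hT⟩ := hex e₁ (by simp)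
      exact ⟨T, (h.mem_twoTorsion_cover hO hd T).2 (by tauto), (key₁ T hT γ).2 hγ⟩
    · obtain ⟨T, hT⟩ := hex e₂ (by simp)
      exact ⟨T, (h.mem_twoTorsion_cover hO hd T).2 (by tauto), (key₂ T hT γ).2 hγ⟩
    · obtain ⟨T, hT⟩ := hex e₃ (by simp)
      exact ⟨T, (h.mem_twoTorsion_cover hO hd T).2 (by tauto), (key₃ T hT γ).2 hγ⟩

end Cover

/-! ### Torsion values -/

/-- The set of values of the function `x` at the points that differ from `O` by torsion. -/
def torsionValues (x : K) (O : Place K) : Set P1 :=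
  value x '' {P | IsOfFinAddOrder (diffClass P O)}

/-- The only other point with the same value is the conjugate, whose class is the negative. -/
theorem IsHyper.value_mem_torsionValues_iff {x y : K} {f : ℂ[X]} (h : IsHyper x y f)
    (hodd : Odd f.natDegree) {O : Place K} (hO : O.ord x < 0) (P : Place K) :
    value x P ∈ torsionValues x O ↔ IsOfFinAddOrder (diffClass P O) := by
  refine ⟨?_, fun hP => ⟨P, hP, rfl⟩⟩
  rintro ⟨Q, hQ, hv⟩
  rcases h.eq_or_eq_conj hv.symm with rfl | rfl
  · exact hQ
  · rw [h.diffClass_conj hodd hO]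
    exact IsOfFinAddOrder.neg hQ

theorem IsHyper.image_torsion_cover {x y : K} {e₁ e₂ e₃ : ℂ} (h : IsHyper x y (cubic e₁ e₂ e₃))
    {O : Place K} (hO : O.ord x < 0) {a b c d : ℂ} (hd : a * d - b * c ≠ 0) :
    (h.cover hO hd).toFun '' (h.cover hO hd).torsion =
      (mob a b c d hd • ·) '' torsionValues x O := by
  rw [torsionValues, Set.image_image]
  exact Set.image_congr fun P _ => h.toFun_cover hO hd P

end

/-! ### Counting fibres; pairs of covers with invariants (3,1) and (0,4) -/

section

variable {K : Type} [Field K] [Algebra ℂ K]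

/-! ### Counting fibres -/

section Count

variable {α β : Type*} (f : α → β)

theorem encard_preimage_insert {A : Set β} {b : β} (hb : b ∉ A) :
    (f ⁻¹' insert b A).encard = (f ⁻¹' {b}).encard + (f ⁻¹' A).encard := by
  rw [Set.insert_eq, Set.preimage_union, Set.encard_union_eq]
  refine Disjoint.preimage f ?_
  simpa using hb

theorem mul_encard_le_encard_preimage {A : Set β} {k : ℕ∞}
    (h : ∀ b ∈ A, k ≤ (f ⁻¹' {b}).encard) : k * A.encard ≤ (f ⁻¹' A).encard := by
  by_cases hA : A.Finite
  · induction A, hA using Set.Finite.induction_on with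
    | empty => simp
    | @insert b A hb _ ih =>
      rw [encard_preimage_insert f hb, Set.encard_insert_of_notMem hb, mul_add, mul_one, add_comm]
      exact add_le_add (h b (Set.mem_insert _ _)) (ih fun b hb => h b (Set.mem_insert_of_mem _ hb))
  · by_cases hk : k = 0
    · simp [hk]
    have himg : f '' (f ⁻¹' A) = A := by
      apply Set.image_preimage_eq_of_subset
      intro b hb
      have h1 : (f ⁻¹' {b}).Nonempty := by
        rw [← Set.encard_pos]
        exact lt_of_lt_of_le (pos_iff_ne_zero.2 hk) (h b hb)
      obtain ⟨a, ha⟩ := h1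
      exact ⟨a, ha⟩
    have h2 := Set.encard_image_le f (f ⁻¹' A)
    rw [himg, Set.Infinite.encard_eq hA, top_le_iff] at h2
    rw [h2]; exact le_top

theorem encard_preimage_le_mul_encard {A : Set β} {k : ℕ∞} (hk : k ≠ 0)
    (h : ∀ b ∈ A, (f ⁻¹' {b}).encard ≤ k) : (f ⁻¹' A).encard ≤ k * A.encard := by
  by_cases hA : A.Finite
  · induction A, hA using Set.Finite.induction_on with
    | empty => simp
    | @insert b A hb _ ih =>
      rw [encard_preimage_insert f hb, Set.encard_insert_of_notMem hb, mul_add, mul_one,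
        add_comm (k * _)]
      exact add_le_add (h b (Set.mem_insert _ _)) (ih fun b hb => h b (Set.mem_insert_of_mem _ hb))
  · rw [Set.Infinite.encard_eq hA, ENat.mul_top hk]; exact le_top

end Count

/-- The three points over which both covers are branched. -/
def basePoints : Set P1 := {P1.infinity, P1.ofComplex 0, P1.ofComplex 1}

theorem encard_basePoints : basePoints.encard = 3 := by
  rw [basePoints, Set.encard_insert_of_notMem (by simp), Set.encard_pair (by simp)]; rfl

theorem encard_eq_diff_basePoints {A : Set P1} (hA : basePoints ⊆ A) :
    A.encard = (A \ basePoints).encard + 3 := by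
  rw [← encard_basePoints, Set.encard_sdiff_add_encard_of_subset hA]

theorem encard_preimage_eq_diff_basePoints {α : Type*} (f : α → P1) {A : Set P1}
    (hA : basePoints ⊆ A) :
    (f ⁻¹' A).encard = (f ⁻¹' (A \ basePoints)).encard + (f ⁻¹' basePoints).encard := by
  rw [Set.preimage_sdiff, Set.encard_sdiff_add_encard_of_subset (Set.preimage_mono hA)]

/-- The count is `4 (#A - 3) + 2 · 3 = 4 #A - 6`, written without subtraction so that infinite sets
are covered. -/
theorem le_encard_preimage_add {α : Type*} (f : α → P1) {A : Set P1} (hA : basePoints ⊆ A)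
    (h4 : ∀ p ∈ A, p ∉ basePoints → 4 ≤ (f ⁻¹' {p}).encard)
    (h2 : ∀ p ∈ basePoints, 2 ≤ (f ⁻¹' {p}).encard) :
    4 * A.encard ≤ (f ⁻¹' A).encard + 6 := by
  have h1 := mul_encard_le_encard_preimage f (A := A \ basePoints) (k := 4)
    fun p hp => h4 p hp.1 hp.2
  have h3 := mul_encard_le_encard_preimage f (A := basePoints) (k := 2) h2
  rw [encard_basePoints] at h3
  rw [encard_eq_diff_basePoints hA, encard_preimage_eq_diff_basePoints f hA, mul_add, add_assoc]
  refine add_le_add h1 ?_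
  calc (4 * 3 : ℕ∞) = 2 * 3 + 6 := by norm_num
    _ ≤ _ := add_le_add h3 le_rfl

theorem encard_preimage_add_le {α : Type*} (f : α → P1) {A : Set P1} (hA : basePoints ⊆ A)
    (h4 : ∀ p ∈ A, (f ⁻¹' {p}).encard ≤ 4)
    (h2 : ∀ p ∈ basePoints, (f ⁻¹' {p}).encard ≤ 2) :
    (f ⁻¹' A).encard + 6 ≤ 4 * A.encard := by
  have h1 := encard_preimage_le_mul_encard f (A := A \ basePoints) (k := 4) (by norm_num)
    fun p hp => h4 p hp.1
  have h3 := encard_preimage_le_mul_encard f (A := basePoints) (k := 2) (by norm_num) h2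
  rw [encard_basePoints] at h3
  rw [encard_eq_diff_basePoints hA, encard_preimage_eq_diff_basePoints f hA, mul_add, add_assoc]
  refine add_le_add h1 ?_
  calc _ ≤ (2 * 3 + 6 : ℕ∞) := add_le_add h3 le_rfl
    _ = 4 * 3 := by norm_num

/-! ### The double cover of a curve in Legendre form -/

theorem transl_smul_infinity {e₁ e₂ e₃ : ℂ} (h₂ : e₁ ≠ e₂) (h₃ : e₁ ≠ e₃) :
    transl e₁ e₂ e₃ h₂ h₃ • P1.infinity = P1.ofComplex e₁ := by
  rw [transl, mob_smul_infinity _ one_ne_zero, div_one]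

theorem transl_smul_ofComplex {e₁ e₂ e₃ c : ℂ} (h₂ : e₁ ≠ e₂) (h₃ : e₁ ≠ e₃) (hc : c ≠ e₁) :
    transl e₁ e₂ e₃ h₂ h₃ • P1.ofComplex c =
      P1.ofComplex (e₁ + (e₁ - e₂) * (e₁ - e₃) / (c - e₁)) := by
  have hce := sub_ne_zero.2 hc
  rw [transl, mob_smul_ofComplex _ (by rwa [one_mul, ← sub_eq_add_neg]), P1.ofComplex_inj,
    one_mul, ← sub_eq_add_neg]
  field_simp
  ring

section Legendre

variable {K₁ K₂ : Type} [Field K₁] [Algebra ℂ K₁] [Field K₂] [Algebra ℂ K₂]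
  {x : K} {y : K} {x₁ y₁ : K₁} {x₂ y₂ : K₂} {O : Place K} {O₁ : Place K₁} {O₂ : Place K₂}
  {a b : ℂ}

theorem one_mul_one_sub_ne_zero : (1 : ℂ) * 1 - 0 * 0 ≠ 0 := by norm_num

theorem IsHyper.rotate {e₁ e₂ e₃ : ℂ} (h : IsHyper x y (cubic e₁ e₂ e₃)) :
    IsHyper x y (cubic e₂ e₃ e₁) := cubic_rotate e₁ e₂ e₃ ▸ h

/-- The elliptic curve `y² = x (x - 1) (x - a)` with the double cover `x`. -/
def IsHyper.legendreCover (h : IsHyper x y (cubic 0 1 a)) (hO : O.ord x < 0) :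
    EllipticDoubleCover := h.cover hO one_mul_one_sub_ne_zero

theorem IsHyper.branchSet_legendreCover (h : IsHyper x y (cubic 0 1 a)) (hO : O.ord x < 0) :
    (h.legendreCover hO).branchSet =
      {P1.infinity, P1.ofComplex 0, P1.ofComplex 1, P1.ofComplex a} := by
  rw [IsHyper.legendreCover, h.branchSet_cover, mob_one]
  simp only [one_smul]

theorem IsHyper.G_legendreCover (h : IsHyper x y (cubic 0 1 a)) (hO : O.ord x < 0) :
    (h.legendreCover hO).G = {1, transl 0 1 a h.cubic_distinct.1 h.cubic_distinct.2,
      transl 1 a 0 h.rotate.cubic_distinct.1 h.rotate.cubic_distinct.2,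
      transl a 0 1 h.rotate.rotate.cubic_distinct.1 h.rotate.rotate.cubic_distinct.2} :=
  h.mem_G_cover hO _ rfl rfl rfl (by rw [mob_one]; simp) (by rw [mob_one]; simp)
    (by rw [mob_one]; simp)

/-- A nontrivial translation sends `∞` to the coordinate of its point, so translations by points
with different coordinates differ. Translations by the points over `0` are separated by the image of
`1`, and those by the points over `1` by the image of `0`: in each case the image is `a` for one
curve and `b` for the other. -/
theorem P_legendreCover (h₁ : IsHyper x₁ y₁ (cubic 0 1 a)) (h₂ : IsHyper x₂ y₂ (cubic 0 1 b))
    (hO₁ : O₁.ord x₁ < 0) (hO₂ : O₂.ord x₂ < 0) (hab : a ≠ b) :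
    EllipticDoubleCover.P (h₁.legendreCover hO₁) (h₂.legendreCover hO₂) = (((3 : ℕ) : ℕ∞), ((1 : ℕ) : ℕ∞)) := by
  have ha0 : a ≠ 0 := h₁.cubic_distinct.2.symm
  have hb0 : b ≠ 0 := h₂.cubic_distinct.2.symm
  have ha1 : a ≠ 1 := h₁.rotate.cubic_distinct.1.symm
  have hb1 : b ≠ 1 := h₂.rotate.cubic_distinct.1.symm
  rw [EllipticDoubleCover.P, h₁.branchSet_legendreCover, h₂.branchSet_legendreCover,
    h₁.G_legendreCover, h₂.G_legendreCover]
  refine Prod.ext ?_ ?_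
  · change Set.encard _ = _
    have : ({P1.infinity, P1.ofComplex 0, P1.ofComplex 1, P1.ofComplex a} : Set P1) ∩
        {P1.infinity, P1.ofComplex 0, P1.ofComplex 1, P1.ofComplex b} = basePoints := by
      ext p
      simp only [basePoints, Set.mem_inter_iff, Set.mem_insert_iff, Set.mem_singleton_iff]
      constructor
      · rintro ⟨h | h | h | h, h' | h' | h' | h'⟩ <;> simp_all
      · tauto
    rw [this, encard_basePoints]; rfl
  · change Set.encard _ = _
    rw [Nat.cast_one, Set.encard_eq_one]
    refine ⟨1, ?_⟩
    ext γ
    simp only [Set.mem_inter_iff, Set.mem_insert_iff, Set.mem_singleton_iff]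
    constructor
    · rintro ⟨h | h | h | h, h' | h' | h' | h'⟩
      · exact h
      · exact h
      · exact h
      · exact h
      · exact h'
      · have := congrArg (· • P1.ofComplex 1) (h.symm.trans h')
        simp only [transl_smul_ofComplex _ _ (one_ne_zero (α := ℂ)), P1.ofComplex_inj] at this
        exact absurd (by linear_combination this) hab
      · have := congrArg (· • P1.infinity) (h.symm.trans h')
        simp [transl_smul_infinity] at this
      · have := congrArg (· • P1.infinity) (h.symm.trans h')
        simp [transl_smul_infinity] at this
        exact absurd this.symm hb0
      · exact h'
      · have := congrArg (· • P1.infinity) (h.symm.trans h')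
        simp [transl_smul_infinity] at this
      · have := congrArg (· • P1.ofComplex 0) (h.symm.trans h')
        simp only [transl_smul_ofComplex _ _ (zero_ne_one (α := ℂ)), P1.ofComplex_inj] at this
        exact absurd (by linear_combination this) hab
      · have := congrArg (· • P1.infinity) (h.symm.trans h')
        simp [transl_smul_infinity] at this
        exact absurd this.symm hb1
      · exact h'
      · have := congrArg (· • P1.infinity) (h.symm.trans h')
        simp [transl_smul_infinity] at this
        exact absurd this ha0
      · have := congrArg (· • P1.infinity) (h.symm.trans h')
        simp [transl_smul_infinity] at this
        exact absurd this ha1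
      · have := congrArg (· • P1.infinity) (h.symm.trans h')
        simp [transl_smul_infinity] at this
        exact absurd this hab
    · rintro rfl; simp

theorem I_legendreCover (h₁ : IsHyper x₁ y₁ (cubic 0 1 a)) (h₂ : IsHyper x₂ y₂ (cubic 0 1 b))
    (hO₁ : O₁.ord x₁ < 0) (hO₂ : O₂.ord x₂ < 0) :
    EllipticDoubleCover.I (h₁.legendreCover hO₁) (h₂.legendreCover hO₂) =
      torsionValues x₁ O₁ ∩ torsionValues x₂ O₂ := by
  rw [EllipticDoubleCover.I, IsHyper.legendreCover, IsHyper.legendreCover,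
    h₁.image_torsion_cover, h₂.image_torsion_cover, mob_one]
  simp only [one_smul, Set.image_id']

theorem IsHyper.ofComplex_mem_torsionValues (h : IsHyper x y (cubic 0 1 a)) (hO : O.ord x < 0)
    {e : ℂ} (he : (cubic 0 1 a).eval e = 0) : P1.ofComplex e ∈ torsionValues x O := by
  obtain ⟨T, hT⟩ := h.exists_at (c := e) (d := 0) (by rw [he]; simp)
  refine ⟨T, ?_, value_eq_ofComplex hT.1⟩
  have := (h.two_nsmul_diffClass_eq_zero_iff (odd_natDegree_cubic _ _ _)
    (natDegree_cubic _ _ _).ge hO T).2 (Or.inr ⟨e, he, hT⟩)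
  exact isOfFinAddOrder_iff_nsmul_eq_zero.2 ⟨2, by norm_num, this⟩

theorem IsHyper.basePoints_subset_torsionValues (h : IsHyper x y (cubic 0 1 a))
    (hO : O.ord x < 0) : basePoints ⊆ torsionValues x O := by
  rintro p (rfl | rfl | rfl)
  · exact ⟨O, by simp, value_eq_infinity hO⟩
  · exact h.ofComplex_mem_torsionValues hO (by simp)
  · exact h.ofComplex_mem_torsionValues hO (by simp)

/-! ### A second double cover of the same curve -/

/-- The square of `(1 - w²) / (1 + w²)`, as a map of the projective line to itself. -/
def fourfold (p : P1) : P1 :=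
  open Classical in
  if h : ∃ w, p = P1.ofComplex w then
    if 1 + h.choose ^ 2 = 0 then P1.infinity
      else P1.ofComplex (((1 - h.choose ^ 2) / (1 + h.choose ^ 2)) ^ 2)
  else P1.ofComplex 1

theorem fourfold_infinity : fourfold P1.infinity = P1.ofComplex 1 := by
  rw [fourfold, dif_neg (by simp)]

theorem fourfold_ofComplex {w : ℂ} (hw : 1 + w ^ 2 ≠ 0) :
    fourfold (P1.ofComplex w) = P1.ofComplex (((1 - w ^ 2) / (1 + w ^ 2)) ^ 2) := by
  have h : ∃ w', P1.ofComplex w = P1.ofComplex w' := ⟨w, rfl⟩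
  have hc : h.choose = w := (P1.ofComplex_inj.1 h.choose_spec).symm
  rw [fourfold, dif_pos h, hc, if_neg hw]

theorem fourfold_ofComplex_eq_infinity {w : ℂ} (hw : 1 + w ^ 2 = 0) :
    fourfold (P1.ofComplex w) = P1.infinity := by
  have h : ∃ w', P1.ofComplex w = P1.ofComplex w' := ⟨w, rfl⟩
  have hc : h.choose = w := (P1.ofComplex_inj.1 h.choose_spec).symm
  rw [fourfold, dif_pos h, hc, if_pos hw]

theorem two_le_encard_fourfold {p : P1} (hp : p ∈ basePoints) :
    2 ≤ (fourfold ⁻¹' {p}).encard := by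
  have hpair : ∀ u v : P1, u ≠ v → fourfold u = p → fourfold v = p →
      2 ≤ (fourfold ⁻¹' {p}).encard := by
    intro u v huv hu hv
    rw [← Set.encard_pair huv]
    apply Set.encard_le_encard
    rintro w (rfl | rfl)
    · exact hu
    · exact hv
  rcases hp with rfl | rfl | rfl
  · refine hpair (P1.ofComplex Complex.I) (P1.ofComplex (-Complex.I)) ?_
      (fourfold_ofComplex_eq_infinity (by simp)) (fourfold_ofComplex_eq_infinity (by simp))
    rw [Ne, P1.ofComplex_inj, self_eq_neg]
    exact Complex.I_ne_zero
  · refine hpair (P1.ofComplex 1) (P1.ofComplex (-1)) ?_ ?_ ?_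
    · rw [Ne, P1.ofComplex_inj]; norm_num
    · rw [fourfold_ofComplex (by norm_num)]; norm_num
    · rw [fourfold_ofComplex (by norm_num)]; norm_num
  · refine hpair (P1.ofComplex 0) P1.infinity (by simp) ?_ fourfold_infinity
    rw [fourfold_ofComplex (by norm_num)]; norm_num

/-- The fibre contains `±v` and `±1/v`, and these four coincide nowhere unless the value is `0`, `1`
or `∞`. -/
theorem four_le_encard_fourfold {p : P1} (hp : p ∉ basePoints) :
    4 ≤ (fourfold ⁻¹' {p}).encard := by
  rcases P1.cases p with ⟨c, rfl⟩ | rfl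
  swap
  · exact absurd (Or.inl rfl) hp
  have hc0 : c ≠ 0 := by rintro rfl; exact hp (by simp [basePoints])
  have hc1 : c ≠ 1 := by rintro rfl; exact hp (by simp [basePoints])
  obtain ⟨s, hs⟩ := IsAlgClosed.exists_pow_nat_eq c (n := 2) (by norm_num)
  have hs0 : s ≠ 0 := by rintro rfl; apply hc0; rw [← hs]; norm_num
  have hs1 : 1 - s ≠ 0 := by
    intro h0; apply hc1; rw [← hs, ← sub_eq_zero.1 h0]; norm_num
  have hs2 : 1 + s ≠ 0 := by
    intro h0; apply hc1; rw [← hs, show s = -1 by linear_combination h0]; norm_num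
  -- The map `u ↦ (1 - u) / (1 + u)` is its own inverse, so this choice of `v²` makes `(1 - v²) / (1
  -- + v²)` equal to `s`.
  obtain ⟨v, hv⟩ := IsAlgClosed.exists_pow_nat_eq ((1 - s) / (1 + s)) (n := 2) (by norm_num)
  have hv0 : v ≠ 0 := by
    rintro rfl
    rw [zero_pow two_ne_zero] at hv
    exact div_ne_zero hs1 hs2 hv.symm
  have hv' : v ^ 2 * (1 + s) = 1 - s := by rw [hv]; field_simp
  have hp1 : 1 + v ^ 2 ≠ 0 := by
    intro h0
    have : (2 : ℂ) = 0 := by linear_combination (1 + s) * h0 - hv'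
    norm_num at this
  have hm1 : 1 - v ^ 2 ≠ 0 := by
    intro h0
    apply hs0
    have : 2 * s = 0 := by linear_combination (1 + s) * h0 + hv'
    simpa using this
  have hq : ((1 - v ^ 2) / (1 + v ^ 2)) ^ 2 = c := by
    rw [← hs]
    congr 1
    rw [div_eq_iff hp1]
    linear_combination -hv'
  have hp2 : 1 + (v⁻¹) ^ 2 ≠ 0 := by
    intro h0; apply hp1
    field_simp at h0
    linear_combination h0
  have hq2 : ((1 - v⁻¹ ^ 2) / (1 + v⁻¹ ^ 2)) ^ 2 = c := by
    have : (1 - v⁻¹ ^ 2) / (1 + v⁻¹ ^ 2) = -((1 - v ^ 2) / (1 + v ^ 2)) := by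
      rw [← neg_div, div_eq_div_iff hp2 hp1]
      field_simp
      ring
    rw [this, neg_sq, hq]
  have hsub : ({P1.ofComplex v, P1.ofComplex (-v), P1.ofComplex v⁻¹, P1.ofComplex (-v⁻¹)} : Set P1)
      ⊆ fourfold ⁻¹' {P1.ofComplex c} := by
    rintro w (rfl | rfl | rfl | rfl)
    · simp [fourfold_ofComplex hp1, hq]
    · rw [Set.mem_preimage, fourfold_ofComplex (by rwa [neg_sq]), neg_sq, hq]; rfl
    · rw [Set.mem_preimage, fourfold_ofComplex hp2, hq2]; rfl
    · rw [Set.mem_preimage, fourfold_ofComplex (by rwa [neg_sq]), neg_sq, hq2]; rfl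
  refine le_trans ?_ (Set.encard_le_encard hsub)
  have h1 : v ≠ -v := by rwa [Ne, self_eq_neg]
  have h2 : v ≠ v⁻¹ := by
    intro h0; apply hm1
    have : v * v = 1 := by nth_rewrite 2 [h0]; exact mul_inv_cancel₀ hv0
    linear_combination -this
  have h3 : v ≠ -v⁻¹ := by
    intro h0; apply hp1
    have : v * v = -1 := by nth_rewrite 2 [h0]; rw [mul_neg, mul_inv_cancel₀ hv0]
    linear_combination this
  have h4 : -v ≠ v⁻¹ := fun h0 => h3 (by rw [← h0, neg_neg])
  have h5 : -v ≠ -v⁻¹ := fun h0 => h2 (neg_injective h0)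
  have h6 : v⁻¹ ≠ -v⁻¹ := by rw [Ne, self_eq_neg]; exact inv_ne_zero hv0
  rw [Set.encard_insert_of_notMem (by simp [h1, h2, h3]),
    Set.encard_insert_of_notMem (by simp [h4, h5]), Set.encard_pair (by simp [h6])]
  norm_num

/-- The determinant of the Möbius transformation that turns the translations by points of order
two into `w ↦ ± w, ± 1 / w`. -/
theorem det_symmetrize_ne_zero {ℓ m : ℂ} (hℓ : ℓ ≠ 0) (hm : m ≠ 0) :
    m * (-ℓ) - m * ℓ * 1 ≠ 0 := by
  have := mul_ne_zero two_ne_zero (mul_ne_zero hm hℓ)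
  intro h0; apply this; linear_combination -h0

/-- A square root `ℓ` of `a` and a number `m` with `m² (1 + ℓ) = 1 - ℓ`. -/
structure IsSymmetrizer (a ℓ m : ℂ) : Prop where
  sq : ℓ ^ 2 = a
  rel : m ^ 2 * (1 + ℓ) = 1 - ℓ
  ne_zero : ℓ ≠ 0
  ne_zero' : m ≠ 0
  add_ne_zero : 1 + ℓ ≠ 0
  sub_ne_zero : 1 - ℓ ≠ 0

/-- Translation by `(0, 0)` is `x ↦ a / x` with fixed points `±ℓ`, and in the coordinate `m (x + ℓ)
/ (x - ℓ)` it becomes `w ↦ -w`. The scale `m` is chosen so that `∞, 0, 1, a` go to `m, -m, 1/m,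
-1/m`; the other two translations then are `w ↦ ±1/w`. -/
theorem exists_isSymmetrizer (ha0 : a ≠ 0) (ha1 : a ≠ 1) : ∃ ℓ m, IsSymmetrizer a ℓ m := by
  obtain ⟨s, hs⟩ := IsAlgClosed.exists_pow_nat_eq a (n := 2) (by norm_num)
  have hs0 : s ≠ 0 := by rintro rfl; apply ha0; rw [← hs]; norm_num
  have hs1 : 1 - s ≠ 0 := by
    intro h0; apply ha1; rw [← hs, ← sub_eq_zero.1 h0]; norm_num
  have hs2 : 1 + s ≠ 0 := by
    intro h0; apply ha1; rw [← hs, show s = -1 by linear_combination h0]; norm_num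
  obtain ⟨v, hv⟩ := IsAlgClosed.exists_pow_nat_eq ((1 - s) / (1 + s)) (n := 2) (by norm_num)
  refine ⟨s, v, hs, by rw [hv]; field_simp, hs0, ?_, hs2, hs1⟩
  rintro rfl
  rw [zero_pow two_ne_zero] at hv
  exact div_ne_zero hs1 hs2 hv.symm

section Symmetric

variable {ℓ m ℓ' m' : ℂ}

/-- The elliptic curve `y² = x (x - 1) (x - a)` with a double cover for which the translations by
points of order two are `w ↦ ± w, ± 1 / w`. -/
def IsHyper.symmetricCover (h : IsHyper x y (cubic 0 1 a)) (hO : O.ord x < 0)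
    (hs : IsSymmetrizer a ℓ m) : EllipticDoubleCover :=
  h.cover hO (det_symmetrize_ne_zero hs.ne_zero hs.ne_zero')

theorem IsSymmetrizer.one_add_sq_ne_zero (hs : IsSymmetrizer a ℓ m) : 1 + m ^ 2 ≠ 0 := by
  intro h0
  have : (2 : ℂ) = 0 := by linear_combination (1 + ℓ) * h0 - hs.rel
  norm_num at this

theorem IsSymmetrizer.fourfold_eq (hs : IsSymmetrizer a ℓ m) {w : ℂ} (hw : w ^ 2 = m ^ 2) :
    fourfold (P1.ofComplex w) = P1.ofComplex a := by
  rw [fourfold_ofComplex (by rw [hw]; exact hs.one_add_sq_ne_zero), hw, P1.ofComplex_inj, ← hs.sq]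
  congr 1
  rw [div_eq_iff hs.one_add_sq_ne_zero]
  linear_combination -hs.rel

theorem IsSymmetrizer.fourfold_inv_eq (hs : IsSymmetrizer a ℓ m) {w : ℂ}
    (hw : w ^ 2 * m ^ 2 = 1) : fourfold (P1.ofComplex w) = P1.ofComplex a := by
  have hm := hs.ne_zero'
  have h1 : 1 + w ^ 2 ≠ 0 := by
    intro h0
    apply hs.one_add_sq_ne_zero
    linear_combination m ^ 2 * h0 - hw
  rw [fourfold_ofComplex h1, P1.ofComplex_inj, ← hs.sq, ← neg_sq]
  congr 1
  rw [← neg_div, div_eq_iff h1]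
  apply mul_right_cancel₀ (pow_ne_zero 2 hm)
  linear_combination (1 - ℓ) * hw - hs.rel

/-- The branch points are `±m` and `±1/m`, and `(1 - m²) / (1 + m²) = ℓ` is a square root of `a`. -/
theorem IsHyper.branchSet_symmetricCover (h : IsHyper x y (cubic 0 1 a)) (hO : O.ord x < 0)
    (hs : IsSymmetrizer a ℓ m) : ∀ p ∈ (h.symmetricCover hO hs).branchSet,
      fourfold p = P1.ofComplex a := by
  have hℓ := hs.ne_zero
  have hm := hs.ne_zero'
  have h1 := hs.add_ne_zero
  have h2 := hs.sub_ne_zero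
  have h2' : 1 + -ℓ ≠ 0 := by rwa [← sub_eq_add_neg]
  intro p hp
  rw [IsHyper.symmetricCover, h.branchSet_cover] at hp
  rcases hp with rfl | rfl | rfl | rfl
  · rw [mob_smul_infinity _ one_ne_zero]
    exact hs.fourfold_eq (by ring)
  · rw [mob_smul_ofComplex _ (by simpa using hℓ)]
    refine hs.fourfold_eq ?_
    rw [mul_zero, mul_zero, zero_add, zero_add, div_neg, mul_div_assoc, div_self hℓ, mul_one, neg_sq]
  · rw [mob_smul_ofComplex _ (by simpa using h2')]
    refine hs.fourfold_inv_eq ?_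
    rw [one_mul, div_pow, div_mul_eq_mul_div, div_eq_one_iff_eq (pow_ne_zero 2 h2')]
    linear_combination (m ^ 2 * (1 + ℓ) + (1 - ℓ)) * hs.rel
  · have h3 : 1 * a + -ℓ ≠ 0 := by
      rw [← hs.sq, show 1 * ℓ ^ 2 + -ℓ = -(ℓ * (1 - ℓ)) by ring]
      exact neg_ne_zero.2 (mul_ne_zero hℓ h2)
    rw [mob_smul_ofComplex _ h3]
    refine hs.fourfold_inv_eq ?_
    rw [div_pow, div_mul_eq_mul_div, div_eq_one_iff_eq (pow_ne_zero 2 h3), ← hs.sq]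
    linear_combination ℓ ^ 2 * (m ^ 2 * (1 + ℓ) + (1 - ℓ)) * hs.rel

theorem IsHyper.G_symmetricCover (h : IsHyper x y (cubic 0 1 a)) (hO : O.ord x < 0)
    (hs : IsSymmetrizer a ℓ m) : (h.symmetricCover hO hs).G =
      {1, mob (-1) 0 0 1 (by norm_num), mob 0 1 1 0 (by norm_num),
        mob 0 (-1) 1 0 (by norm_num)} := by
  obtain rfl : a = ℓ ^ 2 := hs.sq.symm
  refine h.mem_G_cover hO _ rfl rfl rfl ?_ ?_ ?_
  · rw [transl, mob_mul, mob_mul]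
    -- The scalar is the ratio of the two matrices that represent the same Möbius map; likewise in
    -- the next two cases.
    apply mob_eq_of_smul _ _ (-ℓ) <;> ring
  · rw [transl, mob_mul, mob_mul]
    apply mob_eq_of_smul _ _ (m * (1 + ℓ))
    · ring
    · ring
    · linear_combination -hs.rel
    · linear_combination -ℓ * hs.rel
  · rw [transl, mob_mul, mob_mul]
    apply mob_eq_of_smul _ _ (-ℓ * m * (1 + ℓ))
    · ring
    · ring
    · linear_combination ℓ * hs.rel
    · linear_combination ℓ ^ 2 * hs.rel

/-- A common branch point would have both `a` and `b` as its image under `fourfold`. The two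
translation groups are literally the same, and the images of the point `2` show that it has four
elements. -/
theorem P_symmetricCover (h₁ : IsHyper x₁ y₁ (cubic 0 1 a)) (h₂ : IsHyper x₂ y₂ (cubic 0 1 b))
    (hO₁ : O₁.ord x₁ < 0) (hO₂ : O₂.ord x₂ < 0) (hs₁ : IsSymmetrizer a ℓ m)
    (hs₂ : IsSymmetrizer b ℓ' m') (hab : a ≠ b) :
    EllipticDoubleCover.P (h₁.symmetricCover hO₁ hs₁) (h₂.symmetricCover hO₂ hs₂) =
      (((0 : ℕ) : ℕ∞), ((4 : ℕ) : ℕ∞)) := by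
  refine Prod.ext ?_ ?_
  · change Set.encard _ = _
    rw [Nat.cast_zero, Set.encard_eq_zero, Set.eq_empty_iff_forall_notMem]
    rintro p ⟨hp₁, hp₂⟩
    have h3 := h₁.branchSet_symmetricCover hO₁ hs₁ p hp₁
    rw [h₂.branchSet_symmetricCover hO₂ hs₂ p hp₂, P1.ofComplex_inj] at h3
    exact hab h3.symm
  · change Set.encard _ = _
    rw [h₁.G_symmetricCover hO₁ hs₁, h₂.G_symmetricCover hO₂ hs₂, Set.inter_self]
    have hinj : ∀ {γ γ' : PGL(2, ℂ)} (p : P1), γ • p ≠ γ' • p → γ ≠ γ' := by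
      rintro γ γ' p hp rfl; exact hp rfl
    have hone : ∀ c : ℂ, mob (-1) 0 0 1 (by norm_num) • P1.ofComplex c = P1.ofComplex (-c) := by
      intro c; rw [mob_smul_ofComplex _ (by norm_num)]; congr 1; ring
    have htwo : ∀ c : ℂ, c ≠ 0 →
        mob 0 1 1 0 (by norm_num) • P1.ofComplex c = P1.ofComplex (1 / c) := by
      intro c hc; rw [mob_smul_ofComplex _ (by simpa using hc)]; congr 1; ring
    have hthree : ∀ c : ℂ, c ≠ 0 →
        mob 0 (-1) 1 0 (by norm_num) • P1.ofComplex c = P1.ofComplex (-1 / c) := by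
      intro c hc; rw [mob_smul_ofComplex _ (by simpa using hc)]; congr 1; ring
    have hp : ∀ {γ γ' : PGL(2, ℂ)}, γ • P1.ofComplex 2 ≠ γ' • P1.ofComplex 2 → γ ≠ γ' :=
      hinj (P1.ofComplex 2)
    rw [Set.encard_insert_of_notMem, Set.encard_insert_of_notMem, Set.encard_pair]
    · norm_num
    · apply hp
      rw [htwo _ two_ne_zero, hthree _ two_ne_zero, Ne, P1.ofComplex_inj]; norm_num
    · rintro (h | h)
      · refine hp ?_ h
        rw [hone, htwo _ two_ne_zero, Ne, P1.ofComplex_inj]; norm_num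
      · refine hp ?_ h
        rw [hone, hthree _ two_ne_zero, Ne, P1.ofComplex_inj]; norm_num
    · rintro (h | h | h)
      · refine hp ?_ h
        rw [hone, one_smul, Ne, P1.ofComplex_inj]; norm_num
      · refine hp ?_ h
        rw [one_smul, htwo _ two_ne_zero, Ne, P1.ofComplex_inj]; norm_num
      · refine hp ?_ h
        rw [one_smul, hthree _ two_ne_zero, Ne, P1.ofComplex_inj]; norm_num

/-- The point `2 P + T`, where `T` is the point of order two with coordinate `a`. -/
theorem IsHyper.exists_two_nsmul_add (h : IsHyper x y (cubic 0 1 a)) (hO : O.ord x < 0)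
    (hs : IsSymmetrizer a ℓ m) (P : Place K) :
    ∃ Q : Place K, (IsOfFinAddOrder (diffClass Q O) ↔ IsOfFinAddOrder (diffClass P O)) ∧
      value x Q = fourfold (mob m (m * ℓ) 1 (-ℓ)
        (det_symmetrize_ne_zero hs.ne_zero hs.ne_zero') • value x P) := by
  have h' : IsHyper x y (cubic a 0 1) := h.rotate.rotate
  have hodd := odd_natDegree_cubic 0 1 a
  have hdeg := (natDegree_cubic 0 1 a).ge
  have ha0 : a ≠ 0 := h.cubic_distinct.2.symm
  obtain ⟨T, hT⟩ := h.exists_at (c := a) (d := 0) (by simp)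
  have h2T := (h.two_nsmul_diffClass_eq_zero_iff hodd hdeg hO T).2 (Or.inr ⟨a, by simp, hT⟩)
  have hfinT : IsOfFinAddOrder (diffClass T O) :=
    isOfFinAddOrder_iff_nsmul_eq_zero.2 ⟨2, by norm_num, h2T⟩
  have htwo : ∀ g : ClassGroup K, IsOfFinAddOrder (2 • g) → IsOfFinAddOrder g := by
    intro g hg
    rw [isOfFinAddOrder_iff_nsmul_eq_zero] at hg ⊢
    obtain ⟨n, hn, h0⟩ := hg
    exact ⟨n * 2, by omega, by rw [mul_nsmul', h0]⟩
  have hfin : ∀ Q : Place K, diffClass Q O = 2 • diffClass P O + diffClass T O →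
      (IsOfFinAddOrder (diffClass Q O) ↔ IsOfFinAddOrder (diffClass P O)) := by
    intro Q hQ
    rw [hQ]
    constructor
    · intro h1
      apply htwo
      have := h1.add hfinT.neg
      rwa [add_neg_cancel_right] at this
    · intro h1
      exact h1.nsmul.add hfinT
  -- If `2 P = 0` then `2 P + T = T`, and the new coordinate of `P` is a branch point, which
  -- `fourfold` sends to `a`.
  have hbranch : 2 • diffClass P O = 0 → ∃ Q : Place K,
      (IsOfFinAddOrder (diffClass Q O) ↔ IsOfFinAddOrder (diffClass P O)) ∧
      value x Q = fourfold (mob m (m * ℓ) 1 (-ℓ)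
        (det_symmetrize_ne_zero hs.ne_zero hs.ne_zero') • value x P) := by
    intro h2
    refine ⟨T, hfin T (by rw [h2, zero_add]), ?_⟩
    rw [value_eq_ofComplex hT.1]
    symm
    apply h.branchSet_symmetricCover hO hs
    exact ⟨P, h2, h.toFun_cover hO _ P⟩
  rcases h.exists_at_or_pole P with ⟨c, d, hP⟩ | hP
  swap
  · exact hbranch (by rw [h.pole_unique hodd hO hP]; simp)
  by_cases hd : d = 0
  · subst hd
    apply hbranch
    have := h.sq_eq_of_at hP
    exact (h.two_nsmul_diffClass_eq_zero_iff hodd hdeg hO P).2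
      (Or.inr ⟨c, by rw [← this]; norm_num, hP⟩)
  have hd2 := h.sq_eq_of_at hP
  rw [eval_cubic] at hd2
  obtain ⟨R, d', hR, hR2⟩ := h.double hO hP hd
  obtain ⟨Q, hQ, hQv⟩ := h'.exists_translate hO hT R
  refine ⟨Q, hfin Q (by rw [hQ, hR2]), ?_⟩
  rw [hQv, value_eq_ofComplex hR.1, value_eq_ofComplex hP.1]
  set D := (eval c (derivative (cubic 0 1 a)) / (2 * d)) ^ 2 + (0 + 1 + a) - 2 * c with hD
  have hder : (derivative (cubic 0 1 a)).eval c =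
      c * (c - 1) + c * (c - a) + (c - 1) * (c - a) := by
    simp [cubic]; ring
  -- With `D` the coordinate of `2 P`, that of `2 P + T` is `a + a (a - 1) / (D - a)`. It turns out
  -- to be the square of `ℓ (c² - 2c + a) / (c² - 2ac + a)`. The identities `hplus` and `hminus`
  -- below identify this quotient with `(1 - w²) / (1 + w²)` for the new coordinate `w` of `P`.
  have hDa : (D - a) * (4 * d ^ 2) = (c ^ 2 - 2 * a * c + a) ^ 2 := by
    rw [hD, hder, div_pow]
    field_simp
    rw [hd2]
    ring
  have hℓ := hs.ne_zero
  have hsq := hs.sq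
  have hplus : (c - ℓ) ^ 2 * (1 + ℓ) + (1 - ℓ) * (c + ℓ) ^ 2 = 2 * (c ^ 2 - 2 * a * c + a) := by
    rw [← hsq]; ring
  have hminus : (c - ℓ) ^ 2 * (1 + ℓ) - (1 - ℓ) * (c + ℓ) ^ 2 =
      2 * ℓ * (c ^ 2 - 2 * c + a) := by
    rw [← hsq]; ring
  by_cases hc : c = ℓ
  · subst hc
    rw [mob_smul_ofComplex_eq_infinity _ (by ring), fourfold_infinity]
    have hne : D ≠ a := by
      intro h0
      rw [h0, sub_self, zero_mul, ← hsq] at hDa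
      have h1 : c ^ 2 - 2 * c ^ 2 * c + c ^ 2 ≠ 0 := by
        rw [show c ^ 2 - 2 * c ^ 2 * c + c ^ 2 = 2 * c ^ 2 * (1 - c) by ring]
        exact mul_ne_zero (mul_ne_zero two_ne_zero (pow_ne_zero 2 hℓ)) hs.sub_ne_zero
      exact pow_ne_zero 2 h1 hDa.symm
    rw [transl_smul_ofComplex _ _ hne, P1.ofComplex_inj]
    have hne' := _root_.sub_ne_zero.2 hne
    have h3 : (D - a) * (1 - a) = a * (a - 1) := by
      apply mul_right_cancel₀ (mul_ne_zero (by norm_num : (4 : ℂ) ≠ 0) (pow_ne_zero 2 hd))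
      rw [show (D - a) * (1 - a) * (4 * d ^ 2) = (D - a) * (4 * d ^ 2) * (1 - a) by ring, hDa,
        hd2, ← hsq]
      ring
    field_simp
    linear_combination -h3
  · have hcℓ := _root_.sub_ne_zero.2 hc
    have hcℓ' : 1 * c + -ℓ ≠ 0 := by rwa [one_mul, ← sub_eq_add_neg]
    rw [mob_smul_ofComplex _ hcℓ']
    set w := (m * c + m * ℓ) / (1 * c + -ℓ) with hw
    have hw' : w * (c - ℓ) = m * (c + ℓ) := by
      rw [hw, show c - ℓ = 1 * c + -ℓ by ring, div_mul_cancel₀ _ hcℓ']; ring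
    have hw2 : w ^ 2 * (c - ℓ) ^ 2 * (1 + ℓ) = (1 - ℓ) * (c + ℓ) ^ 2 := by
      linear_combination (1 + ℓ) * (w * (c - ℓ) + m * (c + ℓ)) * hw' + (c + ℓ) ^ 2 * hs.rel
    have hfac := mul_ne_zero (pow_ne_zero 2 hcℓ) hs.add_ne_zero
    have hp : (1 + w ^ 2) * ((c - ℓ) ^ 2 * (1 + ℓ)) = 2 * (c ^ 2 - 2 * a * c + a) := by
      linear_combination hplus + hw2
    have hm : (1 - w ^ 2) * ((c - ℓ) ^ 2 * (1 + ℓ)) = 2 * ℓ * (c ^ 2 - 2 * c + a) := by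
      linear_combination hminus - hw2
    by_cases hDeq : D = a
    · have h0 : c ^ 2 - 2 * a * c + a = 0 := by
        rw [hDeq, sub_self, zero_mul] at hDa
        exact pow_eq_zero_iff two_ne_zero |>.1 hDa.symm
      rw [fourfold_ofComplex_eq_infinity, transl, hDeq, mob_smul_ofComplex_eq_infinity _ (by ring)]
      rw [h0, mul_zero] at hp
      exact (mul_eq_zero.1 hp).resolve_right hfac
    · have hne' := _root_.sub_ne_zero.2 hDeq
      have h0 : c ^ 2 - 2 * a * c + a ≠ 0 := by
        intro h0
        rw [h0, zero_pow two_ne_zero] at hDa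
        exact mul_ne_zero hne' (mul_ne_zero (by norm_num : (4 : ℂ) ≠ 0) (pow_ne_zero 2 hd)) hDa
      have hp0 : 1 + w ^ 2 ≠ 0 := by
        intro h1
        rw [h1, zero_mul] at hp
        exact mul_ne_zero two_ne_zero h0 hp.symm
      rw [fourfold_ofComplex hp0, transl_smul_ofComplex _ _ hDeq, P1.ofComplex_inj]
      have hquot : (1 - w ^ 2) / (1 + w ^ 2) =
          ℓ * (c ^ 2 - 2 * c + a) / (c ^ 2 - 2 * a * c + a) := by
        rw [div_eq_div_iff hp0 h0]
        apply mul_right_cancel₀ hfac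
        linear_combination (c ^ 2 - 2 * a * c + a) * hm - ℓ * (c ^ 2 - 2 * c + a) * hp
      have hDinv : 1 / (D - a) = 4 * d ^ 2 / (c ^ 2 - 2 * a * c + a) ^ 2 := by
        rw [div_eq_div_iff hne' (pow_ne_zero 2 h0), one_mul, ← hDa]; ring
      rw [hquot, div_eq_mul_one_div _ (D - a), hDinv, div_pow, mul_pow, hsq, eq_div_iff
        (pow_ne_zero 2 h0)]
      have hcancel := div_mul_cancel₀ (4 * d ^ 2) (pow_ne_zero 2 h0)
      generalize 4 * d ^ 2 / (c ^ 2 - 2 * a * c + a) ^ 2 = Y at hcancel ⊢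
      linear_combination a * (a - 1) * hcancel + 4 * a * (a - 1) * hd2

/-- `P` is torsion if and only if `2 P + T` is, and `fourfold` of the new coordinate of `P` is the
value of `x` at `2 P + T`. -/
theorem IsHyper.image_torsion_symmetricCover (h : IsHyper x y (cubic 0 1 a)) (hO : O.ord x < 0)
    (hs : IsSymmetrizer a ℓ m) :
    (h.symmetricCover hO hs).toFun '' (h.symmetricCover hO hs).torsion =
      fourfold ⁻¹' torsionValues x O := by
  have hodd := odd_natDegree_cubic 0 1 a
  refine (h.image_torsion_cover hO _).trans ?_
  set M := mob m (m * ℓ) 1 (-ℓ) (det_symmetrize_ne_zero hs.ne_zero hs.ne_zero') with hM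
  ext p
  obtain ⟨P, hP⟩ := h.value_surjective (M⁻¹ • p)
  have hp : p = M • value x P := by rw [hP, smul_inv_smul]
  obtain ⟨Q, hQ, hv⟩ := h.exists_two_nsmul_add hO hs P
  rw [hp, Set.mem_preimage, hM, ← hv, h.value_mem_torsionValues_iff hodd hO, hQ,
    ← h.value_mem_torsionValues_iff hodd hO]
  exact (MulAction.injective _).mem_set_image

theorem I_symmetricCover (h₁ : IsHyper x₁ y₁ (cubic 0 1 a)) (h₂ : IsHyper x₂ y₂ (cubic 0 1 b))
    (hO₁ : O₁.ord x₁ < 0) (hO₂ : O₂.ord x₂ < 0) (hs₁ : IsSymmetrizer a ℓ m)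
    (hs₂ : IsSymmetrizer b ℓ' m') :
    EllipticDoubleCover.I (h₁.symmetricCover hO₁ hs₁) (h₂.symmetricCover hO₂ hs₂) =
      fourfold ⁻¹' (torsionValues x₁ O₁ ∩ torsionValues x₂ O₂) := by
  rw [EllipticDoubleCover.I, h₁.image_torsion_symmetricCover, h₂.image_torsion_symmetricCover,
    Set.preimage_inter]

end Symmetric

end Legendre

end

/-! ### Curves of genus two as fibre products of two Legendre curves -/

section

variable {K : Type} [Field K] [Algebra ℂ K]

/-! ### Quadratic extensions -/

theorem algHom_ext_of_adjoin {s : Set K} (hs : IntermediateField.adjoin ℂ s = ⊤) {σ τ : K →ₐ[ℂ] K}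
    (h : ∀ a ∈ s, σ a = τ a) (a : K) : σ a = τ a := by
  have ha : a ∈ IntermediateField.adjoin ℂ s := by rw [hs]; trivial
  induction ha using IntermediateField.adjoin_induction with
  | mem z hz => exact h z hz
  | algebraMap c => rw [σ.commutes, τ.commutes]
  | add a b _ _ ha hb => rw [map_add, map_add, ha, hb]
  | inv a _ ha => rw [map_inv₀, map_inv₀, ha]
  | mul a b _ _ ha hb => rw [map_mul, map_mul, ha, hb]

theorem mem_of_algebraMap_eq {L : IntermediateField ℂ K} {z : L} {w : K}
    (h : algebraMap L K z = w) : w ∈ L := h ▸ z.2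

theorem finrank_eq_two_of_sq {F : Type} [Field F] [Algebra F K] {y : K} {d : F}
    (hgen : IntermediateField.adjoin F {y} = ⊤) (hsq : y ^ 2 = algebraMap F K d)
    (hy : ∀ a : F, algebraMap F K a ≠ y) : Module.finrank F K = 2 := by
  have hmon : (X ^ 2 - C d).Monic := monic_X_pow_sub_C _ two_ne_zero
  have hroot : aeval y (X ^ 2 - C d) = 0 := by
    rw [map_sub, map_pow, aeval_X, aeval_C, hsq, sub_self]
  have hint : IsIntegral F y := ⟨_, hmon, hroot⟩
  have h1 := IntermediateField.adjoin.finrank hint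
  rw [hgen, IntermediateField.finrank_top'] at h1
  rw [h1]
  apply le_antisymm
  · have := natDegree_le_natDegree (minpoly.min _ y hmon hroot)
    rwa [natDegree_X_pow_sub_C] at this
  · rw [minpoly.two_le_natDegree_iff hint]
    rintro ⟨a, ha⟩
    exact hy a ha

theorem IsHyper.of_adjoin {t y : K} {f : ℂ[X]} (ht : Transcendental ℂ t) (hy : y ^ 2 = aeval t f)
    (hf : Squarefree f) (hdeg : f.natDegree ≠ 0) {L : IntermediateField ℂ K}
    (hL : L = IntermediateField.adjoin ℂ {t, y}) (htL : t ∈ L) (hyL : y ∈ L) :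
    IsHyper (⟨t, htL⟩ : L) (⟨y, hyL⟩ : L) f where
  trans := by
    rw [← transcendental_algebraMap_iff (FaithfulSMul.algebraMap_injective _ K)]
    exact ht
  gen := by
    apply IntermediateField.lift_injective
    rw [IntermediateField.lift_adjoin, IntermediateField.lift_top, Set.image_pair]
    exact hL.symm
  sq := by
    apply (algebraMap L K).injective
    rw [← aeval_algebraMap_apply]
    exact hy
  sqf := hf
  deg := hdeg

theorem Place.LiesOver.atLeast_one_iff {F : Type} [Field F] [Algebra ℂ F] [Algebra F K]
    {P : Place K} {Q : Place F} {e : ℤ} (h : P.LiesOver Q e) (he : e = 1 ∨ e = 2) (a : F) :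
    P.AtLeast 1 (algebraMap F K a) ↔ Q.AtLeast 1 a := by
  by_cases ha : a = 0
  · subst ha
    rw [map_zero]
    exact iff_of_true (Place.atLeast_zero_fun 1) (Place.atLeast_zero_fun 1)
  · rw [Place.atLeast_iff ((_root_.map_ne_zero _).2 ha), Place.atLeast_iff ha, h a]
    rcases he with rfl | rfl <;> omega

theorem Place.LiesOver.value_eq {F : Type} [Field F] [Algebra ℂ F] [Algebra F K]
    [IsScalarTower ℂ F K] {P : Place K} {Q : Place F} {e : ℤ} (h : P.LiesOver Q e)
    (he : e = 1 ∨ e = 2) (a : F) : value (algebraMap F K a) P = value a Q := by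
  have hiff : ∀ c : ℂ, P.AtLeast 1 (algebraMap F K a - algebraMap ℂ K c) ↔
      Q.AtLeast 1 (a - algebraMap ℂ F c) := by
    intro c
    rw [IsScalarTower.algebraMap_apply ℂ F K, ← map_sub, h.atLeast_one_iff he]
  by_cases hQ : ∃ c : ℂ, Q.AtLeast 1 (a - algebraMap ℂ F c)
  · obtain ⟨c, hc⟩ := hQ
    rw [value_eq_ofComplex hc, value_eq_ofComplex ((hiff c).2 hc)]
  · rw [value, value, dif_neg, dif_neg]
    · rintro ⟨c, hc⟩; exact hQ ⟨c, Place.atLeast_one_iff.2 hc⟩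
    · rintro ⟨c, hc⟩; exact hQ ⟨c, (hiff c).1 (Place.atLeast_one_iff.2 hc)⟩

theorem IsRational.diffClass_eq_zero {x : K} (h : IsRational x) (P Q : Place K) :
    diffClass P Q = 0 := by
  obtain ⟨O, hO⟩ := h.exists_place_infinity
  have hx : x ≠ 0 := by simpa using ne_const_of_transcendental h.trans 0
  have hval : ∀ R : Place K, R = O ∨ ∃ c, R.AtLeast 1 (x - algebraMap ℂ K c) := by
    intro R
    by_cases hR : R.ord x < 0
    · exact Or.inl (h.place_infinity_unique hR hO)
    · exact Or.inr (h.isCurve.exists_value R ((Place.atLeast_iff hx).2 (by omega)))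
  have key : ∀ P : Place K, diffClass P O = 0 := by
    intro P
    rcases hval P with rfl | ⟨c, hP⟩
    · simp
    · have hne := sub_ne_zero.2 (ne_const_of_transcendental h.trans c)
      rw [← one_smul ℕ (diffClass P O), nsmul_diffClass_eq_zero_iff]
      refine ⟨x - algebraMap ℂ K c, hne, fun R => ?_⟩
      rcases hval R with rfl | ⟨c', hR⟩
      · rw [Place.ord_sub_of_pole hO, h.ord_eq_neg_one hO, delta_self,
          delta_of_ne (Place.ne_of_pole hP hO).symm]
        norm_num
      · rw [delta_of_ne (Place.ne_of_pole hR hO)]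
        by_cases hcc : c' = c
        · subst hcc
          rw [h.ord_eq_one hR, h.place_unique hP hR, delta_self]; norm_num
        · rw [Place.ord_sub_of_value hR hcc, delta_of_ne]
          · norm_num
          · rintro rfl; exact hcc (Place.value_unique hR hP)
  rw [← diffClass_add_diffClass P O Q, key, ← neg_diffClass Q O, key]; simp

/-- The sum of a point and its hyperelliptic conjugate does not depend on the point, up to
torsion. -/
theorem IsHyper.isOfFinAddOrder_add_conj {x y : K} {f : ℂ[X]} (h : IsHyper x y f)
    (P P₀ : Place K) :
    IsOfFinAddOrder (diffClass P P₀ + diffClass (P.conj h.conj) (P₀.conj h.conj)) := by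
  obtain ⟨Q, e, he, hQ⟩ := h.isConj.exists_liesOver P
  obtain ⟨Q₀, e₀, he₀, hQ₀⟩ := h.isConj.exists_liesOver P₀
  refine h.isConj.isOfFinAddOrder_pull h.isCurve he he₀ hQ hQ₀ ?_
  rw [(isRational_gen h.trans).diffClass_eq_zero]
  exact IsOfFinAddOrder.zero

theorem IsHyper.isRamifiedAt_iff {x y : K} {f : ℂ[X]} (h : IsHyper x y f) (P : Place K) :
    IsRamifiedAt x P ↔ P.conj h.conj = P := by
  rcases h.exists_value_or_pole P with ⟨c, hc⟩ | hP
  · have hx0 : x ≠ 0 := by simpa using ne_const_of_transcendental h.trans 0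
    have hx := (Place.atLeast_zero_of_value hc).le_ord hx0
    have h1 : IsRamifiedAt x P ↔ 2 ≤ P.ord (x - algebraMap ℂ K c) := by
      constructor
      · rintro (⟨c', hc'⟩ | h1)
        · have hne := sub_ne_zero.2 (ne_const_of_transcendental h.trans c')
          rwa [Place.value_unique hc ((Place.atLeast_iff hne).2 (by omega))]
        · omega
      · exact fun h1 => Or.inl ⟨c, h1⟩
    rw [h1]
    by_cases hb : f.eval c = 0
    · obtain ⟨h2, -, h3⟩ := h.ord_of_branch hc hb
      exact iff_of_true h2.ge h3
    · obtain ⟨h2, -, h3⟩ := h.ord_of_not_branch hc hb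
      exact iff_of_false (by omega) h3
  · have h1 : IsRamifiedAt x P ↔ P.ord x ≤ -2 := by
      constructor
      · rintro (⟨c', hc'⟩ | h1)
        · rw [Place.ord_sub_of_pole hP] at hc'; omega
        · exact h1
      · exact Or.inr
    rw [h1]
    rcases Nat.even_or_odd' f.natDegree with ⟨d, hd | hd⟩
    · obtain ⟨h2, -, h3⟩ := h.ord_of_pole_even hP hd
      exact iff_of_false (by omega) h3
    · obtain ⟨h2, -, h3⟩ := h.ord_of_pole_odd hP ⟨d, hd⟩
      exact iff_of_true h2.le h3

/-! ### Pairs of elliptic curves and curves of genus two -/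

/-- The field `K` is the compositum of the function fields of the curves `y₁² = t (t - 1) (t - a)`
and `y₂² = t (t - 1) (t - b)`. -/
structure IsBiquadratic (t y₁ y₂ : K) (a b : ℂ) : Prop where
  trans : Transcendental ℂ t
  gen : IntermediateField.adjoin ℂ {t, y₁, y₂} = ⊤
  sq₁ : y₁ ^ 2 = aeval t (cubic 0 1 a)
  sq₂ : y₂ ^ 2 = aeval t (cubic 0 1 b)
  ne : a ≠ b
  a_ne_zero : a ≠ 0
  a_ne_one : a ≠ 1
  b_ne_zero : b ≠ 0
  b_ne_one : b ≠ 1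

/-- The polynomial that defines the curve of genus two. -/
def sextic (a b : ℂ) : ℂ[X] :=
  C (b - a) * ((C b - C a * X ^ 2) * ((C (b - 1) - C (a - 1) * X ^ 2) * (1 - X ^ 2)))

/-- With `η = y₂ / y₁` one has `η² = (t - b) / (t - a)`, so the roots `±r`, `±s`, `±1` are the
values of `η` over `t = 0, 1, ∞`. -/
theorem exists_sextic_eq {a b : ℂ} (ha : a ≠ 0) (ha' : a ≠ 1) : ∃ r s : ℂ, r ^ 2 = b / a ∧
    s ^ 2 = (b - 1) / (a - 1) ∧ sextic a b = C (-(b - a) * a * (a - 1)) *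
      ((X - C r) * ((X - C (-r)) * ((X - C s) * ((X - C (-s)) * ((X - C 1) * (X - C (-1))))))) := by
  have ha1 := sub_ne_zero.2 ha'
  obtain ⟨r, hr⟩ := IsAlgClosed.exists_pow_nat_eq (b / a) (n := 2) (by norm_num)
  obtain ⟨s, hs⟩ := IsAlgClosed.exists_pow_nat_eq ((b - 1) / (a - 1)) (n := 2) (by norm_num)
  refine ⟨r, s, hr, hs, ?_⟩
  have hr' : b = a * r ^ 2 := by rw [hr]; field_simp
  have hs' : b - 1 = (a - 1) * s ^ 2 := by rw [hs]; field_simp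
  rw [sextic, hs']
  conv_lhs => enter [2, 1, 1]; rw [hr']
  simp only [map_mul, map_neg, map_pow, map_one]
  ring

theorem squarefree_sextic {a b : ℂ} (hab : a ≠ b) (ha : a ≠ 0) (ha' : a ≠ 1) (hb : b ≠ 0)
    (hb' : b ≠ 1) : Squarefree (sextic a b) ∧ (sextic a b).natDegree = 6 := by
  have ha1 := sub_ne_zero.2 ha'
  have hb1 := sub_ne_zero.2 hb'
  obtain ⟨r, s, hr, hs, heq⟩ := exists_sextic_eq (b := b) ha ha'
  have hk : -(b - a) * a * (a - 1) ≠ 0 :=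
    mul_ne_zero (mul_ne_zero (neg_ne_zero.2 (sub_ne_zero.2 hab.symm)) ha) ha1
  have hr0 : r ≠ 0 := by
    rintro rfl; rw [zero_pow two_ne_zero] at hr; exact div_ne_zero hb ha hr.symm
  have hs0 : s ≠ 0 := by
    rintro rfl; rw [zero_pow two_ne_zero] at hs; exact div_ne_zero hb1 ha1 hs.symm
  have hr1 : r ^ 2 ≠ 1 := by
    rw [hr, Ne, div_eq_one_iff_eq ha]; exact hab.symm
  have hs1 : s ^ 2 ≠ 1 := by
    rw [hs, Ne, div_eq_one_iff_eq ha1]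
    intro h0; apply hab; linear_combination -h0
  have hrs : r ^ 2 ≠ s ^ 2 := by
    rw [hr, hs, Ne, div_eq_div_iff ha ha1]
    intro h0; apply hab; linear_combination h0
  have hsq : ∀ {u v : ℂ}, u ^ 2 ≠ v ^ 2 → u - v ≠ 0 ∧ u + v ≠ 0 := by
    intro u v huv
    constructor
    · intro h0; exact huv (by linear_combination (u + v) * h0)
    · intro h0; exact huv (by linear_combination (u - v) * h0)
  have h1 := hsq hrs
  have h2 : r - 1 ≠ 0 ∧ r + 1 ≠ 0 := hsq (by rwa [one_pow])
  have h3 : s - 1 ≠ 0 ∧ s + 1 ≠ 0 := hsq (by rwa [one_pow])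
  have hrr : r + r ≠ 0 := by rw [← two_mul]; exact mul_ne_zero two_ne_zero hr0
  have hss : s + s ≠ 0 := by rw [← two_mul]; exact mul_ne_zero two_ne_zero hs0
  have h4 : -r - s ≠ 0 := by
    intro h0; exact h1.2 (by linear_combination -h0)
  have h5 : -r + s ≠ 0 := by
    intro h0; exact h1.1 (by linear_combination -h0)
  have h6 : -r - 1 ≠ 0 := by
    intro h0; exact h2.2 (by linear_combination -h0)
  have h7 : -r + 1 ≠ 0 := by
    intro h0; exact h2.1 (by linear_combination -h0)
  have h8 : -s - 1 ≠ 0 := by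
    intro h0; exact h3.2 (by linear_combination -h0)
  have h9 : -s + 1 ≠ 0 := by
    intro h0; exact h3.1 (by linear_combination -h0)
  rw [heq]
  constructor
  · have hu : IsUnit (C (-(b - a) * a * (a - 1))) := isUnit_C.2 (isUnit_iff_ne_zero.2 hk)
    rw [squarefree_mul_iff]
    refine ⟨hu.isRelPrime_left, hu.squarefree, ?_⟩
    refine squarefree_X_sub_C_mul (squarefree_X_sub_C_mul (squarefree_X_sub_C_mul
      (squarefree_X_sub_C_mul (squarefree_X_sub_C_mul (irreducible_X_sub_C _).squarefree ?_) ?_)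
      ?_) ?_) ?_
    all_goals simp only [eval_mul, eval_sub, eval_X, eval_C, sub_neg_eq_add]
    · norm_num
    · exact mul_ne_zero h8 h9
    · exact mul_ne_zero hss (mul_ne_zero h3.1 h3.2)
    · exact mul_ne_zero h4 (mul_ne_zero h5 (mul_ne_zero h6 h7))
    · exact mul_ne_zero hrr (mul_ne_zero h1.1 (mul_ne_zero h1.2 (mul_ne_zero h2.1 h2.2)))
  · rw [natDegree_C_mul hk]
    have hX := fun c : ℂ => X_sub_C_ne_zero c
    rw [natDegree_mul (hX _) (mul_ne_zero (hX _) (mul_ne_zero (hX _) (mul_ne_zero (hX _)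
        (mul_ne_zero (hX _) (hX _))))),
      natDegree_mul (hX _) (mul_ne_zero (hX _) (mul_ne_zero (hX _) (mul_ne_zero (hX _) (hX _)))),
      natDegree_mul (hX _) (mul_ne_zero (hX _) (mul_ne_zero (hX _) (hX _))),
      natDegree_mul (hX _) (mul_ne_zero (hX _) (hX _)), natDegree_mul (hX _) (hX _)]
    simp only [natDegree_X_sub_C]

namespace IsBiquadratic

variable {t y₁ y₂ : K} {a b : ℂ}

theorem swap (h : IsBiquadratic t y₁ y₂ a b) : IsBiquadratic t y₂ y₁ b a where
  trans := h.trans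
  gen := by rw [Set.pair_comm y₂ y₁]; exact h.gen
  sq₁ := h.sq₂
  sq₂ := h.sq₁
  ne := h.ne.symm
  a_ne_zero := h.b_ne_zero
  a_ne_one := h.b_ne_one
  b_ne_zero := h.a_ne_zero
  b_ne_one := h.a_ne_one

theorem sub_ne_zero (h : IsBiquadratic t y₁ y₂ a b) (c : ℂ) : t - algebraMap ℂ K c ≠ 0 :=
  _root_.sub_ne_zero.2 (ne_const_of_transcendental h.trans c)

theorem sq₁' (h : IsBiquadratic t y₁ y₂ a b) :
    y₁ ^ 2 = t * (t - 1) * (t - algebraMap ℂ K a) := by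
  rw [h.sq₁]; simp [cubic]

theorem sq₂' (h : IsBiquadratic t y₁ y₂ a b) :
    y₂ ^ 2 = t * (t - 1) * (t - algebraMap ℂ K b) := h.swap.sq₁'

theorem t_ne_zero (h : IsBiquadratic t y₁ y₂ a b) : t ≠ 0 := by simpa using h.sub_ne_zero 0

theorem t_sub_one_ne_zero (h : IsBiquadratic t y₁ y₂ a b) : t - 1 ≠ 0 := by
  simpa using h.sub_ne_zero 1

theorem y₁_ne_zero (h : IsBiquadratic t y₁ y₂ a b) : y₁ ≠ 0 := by
  intro h0
  have := h.sq₁'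
  rw [h0, zero_pow two_ne_zero] at this
  exact mul_ne_zero (mul_ne_zero h.t_ne_zero h.t_sub_one_ne_zero) (h.sub_ne_zero a) this.symm

theorem sq_quot (h : IsBiquadratic t y₁ y₂ a b) :
    (y₂ / y₁) ^ 2 = (t - algebraMap ℂ K b) / (t - algebraMap ℂ K a) := by
  have h1 := h.t_ne_zero
  have h2 := h.t_sub_one_ne_zero
  rw [div_pow, h.sq₁', h.sq₂', mul_div_mul_left _ _ (mul_ne_zero h1 h2)]

theorem one_sub_sq (h : IsBiquadratic t y₁ y₂ a b) :
    1 - (y₂ / y₁) ^ 2 = algebraMap ℂ K (b - a) / (t - algebraMap ℂ K a) := by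
  have := h.sub_ne_zero a
  rw [h.sq_quot, map_sub, eq_div_iff this, sub_mul, div_mul_cancel₀ _ this]
  ring

theorem one_sub_sq_ne_zero (h : IsBiquadratic t y₁ y₂ a b) : 1 - (y₂ / y₁) ^ 2 ≠ 0 := by
  rw [h.one_sub_sq]
  exact div_ne_zero ((_root_.map_ne_zero _).2 (_root_.sub_ne_zero.2 h.ne.symm)) (h.sub_ne_zero a)

theorem t_eq (h : IsBiquadratic t y₁ y₂ a b) :
    t * (1 - (y₂ / y₁) ^ 2) = algebraMap ℂ K b - algebraMap ℂ K a * (y₂ / y₁) ^ 2 := by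
  have h1 := h.sub_ne_zero a
  have h2 := (eq_div_iff h1).1 h.sq_quot
  linear_combination -h2

/-- The compositum is the function field of a curve of genus two. -/
theorem isHyper (h : IsBiquadratic t y₁ y₂ a b) :
    IsHyper (y₂ / y₁) (y₁ * (1 - (y₂ / y₁) ^ 2) ^ 2) (sextic a b) := by
  obtain ⟨hsqf, hdeg⟩ := squarefree_sextic h.ne h.a_ne_zero h.a_ne_one h.b_ne_zero h.b_ne_one
  have hone := h.one_sub_sq_ne_zero
  have hteq := h.t_eq
  have hy₁ := h.y₁_ne_zero
  have hy₂ : y₂ = y₂ / y₁ * y₁ := by field_simp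
  have hsq := h.sq₁'
  -- `t` is a Möbius function of `η²`, so `η` and `y₁` generate the field. The factor `(1 - η²)²`
  -- clears the denominators of `y₁² = t (t - 1)(t - a)`.
  set η := y₂ / y₁ with hη
  have ht : t = (algebraMap ℂ K b - algebraMap ℂ K a * η ^ 2) / (1 - η ^ 2) := by
    rw [eq_div_iff hone, hteq]
  refine ⟨?_, ?_, ?_, hsqf, by rw [hdeg]; norm_num⟩
  · intro halg
    apply h.trans
    rw [ht, div_eq_mul_inv]
    exact ((isAlgebraic_algebraMap b).sub ((isAlgebraic_algebraMap a).mul (halg.pow 2))).mul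
      ((isAlgebraic_one.sub (halg.pow 2)).inv)
  · rw [eq_top_iff, ← h.gen, IntermediateField.adjoin_le_iff]
    set L := IntermediateField.adjoin ℂ {η, y₁ * (1 - η ^ 2) ^ 2} with hL
    have hηL : η ∈ L := IntermediateField.subset_adjoin _ _ (by simp)
    have hYL : y₁ * (1 - η ^ 2) ^ 2 ∈ L := IntermediateField.subset_adjoin _ _ (by simp)
    have hone' : 1 - η ^ 2 ∈ L := sub_mem (one_mem _) (pow_mem hηL 2)
    have hy₁L : y₁ ∈ L := by
      have := div_mem hYL (pow_mem hone' 2)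
      rwa [mul_div_cancel_right₀ _ (pow_ne_zero 2 hone)] at this
    rintro z (rfl | rfl | rfl)
    · rw [ht]
      exact div_mem (sub_mem (L.algebraMap_mem b)
        (mul_mem (L.algebraMap_mem a) (pow_mem hηL 2))) hone'
    · exact hy₁L
    · rw [hy₂]; exact mul_mem hηL hy₁L
  · simp only [sextic, map_mul, map_sub, map_pow, aeval_C, aeval_X, map_one]
    rw [mul_pow, hsq]
    generalize algebraMap ℂ K a = A at hteq ⊢
    generalize algebraMap ℂ K b = B at hteq ⊢
    have e1 : (t - 1) * (1 - η ^ 2) = B - 1 - (A - 1) * η ^ 2 := by linear_combination hteq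
    have e2 : (t - A) * (1 - η ^ 2) = B - A := by linear_combination hteq
    calc t * (t - 1) * (t - A) * ((1 - η ^ 2) ^ 2) ^ 2 = (t * (1 - η ^ 2)) *
          ((t - 1) * (1 - η ^ 2)) * ((t - A) * (1 - η ^ 2)) * (1 - η ^ 2) := by ring
      _ = _ := by rw [hteq, e1, e2]; ring

theorem isCurve (h : IsBiquadratic t y₁ y₂ a b) : IsCurve K := h.isHyper.isCurve

theorem genus_eq (h : IsBiquadratic t y₁ y₂ a b) : genus K = 2 := by
  rw [h.isHyper.genus_eq,
    (squarefree_sextic h.ne h.a_ne_zero h.a_ne_one h.b_ne_zero h.b_ne_one).2]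

/-- The function field of the first elliptic curve. -/
def field₁ (_h : IsBiquadratic t y₁ y₂ a b) : IntermediateField ℂ K :=
  IntermediateField.adjoin ℂ {t, y₁}

/-- The function `t` on the first elliptic curve. -/
def t₁ (h : IsBiquadratic t y₁ y₂ a b) : h.field₁ :=
  ⟨t, IntermediateField.subset_adjoin _ _ (by simp)⟩

/-- The function `y₁` on the first elliptic curve. -/
def s₁ (h : IsBiquadratic t y₁ y₂ a b) : h.field₁ :=
  ⟨y₁, IntermediateField.subset_adjoin _ _ (by simp)⟩

theorem isHyper₁ (h : IsBiquadratic t y₁ y₂ a b) : IsHyper h.t₁ h.s₁ (cubic 0 1 a) :=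
  IsHyper.of_adjoin h.trans h.sq₁
    (squarefree_cubic zero_ne_one h.a_ne_zero.symm h.a_ne_one.symm)
    (by rw [natDegree_cubic]; norm_num) rfl _ _

/-- Otherwise `K` would be the function field of the first elliptic curve, of genus 1, while it has
genus 2. -/
theorem y₂_notMem (h : IsBiquadratic t y₁ y₂ a b) : y₂ ∉ h.field₁ := by
  intro hy
  have hgen : IntermediateField.adjoin ℂ {t, y₁} = ⊤ := by
    rw [eq_top_iff, ← h.gen, IntermediateField.adjoin_le_iff]
    rintro z (rfl | rfl | rfl)
    · exact h.t₁.2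
    · exact h.s₁.2
    · exact hy
  have h1 : IsHyper t y₁ (cubic 0 1 a) :=
    ⟨h.trans, hgen, h.sq₁, squarefree_cubic zero_ne_one h.a_ne_zero.symm h.a_ne_one.symm,
      by rw [natDegree_cubic]; norm_num⟩
  have h2 := h1.genus_eq
  rw [h.genus_eq, natDegree_cubic] at h2
  norm_num at h2

theorem finrank_eq (h : IsBiquadratic t y₁ y₂ a b) : Module.finrank h.field₁ K = 2 := by
  refine finrank_eq_two_of_sq (y := y₂) (d := aeval h.t₁ (cubic 0 1 b)) ?_ ?_ ?_
  · rw [eq_top_iff]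
    intro z _
    have hz : z ∈ IntermediateField.adjoin ℂ {t, y₁, y₂} := by rw [h.gen]; trivial
    induction hz using IntermediateField.adjoin_induction with
    | mem z hz =>
      rcases hz with hz | hz | hz
      · rw [hz]; exact IntermediateField.algebraMap_mem _ h.t₁
      · rw [hz]; exact IntermediateField.algebraMap_mem _ h.s₁
      · rw [hz]; exact IntermediateField.mem_adjoin_simple_self _ _
    | algebraMap c =>
      exact IntermediateField.algebraMap_mem _ (algebraMap ℂ h.field₁ c)
    | add a b _ _ ha hb => exact add_mem (ha trivial) (hb trivial)
    | inv a _ ha => exact inv_mem (ha trivial)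
    | mul a b _ _ ha hb => exact mul_mem (ha trivial) (hb trivial)
  · rw [← aeval_algebraMap_apply]; exact h.sq₂
  · intro z hz
    exact h.y₂_notMem (mem_of_algebraMap_eq hz)

theorem finite (h : IsBiquadratic t y₁ y₂ a b) : Module.Finite h.field₁ K :=
  Module.finite_of_finrank_pos (by rw [h.finrank_eq]; norm_num)

/-- The involution over the first elliptic curve. -/
def σ₁ (h : IsBiquadratic t y₁ y₂ a b) : K ≃ₐ[h.field₁] K := (exists_isConj h.finrank_eq).choose

theorem isConj₁ (h : IsBiquadratic t y₁ y₂ a b) : IsConj h.σ₁ :=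
  (exists_isConj h.finrank_eq).choose_spec

@[simp] theorem σ₁_t (h : IsBiquadratic t y₁ y₂ a b) : h.σ₁ t = t := h.σ₁.commutes h.t₁

@[simp] theorem σ₁_y₁ (h : IsBiquadratic t y₁ y₂ a b) : h.σ₁ y₁ = y₁ := h.σ₁.commutes h.s₁

theorem σ₁_const (h : IsBiquadratic t y₁ y₂ a b) (c : ℂ) :
    h.σ₁ (algebraMap ℂ K c) = algebraMap ℂ K c := (h.σ₁.restrictScalars ℂ).commutes c

@[simp] theorem σ₁_y₂ (h : IsBiquadratic t y₁ y₂ a b) : h.σ₁ y₂ = -y₂ := by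
  have h1 : (h.σ₁ y₂) ^ 2 = y₂ ^ 2 := by
    rw [← map_pow, h.sq₂', map_mul, map_mul, map_sub, map_sub, h.σ₁_t, h.σ₁_const, map_one]
  rcases sq_eq_sq_iff_eq_or_eq_neg.1 h1 with h2 | h2
  · obtain ⟨z, hz⟩ := h.isConj₁.fixed y₂ h2
    exact absurd (mem_of_algebraMap_eq hz) h.y₂_notMem
  · exact h2

theorem conj_t (h : IsBiquadratic t y₁ y₂ a b) : h.isHyper.conj t = t := by
  have h1 := congrArg h.isHyper.conj h.t_eq
  have h2 : h.isHyper.conj (y₂ / y₁) = y₂ / y₁ := h.isHyper.conj_x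
  rw [map_mul, map_sub, map_sub, map_mul, map_pow, h2, map_one, h.isHyper.conj_const,
    h.isHyper.conj_const, ← h.t_eq] at h1
  exact mul_right_cancel₀ h.one_sub_sq_ne_zero h1

theorem conj_y₁ (h : IsBiquadratic t y₁ y₂ a b) : h.isHyper.conj y₁ = -y₁ := by
  have h1 := h.isHyper.conj_y
  have h2 : h.isHyper.conj (y₂ / y₁) = y₂ / y₁ := h.isHyper.conj_x
  rw [map_mul, map_pow, map_sub, map_pow, h2, map_one, ← neg_mul] at h1
  exact mul_right_cancel₀ (pow_ne_zero 2 h.one_sub_sq_ne_zero) h1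

theorem conj_y₂ (h : IsBiquadratic t y₁ y₂ a b) : h.isHyper.conj y₂ = -y₂ := by
  have h2 : h.isHyper.conj (y₂ / y₁) = y₂ / y₁ := h.isHyper.conj_x
  have h3 : y₂ = y₂ / y₁ * y₁ := by have := h.y₁_ne_zero; field_simp
  calc h.isHyper.conj y₂ = h.isHyper.conj (y₂ / y₁ * y₁) := congrArg _ h3
    _ = -y₂ := by rw [map_mul, h2, h.conj_y₁, mul_neg, ← h3]

/-- The involutions of `K` over `ℂ(t)` are sign changes: `σ₁` negates `y₂`, the hyperelliptic one
negates both `y₁` and `y₂`, so their product negates only `y₁`. This relation lets a class on the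
genus two curve be split between the two elliptic curves. -/
theorem conj_σ₁ (h : IsBiquadratic t y₁ y₂ a b) (P : Place K) :
    (P.conj h.σ₁).conj h.isHyper.conj = P.conj h.swap.σ₁ := by
  have key := algHom_ext_of_adjoin h.gen
    (σ := ((h.isHyper.conj.restrictScalars ℂ).trans (h.σ₁.restrictScalars ℂ) : K →ₐ[ℂ] K))
    (τ := (h.swap.σ₁.restrictScalars ℂ : K →ₐ[ℂ] K)) (by
      rintro z (rfl | rfl | rfl)
      · change h.σ₁ (h.isHyper.conj z) = h.swap.σ₁ z
        rw [h.conj_t, h.σ₁_t, h.swap.σ₁_t]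
      · change h.σ₁ (h.isHyper.conj z) = h.swap.σ₁ z
        rw [h.conj_y₁, map_neg, h.σ₁_y₁, h.swap.σ₁_y₂]
      · change h.σ₁ (h.isHyper.conj z) = h.swap.σ₁ z
        rw [h.conj_y₂, map_neg, h.σ₁_y₂, h.swap.σ₁_y₁, neg_neg])
  refine Place.ext_ord fun f _ => ?_
  rw [Place.ord_conj, Place.ord_conj, Place.ord_conj]
  exact congrArg P.ord (key f)

end IsBiquadratic

end

/-! ### Torsion packets on the fibre product and their size -/

section

variable {K : Type} [Field K] [Algebra ℂ K]

theorem isOfFinAddOrder_of_two_nsmul {G : Type*} [AddCommGroup G] {g : G}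
    (h : IsOfFinAddOrder (2 • g)) : IsOfFinAddOrder g := by
  rw [isOfFinAddOrder_iff_nsmul_eq_zero] at h ⊢
  obtain ⟨n, hn, h0⟩ := h
  exact ⟨n * 2, by omega, by rw [mul_nsmul', h0]⟩

/-- Lets finiteness pass from the set of common torsion values to its preimage, as required for the
comparison of finite packets with finite intersections. -/
theorem finite_fibre_fourfold (p : P1) : (fourfold ⁻¹' {p}).Finite := by
  have key : ∀ q : ℂ[X], q ≠ 0 →
      (∀ w : ℂ, fourfold (P1.ofComplex w) = p → q.IsRoot w) → (fourfold ⁻¹' {p}).Finite := by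
    intro q hq hw
    refine (((finite_setOfPred_isRoot hq).image P1.ofComplex).insert P1.infinity).subset fun r hr => ?_
    rcases P1.cases r with ⟨w, rfl⟩ | rfl
    · exact Or.inr ⟨w, hw w hr, rfl⟩
    · exact Or.inl rfl
  rcases P1.cases p with ⟨c, rfl⟩ | rfl
  · refine key ((1 - X ^ 2) ^ 2 - C c * (1 + X ^ 2) ^ 2) (fun h0 => ?_) fun w hw => ?_
    -- At `w = i` the second term vanishes and the first does not, whatever `c` is.
    · have := congrArg (eval Complex.I) h0
      norm_num at this
    · by_cases h1 : 1 + w ^ 2 = 0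
      · rw [fourfold_ofComplex_eq_infinity h1] at hw
        simp at hw
      · rw [fourfold_ofComplex h1, P1.ofComplex_inj] at hw
        simp only [IsRoot.def, eval_sub, eval_pow, eval_one, eval_X, eval_mul, eval_C, eval_add]
        rw [← hw]
        field_simp
        ring
  · refine key (1 + X ^ 2) (fun h0 => ?_) fun w hw => ?_
    · have := congrArg (eval 0) h0
      norm_num at this
    · by_contra h1
      simp only [IsRoot.def, eval_add, eval_one, eval_pow, eval_X] at h1
      rw [fourfold_ofComplex h1] at hw
      simp at hw

namespace IsBiquadratic

variable {t y₁ y₂ : K} {a b : ℂ}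

/-- The image of a point on the first elliptic curve. -/
def below₁ (h : IsBiquadratic t y₁ y₂ a b) (P : Place K) : Place h.field₁ :=
  (h.isConj₁.exists_liesOver P).choose

theorem liesOver_below₁ (h : IsBiquadratic t y₁ y₂ a b) (P : Place K) :
    ∃ e : ℤ, (e = 1 ∨ e = 2) ∧ P.LiesOver (h.below₁ P) e :=
  (h.isConj₁.exists_liesOver P).choose_spec

theorem value_below₁ (h : IsBiquadratic t y₁ y₂ a b) (P : Place K) :
    value h.t₁ (h.below₁ P) = value t P := by
  obtain ⟨e, he, hl⟩ := h.liesOver_below₁ P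
  exact (hl.value_eq he h.t₁).symm

theorem ord_below₁_neg (h : IsBiquadratic t y₁ y₂ a b) {P : Place K} (hP : P.ord t < 0) :
    (h.below₁ P).ord h.t₁ < 0 := by
  obtain ⟨e, he, hl⟩ := h.liesOver_below₁ P
  have h1 : P.ord t = e * (h.below₁ P).ord h.t₁ := hl h.t₁
  rcases he with rfl | rfl <;> omega

theorem exists_value_eq (h : IsBiquadratic t y₁ y₂ a b) (p : P1) :
    ∃ P : Place K, value t P = p := by
  obtain ⟨Q, hQ⟩ := h.isHyper₁.value_surjective p
  obtain ⟨P, e, he, hP⟩ := h.isConj₁.exists_place_over h.finite Q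
  exact ⟨P, by rw [← hQ]; exact hP.value_eq he h.t₁⟩

theorem value_eq_infinity_iff (h : IsBiquadratic t y₁ y₂ a b) (P : Place K) :
    value t P = P1.infinity ↔ P.ord t < 0 := by
  refine ⟨fun h1 => ?_, value_eq_infinity⟩
  by_contra h2
  obtain ⟨c, hc⟩ := h.isCurve.exists_value P ((Place.atLeast_iff h.t_ne_zero).2 (by omega))
  rw [value_eq_ofComplex hc] at h1
  exact P1.ofComplex_ne_infinity c h1

theorem exists_pole (h : IsBiquadratic t y₁ y₂ a b) : ∃ P : Place K, P.ord t < 0 := by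
  obtain ⟨P, hP⟩ := h.exists_value_eq P1.infinity
  exact ⟨P, (h.value_eq_infinity_iff P).1 hP⟩

theorem value_conj_σ₁ (h : IsBiquadratic t y₁ y₂ a b) (P : Place K) :
    value t (P.conj h.σ₁) = value t P := by
  obtain ⟨e, he, hl⟩ := h.liesOver_below₁ P
  have h1 : value t (P.conj h.σ₁) = _ := (IsConj.liesOver_conj hl).value_eq he h.t₁
  rw [h1, h.value_below₁]

/-- The common torsion values of the two elliptic curves. -/
def common (h : IsBiquadratic t y₁ y₂ a b) (P₀ : Place K) : Set P1 :=
  torsionValues h.t₁ (h.below₁ P₀) ∩ torsionValues h.swap.t₁ (h.swap.below₁ P₀)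

theorem basePoints_subset_common (h : IsBiquadratic t y₁ y₂ a b) {P₀ : Place K}
    (hP₀ : P₀.ord t < 0) : basePoints ⊆ h.common P₀ :=
  Set.subset_inter (h.isHyper₁.basePoints_subset_torsionValues (h.ord_below₁_neg hP₀))
    (h.swap.isHyper₁.basePoints_subset_torsionValues (h.swap.ord_below₁_neg hP₀))

theorem value_mem_of_isOfFinAddOrder (h : IsBiquadratic t y₁ y₂ a b) {P₀ P : Place K}
    (hP : IsOfFinAddOrder (diffClass P P₀)) : value t P ∈ torsionValues h.t₁ (h.below₁ P₀) := by
  obtain ⟨e, he, hl⟩ := h.liesOver_below₁ P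
  obtain ⟨e₀, he₀, hl₀⟩ := h.liesOver_below₁ P₀
  exact ⟨h.below₁ P, h.isConj₁.isOfFinAddOrder_push h.finite h.isCurve he he₀ hl hl₀ hP,
    h.value_below₁ P⟩

theorem isOfFinAddOrder_add_conj_σ₁ (h : IsBiquadratic t y₁ y₂ a b) {P₀ P : Place K}
    (hP₀ : P₀.ord t < 0) (hP : value t P ∈ torsionValues h.t₁ (h.below₁ P₀)) :
    IsOfFinAddOrder (diffClass P P₀ + diffClass (P.conj h.σ₁) (P₀.conj h.σ₁)) := by
  rw [← h.value_below₁ P, h.isHyper₁.value_mem_torsionValues_iff (odd_natDegree_cubic _ _ _)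
    (h.ord_below₁_neg hP₀)] at hP
  obtain ⟨e, he, hl⟩ := h.liesOver_below₁ P
  obtain ⟨e₀, he₀, hl₀⟩ := h.liesOver_below₁ P₀
  exact h.isConj₁.isOfFinAddOrder_pull h.isCurve he he₀ hl hl₀ hP

theorem ord_quot_eq_zero (h : IsBiquadratic t y₁ y₂ a b) {P : Place K}
    (ha : value t P ≠ P1.ofComplex a) (hb : value t P ≠ P1.ofComplex b) :
    P.ord (y₂ / y₁) = 0 := by
  have h1 := congrArg P.ord h.sq_quot
  rw [P.ord_pow, P.ord_div (h.sub_ne_zero b) (h.sub_ne_zero a)] at h1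
  by_cases hP : P.ord t < 0
  · rw [Place.ord_sub_of_pole hP, Place.ord_sub_of_pole hP] at h1
    push_cast at h1; omega
  · obtain ⟨c, hc⟩ := h.isCurve.exists_value P ((Place.atLeast_iff h.t_ne_zero).2 (by omega))
    rw [value_eq_ofComplex hc, Ne, P1.ofComplex_inj] at ha hb
    rw [Place.ord_sub_of_value hc ha, Place.ord_sub_of_value hc hb] at h1
    push_cast at h1; omega

theorem y₂_ne_zero (h : IsBiquadratic t y₁ y₂ a b) : y₂ ≠ 0 := h.swap.y₁_ne_zero

/-- Away from `a` and `b`, and so also over `0`, `1`, `∞`, the function `y₂ / y₁` has a nonzero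
value at `P`, and `σ₁` negates it. -/
theorem conj_σ₁_ne (h : IsBiquadratic t y₁ y₂ a b) {P : Place K}
    (ha : value t P ≠ P1.ofComplex a) (hb : value t P ≠ P1.ofComplex b) : P.conj h.σ₁ ≠ P := by
  intro heq
  have hne : y₂ / y₁ ≠ 0 := div_ne_zero h.y₂_ne_zero h.y₁_ne_zero
  have h0 := h.ord_quot_eq_zero ha hb
  obtain ⟨v, hv⟩ := h.isCurve.exists_value P ((Place.atLeast_iff hne).2 h0.ge)
  have hv2 := hv
  rw [← heq, Place.atLeast_conj, map_sub, map_div₀, h.σ₁_y₁, h.σ₁_y₂, h.σ₁_const] at hv2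
  have h3 := P.value_unique hv (d := -v) (by convert hv2.neg using 1; rw [map_neg]; ring)
  have hv0 : v = 0 := by
    have : 2 * v = 0 := by linear_combination h3
    simpa using this
  rw [hv0, map_zero, sub_zero, Place.atLeast_iff hne] at hv
  omega

/-- A pole of `t` is a ramification point of the hyperelliptic double cover. -/
theorem conj_eq_of_pole (h : IsBiquadratic t y₁ y₂ a b) {P₀ : Place K} (hP₀ : P₀.ord t < 0) :
    P₀.conj h.isHyper.conj = P₀ := by
  have hne : y₂ / y₁ ≠ 0 := div_ne_zero h.y₂_ne_zero h.y₁_ne_zero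
  have h0 := h.ord_quot_eq_zero (P := P₀) (by rw [value_eq_infinity hP₀]; simp)
    (by rw [value_eq_infinity hP₀]; simp)
  obtain ⟨v, hv⟩ := h.isCurve.exists_value P₀ ((Place.atLeast_iff hne).2 h0.ge)
  -- `1 - (y₂ / y₁)² = (b - a) / (t - a)` vanishes at a pole of `t`, so `y₂ / y₁` has value `±1`
  -- there, a root of the sextic.
  have h1 := Place.atLeast_aeval_sub hv (1 - X ^ 2)
  have h2 : P₀.AtLeast 1 (1 - (y₂ / y₁) ^ 2) := by
    rw [Place.atLeast_iff h.one_sub_sq_ne_zero, h.one_sub_sq,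
      P₀.ord_div ((_root_.map_ne_zero _).2 (_root_.sub_ne_zero.2 h.ne.symm)) (h.sub_ne_zero a),
      P₀.ord_const, Place.ord_sub_of_pole hP₀]
    omega
  have hv2 := Place.value_unique h1 (d := 0) (by simpa using h2)
  simp only [eval_sub, eval_one, eval_pow, eval_X] at hv2
  refine (h.isHyper.ord_of_branch hv ?_).2.2
  simp [sextic, hv2]

/-- Write `D` for the class of `P - P₀` and `σ₂` for the involution over the second curve. If `t(P)`
is a torsion value on both curves, `D + σ₁ D` and `D + σ₂ D` are torsion, being pulled back. As `σ₂`
is `σ₁` followed by the hyperelliptic involution, `σ₁ D + σ₂ D` is torsion as well. Hence so is `2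
D`. The converse is push-forward. -/
theorem isOfFinAddOrder_iff (h : IsBiquadratic t y₁ y₂ a b) {P₀ : Place K} (hP₀ : P₀.ord t < 0)
    (P : Place K) : IsOfFinAddOrder (diffClass P P₀) ↔ value t P ∈ h.common P₀ := by
  refine ⟨fun hP => ⟨h.value_mem_of_isOfFinAddOrder hP, h.swap.value_mem_of_isOfFinAddOrder hP⟩, ?_⟩
  rintro ⟨h₁, h₂⟩
  have hA := h.isOfFinAddOrder_add_conj_σ₁ hP₀ h₁
  have hB := h.swap.isOfFinAddOrder_add_conj_σ₁ hP₀ h₂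
  have hC := h.isHyper.isOfFinAddOrder_add_conj (P.conj h.σ₁) P₀
  have hD := h.isHyper.isOfFinAddOrder_add_conj (P₀.conj h.σ₁) P₀
  rw [h.conj_σ₁, h.conj_eq_of_pole hP₀] at hC hD
  have hsplit : ∀ Q R : Place K, diffClass Q R = diffClass Q P₀ - diffClass R P₀ := by
    intro Q R
    rw [← diffClass_add_diffClass Q P₀ R, ← neg_diffClass R P₀, sub_eq_add_neg]
  rw [hsplit (P.conj h.σ₁)] at hA
  rw [hsplit (P.conj h.swap.σ₁)] at hB
  apply isOfFinAddOrder_of_two_nsmul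
  have := ((hA.add hB).add hC.neg).add hD
  refine (congrArg IsOfFinAddOrder ?_).mp this
  generalize diffClass P P₀ = u₁, diffClass (P.conj h.σ₁) P₀ = u₂,
    diffClass (P.conj h.swap.σ₁) P₀ = u₃, diffClass (P₀.conj h.σ₁) P₀ = u₄,
    diffClass (P₀.conj h.swap.σ₁) P₀ = u₅
  abel

/-! ### Fibres of `t` -/

theorem eq_or_eq_conj_of_below₁_eq (h : IsBiquadratic t y₁ y₂ a b) {P P' : Place K}
    (hP : h.below₁ P' = h.below₁ P) : P' = P ∨ P' = P.conj h.σ₁ := by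
  obtain ⟨e, he, hl⟩ := h.liesOver_below₁ P
  obtain ⟨e', he', hl'⟩ := h.liesOver_below₁ P'
  rw [hP] at hl'
  exact h.isConj₁.eq_or_eq_conj h.isCurve he he' hl hl'

theorem exists_below₁_eq (h : IsBiquadratic t y₁ y₂ a b) (Q : Place h.field₁) :
    ∃ P : Place K, h.below₁ P = Q := by
  obtain ⟨P, e, he, hP⟩ := h.isConj₁.exists_place_over h.finite Q
  obtain ⟨e', he', hl⟩ := h.liesOver_below₁ P
  exact ⟨P, IsConj.liesOver_unique he' he hl hP⟩

theorem encard_fibre_le_four (h : IsBiquadratic t y₁ y₂ a b) (p : P1) :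
    (value t ⁻¹' {p}).encard ≤ 4 := by
  obtain ⟨Q, hQ⟩ := h.isHyper₁.value_surjective p
  obtain ⟨P, hP⟩ := h.exists_below₁_eq Q
  obtain ⟨P', hP'⟩ := h.exists_below₁_eq (Q.conj h.isHyper₁.conj)
  have hsub : value t ⁻¹' {p} ⊆ {P, P.conj h.σ₁, P', P'.conj h.σ₁} := by
    intro R hR
    rw [Set.mem_preimage, Set.mem_singleton_iff, ← h.value_below₁, ← hQ] at hR
    rcases h.isHyper₁.eq_or_eq_conj hR with h1 | h1
    · rw [← hP] at h1
      rcases h.eq_or_eq_conj_of_below₁_eq h1 with h2 | h2 <;> simp [h2]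
    · rw [← hP'] at h1
      rcases h.eq_or_eq_conj_of_below₁_eq h1 with h2 | h2 <;> simp [h2]
  calc _ ≤ _ := Set.encard_le_encard hsub
    _ ≤ 4 := by
      refine (Set.encard_insert_le _ _).trans ?_
      refine (add_le_add_left (Set.encard_insert_le _ _) 1).trans ?_
      refine (add_le_add_left (add_le_add_left (Set.encard_insert_le _ _) 1) 1).trans ?_
      rw [Set.encard_singleton]; norm_num

/-- Over `0`, `1`, `∞` the first elliptic curve has a single point, being ramified there, and at
most two points lie above it. -/
theorem encard_fibre_le_two (h : IsBiquadratic t y₁ y₂ a b) {p : P1} (hp : p ∈ basePoints) :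
    (value t ⁻¹' {p}).encard ≤ 2 := by
  obtain ⟨Q, hQ⟩ := h.isHyper₁.value_surjective p
  obtain ⟨P, hP⟩ := h.exists_below₁_eq Q
  have hconj : Q.conj h.isHyper₁.conj = Q := by
    rcases hp with hp | hp | hp
    · rw [hp, h.isHyper₁.value_eq_infinity_iff] at hQ
      exact (h.isHyper₁.ord_of_pole_odd hQ (odd_natDegree_cubic _ _ _)).2.2
    · rw [hp, value_eq_ofComplex_iff] at hQ
      exact (h.isHyper₁.ord_of_branch hQ (by simp)).2.2
    · rw [hp, value_eq_ofComplex_iff] at hQ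
      exact (h.isHyper₁.ord_of_branch hQ (by simp)).2.2
  have hsub : value t ⁻¹' {p} ⊆ {P, P.conj h.σ₁} := by
    intro R hR
    rw [Set.mem_preimage, Set.mem_singleton_iff, ← h.value_below₁, ← hQ] at hR
    have h1 : h.below₁ R = h.below₁ P := by
      rw [hP]
      rcases h.isHyper₁.eq_or_eq_conj hR with h1 | h1
      · exact h1
      · rw [h1, hconj]
    rcases h.eq_or_eq_conj_of_below₁_eq h1 with h2 | h2 <;> simp [h2]
  refine (Set.encard_le_encard hsub).trans ((Set.encard_insert_le _ _).trans ?_)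
  rw [Set.encard_singleton]; norm_num

theorem two_le_encard_fibre (h : IsBiquadratic t y₁ y₂ a b) {p : P1}
    (ha : p ≠ P1.ofComplex a) (hb : p ≠ P1.ofComplex b) : 2 ≤ (value t ⁻¹' {p}).encard := by
  obtain ⟨P, rfl⟩ := h.exists_value_eq p
  have hne := h.conj_σ₁_ne ha hb
  rw [← Set.encard_pair hne]
  apply Set.encard_le_encard
  rintro R (rfl | rfl)
  · exact h.value_conj_σ₁ P
  · rfl

/-- The orbit of `P` under sign changes has four elements: `σ₁` moves `P` and its conjugate over the
second curve, and these two lie over different points of the first curve because `y₁` takes opposite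
nonzero values there. -/
theorem four_le_encard_fibre (h : IsBiquadratic t y₁ y₂ a b) {p : P1} (hp : p ∉ basePoints)
    (ha : p ≠ P1.ofComplex a) (hb : p ≠ P1.ofComplex b) : 4 ≤ (value t ⁻¹' {p}).encard := by
  obtain ⟨P, rfl⟩ := h.exists_value_eq p
  have hne := h.conj_σ₁_ne ha hb
  have hne' : (P.conj h.swap.σ₁).conj h.σ₁ ≠ P.conj h.swap.σ₁ :=
    h.conj_σ₁_ne (by rwa [h.swap.value_conj_σ₁]) (by rwa [h.swap.value_conj_σ₁])
  have hbel : ∀ R, h.below₁ (R.conj h.σ₁) = h.below₁ R := by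
    intro R
    obtain ⟨e, he, hl⟩ := h.liesOver_below₁ R
    obtain ⟨e', he', hl'⟩ := h.liesOver_below₁ (R.conj h.σ₁)
    exact IsConj.liesOver_unique he' he hl' (IsConj.liesOver_conj hl)
  obtain ⟨c, hc⟩ : ∃ c, value t P = P1.ofComplex c := by
    rcases P1.cases (value t P) with h1 | h1
    · exact h1
    · exact absurd (Or.inl h1) hp
  have hy : P.ord y₁ = 0 := by
    have h1 := congrArg P.ord h.sq₁'
    have h0 : c ≠ 0 := by rintro rfl; apply hp; rw [hc]; simp [basePoints]
    have h01 : c ≠ 1 := by rintro rfl; apply hp; rw [hc]; simp [basePoints]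
    have hca : c ≠ a := by rintro rfl; exact ha hc
    rw [value_eq_ofComplex_iff] at hc
    have e0 := Place.ord_sub_of_value hc h0
    have e1 := Place.ord_sub_of_value hc h01
    rw [map_zero, sub_zero] at e0
    rw [map_one] at e1
    rw [P.ord_pow, P.ord_mul (mul_ne_zero h.t_ne_zero h.t_sub_one_ne_zero) (h.sub_ne_zero a),
      P.ord_mul h.t_ne_zero h.t_sub_one_ne_zero, e0, e1, Place.ord_sub_of_value hc hca] at h1
    push_cast at h1; omega
  obtain ⟨d, hd⟩ := h.isCurve.exists_value P ((Place.atLeast_iff h.y₁_ne_zero).2 hy.ge)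
  have hd0 : d ≠ 0 := by
    rintro rfl
    rw [map_zero, sub_zero, Place.atLeast_iff h.y₁_ne_zero] at hd
    omega
  have hbne : h.below₁ (P.conj h.swap.σ₁) ≠ h.below₁ P := by
    intro heq
    have hd' : (P.conj h.swap.σ₁).AtLeast 1 (y₁ - algebraMap ℂ K (-d)) := by
      rw [Place.atLeast_conj, map_sub, h.swap.σ₁_y₂, h.swap.σ₁_const]
      convert hd.neg using 1; rw [map_neg]; ring
    obtain ⟨e, he, hl⟩ := h.liesOver_below₁ P
    obtain ⟨e', he', hl'⟩ := h.liesOver_below₁ (P.conj h.swap.σ₁)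
    have e1 := hl.value_eq he h.s₁
    have e2 := hl'.value_eq he' h.s₁
    rw [heq, ← e1] at e2
    have e3 : value y₁ (P.conj h.swap.σ₁) = value y₁ P := e2
    rw [value_eq_ofComplex hd, value_eq_ofComplex hd', P1.ofComplex_inj, neg_eq_self] at e3
    exact hd0 e3
  have n1 : P.conj h.σ₁ ≠ P.conj h.swap.σ₁ := by
    intro h0; apply hbne; rw [← h0, hbel]
  have n2 : P ≠ P.conj h.swap.σ₁ := by
    intro h0; apply hbne; rw [← h0]
  have n3 : P ≠ (P.conj h.swap.σ₁).conj h.σ₁ := by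
    intro h0; apply hbne; rw [← hbel (P.conj h.swap.σ₁), ← h0]
  have n4 : P.conj h.σ₁ ≠ (P.conj h.swap.σ₁).conj h.σ₁ := by
    intro h0; apply hbne; rw [← hbel (P.conj h.swap.σ₁), ← h0, hbel]
  have hsub : ({P, P.conj h.σ₁, P.conj h.swap.σ₁, (P.conj h.swap.σ₁).conj h.σ₁} : Set (Place K)) ⊆
      value t ⁻¹' {value t P} := by
    rintro R (rfl | rfl | rfl | rfl)
    · rfl
    · exact h.value_conj_σ₁ P
    · exact h.swap.value_conj_σ₁ P
    · exact (h.value_conj_σ₁ _).trans (h.swap.value_conj_σ₁ P)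
  refine le_trans ?_ (Set.encard_le_encard hsub)
  rw [Set.encard_insert_of_notMem (by simp [hne.symm, n2, n3]),
    Set.encard_insert_of_notMem (by simp [n1, n4]), Set.encard_pair hne'.symm]
  norm_num

/-! ### Torsion packets -/

theorem encard_add_six_le (h : IsBiquadratic t y₁ y₂ a b) {P₀ : Place K} (hP₀ : P₀.ord t < 0) :
    (value t ⁻¹' h.common P₀).encard + 6 ≤ 4 * (h.common P₀).encard :=
  encard_preimage_add_le _ (h.basePoints_subset_common hP₀) (fun p _ => h.encard_fibre_le_four p)
    fun _ hp => h.encard_fibre_le_two hp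

/-- `a` and `b` must be kept out of `A`, since `t` is ramified over them as well and the fibres are
smaller. -/
theorem le_encard_add_six (h : IsBiquadratic t y₁ y₂ a b) {P₀ : Place K}
    {A : Set P1} (hA : basePoints ⊆ A) (ha : P1.ofComplex a ∉ A) (hb : P1.ofComplex b ∉ A)
    (hsub : A ⊆ h.common P₀) :
    4 * A.encard ≤ (value t ⁻¹' h.common P₀).encard + 6 := by
  refine (le_encard_preimage_add (value t) hA (fun p hp hp' => h.four_le_encard_fibre hp' ?_ ?_)
    fun p hp => h.two_le_encard_fibre ?_ ?_).trans
    (add_le_add_left (Set.encard_le_encard (Set.preimage_mono hsub)) 6)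
  · rintro rfl; exact ha hp
  · rintro rfl; exact hb hp
  · rintro rfl; exact ha (hA hp)
  · rintro rfl; exact hb (hA hp)

theorem isOfFinAddOrder_of_common (h : IsBiquadratic t y₁ y₂ a b) {P₀ : Place K}
    (hP₀ : P₀.ord t < 0) : IsTorsionPacket (value t ⁻¹' h.common P₀) := by
  refine ⟨fun P hP Q hQ => ?_, fun S hS hle P hP => ?_⟩
  · have h1 := (h.isOfFinAddOrder_iff hP₀ P).2 hP
    have h2 := (h.isOfFinAddOrder_iff hP₀ Q).2 hQ
    rw [← diffClass_add_diffClass P P₀ Q, ← neg_diffClass Q P₀]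
    exact h1.add h2.neg
  · have hP₀S : P₀ ∈ S := hle ((h.isOfFinAddOrder_iff hP₀ P₀).1 (by simp))
    exact (h.isOfFinAddOrder_iff hP₀ P).1 (hS P hP P₀ hP₀S)

theorem isHyperellipticTorsionPacket (h : IsBiquadratic t y₁ y₂ a b) {P₀ : Place K}
    (hP₀ : P₀.ord t < 0) : IsHyperellipticTorsionPacket (value t ⁻¹' h.common P₀) := by
  refine ⟨h.isOfFinAddOrder_of_common hP₀, y₂ / y₁, h.isHyper.isDoubleCover, fun W hW => ?_⟩
  rw [h.isHyper.isRamifiedAt_iff] at hW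
  apply (h.isOfFinAddOrder_iff hP₀ W).1
  have := h.isHyper.isOfFinAddOrder_add_conj W P₀
  rw [hW, h.conj_eq_of_pole hP₀, ← two_nsmul] at this
  exact isOfFinAddOrder_of_two_nsmul this

theorem eq_of_isTorsionPacket (h : IsBiquadratic t y₁ y₂ a b) {P₀ : Place K}
    (hP₀ : P₀.ord t < 0) {S : Set (Place K)} (hS : IsTorsionPacket S) (hP₀S : P₀ ∈ S) :
    S = value t ⁻¹' h.common P₀ :=
  hS.eq_of_subset (h.isOfFinAddOrder_of_common hP₀).1
    fun P hP => (h.isOfFinAddOrder_iff hP₀ P).1 (hS.1 P hP P₀ hP₀S)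

/-- The bielliptic curve of genus two. -/
def curve (h : IsBiquadratic t y₁ y₂ a b) : BiellipticGenusTwoCurve where
  K := K
  isCurve := h.isCurve
  genus_eq := h.genus_eq
  bielliptic := ⟨h.field₁, h.isHyper₁.isCurve, by rw [h.isHyper₁.genus_eq, natDegree_cubic],
    h.finrank_eq⟩

/-- The bounds that a biquadratic field gives. -/
theorem exists_covers (h : IsBiquadratic t y₁ y₂ a b) {P₀ : Place K} (hP₀ : P₀.ord t < 0) :
    (∃ π₁ π₂ : EllipticDoubleCover, EllipticDoubleCover.P π₁ π₂ = (((3 : ℕ) : ℕ∞), ((1 : ℕ) : ℕ∞)) ∧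
      (value t ⁻¹' h.common P₀).encard + 6 ≤ 4 * (EllipticDoubleCover.I π₁ π₂).encard) ∧
    ∃ π₁ π₂ : EllipticDoubleCover, EllipticDoubleCover.P π₁ π₂ = (((0 : ℕ) : ℕ∞), ((4 : ℕ) : ℕ∞)) ∧
      (value t ⁻¹' h.common P₀).encard ≤ (EllipticDoubleCover.I π₁ π₂).encard ∧
      π₁.branchSet ≠ π₂.branchSet ∧
      ((value t ⁻¹' h.common P₀).Finite → (EllipticDoubleCover.I π₁ π₂).Finite) := by
  have hO₁ := h.ord_below₁_neg hP₀
  have hO₂ := h.swap.ord_below₁_neg hP₀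
  refine ⟨⟨h.isHyper₁.legendreCover hO₁, h.swap.isHyper₁.legendreCover hO₂,
    P_legendreCover _ _ _ _ h.ne, ?_⟩, ?_⟩
  · rw [I_legendreCover]
    exact h.encard_add_six_le hP₀
  · obtain ⟨ℓ, m, hs₁⟩ := exists_isSymmetrizer h.a_ne_zero h.a_ne_one
    obtain ⟨ℓ', m', hs₂⟩ := exists_isSymmetrizer h.b_ne_zero h.b_ne_one
    have hP := P_symmetricCover h.isHyper₁ h.swap.isHyper₁ hO₁ hO₂ hs₁ hs₂ h.ne
    have hI := I_symmetricCover h.isHyper₁ h.swap.isHyper₁ hO₁ hO₂ hs₁ hs₂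
    have hcount := le_encard_preimage_add fourfold (h.basePoints_subset_common hP₀)
      (fun p _ hp => four_le_encard_fourfold hp) fun p hp => two_le_encard_fourfold hp
    -- Both sets are compared with four times the number of common values: `t` has at most,
    -- `fourfold` at least, that many preimages less 6.
    have hle : (value t ⁻¹' h.common P₀).encard ≤ (fourfold ⁻¹' h.common P₀).encard :=
      (ENat.add_le_add_iff_right (by norm_num)).1 ((h.encard_add_six_le hP₀).trans hcount)
    refine ⟨_, _, hP, by rw [hI]; exact hle, ?_, ?_⟩
    -- The branch sets are disjoint by the first invariant, and not empty, so they cannot be equal.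
    · intro heq
      have h0 := congrArg Prod.fst hP
      simp only [EllipticDoubleCover.P, heq, Set.inter_self, Nat.cast_zero, Set.encard_eq_zero] at h0
      have h1 := h.swap.isHyper₁.branchSet_cover hO₂
        (det_symmetrize_ne_zero hs₂.ne_zero hs₂.ne_zero')
      have h2 := h0.symm.trans h1
      exact (Set.insert_nonempty _ _).ne_empty h2.symm
    · intro hfin
      rw [hI]
      -- `t` is surjective on points, so it maps the packet onto the set of common values.
      have hc : (h.common P₀).Finite := by
        refine (hfin.image (value t)).subset fun p hp => ?_
        obtain ⟨P, rfl⟩ := h.exists_value_eq p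
        exact ⟨P, hp, rfl⟩
      exact hc.preimage' fun p _ => finite_fibre_fourfold p

end IsBiquadratic

end

/-! ### The normal form of a bielliptic curve of genus two -/

section

open KaehlerDifferential

variable {K : Type} [Field K] [Algebra ℂ K]

/-! ### Curves of genus two -/

namespace IsHyper

variable {x y x' y' : K} {f f' : ℂ[X]}

theorem map (h : IsHyper x y f) (e : K ≃ₐ[ℂ] K) : IsHyper (e x) (e y) f where
  trans := fun h0 => h.trans ((isAlgebraic_algHom_iff e.toAlgHom e.injective).1 h0)
  gen := by
    have := congrArg (IntermediateField.map e.toAlgHom) h.gen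
    rw [IntermediateField.adjoin_map, Set.image_pair] at this
    refine this.trans ?_
    rw [← AlgHom.fieldRange_eq_map, AlgHom.fieldRange_eq_top]
    exact e.surjective
  sq := by rw [← map_pow, h.sq, aeval_algHom_apply]
  sqf := h.sqf
  deg := h.deg

theorem mem_regularDifferentials_iff_of_genus (h : IsHyper x y f) (hg : genus K = 2)
    (ω : Ω[K⁄ℂ]) : ω ∈ regularDifferentials K ↔
      ∃ a b : ℂ, ω = ((algebraMap ℂ K a * x + algebraMap ℂ K b) / y) • D ℂ K x := by
  rw [h.genus_eq] at hg
  rw [h.mem_regularDifferentials_iff, show (f.natDegree + 1) / 2 - 1 = 2 by omega]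
  constructor
  · rintro ⟨p, hp, rfl⟩
    rw [mem_degreeLT] at hp
    obtain ⟨a, b, rfl⟩ := exists_eq_X_add_C_of_natDegree_le_one (p := p) (by
      rw [natDegree_le_iff_degree_le]; exact Order.le_of_lt_succ (by exact_mod_cast hp))
    exact ⟨a, b, by simp⟩
  · rintro ⟨a, b, rfl⟩
    refine ⟨C a * X + C b, ?_, by simp⟩
    rw [mem_degreeLT]
    exact lt_of_le_of_lt degree_linear_le (by norm_num)

theorem D_ne_zero (h : IsHyper x y f) : D ℂ K x ≠ 0 :=
  TorsionPackets.D_ne_zero h.isCurve h.exists_D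

/-- Two double covers of the projective line by a curve of genus two differ by an
automorphism of the projective line. -/
theorem exists_mul_eq (h : IsHyper x y f) (h' : IsHyper x' y' f') (hg : genus K = 2) :
    ∃ a b c d : ℂ, algebraMap ℂ K c * x + algebraMap ℂ K d ≠ 0 ∧
      x' * (algebraMap ℂ K c * x + algebraMap ℂ K d) =
        algebraMap ℂ K a * x + algebraMap ℂ K b := by
  obtain ⟨k, hk⟩ := h.exists_D x'
  have hk0 : k ≠ 0 := by rintro rfl; exact h'.D_ne_zero (by rw [hk, zero_smul])
  -- `dx'/y'` and `x' dx'/y'` are regular, so each is a linear polynomial in `x` times `dx/y`. Their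
  -- quotient `x'` is therefore a quotient of linear polynomials in `x`.
  obtain ⟨c, d, h1⟩ := (h.mem_regularDifferentials_iff_of_genus hg _).1
    ((h'.mem_regularDifferentials_iff_of_genus hg _).2 ⟨0, 1, rfl⟩)
  obtain ⟨a, b, h2⟩ := (h.mem_regularDifferentials_iff_of_genus hg _).1
    ((h'.mem_regularDifferentials_iff_of_genus hg _).2 ⟨1, 0, rfl⟩)
  rw [hk, smul_smul] at h1 h2
  have e1 := smul_D_injective h.isCurve h.exists_D h1
  have e2 := smul_D_injective h.isCurve h.exists_D h2
  have hy := h.y_ne_zero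
  have hy' := h'.y_ne_zero
  simp only [map_zero, zero_mul, map_one, zero_add, one_mul, add_zero] at e1 e2
  refine ⟨a, b, c, d, ?_, ?_⟩
  · intro h0
    rw [h0, zero_div] at e1
    exact mul_ne_zero (one_div_ne_zero hy') hk0 e1
  · field_simp at e1 e2
    have e3 : y' * (x' * (algebraMap ℂ K c * x + algebraMap ℂ K d)) =
        y' * (algebraMap ℂ K a * x + algebraMap ℂ K b) := by
      linear_combination e2 - x' * e1
    exact mul_left_cancel₀ hy' e3

theorem mem_adjoin_of_genus (h : IsHyper x y f) (h' : IsHyper x' y' f') (hg : genus K = 2) :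
    x' ∈ IntermediateField.adjoin ℂ {x} := by
  obtain ⟨a, b, c, d, h0, h1⟩ := h.exists_mul_eq h' hg
  rw [eq_div_of_mul_eq h0 h1]
  have hx := IntermediateField.mem_adjoin_simple_self ℂ x
  have hc := fun c : ℂ => (IntermediateField.adjoin ℂ {x}).algebraMap_mem c
  exact div_mem (add_mem (mul_mem (hc a) hx) (hc b)) (add_mem (mul_mem (hc c) hx) (hc d))

theorem conj_eq_of_mem (h : IsHyper x y f) (h' : IsHyper x' y' f')
    (hx : x' ∈ IntermediateField.adjoin ℂ {x}) (z : K) : h.conj z = h'.conj z := by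
  have hcx : h.conj x' = x' := h.conj.commutes ⟨x', hx⟩
  have hcx' : h'.conj x' = x' := h'.conj.commutes (IntermediateField.AdjoinSimple.gen ℂ x')
  have key : ∀ τ : K →ₐ[ℂ] K, τ x' = x' → (∃ z, τ z ≠ z) → τ y' = -y' := by
    intro τ hτ ⟨z, hz⟩
    have hsq : τ y' ^ 2 = y' ^ 2 := by
      rw [← map_pow, h'.sq, ← aeval_algHom_apply, hτ]
    rcases sq_eq_sq_iff_eq_or_eq_neg.1 hsq with h1 | h1
    · exact absurd (algHom_ext_of_adjoin h'.gen (σ := τ) (τ := AlgHom.id ℂ K)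
        (by rintro a (rfl | rfl) <;> assumption) z) hz
    · exact h1
  refine algHom_ext_of_adjoin h'.gen (σ := (h.conj.restrictScalars ℂ).toAlgHom)
    (τ := (h'.conj.restrictScalars ℂ).toAlgHom) ?_ z
  rintro a (rfl | rfl)
  · exact hcx.trans hcx'.symm
  · exact (key _ hcx h.isConj.ne).trans (key _ hcx' h'.isConj.ne).symm

/-- Makes the notion of a hyperelliptic packet independent of the chosen double cover: both covers
have the same field of rational functions and hence the same involution. -/
theorem isRamifiedAt_iff_of_genus (h : IsHyper x y f) (h' : IsHyper x' y' f') (hg : genus K = 2)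
    (P : Place K) : IsRamifiedAt x P ↔ IsRamifiedAt x' P := by
  rw [h.isRamifiedAt_iff, h'.isRamifiedAt_iff]
  have : P.conj h.conj = P.conj h'.conj := by
    refine Place.ext_ord fun z _ => ?_
    change -WithZero.log (P.v (h.conj z)) = -WithZero.log (P.v (h'.conj z))
    rw [h.conj_eq_of_mem h' (h.mem_adjoin_of_genus h' hg)]
  rw [this]

end IsHyper

/-! ### The normal form of a bielliptic curve of genus two -/

/-- An involution of a rational function field acts on a suitable generator by a change of sign. -/
theorem exists_anti_of_mul_eq {x : K} (hx : Transcendental ℂ x) {σ : K →ₐ[ℂ] K}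
    (hσ : ∀ z, σ (σ z) = z) (hσx : σ x ≠ x) {a b c d : ℂ}
    (h0 : algebraMap ℂ K c * x + algebraMap ℂ K d ≠ 0)
    (h1 : σ x * (algebraMap ℂ K c * x + algebraMap ℂ K d) =
      algebraMap ℂ K a * x + algebraMap ℂ K b) :
    ∃ X : K, IntermediateField.adjoin ℂ {X} = IntermediateField.adjoin ℂ {x} ∧ σ X = -X := by
  have h2 := congrArg σ h1
  simp only [map_mul, map_add, hσ, AlgHom.commutes] at h2
  -- An involution different from the identity has a matrix of trace zero.
  have had : algebraMap ℂ K d = -algebraMap ℂ K a := by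
    have : (σ x - x) * (algebraMap ℂ K d + algebraMap ℂ K a) = 0 := by
      linear_combination h1 - h2
    rcases mul_eq_zero.1 this with h3 | h3
    · exact absurd (sub_eq_zero.1 h3) hσx
    · exact eq_neg_of_add_eq_zero_left h3
  rw [had] at h0 h1
  by_cases hc : c = 0
  · subst hc
    have ha : algebraMap ℂ K a ≠ 0 := by simpa using h0
    refine ⟨x - algebraMap ℂ K (-b / a / 2), adjoin_sub_const _ _, ?_⟩
    rw [map_sub, AlgHom.commutes]
    have he : algebraMap ℂ K a * (2 * algebraMap ℂ K (-b / a / 2)) = -algebraMap ℂ K b := by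
      rw [← map_ofNat (algebraMap ℂ K) 2, ← map_mul, ← map_mul, ← map_neg]
      congr 1
      have ha0 : a ≠ 0 := by rintro rfl; exact ha (map_zero _)
      field_simp
    refine mul_left_cancel₀ ha ?_
    rw [map_zero] at h1
    linear_combination -h1 - he
  · have hc' : algebraMap ℂ K c ≠ 0 := (_root_.map_ne_zero _).2 hc
    -- The fixed points of the involution are `a / c ± r`; the coordinate sending them to `0` and
    -- `∞` is negated.
    obtain ⟨r, hr⟩ := IsAlgClosed.exists_pow_nat_eq (b / c + (a / c) ^ 2) (n := 2) (by norm_num)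
    have hrel : (σ x - algebraMap ℂ K (a / c)) * (x - algebraMap ℂ K (a / c)) =
        algebraMap ℂ K r ^ 2 := by
      rw [← map_pow, hr]
      simp only [map_div₀, map_add, map_pow]
      field_simp
      linear_combination algebraMap ℂ K c * h1
    have hr0 : r ≠ 0 := by
      rintro rfl
      rw [map_zero, zero_pow two_ne_zero] at hrel
      have hne := ne_const_of_transcendental hx (a / c)
      rcases mul_eq_zero.1 hrel with h3 | h3
      · apply hne
        have := congrArg σ (sub_eq_zero.1 h3)
        rwa [hσ, AlgHom.commutes] at this
      · exact hne (sub_eq_zero.1 h3)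
    have hdet : (1 : ℂ) * (r - a / c) - (-r - a / c) * 1 ≠ 0 := by
      rw [show (1 : ℂ) * (r - a / c) - (-r - a / c) * 1 = 2 * r by ring]
      exact mul_ne_zero two_ne_zero hr0
    refine ⟨_, adjoin_mob hdet hx, ?_⟩
    have hd1 : x - algebraMap ℂ K (a / c) + algebraMap ℂ K r ≠ 0 := by
      intro h3
      exact ne_const_of_transcendental hx (a / c - r) (by rw [map_sub]; linear_combination h3)
    have hd2 : σ x - algebraMap ℂ K (a / c) + algebraMap ℂ K r ≠ 0 := by
      intro h3
      refine ne_const_of_transcendental hx (a / c - r) ?_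
      have := congrArg σ (show σ x = algebraMap ℂ K (a / c - r) by rw [map_sub]; linear_combination h3)
      rwa [hσ, AlgHom.commutes] at this
    simp only [map_div₀ σ, map_add, AlgHom.commutes, map_one, map_sub, map_neg, one_mul]
    rw [← neg_div, div_eq_div_iff (by convert hd2 using 1; ring) (by convert hd1 using 1; ring)]
    linear_combination 2 * hrel

/-- The image `-dx / σ y` of the regular differential `dx / y` is again regular, so it equals `(a x
+ b) dx / y`. Applying `σ` once more gives `b² - a² x² = 1`, hence `a = 0`, `b = ±1` and `σ y = ±y`.
Thus `f(-x) = (σ y)² = y² = f(x)`. -/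
theorem comp_neg_X_eq {x y : K} {f : ℂ[X]} (h : IsHyper x y f) (hg : genus K = 2)
    {σ : K ≃ₐ[ℂ] K} (hσ : ∀ z, σ (σ z) = z) (hσx : σ x = -x) : f.comp (-X) = f := by
  have h' := h.map σ
  obtain ⟨a, b, h1⟩ := (h.mem_regularDifferentials_iff_of_genus hg _).1
    ((h'.mem_regularDifferentials_iff_of_genus hg _).2 ⟨0, 1, rfl⟩)
  rw [hσx, map_neg (D ℂ K), smul_neg, ← neg_smul] at h1
  have e1 := smul_D_injective h.isCurve h.exists_D h1
  have hy := h.y_ne_zero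
  have hy' := h'.y_ne_zero
  simp only [map_zero, zero_mul, map_one, zero_add, ← neg_div] at e1
  rw [div_eq_div_iff hy' hy] at e1
  have e2 := congrArg σ e1
  simp only [map_neg, map_mul, map_add, AlgEquiv.commutes, hσ, hσx, map_one] at e2
  have e3 : aeval x (C (b ^ 2) - C (a ^ 2) * X ^ 2 - 1) = 0 := by
    refine mul_left_cancel₀ hy ?_
    simp only [map_sub, map_mul, map_pow, aeval_C, aeval_X, map_one]
    linear_combination e1 - (algebraMap ℂ K a * x + algebraMap ℂ K b) * e2
  have e4 : (C (b ^ 2) - C (a ^ 2) * X ^ 2 - 1 : ℂ[X]) = 0 := by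
    by_contra h0
    exact aeval_ne_zero_of_transcendental h.trans h0 e3
  have ha2 := congrArg (coeff · 2) e4
  have hb2 := congrArg (coeff · 0) e4
  simp only [coeff_sub, coeff_C, coeff_C_mul, coeff_X_pow, coeff_one, coeff_zero] at ha2 hb2
  have ha : a = 0 := by simpa using ha2
  have hb : b ^ 2 = 1 := by norm_num at hb2; linear_combination hb2
  have e5 : y ^ 2 = σ y ^ 2 := by
    have hb' : algebraMap ℂ K b ^ 2 = 1 := by rw [← map_pow, hb, map_one]
    simp only [ha, map_zero, zero_mul, zero_add] at e1
    linear_combination (-y + algebraMap ℂ K b * σ y) * e1 + σ y ^ 2 * hb'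
  by_contra hne
  refine aeval_ne_zero_of_transcendental h.trans (sub_ne_zero.2 hne) ?_
  rw [map_sub, aeval_comp, map_neg, aeval_X, ← hσx, ← h'.sq, ← h.sq, e5, sub_self]

theorem exists_cubic {g : ℂ[X]} (hg : g.natDegree = 3) :
    ∃ k A B D : ℂ, k ≠ 0 ∧ g = C k * ((X - C A) * (X - C B) * (X - C D)) := by
  have hs := IsAlgClosed.splits g
  have hc := hs.natDegree_eq_card_roots
  rw [hg] at hc
  obtain ⟨A, B, D, hABD⟩ := Multiset.card_eq_three.1 hc.symm
  refine ⟨g.leadingCoeff, A, B, D, ?_, ?_⟩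
  · rw [leadingCoeff_ne_zero]; rintro rfl; simp at hg
  · conv_lhs => rw [hs.eq_prod_roots]
    simp [hABD, mul_assoc]

/-- An even polynomial has no term of degree 5, so the degree is 6 and `f` is a cubic in `X²`. A
root of the cubic at `0`, or a double root, would give a square factor of `f`. -/
theorem exists_sextic_of_even {f : ℂ[X]} (hf : Squarefree f) (heven : f.comp (-X) = f)
    (hdeg : f.natDegree = 5 ∨ f.natDegree = 6) :
    ∃ k A B D : ℂ, k ≠ 0 ∧ A ≠ 0 ∧ B ≠ 0 ∧ D ≠ 0 ∧ A ≠ B ∧ A ≠ D ∧ B ≠ D ∧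
      f = C k * ((X ^ 2 - C A) * (X ^ 2 - C B) * (X ^ 2 - C D)) := by
  have hodd : ∀ n, Odd n → f.coeff n = 0 := by
    intro n hn
    have h1 := congrArg (coeff · n) heven
    simp only [show (-X : ℂ[X]) = C (-1) * X by simp, comp_C_mul_X_coeff, hn.neg_one_pow] at h1
    have : 2 * f.coeff n = 0 := by linear_combination -h1
    simpa using this
  have h6 : f.natDegree = 6 := by
    refine hdeg.resolve_left fun h5 => ?_
    have := hodd 5 (by decide)
    rw [← h5, coeff_natDegree, leadingCoeff_eq_zero] at this
    exact hf.ne_zero this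
  have hlead : f.coeff 6 ≠ 0 := by
    rw [← h6, coeff_natDegree, leadingCoeff_ne_zero]; exact hf.ne_zero
  have hexp : f = (C (f.coeff 6) * X ^ 3 + C (f.coeff 4) * X ^ 2 + C (f.coeff 2) * X +
      C (f.coeff 0)).comp (X ^ 2) := by
    conv_lhs => rw [f.as_sum_range_C_mul_X_pow, h6]
    simp only [Finset.sum_range_succ, Finset.sum_range_zero, hodd 1 (by decide),
      hodd 3 (by decide), hodd 5 (by decide), add_comp, mul_comp, C_comp, pow_comp, X_comp]
    simp only [map_zero]
    ring
  obtain ⟨k, A, B, D, hk, hg⟩ := exists_cubic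
    (Polynomial.natDegree_cubic (b := f.coeff 4) (c := f.coeff 2) (d := f.coeff 0) hlead)
  rw [hg] at hexp
  simp only [mul_comp, sub_comp, C_comp, X_comp] at hexp
  have hsq : ∀ p : ℂ[X], p * p ∣ f → p.natDegree ≠ 0 → False := fun p hp hp0 =>
    hp0 (natDegree_eq_zero_of_isUnit (hf p hp))
  have hX : ¬ (X * X ∣ f) := fun h => hsq X h (by simp)
  have hq : ∀ A : ℂ, ¬ ((X ^ 2 - C A) * (X ^ 2 - C A) ∣ f) := fun A h =>
    hsq _ h (by rw [natDegree_X_pow_sub_C]; norm_num)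
  refine ⟨k, A, B, D, hk, ?_, ?_, ?_, ?_, ?_, ?_, hexp⟩
  · rintro rfl
    exact hX ⟨C k * ((X ^ 2 - C B) * (X ^ 2 - C D)), by rw [hexp, C_0]; ring⟩
  · rintro rfl
    exact hX ⟨C k * ((X ^ 2 - C A) * (X ^ 2 - C D)), by rw [hexp, C_0]; ring⟩
  · rintro rfl
    exact hX ⟨C k * ((X ^ 2 - C A) * (X ^ 2 - C B)), by rw [hexp, C_0]; ring⟩
  · rintro rfl
    exact hq A ⟨C k * (X ^ 2 - C D), by rw [hexp]; ring⟩
  · rintro rfl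
    exact hq A ⟨C k * (X ^ 2 - C B), by rw [hexp]; ring⟩
  · rintro rfl
    exact hq B ⟨C k * (X ^ 2 - C A), by rw [hexp]; ring⟩

/-- The Möbius function `t` of `x²` sends `A, B, D` to `0, 1, ∞`; the parameters `a` and `b` are its
values at `x² = ∞` and `x² = 0`. Then `(t - b) / (t - a) = x² / D`, so `y₂ / y₁` may be taken as `μ
x` with `μ² = 1 / D`, and the constant `κ` normalizes `y₁`. -/
theorem IsHyper.exists_isBiquadratic {x y : K} {k A B D : ℂ}
    (h : IsHyper x y (C k * ((X ^ 2 - C A) * (X ^ 2 - C B) * (X ^ 2 - C D)))) (hk : k ≠ 0)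
    (hA : A ≠ 0) (hB : B ≠ 0) (hD : D ≠ 0) (hAB : A ≠ B) (hAD : A ≠ D) (hBD : B ≠ D) :
    ∃ (t y₁ y₂ : K) (a b : ℂ), IsBiquadratic t y₁ y₂ a b := by
  have hAB' := sub_ne_zero.2 hAB.symm
  have hBD' := sub_ne_zero.2 hBD
  have hDA' := sub_ne_zero.2 hAD.symm
  obtain ⟨κ, hκ⟩ := IsAlgClosed.exists_pow_nat_eq
    (-((B - D) / (B - A)) ^ 2 * (D - A) ^ 2 / ((B - A) * k)) (n := 2) (by norm_num)
  obtain ⟨μ, hμ⟩ := IsAlgClosed.exists_pow_nat_eq D⁻¹ (n := 2) (by norm_num)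
  have hμ0 : μ ≠ 0 := by
    rintro rfl
    exact inv_ne_zero hD (by rw [← hμ]; norm_num)
  have hκ0 : κ ≠ 0 := by
    rintro rfl
    rw [zero_pow two_ne_zero, eq_comm, div_eq_zero_iff] at hκ
    simp [hAB', hBD', hDA', hk] at hκ
  have hu : ∀ c : ℂ, x ^ 2 - algebraMap ℂ K c ≠ 0 := fun c => by
    have := aeval_ne_zero_of_transcendental h.trans (X_pow_sub_C_ne_zero two_pos c)
    simpa using this
  have hsq := h.sq
  simp only [map_mul, map_sub, map_pow, aeval_X, aeval_C] at hsq
  have ne : ∀ {c : ℂ}, c ≠ 0 → algebraMap ℂ K c ≠ 0 := fun hc => (_root_.map_ne_zero _).2 hc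
  have hμ' : algebraMap ℂ K μ ^ 2 = (algebraMap ℂ K D)⁻¹ := by rw [← map_pow, hμ, map_inv₀]
  have hκ' : algebraMap ℂ K κ ^ 2 = -((algebraMap ℂ K B - algebraMap ℂ K D) /
      (algebraMap ℂ K B - algebraMap ℂ K A)) ^ 2 * (algebraMap ℂ K D - algebraMap ℂ K A) ^ 2 /
      ((algebraMap ℂ K B - algebraMap ℂ K A) * algebraMap ℂ K k) := by
    rw [← map_pow, hκ]
    simp only [map_div₀, map_mul, map_neg, map_pow, map_sub]
  have nAB := ne hAB'
  have nBD := ne hBD'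
  have nDA := ne hDA'
  have nD := ne hD
  have nk := ne hk
  have nκ := ne hκ0
  have nμ := ne hμ0
  have hx0 : x ≠ 0 := by simpa using ne_const_of_transcendental h.trans 0
  rw [map_sub] at nAB nBD nDA
  have huD := hu D
  have hcub : ∀ (T : K) (e : ℂ), aeval T (cubic 0 1 e) = T * (T - 1) * (T - algebraMap ℂ K e) := by
    intro T e; simp [cubic]
  have hsq₁ : (algebraMap ℂ K κ * y / (x ^ 2 - algebraMap ℂ K D) ^ 2) ^ 2 =
      aeval (algebraMap ℂ K ((B - D) / (B - A)) * (x ^ 2 - algebraMap ℂ K A) /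
        (x ^ 2 - algebraMap ℂ K D)) (cubic 0 1 ((B - D) / (B - A))) := by
    rw [hcub, div_pow, mul_pow, hκ', hsq]
    simp only [map_div₀, map_sub]
    field_simp
    ring
  refine ⟨algebraMap ℂ K ((B - D) / (B - A)) * (x ^ 2 - algebraMap ℂ K A) /
      (x ^ 2 - algebraMap ℂ K D), algebraMap ℂ K κ * y / (x ^ 2 - algebraMap ℂ K D) ^ 2,
    algebraMap ℂ K μ * x * (algebraMap ℂ K κ * y / (x ^ 2 - algebraMap ℂ K D) ^ 2),
    (B - D) / (B - A), (B - D) / (B - A) * A / D, ?_, ?_, hsq₁, ?_, ?_, ?_, ?_, ?_, ?_⟩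
  · intro halg
    set T := algebraMap ℂ K ((B - D) / (B - A)) * (x ^ 2 - algebraMap ℂ K A) /
      (x ^ 2 - algebraMap ℂ K D) with hT
    have hTne : T - algebraMap ℂ K ((B - D) / (B - A)) ≠ 0 := by
      rw [hT, mul_div_assoc, ← mul_sub_one, div_sub_one huD]
      refine mul_ne_zero (ne (div_ne_zero hBD' hAB')) (div_ne_zero ?_ huD)
      rwa [sub_sub_sub_cancel_left]
    have hx2 : x ^ 2 = (T * algebraMap ℂ K D - algebraMap ℂ K ((B - D) / (B - A)) *
        algebraMap ℂ K A) / (T - algebraMap ℂ K ((B - D) / (B - A))) := by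
      have hTe : T * (x ^ 2 - algebraMap ℂ K D) =
          algebraMap ℂ K ((B - D) / (B - A)) * (x ^ 2 - algebraMap ℂ K A) := by
        rw [hT, div_mul_cancel₀ _ huD]
      rw [eq_div_iff hTne]
      linear_combination hTe
    have hc : ∀ c : ℂ, IsAlgebraic ℂ (algebraMap ℂ K c) := fun c => isAlgebraic_algebraMap c
    refine h.trans (IsAlgebraic.of_pow (r := x) two_pos ?_)
    rw [hx2, div_eq_mul_inv]
    exact ((halg.mul (hc D)).sub ((hc _).mul (hc A))).mul (halg.sub (hc _)).inv
  · set L := IntermediateField.adjoin ℂ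
      {algebraMap ℂ K ((B - D) / (B - A)) * (x ^ 2 - algebraMap ℂ K A) /
      (x ^ 2 - algebraMap ℂ K D), algebraMap ℂ K κ * y / (x ^ 2 - algebraMap ℂ K D) ^ 2,
      algebraMap ℂ K μ * x * (algebraMap ℂ K κ * y / (x ^ 2 - algebraMap ℂ K D) ^ 2)} with hL
    have hm₁ : algebraMap ℂ K κ * y / (x ^ 2 - algebraMap ℂ K D) ^ 2 ∈ L :=
      IntermediateField.subset_adjoin _ _ (by simp)
    have hm₂ : algebraMap ℂ K μ * x * (algebraMap ℂ K κ * y / (x ^ 2 - algebraMap ℂ K D) ^ 2) ∈ L :=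
      IntermediateField.subset_adjoin _ _ (by simp)
    have hy := h.y_ne_zero
    have hxL : x ∈ L := by
      have := div_mem (div_mem hm₂ hm₁) (L.algebraMap_mem μ)
      convert this using 1
      field_simp
    have hyL : y ∈ L := by
      have := div_mem (mul_mem hm₁ (pow_mem (sub_mem (pow_mem hxL 2) (L.algebraMap_mem D)) 2))
        (L.algebraMap_mem κ)
      convert this using 1
      field_simp
    rw [eq_top_iff, ← h.gen, IntermediateField.adjoin_le_iff]
    rintro z (rfl | rfl)
    · exact hxL
    · exact hyL
  · rw [mul_pow, hsq₁, hcub, hcub, mul_pow, hμ']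
    simp only [map_div₀, map_mul, map_sub]
    field_simp
    ring
  · rw [Ne, eq_div_iff hD]
    intro h0
    exact hAD (mul_left_cancel₀ (div_ne_zero hBD' hAB') h0).symm
  · exact div_ne_zero hBD' hAB'
  · rw [Ne, div_eq_one_iff_eq hAB']
    intro h0; exact hAD (by linear_combination h0)
  · exact div_ne_zero (mul_ne_zero (div_ne_zero hBD' hAB') hA) hD
  · rw [Ne, div_mul_eq_mul_div, div_div, div_eq_one_iff_eq (mul_ne_zero hAB' hD)]
    intro h0
    exact mul_ne_zero hB hDA' (by linear_combination -h0)

/-- A bielliptic curve of genus two is the fibre product of two double covers in Legendre form. -/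
theorem BiellipticGenusTwoCurve.exists_isBiquadratic (C : BiellipticGenusTwoCurve) {x : C.K}
    (hx : IsDoubleCover x) : ∃ (t y₁ y₂ : C.K) (a b : ℂ), IsBiquadratic t y₁ y₂ a b := by
  obtain ⟨F, hF, hgF, hfin⟩ := C.bielliptic
  obtain ⟨σ, hσ⟩ := exists_isConj hfin
  obtain ⟨y, f, h⟩ := hx.exists_isHyper C.isCurve
  set τ : C.K ≃ₐ[ℂ] C.K := σ.restrictScalars ℂ with hτ
  have hτ2 : ∀ z, τ (τ z) = z := hσ.invol
  -- If the bielliptic involution fixed `x`, its fixed field would be `ℂ(x)`, which has genus 0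
  -- instead of 1.
  have hτx : τ x ≠ x := by
    intro h0
    obtain ⟨z, hz⟩ := hσ.fixed x h0
    have hle : IntermediateField.adjoin ℂ {x} ≤ F := by
      rw [IntermediateField.adjoin_simple_le_iff]; exact mem_of_algebraMap_eq hz
    have := h.finite
    have heq := IntermediateField.eq_of_le_of_finrank_eq' hle (hx.trans hfin.symm)
    rw [← heq, (isRational_gen h.trans).genus_eq_zero] at hgF
    exact zero_ne_one hgF
  obtain ⟨a, b, c, d, h0, h1⟩ := h.exists_mul_eq (h.map τ) C.genus_eq
  obtain ⟨X', hX, hτX⟩ := exists_anti_of_mul_eq h.trans (σ := τ.toAlgHom) hτ2 hτx h0 h1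
  have hX2 : IsDoubleCover X' := by rw [IsDoubleCover, hX]; exact hx
  obtain ⟨Y, g, h'⟩ := hX2.exists_isHyper C.isCurve
  have hdeg := h'.genus_eq.symm.trans C.genus_eq
  obtain ⟨k, A, B, D, hk, hA, hB, hD, hAB, hAD, hBD, rfl⟩ := exists_sextic_of_even h'.sqf
    (comp_neg_X_eq h' C.genus_eq hτ2 hτX) (by omega)
  exact h'.exists_isBiquadratic hk hA hB hD hAB hAD hBD

end

/-! ### Existence of fibre products, and a packet with at least 34 points -/

section

/-! ### Existence of biquadratic fields -/

theorem exists_field_isBiquadratic {a b : ℂ} (hab : a ≠ b) (ha : a ≠ 0) (ha' : a ≠ 1)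
    (hb : b ≠ 0) (hb' : b ≠ 1) :
    ∃ (K : Type) (_ : Field K) (_ : Algebra ℂ K) (t y₁ y₂ : K), IsBiquadratic t y₁ y₂ a b := by
  let Ω := AlgebraicClosure (RatFunc ℂ)
  let t : Ω := algebraMap (RatFunc ℂ) Ω RatFunc.X
  have ht : Transcendental ℂ t :=
    (transcendental_algebraMap_iff (FaithfulSMul.algebraMap_injective _ Ω)).2 RatFunc.transcendental_X
  obtain ⟨y₁, h₁⟩ := IsAlgClosed.exists_pow_nat_eq (aeval t (cubic 0 1 a)) (n := 2) (by norm_num)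
  obtain ⟨y₂, h₂⟩ := IsAlgClosed.exists_pow_nat_eq (aeval t (cubic 0 1 b)) (n := 2) (by norm_num)
  let L := IntermediateField.adjoin ℂ {t, y₁, y₂}
  have hm : ∀ z ∈ ({t, y₁, y₂} : Set Ω), z ∈ L := fun z hz => IntermediateField.subset_adjoin _ _ hz
  refine ⟨L, inferInstance, inferInstance, ⟨t, hm t (by simp)⟩, ⟨y₁, hm y₁ (by simp)⟩,
    ⟨y₂, hm y₂ (by simp)⟩, ?_, ?_, ?_, ?_, hab, ha, ha', hb, hb'⟩
  · rw [← transcendental_algebraMap_iff (FaithfulSMul.algebraMap_injective _ Ω)]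
    exact ht
  · apply IntermediateField.lift_injective
    rw [IntermediateField.lift_adjoin, IntermediateField.lift_top, Set.image_insert_eq,
      Set.image_pair]
  · apply (algebraMap L Ω).injective
    rw [← aeval_algebraMap_apply]
    exact h₁
  · apply (algebraMap L Ω).injective
    rw [← aeval_algebraMap_apply]
    exact h₂

/-! ### Torsion values from the duplication formula -/

/-- On the curve `y² = (v - e₁)(v - e₂)(v - e₃)` the double of a point with first coordinate `v`
has first coordinate `v'`. -/
def IsDouble (e₁ e₂ e₃ v v' : ℂ) : Prop :=
  ((v - e₃) * (2 * v - (e₁ + e₂)) + (v - e₁) * (v - e₂)) ^ 2 =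
    4 * ((v - e₁) * (v - e₂) * (v - e₃)) * (v' + 2 * v - (e₁ + e₂ + e₃))

/-- `IsDouble` is the duplication formula with denominators cleared. At a root `eᵢ` its right side
vanishes, while the left side is the square of the nonzero derivative there. -/
theorem IsDouble.ne {e₁ e₂ e₃ v v' : ℂ} (h : IsDouble e₁ e₂ e₃ v v') (h₁₂ : e₁ ≠ e₂)
    (h₁₃ : e₁ ≠ e₃) (h₂₃ : e₂ ≠ e₃) : v ≠ e₁ ∧ v ≠ e₂ ∧ v ≠ e₃ := by
  have h₁ := sub_ne_zero.2 h₁₂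
  have h₂ := sub_ne_zero.2 h₁₃
  have h₃ := sub_ne_zero.2 h₂₃
  unfold IsDouble at h
  refine ⟨?_, ?_, ?_⟩
  · rintro rfl
    refine pow_ne_zero 2 (mul_ne_zero h₁ h₂) ?_
    linear_combination h
  · rintro rfl
    refine pow_ne_zero 2 (mul_ne_zero h₁ h₃) ?_
    linear_combination h
  · rintro rfl
    refine pow_ne_zero 2 (mul_ne_zero h₂ h₃) ?_
    linear_combination h

section Double

variable {K : Type} [Field K] [Algebra ℂ K] {x y : K} {O : Place K}
  {a α β e₁ e₂ e₃ v v' : ℂ}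

/-- The affine map `v ↦ α v + β` carries the roots `e₁, e₂, e₃` to `0, 1, a`. It multiplies the
cubic by `α³`, which is harmless because the duplication formula involves the second coordinate only
through its square. -/
theorem IsHyper.exists_of_isDouble (h : IsHyper x y (cubic 0 1 a)) (hO : O.ord x < 0)
    (h₁ : α * e₁ + β = 0) (h₂ : α * e₂ + β = 1) (h₃ : α * e₃ + β = a)
    (hv : IsDouble e₁ e₂ e₃ v v') :
    ∃ P Q : Place K, value x P = P1.ofComplex (α * v + β) ∧
      value x Q = P1.ofComplex (α * v' + β) ∧ diffClass Q O = 2 • diffClass P O := by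
  have hα : α ≠ 0 := by
    rintro rfl
    exact zero_ne_one (by linear_combination h₂ - h₁ : (0 : ℂ) = 1)
  have h₁₃ := h.cubic_distinct.2
  have h' := h
  rw [cubic_rotate] at h'
  have h₂₃ := h'.cubic_distinct.1
  have hne := hv.ne (e₁ := e₁) (e₂ := e₂) (e₃ := e₃)
    (by rintro rfl; exact zero_ne_one (h₁.symm.trans h₂))
    (by rintro rfl; exact h₁₃ (h₁.symm.trans h₃)) (by rintro rfl; exact h₂₃ (h₂.symm.trans h₃))
  have hβ : β = -(α * e₁) := by linear_combination h₁
  have hev : (cubic 0 1 a).eval (α * v + β) = α ^ 3 * ((v - e₁) * (v - e₂) * (v - e₃)) := by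
    rw [eval_cubic, ← h₂, ← h₃, hβ]
    ring
  obtain ⟨d, hd⟩ := IsAlgClosed.exists_pow_nat_eq ((cubic 0 1 a).eval (α * v + β)) (n := 2)
    (by norm_num)
  have hg : (v - e₁) * (v - e₂) * (v - e₃) ≠ 0 :=
    mul_ne_zero (mul_ne_zero (sub_ne_zero.2 hne.1) (sub_ne_zero.2 hne.2.1)) (sub_ne_zero.2 hne.2.2)
  have hd0 : d ≠ 0 := by
    rintro rfl
    rw [zero_pow two_ne_zero, hev] at hd
    exact mul_ne_zero (pow_ne_zero 3 hα) hg hd.symm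
  obtain ⟨P, hP⟩ := h.exists_at hd
  obtain ⟨Q, d', hQ, hQP⟩ := h.double hO hP hd0
  refine ⟨P, Q, value_eq_ofComplex hP.1, ?_, hQP⟩
  rw [value_eq_ofComplex hQ.1, P1.ofComplex_inj]
  have hder : (derivative (cubic 0 1 a)).eval (α * v + β) =
      α ^ 2 * ((v - e₃) * (2 * v - (e₁ + e₂)) + (v - e₁) * (v - e₂)) := by
    have : (derivative (cubic 0 1 a)).eval (α * v + β) = (α * v + β - 1) * (α * v + β - a) +
        (α * v + β) * (α * v + β - a) + (α * v + β) * (α * v + β - 1) := by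
      simp [cubic]
      ring
    rw [this, ← h₂, ← h₃, hβ]
    ring
  rw [hder, div_pow, mul_pow, mul_pow, hd, hev, hv, ← h₂, ← h₃, hβ]
  generalize (v - e₁) * (v - e₂) * (v - e₃) = G at hg ⊢
  field_simp
  ring

theorem IsHyper.mem_torsionValues_of_isDouble (h : IsHyper x y (cubic 0 1 a)) (hO : O.ord x < 0)
    (h₁ : α * e₁ + β = 0) (h₂ : α * e₂ + β = 1) (h₃ : α * e₃ + β = a)
    (hv : IsDouble e₁ e₂ e₃ v v') (hv' : P1.ofComplex (α * v' + β) ∈ torsionValues x O) :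
    P1.ofComplex (α * v + β) ∈ torsionValues x O := by
  obtain ⟨P, Q, hP, hQ, hPQ⟩ := h.exists_of_isDouble hO h₁ h₂ h₃ hv
  have hodd := odd_natDegree_cubic 0 1 a
  rw [← hP, h.value_mem_torsionValues_iff hodd hO]
  rw [← hQ, h.value_mem_torsionValues_iff hodd hO, hPQ] at hv'
  exact isOfFinAddOrder_of_two_nsmul hv'

/-- A point whose double has the same first coordinate satisfies `2 P = ±P`, so `3 P = 0` or `P =
0`. -/
theorem IsHyper.mem_torsionValues_of_isDouble_self (h : IsHyper x y (cubic 0 1 a))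
    (hO : O.ord x < 0) (h₁ : α * e₁ + β = 0) (h₂ : α * e₂ + β = 1) (h₃ : α * e₃ + β = a)
    (hv : IsDouble e₁ e₂ e₃ v v) : P1.ofComplex (α * v + β) ∈ torsionValues x O := by
  obtain ⟨P, Q, hP, hQ, hPQ⟩ := h.exists_of_isDouble hO h₁ h₂ h₃ hv
  have hodd := odd_natDegree_cubic 0 1 a
  rw [← hP, h.value_mem_torsionValues_iff hodd hO]
  rcases h.eq_or_eq_conj (hQ.trans hP.symm) with rfl | rfl
  · have : diffClass Q O = 0 := by rwa [two_nsmul, left_eq_add] at hPQ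
    rw [this]
    exact IsOfFinAddOrder.zero
  · rw [h.diffClass_conj hodd hO] at hPQ
    refine isOfFinAddOrder_iff_nsmul_eq_zero.2 ⟨3, by norm_num, ?_⟩
    rw [succ_nsmul, ← hPQ, neg_add_cancel]

end Double

/-! ### A curve with a large hyperelliptic torsion packet -/

section Large

variable {w e₁ e₂ p q : ℂ}

/-- Removes `e₁` and `e₂` from the duplication formula for the explicit curve, with `w² = 13`, roots
`e₁, e₂` of `v² + 3 w v + 36` and third root `-8 - 4 w`. What remains are polynomial identities
modulo the relations for `w` and for `p` or `q`; the coefficients in `linear_combination` are the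
cofactors. Doubling acts on first coordinates by `q ↦ 2 - 2w ↦ -8 - 4w`, ending at a point of order
two, and by `p ↦ … ↦ 0 ↦ -2 - 2w`, ending at a point of order three. -/
theorem sub_mul_sub_eq (hs : e₁ + e₂ = -(3 * w)) (hp : e₁ * e₂ = 36) (v : ℂ) :
    (v - e₁) * (v - e₂) = v ^ 2 + 3 * w * v + 36 := by
  linear_combination -v * hs + hp

theorem isDouble_zero (hw : w ^ 2 = 13) (hs : e₁ + e₂ = -(3 * w)) (hp : e₁ * e₂ = 36) :
    IsDouble e₁ e₂ (-8 - 4 * w) 0 (-2 - 2 * w) := by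
  rw [IsDouble, sub_mul_sub_eq hs hp, hs]
  linear_combination (144*w^2 + 576*w + 432) * hw

theorem isDouble_of_order_three (hw : w ^ 2 = 13) (hs : e₁ + e₂ = -(3 * w)) (hp : e₁ * e₂ = 36) :
    IsDouble e₁ e₂ (-8 - 4 * w) (-2 - 2 * w) (-2 - 2 * w) := by
  rw [IsDouble, sub_mul_sub_eq hs hp, hs]
  linear_combination (32*w^2 + 160*w + 128) * hw

theorem isDouble_of_order_four (hs : e₁ + e₂ = -(3 * w)) (hp : e₁ * e₂ = 36) :
    IsDouble e₁ e₂ (-8 - 4 * w) (2 - 2 * w) (-8 - 4 * w) := by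
  rw [IsDouble, sub_mul_sub_eq hs hp, hs]
  ring

theorem isDouble_of_order_eight (hw : w ^ 2 = 13) (hs : e₁ + e₂ = -(3 * w)) (hp : e₁ * e₂ = 36)
    (hq : q ^ 2 + 6 * (w - 1) * q + 144 = 0) :
    IsDouble e₁ e₂ (-8 - 4 * w) q (2 - 2 * w) := by
  rw [IsDouble, sub_mul_sub_eq hs hp, hs]
  linear_combination (144*w^2 - 24*w*q + 576*w + 312*q - 2448) * hw +
    (20*w^2 + 2*w*q - 16*w + q^2 - 2*q - 292) * hq

theorem isDouble_of_order_twentyFour (hw : w ^ 2 = 13) (hs : e₁ + e₂ = -(3 * w))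
    (he : e₁ * e₂ = 36) (hp : p ^ 2 + 6 * (w + 1) * p + 144 = 0) :
    IsDouble e₁ e₂ (-8 - 4 * w) p (6 - (3 + w) / 2 * (p + 3 * w + 3)) := by
  rw [IsDouble, sub_mul_sub_eq hs he, hs]
  linear_combination ((-36)*w^2*p + 144*w^2 + (-252)*w*p + (-1152)*w + (-360)*p + (-9360)) * hw +
    (18*w^3 + 8*w^2*p + 96*w^2 + 2*w*p^2 + 28*w*p + (-138)*w + 7*p^2 + (-912)) * hp

/-- The coordinate of order twelve is only a link in the chain from `p` to `0`; it is not among the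
common values. -/
theorem isDouble_of_order_twelve (hw : w ^ 2 = 13) (hs : e₁ + e₂ = -(3 * w))
    (he : e₁ * e₂ = 36) (hp : p ^ 2 + 6 * (w + 1) * p + 144 = 0) :
    IsDouble e₁ e₂ (-8 - 4 * w) (6 - (3 + w) / 2 * (p + 3 * w + 3)) 0 := by
  rw [IsDouble, sub_mul_sub_eq hs he, hs]
  linear_combination ((81/16)*w^6 + 81*w^5 + (5049/16)*w^4 + (-27)*w^3*p + (-702)*w^3 +
      (-297)*w^2*p + (-104373/16)*w^2 + (-1017)*w*p + (-11763)*w + (-1107)*p + (-84501/16)) * hw +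
    ((9/8)*w^6 + (3/8)*w^5*p + (63/4)*w^5 + (1/16)*w^4*p^2 + (39/8)*w^4*p + (519/8)*w^4 +
      (3/4)*w^3*p^2 + (87/4)*w^3*p + (21/2)*w^3 + (27/8)*w^2*p^2 + (135/4)*w^2*p +
      (-4041/8)*w^2 + (27/4)*w*p^2 + (-81/8)*w*p + (-4185/4)*w + (81/16)*p^2 + (-405/8)*p +
      (-4455/8)) * hp

/-- The first coordinates of the known torsion points. -/
def IsKnown (w v : ℂ) : Prop :=
  v = 0 ∨ v = -2 - 2 * w ∨ v = 2 - 2 * w ∨ v ^ 2 + 6 * (w - 1) * v + 144 = 0 ∨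
    v ^ 2 + 6 * (w + 1) * v + 144 = 0

/-- The substitution `(w, v) ↦ (-w, -v)` passes to the conjugate curve. It exchanges the values of
orders three and four, and the quadratics for orders eight and twenty-four, so one list serves both
curves. -/
theorem IsKnown.neg {v : ℂ} (h : IsKnown w v) : IsKnown (-w) (-v) := by
  rcases h with rfl | rfl | rfl | h | h
  · exact Or.inl neg_zero
  · exact Or.inr (Or.inr (Or.inl (by ring)))
  · exact Or.inr (Or.inl (by ring))
  · exact Or.inr (Or.inr (Or.inr (Or.inr (by linear_combination h))))
  · exact Or.inr (Or.inr (Or.inr (Or.inl (by linear_combination h))))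

/-- Used through `IsDouble.ne`, to see that no known value is a root of the cubic. -/
theorem IsKnown.exists_isDouble {v : ℂ} (h : IsKnown w v) (hw : w ^ 2 = 13)
    (hs : e₁ + e₂ = -(3 * w)) (he : e₁ * e₂ = 36) : ∃ v', IsDouble e₁ e₂ (-8 - 4 * w) v v' := by
  rcases h with rfl | rfl | rfl | h | h
  · exact ⟨_, isDouble_zero hw hs he⟩
  · exact ⟨_, isDouble_of_order_three hw hs he⟩
  · exact ⟨_, isDouble_of_order_four hs he⟩
  · exact ⟨_, isDouble_of_order_eight hw hs he h⟩
  · exact ⟨_, isDouble_of_order_twentyFour hw hs he h⟩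

theorem IsKnown.mem_torsionValues {v : ℂ} (hv : IsKnown w v) (hw : w ^ 2 = 13)
    (hs : e₁ + e₂ = -(3 * w)) (he : e₁ * e₂ = 36)
    {K : Type} [Field K] [Algebra ℂ K] {x y : K} {O : Place K} {a α β : ℂ}
    (h : IsHyper x y (cubic 0 1 a)) (hO : O.ord x < 0) (h₁ : α * e₁ + β = 0)
    (h₂ : α * e₂ + β = 1) (h₃ : α * (-8 - 4 * w) + β = a) :
    P1.ofComplex (α * v + β) ∈ torsionValues x O := by
  have step : ∀ {v v' : ℂ}, IsDouble e₁ e₂ (-8 - 4 * w) v v' →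
      P1.ofComplex (α * v' + β) ∈ torsionValues x O → P1.ofComplex (α * v + β) ∈ torsionValues x O :=
    fun hd => h.mem_torsionValues_of_isDouble hO h₁ h₂ h₃ hd
  have three := h.mem_torsionValues_of_isDouble_self hO h₁ h₂ h₃ (isDouble_of_order_three hw hs he)
  have zero := step (isDouble_zero hw hs he) three
  have four := step (isDouble_of_order_four hs he)
    (by rw [h₃]; exact h.ofComplex_mem_torsionValues hO (by simp))
  rcases hv with rfl | rfl | rfl | hv | hv
  · exact zero
  · exact three
  · exact four
  · exact step (isDouble_of_order_eight hw hs he hv) four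
  · exact step (isDouble_of_order_twentyFour hw hs he hv)
      (step (isDouble_of_order_twelve hw hs he hv) zero)

/-- Reduces the nonvanishing of `m + n w` to that of its norm, which is a numerical check. -/
theorem add_mul_ne_zero_of_sq (hw : w ^ 2 = 13) {m n : ℂ} (h : m ^ 2 - 13 * n ^ 2 ≠ 0) :
    m + n * w ≠ 0 := by
  intro h0
  exact h (by linear_combination (m - n * w) * h0 + n ^ 2 * hw)

theorem ne_third_root (hw : w ^ 2 = 13) (hs : e₁ + e₂ = -(3 * w)) (he : e₁ * e₂ = 36) :
    e₁ ≠ -8 - 4 * w ∧ e₂ ≠ -8 - 4 * w := by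
  have h := sub_mul_sub_eq hs he (-8 - 4 * w)
  have h0 : (-8 - 4 * w) ^ 2 + 3 * w * (-8 - 4 * w) + 36 ≠ 0 := by
    rw [show (-8 - 4 * w) ^ 2 + 3 * w * (-8 - 4 * w) + 36 = 152 + 40 * w by
      linear_combination 4 * hw]
    exact add_mul_ne_zero_of_sq hw (by norm_num)
  rw [← h] at h0
  exact ⟨(sub_ne_zero.1 (left_ne_zero_of_mul h0)).symm,
    (sub_ne_zero.1 (right_ne_zero_of_mul h0)).symm⟩

theorem exists_two_roots {B C : ℂ} (h : B ^ 2 - 4 * C ≠ 0) :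
    ∃ u v : ℂ, u ≠ v ∧ u ^ 2 + B * u + C = 0 ∧ v ^ 2 + B * v + C = 0 := by
  obtain ⟨s, hs⟩ := IsAlgClosed.exists_pow_nat_eq (B ^ 2 - 4 * C) (n := 2) (by norm_num)
  refine ⟨(-B + s) / 2, (-B - s) / 2, fun h0 => h ?_, ?_, ?_⟩
  · have : s = 0 := by linear_combination h0
    rw [← hs, this, zero_pow two_ne_zero]
  · linear_combination hs / 4
  · linear_combination hs / 4

theorem exists_known (hw : w ^ 2 = 13) : ∃ V : Set ℂ, V.encard = 7 ∧ ∀ v ∈ V, IsKnown w v := by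
  have ne : ∀ m n : ℂ, m ^ 2 - 13 * n ^ 2 ≠ 0 → m + n * w ≠ 0 :=
    fun m n => add_mul_ne_zero_of_sq hw
  obtain ⟨q₁, q₂, hq, hq₁, hq₂⟩ := exists_two_roots (B := 6 * (w - 1)) (C := 144) (by
    rw [show (6 * (w - 1)) ^ 2 - 4 * 144 = -72 + (-72) * w by linear_combination 36 * hw]
    exact ne _ _ (by norm_num))
  obtain ⟨p₁, p₂, hp, hp₁, hp₂⟩ := exists_two_roots (B := 6 * (w + 1)) (C := 144) (by
    rw [show (6 * (w + 1)) ^ 2 - 4 * 144 = -72 + 72 * w by linear_combination 36 * hw]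
    exact ne _ _ (by norm_num))
  have hqn : ∀ {v : ℂ}, v ^ 2 + 6 * (w - 1) * v + 144 = 0 →
      0 ≠ v ∧ -2 - 2 * w ≠ v ∧ 2 - 2 * w ≠ v := by
    refine fun {v} hv => ⟨?_, ?_, ?_⟩ <;> rintro rfl
    · norm_num at hv
    · exact ne 56 8 (by norm_num) (by linear_combination hv + 8 * hw)
    · exact ne 32 16 (by norm_num) (by linear_combination hv + 8 * hw)
  have hpn : ∀ {v : ℂ}, v ^ 2 + 6 * (w + 1) * v + 144 = 0 →
      0 ≠ v ∧ -2 - 2 * w ≠ v ∧ 2 - 2 * w ≠ v := by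
    refine fun {v} hv => ⟨?_, ?_, ?_⟩ <;> rintro rfl
    · norm_num at hv
    · exact ne 32 (-16) (by norm_num) (by linear_combination hv + 8 * hw)
    · exact ne 56 (-8) (by norm_num) (by linear_combination hv + 8 * hw)
  have hqp : ∀ {u v : ℂ}, u ^ 2 + 6 * (w - 1) * u + 144 = 0 →
      v ^ 2 + 6 * (w + 1) * v + 144 = 0 → u ≠ v := by
    rintro u _ hu hv rfl
    exact (hqn hu).1 (by linear_combination (hu - hv) / 12)
  have h₁ : (0 : ℂ) ≠ -2 - 2 * w := fun h => ne 2 2 (by norm_num) (by linear_combination h)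
  have h₂ : (0 : ℂ) ≠ 2 - 2 * w := fun h => ne 2 (-2) (by norm_num) (by linear_combination -h)
  have h₃ : -2 - 2 * w ≠ 2 - 2 * w := fun h => by
    have : (4 : ℂ) = 0 := by linear_combination -h
    norm_num at this
  refine ⟨{0, -2 - 2 * w, 2 - 2 * w, q₁, q₂, p₁, p₂}, ?_, ?_⟩
  · have hnot : ∀ {v : ℂ} {s : Set ℂ}, (∀ u ∈ s, v ≠ u) → v ∉ s := fun h hv => h _ hv rfl
    rw [Set.encard_insert_of_notMem, Set.encard_insert_of_notMem, Set.encard_insert_of_notMem,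
      Set.encard_insert_of_notMem, Set.encard_insert_of_notMem, Set.encard_pair hp]
    · norm_num
    all_goals apply hnot
    · rintro u (rfl | rfl)
      exacts [hqp hq₂ hp₁, hqp hq₂ hp₂]
    · rintro u (rfl | rfl | rfl)
      exacts [hq, hqp hq₁ hp₁, hqp hq₁ hp₂]
    · rintro u (rfl | rfl | rfl | rfl)
      exacts [(hqn hq₁).2.2, (hqn hq₂).2.2, (hpn hp₁).2.2, (hpn hp₂).2.2]
    · rintro u (rfl | rfl | rfl | rfl | rfl)
      exacts [h₃, (hqn hq₁).2.1, (hqn hq₂).2.1, (hpn hp₁).2.1, (hpn hp₂).2.1]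
    · rintro u (rfl | rfl | rfl | rfl | rfl | rfl)
      exacts [h₁, h₂, (hqn hq₁).1, (hqn hq₂).1, (hpn hp₁).1, (hpn hp₂).1]
  · rintro v (rfl | rfl | rfl | rfl | rfl | rfl | rfl)
    · exact Or.inl rfl
    · exact Or.inr (Or.inl rfl)
    · exact Or.inr (Or.inr (Or.inl rfl))
    · exact Or.inr (Or.inr (Or.inr (Or.inl hq₁)))
    · exact Or.inr (Or.inr (Or.inr (Or.inl hq₂)))
    · exact Or.inr (Or.inr (Or.inr (Or.inr hp₁)))
    · exact Or.inr (Or.inr (Or.inr (Or.inr hp₂)))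

/-- A hyperelliptic torsion packet with at least 34 points. -/
theorem exists_large_packet : ∃ (C : BiellipticGenusTwoCurve) (S : Set (Place C.K)),
    IsHyperellipticTorsionPacket S ∧ 34 ≤ S.encard := by
  obtain ⟨w, hw⟩ := IsAlgClosed.exists_pow_nat_eq (13 : ℂ) (n := 2) (by norm_num)
  obtain ⟨e₁, e₂, h₁₂, he₁, he₂⟩ := exists_two_roots (B := 3 * w) (C := 36) (by
    rw [show (3 * w) ^ 2 - 4 * 36 = -27 by linear_combination 9 * hw]
    norm_num)
  have hs : e₁ + e₂ = -(3 * w) :=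
    mul_left_cancel₀ (sub_ne_zero.2 h₁₂) (by linear_combination he₁ - he₂)
  have he : e₁ * e₂ = 36 := by linear_combination e₁ * hs - he₁
  have hw' : (-w) ^ 2 = 13 := by rw [neg_sq, hw]
  have hs' : -e₁ + -e₂ = -(3 * -w) := by linear_combination -hs
  have he' : -e₁ * -e₂ = 36 := by linear_combination he
  obtain ⟨h₁₃, h₂₃⟩ := ne_third_root hw hs he
  obtain ⟨h₁₃', h₂₃'⟩ := ne_third_root hw' hs' he'
  have hd := sub_ne_zero.2 h₁₂.symm
  obtain ⟨α, hα⟩ : ∃ α, α = (e₂ - e₁)⁻¹ := ⟨_, rfl⟩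
  obtain ⟨β, hβ⟩ : ∃ β, β = -(α * e₁) := ⟨_, rfl⟩
  have hα0 : α ≠ 0 := by rw [hα]; exact inv_ne_zero hd
  have h₁ : α * e₁ + β = 0 := by rw [hβ]; ring
  have h₂ : α * e₂ + β = 1 := by rw [hβ, hα]; field_simp; ring
  have inj : ∀ {u v : ℂ}, α * u + β = α * v + β → u = v := fun h =>
    mul_left_cancel₀ hα0 (add_right_cancel h)
  -- The second curve is the conjugate one, taken in the coordinate `-v`. In terms of `v` it has the
  -- roots `e₁`, `e₂` and `8 - 4 w`, so the same affine map normalizes both curves and only the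
  -- third branch point differs.
  obtain ⟨K, _, _, t, y₁, y₂, h⟩ := exists_field_isBiquadratic
    (a := α * (-8 - 4 * w) + β) (b := -α * (-8 - 4 * -w) + β)
    (fun h0 => by
      have := inj (h0.trans (by ring : _ = α * (8 - 4 * w) + β))
      have h16 : (16 : ℂ) = 0 := by linear_combination -this
      norm_num at h16)
    (fun h0 => h₁₃ (inj (h₁.trans h0.symm)))
    (fun h0 => h₂₃ (inj (h₂.trans h0.symm)))
    (fun h0 => h₁₃' (by linear_combination -inj (h₁.trans (h0.symm.trans
      (by ring : _ = α * (8 - 4 * w) + β)))))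
    (fun h0 => h₂₃' (by linear_combination -inj (h₂.trans (h0.symm.trans
      (by ring : _ = α * (8 - 4 * w) + β)))))
  obtain ⟨P₀, hP₀⟩ := h.exists_pole
  obtain ⟨V, hV, hVk⟩ := exists_known hw
  -- The seven values avoid the branch points of both curves. Thus they are distinct from the base
  -- points, and `a`, `b` are not among the values counted.
  have hne : ∀ v ∈ V, v ≠ e₁ ∧ v ≠ e₂ ∧ v ≠ -8 - 4 * w ∧ v ≠ 8 - 4 * w := by
    intro v hv
    obtain ⟨v', hd⟩ := (hVk v hv).exists_isDouble hw hs he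
    obtain ⟨v'', hd'⟩ := (hVk v hv).neg.exists_isDouble hw' hs' he'
    obtain ⟨n₁, n₂, n₃⟩ := hd.ne h₁₂ h₁₃ h₂₃
    obtain ⟨-, -, n₄⟩ := hd'.ne (fun h => h₁₂ (neg_injective h)) h₁₃' h₂₃'
    exact ⟨n₁, n₂, n₃, fun h => n₄ (by linear_combination -h)⟩
  let φ : ℂ → P1 := fun v => P1.ofComplex (α * v + β)
  have hφ : Function.Injective φ := fun u v huv => inj (P1.ofComplex_inj.1 huv)
  have hφ₁ : φ e₁ = P1.ofComplex 0 := congrArg P1.ofComplex h₁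
  have hφ₂ : φ e₂ = P1.ofComplex 1 := congrArg P1.ofComplex h₂
  have hsub : basePoints ∪ φ '' V ⊆ h.common P₀ := by
    refine Set.union_subset (h.basePoints_subset_common hP₀) ?_
    rintro _ ⟨v, hv, rfl⟩
    refine ⟨(hVk v hv).mem_torsionValues hw hs he h.isHyper₁ (h.ord_below₁_neg hP₀) h₁ h₂ rfl, ?_⟩
    have := (hVk v hv).neg.mem_torsionValues hw' hs' he' h.swap.isHyper₁
      (h.swap.ord_below₁_neg hP₀) (α := -α) (β := β) (by linear_combination h₁)
      (by linear_combination h₂) rfl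
    rwa [neg_mul_neg] at this
  have hdisj : Disjoint basePoints (φ '' V) := by
    rw [Set.disjoint_right]
    rintro _ ⟨v, hv, rfl⟩ (h0 | h0 | h0)
    · simp [φ] at h0
    · exact (hne v hv).1 (hφ (h0.trans hφ₁.symm))
    · exact (hne v hv).2.1 (hφ (h0.trans hφ₂.symm))
  have hcard : (basePoints ∪ φ '' V).encard = 10 := by
    rw [Set.encard_union_eq hdisj, encard_basePoints, hφ.injOn.encard_image, hV]
    norm_num
  have hle := h.le_encard_add_six Set.subset_union_left ?_ ?_ hsub
  · refine ⟨h.curve, _, h.isHyperellipticTorsionPacket hP₀, ?_⟩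
    -- Ten common values, three base points and seven known ones, give `4 · 10 - 6 = 34`.
    rw [hcard, show (4 * 10 : ℕ∞) = 34 + 6 by norm_num] at hle
    exact (ENat.add_le_add_iff_right (by norm_num)).1 hle
  · rintro ((h0 | h0 | h0) | ⟨v, hv, h0⟩)
    · simp at h0
    · exact h.a_ne_zero (P1.ofComplex_inj.1 h0)
    · exact h.a_ne_one (P1.ofComplex_inj.1 h0)
    · exact (hne v hv).2.2.1 (hφ h0)
  · rintro ((h0 | h0 | h0) | ⟨v, hv, h0⟩)
    · simp at h0
    · exact h.b_ne_zero (P1.ofComplex_inj.1 h0)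
    · exact h.b_ne_one (P1.ofComplex_inj.1 h0)
    · refine (hne v hv).2.2.2 (hφ (h0.trans (congrArg P1.ofComplex ?_)))
      ring

end Large

end

/-! ### From a hyperelliptic packet to pairs of covers, and the conclusion -/

section

/-- The pairs of double covers attached to a hyperelliptic torsion packet. -/
theorem IsHyperellipticTorsionPacket.exists_covers {C : BiellipticGenusTwoCurve}
    {S : Set (Place C.K)} (hS : IsHyperellipticTorsionPacket S) :
    (∃ π₁ π₂ : EllipticDoubleCover, EllipticDoubleCover.P π₁ π₂ = (((3 : ℕ) : ℕ∞), ((1 : ℕ) : ℕ∞)) ∧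
      S.encard + 6 ≤ 4 * (EllipticDoubleCover.I π₁ π₂).encard) ∧
    ∃ π₁ π₂ : EllipticDoubleCover, EllipticDoubleCover.P π₁ π₂ = (((0 : ℕ) : ℕ∞), ((4 : ℕ) : ℕ∞)) ∧
      S.encard ≤ (EllipticDoubleCover.I π₁ π₂).encard ∧ π₁.branchSet ≠ π₂.branchSet ∧
      (S.Finite → (EllipticDoubleCover.I π₁ π₂).Finite) := by
  obtain ⟨hS, x, hx, hram⟩ := hS
  obtain ⟨y, f, hf⟩ := hx.exists_isHyper C.isCurve
  obtain ⟨t, y₁, y₂, a, b, h⟩ := C.exists_isBiquadratic hx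
  obtain ⟨P₀, hP₀⟩ := h.exists_pole
  -- The pole `P₀` of `t` is a ramification point of `y₂ / y₁`, hence of the given double cover, so
  -- it lies in `S`; by maximality `S` is the packet of `P₀`.
  have hmem : P₀ ∈ S := hram P₀ ((hf.isRamifiedAt_iff_of_genus h.isHyper C.genus_eq P₀).2
    ((h.isHyper.isRamifiedAt_iff P₀).2 (h.conj_eq_of_pole hP₀)))
  rw [h.eq_of_isTorsionPacket hP₀ hS hmem]
  exact h.exists_covers hP₀

end

end TorsionPackets

end

open TorsionPackets EllipticDoubleCover in
theorem mainTheorem3 :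
    maxPacket + 6 ≤ 4 * maxI 3 1 ∧
    maxPacket ≤ maxI 0 4 ∧
    34 ≤ maxPacket ∧
    maxPacket ≤ (⨆ (π₁ : EllipticDoubleCover) (π₂ : EllipticDoubleCover)
      (_ : π₁.branchSet ≠ π₂.branchSet), (I π₁ π₂).encard) ∧
    (⨆ (C : BiellipticGenusTwoCurve) (S : Set (Place C.K))
        (_ : IsHyperellipticTorsionPacket S ∧ S.Finite), S.encard) ≤
      (⨆ (π₁ : EllipticDoubleCover) (π₂ : EllipticDoubleCover)
        (_ : (I π₁ π₂).Finite), (I π₁ π₂).encard) := by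
  have hI : ∀ {a b : ℕ} (π₁ π₂ : EllipticDoubleCover), P π₁ π₂ = ((a : ℕ∞), (b : ℕ∞)) →
      (I π₁ π₂).encard ≤ maxI a b := fun π₁ π₂ h =>
    le_iSup_of_le π₁ (le_iSup_of_le π₂ (le_iSup_of_le h le_rfl))
  obtain ⟨C₀, S₀, hS₀, h34⟩ := exists_large_packet
  have hS : ∀ (C : BiellipticGenusTwoCurve) (S : Set (Place C.K)),
      IsHyperellipticTorsionPacket S → S.encard + 6 ≤ 4 * maxI 3 1 := by
    intro C S hS
    obtain ⟨⟨π₁, π₂, hP, hle⟩, -⟩ := hS.exists_covers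
    exact hle.trans (mul_le_mul_right (hI π₁ π₂ hP) 4)
  refine ⟨?_, ?_, ?_, ?_, ?_⟩
  -- To pass to the supremum the 6 is moved to the other side. Truncated subtraction is harmless
  -- because the existence of one packet already gives `6 ≤ 4 * maxI 3 1`.
  · have h6 : 6 ≤ 4 * maxI 3 1 := le_add_self.trans (hS C₀ S₀ hS₀)
    rw [← tsub_add_cancel_of_le h6]
    refine add_le_add_left (iSup_le fun C => iSup_le fun S => iSup_le fun h => ?_) 6
    exact ENat.le_sub_of_add_le_right (by norm_num) (hS C S h)
  · refine iSup_le fun C => iSup_le fun S => iSup_le fun h => ?_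
    obtain ⟨-, π₁, π₂, hP, hle, -⟩ := h.exists_covers
    exact hle.trans (hI π₁ π₂ hP)
  · exact h34.trans (le_iSup_of_le C₀ (le_iSup_of_le S₀ (le_iSup_of_le hS₀ le_rfl)))
  · refine iSup_le fun C => iSup_le fun S => iSup_le fun h => ?_
    obtain ⟨-, π₁, π₂, -, hle, hne, -⟩ := h.exists_covers
    exact hle.trans (le_iSup_of_le π₁ (le_iSup_of_le π₂ (le_iSup_of_le hne le_rfl)))
  · refine iSup_le fun C => iSup_le fun S => iSup_le fun h => ?_
    obtain ⟨-, π₁, π₂, -, hle, -, hfin⟩ := h.1.exists_covers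
    exact hle.trans (le_iSup_of_le π₁ (le_iSup_of_le π₂ (le_iSup_of_le (hfin h.2) le_rfl)))
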